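/- A matchgate is a two-qubit gate $G(A,B)$ with $A,B\in U(2)$, $\det A=\det B$, acting as $A$ on $\mathrm{span}(|00\rangle,|11\rangle)$ and as $B$ on $\mathrm{span}(|01\rangle,|10\rangle)$. A quantum circuit over a finite set $\mathcal Q$ of one- and two-qubit unitary gates is a finite sequence of gates of $\mathcal Q$ applied to specified lines; a (nearest-neighbour) matchgate circuit over a finite set $\mathcal M$ of matchgates is a finite sequence of gates of $\mathcal M$, each applied to two consecutive lines $i,i+1$. The size of a circuit is its number of gates, its width is its number of lines, and every line is acted on by at least one gate. Two circuits, each with a computational basis input and a final $Z$ measurement on one line, are equivalent if their two outcome probabilities coincide. A circuit with gates $g_1,\dots,g_N$ on lines $(i_t,j_t)$, input $x$ and measured line $k$ is encoded by the binary string that lists $(x,k)$ and then the triples $(g_t,i_t,j_t)$ (with $j_t=i_t$ for a one-qubit gate), all numbers in binary and the symbols $0,1$, comma and opening bracket written as two-bit blocks. Space refers to deterministic Turing machines with a read-only input tape, a write-only output tape and a work tape, and counts the cells of the work tape. Theorem. Let $\mathcal M_0$ be any finite set of matchgates and $\mathcal Q_0$ any finite set of one- and two-qubit unitary gates. There are a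 finite set $\mathcal M\supseteq\mathcal M_0$ of matchgates whose products on two lines are dense, up to a global phase, in all matchgates, and a finite set $\mathcal Q\supseteq\mathcal Q_0$ of one- and two-qubit gates whose products are dense, up to a global phase, in all one-qubit gates (on one line) and in all two-qubit gates (on two lines), such that, with all matchgate circuits taken over $\mathcal M$, all quantum circuits taken over $\mathcal Q$, and $O$-constants and Turing machines depending only on $\mathcal M$ and $\mathcal Q$: (a) For every matchgate circuit of width $n$ and size $N$ with input $|x_1\cdots x_n\rangle$ and a $Z$ measurement on line $k$ there is an equivalent quantum circuit of width $\lceil\log_2 n\rceil+3$ and size $O(N\log n)$ with input $|0\cdots0\rangle$ and a $Z$ measurement on line 1. The encoding of such a quantum circuit is computed from that of the matchgate circuit by a Turing machine in space $O(\log n)$. (b) Conversely, for every quantum circuit of width $m\ge1$ and size $M$ with input $|y_1\cdots y_m\rangle$ and a $Z$ measurement on line 1 there is an equivalent matchgate circuit of width $2^{m+1}$ and size $O(M\,2^{2m})$ with input $|0\cdots0\rangle$ and a $Z$ measurement on line 1. The encoding of such a matchgate circuit is computed from that of the quantum circuit by a Turing machine in space $O(m)$. -/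

import Mathlib

/-! ## Gates, circuits and their output distributions -/

/-- The matchgate `G(A,B)`: `A` acts on the even parity subspace spanned by `|00⟩, |11⟩` and `B` on
the odd parity subspace spanned by `|01⟩, |10⟩`.  In each of the two bases the first label
of the pair is the position of the vector in the basis. -/
def matchgate (A B : Matrix (Fin 2) (Fin 2) ℂ) : Matrix (Fin 2 × Fin 2) (Fin 2 × Fin 2) ℂ :=
  Matrix.of fun s t =>
    if s.1 = s.2 then (if t.1 = t.2 then A s.1 t.1 else 0)
    else (if t.1 = t.2 then 0 else B s.1 t.1)

/-- A finite set (listed with names `0, 1, …`) of one- and two-qubit unitary gates. -/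
structure GateSet where
  num1 : ℕ
  num2 : ℕ
  gate1 : Fin num1 → Matrix.unitaryGroup (Fin 2) ℂ
  gate2 : Fin num2 → Matrix.unitaryGroup (Fin 2 × Fin 2) ℂ

namespace GateSet

/-- Every gate of `G` is a gate of `H`. -/
def Sub (G H : GateSet) : Prop :=
  Set.range G.gate1 ⊆ Set.range H.gate1 ∧ Set.range G.gate2 ⊆ Set.range H.gate2

/-- All gates of `G` are matchgates `G(A,B)` with `A, B ∈ U(2)` of the same determinant. -/
def IsMatchgateSet (G : GateSet) : Prop :=
  G.num1 = 0 ∧ ∀ g : Fin G.num2, ∃ A B : Matrix.unitaryGroup (Fin 2) ℂ,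
    A.1.det = B.1.det ∧ (G.gate2 g).1 = matchgate A.1 B.1

end GateSet

/-- One gate of a circuit of width `n`, with the line(s) on which it acts. -/
inductive GateApp (G : GateSet) (n : ℕ) where
  | one (g : Fin G.num1) (i : Fin n)
  | two (g : Fin G.num2) (i j : Fin n) (hij : i ≠ j)

/-- A circuit of width `n` is the list of its gates in the order of application; its size is
the length of the list. -/
abbrev Circuit (G : GateSet) (n : ℕ) := List (GateApp G n)

/-- State vectors of `n` qubits, in coordinates with respect to the computational basis. -/
abbrev QState (n : ℕ) := (Fin n → Fin 2) → ℂ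

/-- The computational basis state `|x₁ ⋯ xₙ⟩`. -/
def ket {n : ℕ} (x : Fin n → Fin 2) : QState n := Pi.single x 1

namespace GateApp

variable {G : GateSet} {n : ℕ}

/-- The action of a gate on the state of all `n` lines. -/
def apply : GateApp G n → QState n → QState n
  | one g i, ψ => fun z =>
      ∑ a : Fin 2, (G.gate1 g).1 (z i) a * ψ (Function.update z i a)
  | two g i j _, ψ => fun z =>
      ∑ a : Fin 2, ∑ b : Fin 2,
        (G.gate2 g).1 (z i, z j) (a, b) * ψ (Function.update (Function.update z i a) j b)

/-- The gate acts on line `l`. -/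
def ActsOn : GateApp G n → Fin n → Prop
  | one _ i, l => l = i
  | two _ i j _, l => l = i ∨ l = j

/-- The gate acts on two consecutive lines `i, i + 1`. -/
def IsNearestNeighbour : GateApp G n → Prop
  | one _ _ => False
  | two _ i j _ => j.val = i.val + 1

end GateApp

namespace Circuit

variable {G : GateSet} {n : ℕ}

/-- The final state of the circuit on the initial state `ψ`. -/
def run (c : Circuit G n) (ψ : QState n) : QState n :=
  c.foldl (fun φ g => g.apply φ) ψ

/-- The probability of outcome `b` when line `k` is measured in the computational basis (a `Z`
measurement) at the end of the circuit started in `|x⟩`. -/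
noncomputable def outProb (c : Circuit G n) (x : Fin n → Fin 2) (k : Fin n) (b : Fin 2) : ℝ :=
  ∑ z : Fin n → Fin 2, if z k = b then ‖c.run (ket x) z‖ ^ 2 else 0

/-- Some gate acts on every line. -/
def NoIdleLine (c : Circuit G n) : Prop :=
  ∀ l : Fin n, ∃ g ∈ c, GateApp.ActsOn g l

/-- All gates are two-qubit gates acting on consecutive lines `i, i + 1`. -/
def IsNearestNeighbour (c : Circuit G n) : Prop :=
  ∀ g ∈ c, GateApp.IsNearestNeighbour g

/-- Up to a global phase, each matrix entry of the unitary operation of the circuit is within `ε`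
of the corresponding entry of `U`. -/
def Approximates (c : Circuit G n) (U : Matrix (Fin n → Fin 2) (Fin n → Fin 2) ℂ) (ε : ℝ) : Prop :=
  ∃ p : ℂ, ‖p‖ = 1 ∧ ∀ x y : Fin n → Fin 2, ‖p * c.run (ket y) x - U x y‖ < ε

end Circuit

/-- The circuit `c` with input `|x⟩` and measurement of line `k` is equivalent to the circuit `d`
with input `|y⟩` and measurement of line `l`: the output distributions coincide. -/
def CircuitEquiv {G H : GateSet} {n m : ℕ}
    (c : Circuit G n) (x : Fin n → Fin 2) (k : Fin n)
    (d : Circuit H m) (y : Fin m → Fin 2) (l : Fin m) : Prop :=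
  ∀ b : Fin 2, c.outProb x k b = d.outProb y l b

namespace GateSet

/-- Products of gates of `G` are dense, up to a global phase, in all one-qubit gates (using
one line) and in all two-qubit gates (using two lines). -/
def IsUniversal (G : GateSet) : Prop :=
  ∀ n : ℕ, n = 1 ∨ n = 2 → ∀ U : Matrix.unitaryGroup (Fin n → Fin 2) ℂ, ∀ ε : ℝ, 0 < ε →
    ∃ c : Circuit G n, c.Approximates U.1 ε

/-- Products of gates of `G`, acting on two consecutive lines, are dense, up to a global
phase, in all matchgates. -/
def IsMatchgateUniversal (G : GateSet) : Prop :=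
  ∀ A B : Matrix.unitaryGroup (Fin 2) ℂ, A.1.det = B.1.det → ∀ ε : ℝ, 0 < ε →
    ∃ c : Circuit G 2, c.IsNearestNeighbour ∧
      c.Approximates (Matrix.of fun x y => matchgate A.1 B.1 (x 0, x 1) (y 0, y 1)) ε

end GateSet

/-! ## Encodings of circuits as binary strings

Tuples of binary strings are written with the four symbols `0`, `1`, `,` and `(`, which are
represented by the two-bit blocks `00`, `01`, `11` and `10`.  The circuit with gates
`g₁, …, g_N` on lines `i_t, j_t`, input `x` and measured line `k` is written as
`(x,k,(g₁,i₁,j₁,(g₂,i₂,j₂,⋯`, with all numbers in binary (least significant bit first) and lines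
numbered from `1`. -/

/-- A binary string followed by a comma. -/
def encodeField (s : List Bool) : List Bool :=
  s.flatMap (fun b => [false, b]) ++ [true, true]

/-- A tuple of binary strings. -/
def encodeTuple (fs : List (List Bool)) : List Bool :=
  [true, false] ++ fs.flatMap encodeField

/-- The triple `(g,i,j)`; two-qubit gates are named by the numbers after those of the one-qubit
gates, and `j = i` is written for a one-qubit gate. -/
def GateApp.encode {G : GateSet} {n : ℕ} : GateApp G n → List Bool
  | .one g i => encodeTuple
      [Nat.bits g.val, Nat.bits (i.val + 1), Nat.bits (i.val + 1)]
  | .two g i j _ => encodeTuple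
      [Nat.bits (G.num1 + g.val), Nat.bits (i.val + 1), Nat.bits (j.val + 1)]

/-- The encoding of a circuit, together with its input and the measured line. -/
def Circuit.encode {G : GateSet} {n : ℕ} (c : Circuit G n) (x : Fin n → Fin 2) (k : Fin n) :
    List Bool :=
  encodeTuple [List.ofFn (fun l => decide (x l = 1)), Nat.bits (k.val + 1)]
    ++ c.flatMap GateApp.encode

/-! ## Space-bounded deterministic Turing machines -/

/-- Moves of a tape head. -/
inductive TapeMove where
  | left | stay | right

/-- The right-hand side of a transition rule. -/
structure TMAction (Q : Type) where
  state : Q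
  write : Option Bool
  out : Option Bool
  moveInput : TapeMove
  moveWork : TapeMove

/-- A deterministic Turing machine with a read-only input tape, a work tape and a write-only output
tape.  Tape cells hold an element of `Option Bool`, with `none` for the blank symbol.  The input
head may not move right from a blank. -/
structure TM where
  Q : Type
  finite : Finite Q
  start : Q
  halt : Q
  rule : Q → Option Bool → Option Bool → TMAction Q
  input_bounded : ∀ q s, (rule q none s).moveInput ≠ TapeMove.right

/-- Tapes are infinite to the right; a move to the left from the leftmost cell has no effect. -/
def TapeMove.apply : TapeMove → ℕ → ℕ
  | .left, p => p - 1
  | .stay, p => p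
  | .right, p => p + 1

namespace TM

/-- A configuration; `output` is the string written on the output tape. -/
structure Config (T : TM) where
  state : T.Q
  inputPos : ℕ
  work : ℕ → Option Bool
  workPos : ℕ
  output : List Bool

variable (T : TM)

def init : T.Config where
  state := T.start
  inputPos := 0
  work := fun _ => none
  workPos := 0
  output := []

/-- One step on the input string `w`; the machine stops in the halting state. -/
noncomputable def step (w : List Bool) (c : T.Config) : T.Config :=
  open Classical in
  if c.state = T.halt then c else
    let a := T.rule c.state w[c.inputPos]? (c.work c.workPos)
    { state := a.state
      inputPos := a.moveInput.apply c.inputPos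
      work := Function.update c.work c.workPos a.write
      workPos := a.moveWork.apply c.workPos
      output := c.output ++ a.out.toList }

/-- On input `w` the machine halts with output `v`, and the work tape head remains within the
first `s` cells throughout the computation. -/
def ComputesInSpace (w v : List Bool) (s : ℕ) : Prop :=
  ∃ t : ℕ, ((T.step w)^[t] T.init).state = T.halt ∧
    ((T.step w)^[t] T.init).output = v ∧
    ∀ r ≤ t, ((T.step w)^[r] T.init).workPos < s

end TM

/-! # Matchgate circuits and quantum circuits of logarithmic width

Matchgates are the gates of free fermions.  In the Jordan-Wigner representation a matchgate `G(A, B)`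
with `det A = det B` on two consecutive lines transforms the field operators
`∑ v_{j,0} a_j + v_{j,1} a_j†` linearly under conjugation: if the four coefficients of its two modes
are written as a matrix `N`, the new ones are `B N A†` (`matchgate_fieldOp2`, `act2_fieldOp`).  A
measurement of line `k` is given by the norm of `a_k` or `a_k†` applied to the final state.  Moving
this operator past all gates to the input `x`, one obtains the output probability of a circuit on `n`
lines as a sum of squared absolute values of coordinates of a single vector with `2n` coordinates,
which evolves under the gates in reverse order (`Circuit.outProb_eq_backAct`).

For (a), this vector is the state of `⌈log₂ n⌉ + 1` qubits, one for the type of the operator and the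
others for the index of the mode.  A matchgate becomes a unitary matrix of size four on the indices
`i` and `i + 1`.  An affine map over the field with two elements moves these indices to the strings
that have ones in all lines but the lowest, the conjunction of these lines is computed, and the matrix
is performed as a product of controlled gates, with this conjunction as an additional condition
(`QubitTable.runRaw_block`).  Two more qubits hold the conjunction and an auxiliary flag; the
conjunctions borrow other lines as workspace and return them, so each gate costs `O(log n)` gates
(`QubitTable.equiv_simulation`).

For (b), number preserving matchgates rotate the creation operators of two consecutive modes.  The
amplitudes of `m` qubits become the coefficients of creation operators of `2 ^ (m + 1)` modes, whose
index has one more bit.  A controlled gate is a product of rotations of pairs of modes, which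
transpositions bring together (`NpTable.backAct_letter`), and the measurement of the first qubit is
matched by exciting those modes for which its bit is `1` (`MatchTable.equiv_simulation`).

Both simulations are exact.  Every unitary matrix of size four is a product of controlled one-qubit
gates (`mem_of_ctl_mem`), so the gates of the given finite sets involve finitely many one-qubit gates,
and it suffices that the new sets contain these and their inverses and complex conjugates in
controlled or number preserving form (`exists_gateSets`).  Density is added by the Hadamard gate and
the phase gate of angle `1`, since `π` is irrational (`eq_top_of_isClosed`).

The simulating circuits are written by loops over bounded counters.  Programs for such output are
compiled to Turing machines that keep the binary digits of their counters on interleaved tracks of the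
work tape (`Exp.exec`, `Prog.exec`), and that read the encoding of the given circuit backwards
(`exists_machine`).  The space is thus logarithmic in the largest value of a counter, which is linear
in `n` in (a) and in `2 ^ m` in (b) (`exists_machine_of_programs`). -/


/-! ### Structured fragments of Turing machines -/

/-- The part of a machine configuration that does not depend on the state set. -/
structure TapeConf where
  pos : ℕ
  work : ℕ → Option Bool
  wpos : ℕ
  out : List Bool

/-- The effect of an action on the tapes. -/
def TapeConf.act {X : Type} (t : TapeConf) (a : TMAction X) : TapeConf :=
  ⟨a.moveInput.apply t.pos, Function.update t.work t.wpos a.write, a.moveWork.apply t.wpos,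
    t.out ++ a.out.toList⟩

/-- A machine with one entry and one exit.  The next state `none` is the exit. -/
structure Frag where
  Q : Type
  finite : Finite Q
  start : Q
  rule : Q → Option Bool → Option Bool → TMAction (Option Q)
  bounded : ∀ q s, (rule q none s).moveInput ≠ TapeMove.right

/-- An action with its next state renamed. -/
def TMAction.mapState {X Y : Type} (f : X → Y) (a : TMAction X) : TMAction Y :=
  ⟨f a.state, a.write, a.out, a.moveInput, a.moveWork⟩

@[simp] theorem TMAction.mapState_state {X Y : Type} (f : X → Y) (a : TMAction X) :
    (a.mapState f).state = f a.state := rfl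

@[simp] theorem TapeConf.act_mapState {X Y : Type} (t : TapeConf) (f : X → Y) (a : TMAction X) :
    t.act (a.mapState f) = t.act a := rfl

namespace Frag

variable {F G : Frag} {w : List Bool} {S : ℕ}

/-- The action that the fragment takes in a given state. -/
def action (F : Frag) (w : List Bool) (q : F.Q) (t : TapeConf) : TMAction (Option F.Q) :=
  F.rule q w[t.pos]? (t.work t.wpos)

/-- `F.Reach w S q t t'`: started in state `q` on the tapes `t`, the fragment reaches its exit with
the tapes `t'`, and before each of its steps the work head is within the first `S` cells. -/
inductive Reach (F : Frag) (w : List Bool) (S : ℕ) : F.Q → TapeConf → TapeConf → Prop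
  | exit {q t} : t.wpos < S → (F.action w q t).state = none →
      Reach F w S q t (t.act (F.action w q t))
  | step {q q' t t'} : t.wpos < S → (F.action w q t).state = some q' →
      Reach F w S q' (t.act (F.action w q t)) t' → Reach F w S q t t'

/-- A complete run of a fragment. -/
def Run (F : Frag) (w : List Bool) (S : ℕ) (t t' : TapeConf) : Prop :=
  F.Reach w S F.start t t'

/-- A single action, which depends on the symbols read. -/
def prim (f : Option Bool → Option Bool → TMAction (Option Unit))
    (hf : ∀ s, (f none s).moveInput ≠ TapeMove.right) : Frag :=
  ⟨Unit, inferInstance, (), fun _ => f, fun _ => hf⟩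

/-- `F` followed by `G`. -/
def seq (F G : Frag) : Frag where
  Q := F.Q ⊕ G.Q
  finite := by have := F.finite; have := G.finite; infer_instance
  start := .inl F.start
  rule
    | .inl q, a, b => (F.rule q a b).mapState fun
        | none => some (.inr G.start)
        | some q => some (.inl q)
    | .inr q, a, b => (G.rule q a b).mapState (Option.map .inr)
  bounded := by
    rintro (q | q) s
    · exact F.bounded q s
    · exact G.bounded q s

/-- The action that changes the state only. -/
def idle {X : Type} (q : X) (b : Option Bool) : TMAction X := ⟨q, b, none, .stay, .stay⟩

/-- `F` or `G`, according to the symbols under the two heads. -/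
def cond (p : Option Bool → Option Bool → Bool) (F G : Frag) : Frag where
  Q := Option (F.Q ⊕ G.Q)
  finite := by have := F.finite; have := G.finite; infer_instance
  start := none
  rule
    | none, a, b => idle (some (some (if p a b then .inl F.start else .inr G.start))) b
    | some (.inl q), a, b => (F.rule q a b).mapState (Option.map fun q => some (.inl q))
    | some (.inr q), a, b => (G.rule q a b).mapState (Option.map fun q => some (.inr q))
  bounded := by
    rintro (_ | (q | q)) s
    · simp [idle]
    · exact F.bounded q s
    · exact G.bounded q s

/-- `F` repeated while the symbols under the two heads satisfy `p`. -/
def loop (p : Option Bool → Option Bool → Bool) (F : Frag) : Frag where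
  Q := Option F.Q
  finite := by have := F.finite; infer_instance
  start := none
  rule
    | none, a, b => idle (if p a b then some (some F.start) else none) b
    | some q, a, b => (F.rule q a b).mapState some
  bounded := by
    rintro (_ | q) s
    · simp [idle]
    · exact F.bounded q s

theorem act_idle {X : Type} (t : TapeConf) (q : X) : t.act (idle q (t.work t.wpos)) = t := by
  simp [TapeConf.act, idle, TapeMove.apply]

theorem Run.prim {f hf t} (ht : t.wpos < S)
    (h : (f w[t.pos]? (t.work t.wpos)).state = none) :
    (prim f hf).Run w S t (t.act (f w[t.pos]? (t.work t.wpos))) :=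
  Reach.exit (F := Frag.prim f hf) (q := ()) ht h

theorem Run.seq {t t₁ t₂} (h₁ : F.Run w S t t₁) (h₂ : G.Run w S t₁ t₂) :
    (seq F G).Run w S t t₂ := by
  have hG : ∀ q t t', G.Reach w S q t t' → (Frag.seq F G).Reach w S (.inr q) t t' := by
    intro q t t' h
    induction h with
    | exit ht hs => exact Reach.exit (F := Frag.seq F G) ht (by simp [action, Frag.seq] at *; simp [hs])
    | step ht hs _ ih =>
      exact Reach.step (F := Frag.seq F G) (q' := .inr _) ht
        (by simp [action, Frag.seq] at *; simp [hs]) ih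
  have hF : ∀ q t t₁, F.Reach w S q t t₁ → G.Run w S t₁ t₂ →
      (Frag.seq F G).Reach w S (.inl q) t t₂ := by
    intro q t t₁ h hr
    induction h with
    | exit ht hs =>
      exact Reach.step (F := Frag.seq F G) (q' := .inr G.start) ht
        (by simp [action, Frag.seq] at *; simp [hs]) (hG _ _ _ hr)
    | step ht hs _ ih =>
      exact Reach.step (F := Frag.seq F G) (q' := .inl _) ht
        (by simp [action, Frag.seq] at *; simp [hs]) (ih hr)
  exact hF _ _ _ h₁ h₂

theorem Run.cond_true {p} {t t'} (ht : t.wpos < S) (hp : p w[t.pos]? (t.work t.wpos) = true)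
    (h : F.Run w S t t') : (cond p F G).Run w S t t' := by
  have hF : ∀ q t t', F.Reach w S q t t' → (Frag.cond p F G).Reach w S (some (.inl q)) t t' := by
    intro q t t' h
    induction h with
    | exit ht hs => exact Reach.exit (F := Frag.cond p F G) ht (by simp [action, Frag.cond] at *; simp [hs])
    | step ht hs _ ih =>
      exact Reach.step (F := Frag.cond p F G) (q' := some (.inl _)) ht
        (by simp [action, Frag.cond] at *; simp [hs]) ih
  refine Reach.step (F := Frag.cond p F G) (q' := some (.inl F.start)) ht
    (by simp [action, Frag.cond, idle, hp]) ?_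
  have := act_idle t (some (some (if p w[t.pos]? (t.work t.wpos) then
    (.inl F.start : F.Q ⊕ G.Q) else .inr G.start)))
  simp only [action, Frag.cond] at this ⊢
  rw [this]
  exact hF _ _ _ h

theorem Run.cond_false {p} {t t'} (ht : t.wpos < S) (hp : p w[t.pos]? (t.work t.wpos) = false)
    (h : G.Run w S t t') : (cond p F G).Run w S t t' := by
  have hG : ∀ q t t', G.Reach w S q t t' → (Frag.cond p F G).Reach w S (some (.inr q)) t t' := by
    intro q t t' h
    induction h with
    | exit ht hs => exact Reach.exit (F := Frag.cond p F G) ht (by simp [action, Frag.cond] at *; simp [hs])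
    | step ht hs _ ih =>
      exact Reach.step (F := Frag.cond p F G) (q' := some (.inr _)) ht
        (by simp [action, Frag.cond] at *; simp [hs]) ih
  refine Reach.step (F := Frag.cond p F G) (q' := some (.inr G.start)) ht
    (by simp [action, Frag.cond, idle, hp]) ?_
  have := act_idle t (some (some (if p w[t.pos]? (t.work t.wpos) then
    (.inl F.start : F.Q ⊕ G.Q) else .inr G.start)))
  simp only [action, Frag.cond] at this ⊢
  rw [this]
  exact hG _ _ _ h

theorem Run.loop_done {p} {t} (ht : t.wpos < S) (hp : p w[t.pos]? (t.work t.wpos) = false) :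
    (loop p F).Run w S t t := by
  have := Reach.exit (F := Frag.loop p F) (q := none) (w := w) ht
    (by simp [action, Frag.loop, idle, hp])
  have h2 := act_idle t (if p w[t.pos]? (t.work t.wpos) then some (some F.start) else none)
  simp only [action, Frag.loop] at this h2
  rw [h2] at this
  exact this

theorem Run.loop_step {p} {t t₁ t₂} (ht : t.wpos < S) (hp : p w[t.pos]? (t.work t.wpos) = true)
    (h₁ : F.Run w S t t₁) (h₂ : (loop p F).Run w S t₁ t₂) : (loop p F).Run w S t t₂ := by
  have hF : ∀ q t t₁, F.Reach w S q t t₁ → (Frag.loop p F).Run w S t₁ t₂ →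
      (Frag.loop p F).Reach w S (some q) t t₂ := by
    intro q t t₁ h hr
    induction h with
    | exit ht hs =>
      exact Reach.step (F := Frag.loop p F) (q' := none) ht
        (by simp [action, Frag.loop] at *; simp [hs]) hr
    | step ht hs _ ih =>
      exact Reach.step (F := Frag.loop p F) (q' := some _) ht
        (by simp [action, Frag.loop] at *; simp [hs]) (ih hr)
  refine Reach.step (F := Frag.loop p F) (q' := some F.start) ht
    (by simp [action, Frag.loop, idle, hp]) ?_
  have h2 := act_idle t (if p w[t.pos]? (t.work t.wpos) then some (some F.start) else none)
  simp only [action, Frag.loop] at h2 ⊢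
  rw [h2]
  exact hF _ _ _ h₁ h₂

/-- The machine that runs the fragment and halts. -/
def toTM (F : Frag) : TM where
  Q := Option F.Q
  finite := by have := F.finite; infer_instance
  start := some F.start
  halt := none
  rule
    | none, _, b => idle none b
    | some q, a, b => F.rule q a b
  input_bounded := by
    rintro (_ | q) s
    · simp [idle]
    · exact F.bounded q s

/-- The machine configuration with the given state and tapes. -/
def conf (F : Frag) (q : Option F.Q) (t : TapeConf) : F.toTM.Config :=
  ⟨q, t.pos, t.work, t.wpos, t.out⟩

theorem step_conf (q : F.Q) (t : TapeConf) :
    F.toTM.step w (F.conf (some q) t) =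
      F.conf (F.action w q t).state (t.act (F.action w q t)) := by
  simp [TM.step, toTM, conf, TapeConf.act, action]

theorem toTM_computesInSpace {v : List Bool} {t : TapeConf}
    (h : F.Run w S ⟨0, fun _ => none, 0, []⟩ t) (ht : t.wpos < S) (hv : t.out = v) :
    F.toTM.ComputesInSpace w v S := by
  have key : ∀ q t t', F.Reach w S q t t' → t'.wpos < S →
      ∃ k, (F.toTM.step w)^[k] (F.conf (some q) t) = F.conf none t' ∧
        ∀ r ≤ k, ((F.toTM.step w)^[r] (F.conf (some q) t)).workPos < S := by
    intro q t t' h ht'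
    induction h with
    | @exit q t ht hs =>
      refine ⟨1, by simp [step_conf, hs], fun r hr => ?_⟩
      interval_cases r
      · exact ht
      · rw [Function.iterate_one, step_conf]; exact ht'
    | @step q q' t t' ht hs _ ih =>
      obtain ⟨k, hk, hr⟩ := ih ht'
      refine ⟨k + 1, by simpa [Function.iterate_succ_apply, step_conf, hs] using hk,
        fun r hrk => ?_⟩
      rcases r with _ | r
      · exact ht
      · simpa [Function.iterate_succ_apply, step_conf, hs] using hr r (by omega)
  obtain ⟨k, hk, hr⟩ := key _ _ _ h ht
  have h0 : F.conf (some F.start) ⟨0, fun _ => none, 0, []⟩ = F.toTM.init := rfl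
  rw [h0] at hk hr
  exact ⟨k, by rw [hk]; rfl, by rw [hk]; exact hv, hr⟩

end Frag

/-! ### Binary counters on the work tape -/

namespace Frag

variable {F G : Frag} {w : List Bool} {S : ℕ}

/-- Move the work head. -/
def moveWork (m : TapeMove) : Frag :=
  prim (fun _ b => ⟨none, b, none, .stay, m⟩) (by simp)

/-- Write a symbol on the work tape. -/
def write (x : Option Bool) : Frag :=
  prim (fun _ _ => ⟨none, x, none, .stay, .stay⟩) (by simp)

/-- Append a bit to the output. -/
def emit (x : Bool) : Frag :=
  prim (fun _ b => ⟨none, b, some x, .stay, .stay⟩) (by simp)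

/-- Do nothing. -/
def skip : Frag := moveWork .stay

/-- Move the input head to the left. -/
def inputLeft : Frag :=
  prim (fun _ b => ⟨none, b, none, .left, .stay⟩) (by simp)

/-- Move the input head to the right, unless it is on a blank. -/
def inputRight : Frag :=
  prim (fun a b => ⟨none, b, none, if a.isSome then .right else .stay, .stay⟩) (by simp)

/-- The fragment `F` performed `n` times. -/
def times (F : Frag) : ℕ → Frag
  | 0 => skip
  | n + 1 => seq F (times F n)

variable {p x : ℕ} {wk : ℕ → Option Bool} {o : List Bool}

theorem run_moveWork {m : TapeMove} (h : x < S) :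
    (moveWork m).Run w S ⟨p, wk, x, o⟩ ⟨p, wk, m.apply x, o⟩ := by
  have := Run.prim (f := fun _ b => ⟨none, b, none, .stay, m⟩) (hf := by simp) (w := w)
    (t := ⟨p, wk, x, o⟩) h rfl
  simp only [TapeConf.act, TapeMove.apply, Function.update_eq_self, Option.toList_none,
    List.append_nil] at this
  exact this

theorem run_skip {t : TapeConf} (h : t.wpos < S) : skip.Run w S t t := run_moveWork h

theorem run_write {y : Option Bool} (h : x < S) :
    (write y).Run w S ⟨p, wk, x, o⟩ ⟨p, Function.update wk x y, x, o⟩ := by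
  have := Run.prim (f := fun _ _ => ⟨none, y, none, .stay, .stay⟩) (hf := by simp) (w := w)
    (t := ⟨p, wk, x, o⟩) h rfl
  simp only [TapeConf.act, TapeMove.apply, Option.toList_none, List.append_nil] at this
  exact this

theorem run_moveRight {n : ℕ} (h : x + n < S) :
    ((moveWork .right).times n).Run w S ⟨p, wk, x, o⟩ ⟨p, wk, x + n, o⟩ := by
  induction n generalizing x with
  | zero => exact run_skip h
  | succ n ih =>
    have := ih (x := x + 1) (by omega)
    rw [show x + (n + 1) = x + 1 + n by omega]
    exact (run_moveWork (by omega)).seq this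

theorem run_moveLeft {n : ℕ} (h : x + n < S) :
    ((moveWork .left).times n).Run w S ⟨p, wk, x + n, o⟩ ⟨p, wk, x, o⟩ := by
  induction n generalizing x with
  | zero => exact run_skip h
  | succ n ih => exact (run_moveWork (by omega)).seq (ih (by omega))

/-- The work tape with the counters `bs 0, …, bs (k - 1)` in binary, least significant bit first.
The cells are grouped into columns of `k + 1` cells.  The first cell of a column is marked
in column `0` only, and the others hold a bit (or a blank) of each counter. -/
def cells (k : ℕ) (bs : ℕ → List Bool) : ℕ → Option Bool := fun x =>
  if x % (k + 1) = 0 then (if x = 0 then some true else none)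
  else (bs (x % (k + 1) - 1))[x / (k + 1)]?

/-- The value of a binary number, least significant bit first. -/
def bval : List Bool → ℕ
  | [] => 0
  | b :: l => b.toNat + 2 * bval l

theorem bval_append (l l' : List Bool) : bval (l ++ l') = bval l + 2 ^ l.length * bval l' := by
  induction l with
  | nil => simp [bval]
  | cons b l ih => simp [bval, ih, pow_succ]; ring

theorem bval_replicate_true (n : ℕ) : bval (List.replicate n true) + 1 = 2 ^ n := by
  induction n with
  | zero => rfl
  | succ n ih => simp [bval, List.replicate_succ, pow_succ]; omega

variable {k r c : ℕ} {bs : ℕ → List Bool} {l : List Bool}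

theorem cells_col (hr : r < k) : cells k bs ((k + 1) * c + (r + 1)) = (bs r)[c]? := by
  have h1 : ((k + 1) * c + (r + 1)) % (k + 1) = r + 1 := by
    rw [Nat.mul_add_mod, Nat.mod_eq_of_lt (by omega)]
  have h2 : ((k + 1) * c + (r + 1)) / (k + 1) = c := by
    rw [Nat.mul_add_div (by omega), Nat.div_eq_of_lt (by omega)]; simp
  simp [cells, h1, h2]

theorem cells_mark : cells k bs ((k + 1) * c) = if c = 0 then some true else none := by
  simp [cells]

theorem update_cells (hr : r < k) {b : Bool} {l₁ l₂ l₃ : List Bool} (hc : l₁.length = c)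
    (h2 : l₂.length ≤ 1) (h : l₂ = [] → l₃ = []) :
    Function.update (cells k (Function.update bs r (l₁ ++ (l₂ ++ l₃)))) ((k + 1) * c + (r + 1))
      (some b) = cells k (Function.update bs r (l₁ ++ (b :: l₃))) := by
  subst hc
  funext x
  by_cases hx : x = (k + 1) * l₁.length + (r + 1)
  · subst hx
    rw [Function.update_self, cells_col hr]; simp
  · rw [Function.update_of_ne hx]
    simp only [cells]
    split_ifs with h0 h1
    · rfl
    · rfl
    · by_cases hr' : x % (k + 1) - 1 = r
      · have hne : x / (k + 1) ≠ l₁.length := by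
          intro h3
          apply hx
          rw [← Nat.div_add_mod x (k + 1), h3]; omega
        rw [hr', Function.update_self, Function.update_self]
        rcases lt_or_gt_of_ne hne with hl | hl
        · rw [List.getElem?_append_left hl, List.getElem?_append_left hl]
        · rw [List.getElem?_append_right hl.le, List.getElem?_append_right hl.le]
          obtain ⟨m, hm⟩ : ∃ m, x / (k + 1) - l₁.length = m + 1 :=
            ⟨x / (k + 1) - l₁.length - 1, by omega⟩
          rcases l₂ with _ | ⟨y, _ | ⟨z, l₂⟩⟩
          · simp [h rfl, hm]
          · simp [hm]
          · simp at h2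
      · rw [Function.update_of_ne hr', Function.update_of_ne hr']

/-- Return the work head from track `r` to the first cell. -/
def home (k r : ℕ) : Frag :=
  seq ((moveWork .left).times (r + 1))
    (loop (fun _ b => b.isNone) ((moveWork .left).times (k + 1)))

theorem run_home (hS : (k + 1) * c + (r + 1) < S) :
    (home k r).Run w S ⟨p, cells k bs, (k + 1) * c + (r + 1), o⟩ ⟨p, cells k bs, 0, o⟩ := by
  refine (run_moveLeft hS).seq ?_
  induction c with
  | zero => exact Run.loop_done (by simp only; omega) (by simp [cells])
  | succ c ih =>
    have hlt : (k + 1) * c + (k + 1) = (k + 1) * (c + 1) := by ring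
    refine Run.loop_step (t₁ := ⟨p, cells k bs, (k + 1) * c, o⟩) (by simp only; omega) ?_ ?_
      (ih (by omega))
    · simp only [cells_mark]; simp
    · have := run_moveLeft (w := w) (S := S) (p := p) (wk := cells k bs) (o := o)
        (x := (k + 1) * c) (n := k + 1) (by omega)
      rwa [hlt] at this

/-- A binary increment (`x = true`) or decrement (`x = false`): the bits equal to `x` are inverted
up to the first position with a different bit or a blank, which is set to `x` inverted. -/
def carry (k r : ℕ) (x : Bool) : Frag :=
  seq ((moveWork .right).times (r + 1))
    (seq (loop (fun _ b => b == some x)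
        (seq (write (some !x)) ((moveWork .right).times (k + 1))))
      (seq (write (some x)) (home k r)))

/-- The carry stops at `l₂`, which is the first digit different from `x`, or empty at the blank
end of the track. -/
theorem run_carry (hr : r < k) {x : Bool} {n : ℕ} {l₂ l₃ : List Bool} (h2 : l₂.length ≤ 1)
    (h : l₂ = [] → l₃ = []) (hx : ∀ b ∈ l₂, b = !x)
    (hS : (k + 1) * n + (r + 1) < S) :
    (carry k r x).Run w S
      ⟨p, cells k (Function.update bs r (List.replicate n x ++ (l₂ ++ l₃))), 0, o⟩
      ⟨p, cells k (Function.update bs r (List.replicate n (!x) ++ (x :: l₃))), 0, o⟩ := by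
  have hloop : ∀ m c, m + c = n →
      (loop (fun _ b => b == some x)
        (seq (write (some !x)) ((moveWork .right).times (k + 1)))).Run w S
      ⟨p, cells k (Function.update bs r
        (List.replicate c (!x) ++ (List.replicate m x ++ (l₂ ++ l₃)))), (k + 1) * c + (r + 1), o⟩
      ⟨p, cells k (Function.update bs r (List.replicate n (!x) ++ (l₂ ++ l₃))),
        (k + 1) * n + (r + 1), o⟩ := by
    intro m
    induction m with
    | zero =>
      intro c hc
      obtain rfl : c = n := by omega
      refine Run.loop_done hS ?_
      simp only [cells_col hr, Function.update_self]
      rcases l₂ with _ | ⟨y, l₂⟩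
      · simp [h rfl]
      · simp [hx y (by simp)]
    | succ m ih =>
      intro c hc
      have hle : (k + 1) * (c + 1) ≤ (k + 1) * n := Nat.mul_le_mul_left _ (by omega)
      have he : (k + 1) * (c + 1) = (k + 1) * c + (k + 1) := by ring
      refine Run.loop_step (by simp only; omega) ?_ ?_ (ih (c + 1) (by omega))
      · simp only [cells_col hr, Function.update_self]
        simp [List.replicate_succ]
      · refine (run_write (by omega)).seq ?_
        have := update_cells (bs := bs) (c := c) hr (b := !x) (l₁ := List.replicate c (!x)) (l₂ := [x])
          (l₃ := List.replicate m x ++ (l₂ ++ l₃)) (by simp) (by simp) (by simp)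
        rw [show List.replicate (m + 1) x ++ (l₂ ++ l₃) =
          [x] ++ (List.replicate m x ++ (l₂ ++ l₃)) by simp [List.replicate_succ], this,
          show List.replicate c (!x) ++ (!x) :: (List.replicate m x ++ (l₂ ++ l₃)) =
          List.replicate (c + 1) (!x) ++ (List.replicate m x ++ (l₂ ++ l₃)) by
            simp [List.replicate_succ'], he, add_right_comm]
        exact run_moveRight (by omega)
  have h0 := run_moveRight (w := w) (S := S) (p := p) (o := o) (x := 0) (n := r + 1)
    (wk := cells k (Function.update bs r (List.replicate n x ++ (l₂ ++ l₃))))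
    (by omega)
  have h1 := hloop n 0 (by omega)
  simp only [List.replicate_zero, List.nil_append, mul_zero] at h1
  have h3 := run_write (w := w) (p := p) (o := o) (y := some x)
    (wk := cells k (Function.update bs r (List.replicate n (!x) ++ (l₂ ++ l₃)))) hS
  rw [update_cells (c := n) hr (by simp) h2 h] at h3
  exact h0.seq (h1.seq (h3.seq (run_home hS)))

/-- Move to the most significant end of track `r`, or to its lowest bit `1`. -/
def scan (k r : ℕ) : Frag :=
  seq ((moveWork .right).times (r + 1))
    (loop (fun _ b => b == some false) ((moveWork .right).times (k + 1)))

theorem run_scan (hr : r < k) {n : ℕ} {l : List Bool} (hb : bs r = List.replicate n false ++ l)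
    (hl : l.head? ≠ some false) (hS : (k + 1) * n + (r + 1) < S) :
    (scan k r).Run w S ⟨p, cells k bs, 0, o⟩ ⟨p, cells k bs, (k + 1) * n + (r + 1), o⟩ := by
  have hloop : ∀ m c, m + c = n →
      (loop (fun _ b => b == some false) ((moveWork .right).times (k + 1))).Run w S
      ⟨p, cells k bs, (k + 1) * c + (r + 1), o⟩ ⟨p, cells k bs, (k + 1) * n + (r + 1), o⟩ := by
    intro m
    induction m with
    | zero =>
      intro c hc
      obtain rfl : c = n := by omega
      refine Run.loop_done hS ?_
      simp only [cells_col hr, hb]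
      rcases l with _ | ⟨y, l⟩ <;> simp_all
    | succ m ih =>
      intro c hc
      have hle : (k + 1) * (c + 1) ≤ (k + 1) * n := Nat.mul_le_mul_left _ (by omega)
      have he : (k + 1) * (c + 1) = (k + 1) * c + (k + 1) := by ring
      refine Run.loop_step (by simp only; omega) ?_ ?_ (ih (c + 1) (by omega))
      · simp only [cells_col hr, hb]
        rw [List.getElem?_append_left (by simp; omega)]
        simp only [List.getElem?_replicate]
        rw [if_pos (by omega)]; rfl
      · rw [he, add_right_comm]
        exact run_moveRight (by omega)
  have h0 := run_moveRight (w := w) (S := S) (p := p) (o := o) (x := 0) (n := r + 1)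
    (wk := cells k bs) (by omega)
  refine h0.seq ?_
  simpa using hloop n 0 (by omega)

/-- Run `F` if counter `r` is nonzero, and `G` otherwise. -/
def ifNonzero (k r : ℕ) (F G : Frag) : Frag :=
  seq (scan k r) (cond (fun _ b => b == some true) (seq (home k r) F) (seq (home k r) G))

/-- Repeat `F` while counter `r` is nonzero. -/
def whileNonzero (k r : ℕ) (F : Frag) : Frag :=
  seq (scan k r) (seq (loop (fun _ b => b == some true) (seq (home k r) (seq F (scan k r))))
    (home k r))

end Frag

/-- The state of a machine that computes with counters. -/
structure CState where
  cnt : ℕ → ℕ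
  pos : ℕ
  out : List Bool

namespace CState

open Frag

/-- The tapes of a machine in counter state `s`: the numbers are written with at most as many
bits as `B` has. -/
def Holds (k B : ℕ) (s : CState) (t : TapeConf) : Prop :=
  ∃ bs : ℕ → List Bool, (∀ r, bval (bs r) = s.cnt r) ∧ (∀ r, (bs r).length ≤ Nat.size B) ∧
    t = ⟨s.pos, cells k bs, 0, s.out⟩

/-- The state with counter `r` set to `v`. -/
def set (s : CState) (r v : ℕ) : CState := ⟨Function.update s.cnt r v, s.pos, s.out⟩

end CState

namespace Frag

variable {F G : Frag} {w : List Bool} {k B r : ℕ} {s s₁ s₂ : CState}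

/-- `F.Exec k B w s s'`: the fragment leads from the counter state `s` to `s'`, in space that
suffices for `k` counters with values up to `B`. -/
def Exec (F : Frag) (k B : ℕ) (w : List Bool) (s s' : CState) : Prop :=
  ∀ t, s.Holds k B t → ∃ t', s'.Holds k B t' ∧ F.Run w ((k + 1) * (Nat.size B + 1)) t t'

theorem Exec.seq (h₁ : F.Exec k B w s s₁) (h₂ : G.Exec k B w s₁ s₂) :
    (seq F G).Exec k B w s s₂ := by
  intro t ht
  obtain ⟨t₁, ht₁, hr₁⟩ := h₁ t ht
  obtain ⟨t₂, ht₂, hr₂⟩ := h₂ t₁ ht₁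
  exact ⟨t₂, ht₂, hr₁.seq hr₂⟩

theorem space_pos : 0 < (k + 1) * (Nat.size B + 1) := by positivity

theorem col_lt (hr : r < k) {n : ℕ} (hn : n ≤ Nat.size B) :
    (k + 1) * n + (r + 1) < (k + 1) * (Nat.size B + 1) := by
  have := Nat.mul_le_mul_left (k + 1) hn
  rw [mul_add]; omega

/-- The longest prefix of copies of `x`. -/
theorem exists_replicate_append (x : Bool) (l : List Bool) :
    ∃ n l', l = List.replicate n x ++ l' ∧ l'.head? ≠ some x := by
  induction l with
  | nil => exact ⟨0, [], rfl, by simp⟩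
  | cons b l ih =>
    by_cases h : b = x
    · obtain ⟨n, l', rfl, h'⟩ := ih
      exact ⟨n + 1, l', by simp [List.replicate_succ, h], h'⟩
    · exact ⟨0, b :: l, rfl, by simpa using h⟩

/-- Add one to counter `r`. -/
def inc (k r : ℕ) : Frag := carry k r true

/-- Subtract one from counter `r`, which must not be zero. -/
def dec (k r : ℕ) : Frag := carry k r false

theorem exec_carry_aux (hr : r < k) {x : Bool} {n v : ℕ} {l₂ l₃ : List Bool} {bs : ℕ → List Bool}
    (hbs : ∀ r, bval (bs r) = s.cnt r) (hlen : ∀ r, (bs r).length ≤ Nat.size B)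
    (hb : bs r = List.replicate n x ++ (l₂ ++ l₃)) (h2 : l₂.length ≤ 1)
    (h : l₂ = [] → l₃ = []) (hx : ∀ b ∈ l₂, b = !x)
    (hv : bval (List.replicate n (!x) ++ x :: l₃) = v)
    (hlen' : (List.replicate n (!x) ++ x :: l₃).length ≤ Nat.size B) :
    ∃ t', (s.set r v).Holds k B t' ∧
      (carry k r x).Run w ((k + 1) * (Nat.size B + 1)) ⟨s.pos, cells k bs, 0, s.out⟩ t' := by
  have hn : n ≤ Nat.size B := by have := hlen r; simp [hb] at this; omega
  have hbe : bs = Function.update bs r (List.replicate n x ++ (l₂ ++ l₃)) := by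
    rw [← hb, Function.update_eq_self]
  refine ⟨⟨s.pos, cells k (Function.update bs r (List.replicate n (!x) ++ x :: l₃)), 0, s.out⟩,
    ⟨_, ?_, ?_, rfl⟩, ?_⟩
  · intro r'
    by_cases h' : r' = r
    · subst h'; simp [CState.set, hv]
    · simp [CState.set, h', hbs]
  · intro r'
    by_cases h' : r' = r
    · subst h'; rw [Function.update_self]; exact hlen'
    · rw [Function.update_of_ne h']; exact hlen r'
  · conv => arg 4; rw [hbe]
    exact run_carry hr h2 h hx (col_lt hr hn)

theorem exec_inc (hr : r < k) (hB : s.cnt r + 1 ≤ B) :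
    (inc k r).Exec k B w s (s.set r (s.cnt r + 1)) := by
  rintro t ⟨bs, hbs, hlen, rfl⟩
  obtain ⟨n, l', hl, hh⟩ := exists_replicate_append true (bs r)
  have hrep := bval_replicate_true n
  have hf : ∀ m, bval (List.replicate m false) = 0 := by
    intro m; induction m with
    | zero => rfl
    | succ m ih => simp [List.replicate_succ, bval, ih]
  have hval := hbs r
  rcases l' with _ | ⟨b, l'⟩
  · refine exec_carry_aux hr (l₂ := []) (l₃ := []) hbs hlen (by simpa using hl) (by simp)
      (by simp) (by simp) ?_ ?_
    · rw [hl] at hval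
      simp only [List.append_nil] at hval
      simp [bval_append, bval, hf, ← hval, hrep]
    · rw [hl] at hval
      simp only [List.append_nil] at hval
      simp only [List.length_append, List.length_replicate, List.length_singleton]
      have : 2 ^ n ≤ B := by omega
      exact Nat.lt_size.2 this
  · have hb : b = false := by simpa using hh
    subst hb
    refine exec_carry_aux hr (l₂ := [false]) (l₃ := l') hbs hlen (by simpa using hl) (by simp)
      (by simp) (by simp) ?_ ?_
    · rw [hl] at hval
      simp only [bval_append, bval, List.length_replicate, Bool.toNat_false] at hval
      simp only [Bool.not_true, bval_append, bval, hf, List.length_replicate, Bool.toNat_true]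
      rw [← hval]; linarith
    · have := hlen r; rw [hl] at this; simpa using this

theorem exec_dec (hr : r < k) (h0 : s.cnt r ≠ 0) :
    (dec k r).Exec k B w s (s.set r (s.cnt r - 1)) := by
  rintro t ⟨bs, hbs, hlen, rfl⟩
  obtain ⟨n, l', hl, hh⟩ := exists_replicate_append false (bs r)
  have hrep := bval_replicate_true n
  have hf : ∀ m, bval (List.replicate m false) = 0 := by
    intro m; induction m with
    | zero => rfl
    | succ m ih => simp [List.replicate_succ, bval, ih]
  have hval := hbs r
  rcases l' with _ | ⟨b, l'⟩
  · rw [hl] at hval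
    simp [hf] at hval
    omega
  · have hb : b = true := by simpa using hh
    subst hb
    refine exec_carry_aux hr (l₂ := [true]) (l₃ := l') hbs hlen (by simpa using hl) (by simp)
      (by simp) (by simp) ?_ ?_
    · rw [hl] at hval
      simp only [bval_append, bval, hf, List.length_replicate, Bool.toNat_true] at hval
      simp only [Bool.not_false, bval_append, bval, List.length_replicate, Bool.toNat_false]
      rw [← hval]
      have : 2 ^ n * (1 + 2 * bval l') = 2 ^ n + 2 ^ n * (0 + 2 * bval l') := by ring
      omega
    · have := hlen r; rw [hl] at this; simpa using this

theorem exec_scan_aux (hr : r < k) {bs : ℕ → List Bool}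
    (hbs : ∀ r, bval (bs r) = s.cnt r) (hlen : ∀ r, (bs r).length ≤ Nat.size B) :
    ∃ n ≤ Nat.size B, (scan k r).Run w ((k + 1) * (Nat.size B + 1)) ⟨s.pos, cells k bs, 0, s.out⟩
      ⟨s.pos, cells k bs, (k + 1) * n + (r + 1), s.out⟩ ∧
      (cells k bs ((k + 1) * n + (r + 1)) == some true) = decide (s.cnt r ≠ 0) := by
  obtain ⟨n, l', hl, hh⟩ := exists_replicate_append false (bs r)
  have hf : ∀ m, bval (List.replicate m false) = 0 := by
    intro m; induction m with
    | zero => rfl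
    | succ m ih => simp [List.replicate_succ, bval, ih]
  have hn : n ≤ Nat.size B := by have := hlen r; simp [hl] at this; omega
  refine ⟨n, hn, run_scan hr hl hh (col_lt hr hn), ?_⟩
  rw [cells_col hr, ← hbs, hl, bval_append, hf]
  rcases l' with _ | ⟨b, l'⟩
  · simp [bval]
  · have hb : b = true := by simpa using hh
    subst hb
    simp [bval]

theorem Exec.ifNonzero_pos (hr : r < k) (h0 : s.cnt r ≠ 0) (h : F.Exec k B w s s₁) :
    (ifNonzero k r F G).Exec k B w s s₁ := by
  rintro t ⟨bs, hbs, hlen, rfl⟩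
  obtain ⟨n, hn, hrun, hc⟩ := exec_scan_aux (w := w) hr hbs hlen
  obtain ⟨t', ht', h'⟩ := h _ ⟨bs, hbs, hlen, rfl⟩
  exact ⟨t', ht', hrun.seq (Run.cond_true (col_lt hr hn) (by simp only; rw [hc]; simpa using h0)
    ((run_home (col_lt hr hn)).seq h'))⟩

theorem Exec.ifNonzero_zero (hr : r < k) (h0 : s.cnt r = 0) (h : G.Exec k B w s s₁) :
    (ifNonzero k r F G).Exec k B w s s₁ := by
  rintro t ⟨bs, hbs, hlen, rfl⟩
  obtain ⟨n, hn, hrun, hc⟩ := exec_scan_aux (w := w) hr hbs hlen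
  obtain ⟨t', ht', h'⟩ := h _ ⟨bs, hbs, hlen, rfl⟩
  exact ⟨t', ht', hrun.seq (Run.cond_false (col_lt hr hn) (by simp only; rw [hc]; simpa using h0)
    ((run_home (col_lt hr hn)).seq h'))⟩

/-- A loop whose body leads from the state `f i` to `f (i + 1)` for `i < n`, with the counter
nonzero exactly in the states before `f n`. -/
theorem Exec.whileNonzero (hr : r < k) (f : ℕ → CState) (n : ℕ)
    (hpos : ∀ i < n, (f i).cnt r ≠ 0) (hzero : (f n).cnt r = 0)
    (h : ∀ i < n, F.Exec k B w (f i) (f (i + 1))) :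
    (whileNonzero k r F).Exec k B w (f 0) (f n) := by
  have key : ∀ m i, i + m = n → ∀ bs : ℕ → List Bool, (∀ r, bval (bs r) = (f i).cnt r) →
      (∀ r, (bs r).length ≤ Nat.size B) → ∀ c ≤ Nat.size B,
      (cells k bs ((k + 1) * c + (r + 1)) == some true) = decide ((f i).cnt r ≠ 0) →
      ∃ bs' : ℕ → List Bool, ∃ c' ≤ Nat.size B, (∀ r, bval (bs' r) = (f n).cnt r) ∧
      (∀ r, (bs' r).length ≤ Nat.size B) ∧
      (loop (fun _ b => b == some true) (Frag.seq (home k r) (Frag.seq F (scan k r)))).Run w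
        ((k + 1) * (Nat.size B + 1))
        ⟨(f i).pos, cells k bs, (k + 1) * c + (r + 1), (f i).out⟩
        ⟨(f n).pos, cells k bs', (k + 1) * c' + (r + 1), (f n).out⟩ := by
    intro m
    induction m with
    | zero =>
      intro i hi bs hbs hlen c hc hcell
      obtain rfl : i = n := by omega
      exact ⟨bs, c, hc, hbs, hlen, Run.loop_done (col_lt hr hc)
        (by simp only; rw [hcell]; simpa using hzero)⟩
    | succ m ih =>
      intro i hi bs hbs hlen c hc hcell
      obtain ⟨t₁, ⟨bs₁, hbs₁, hlen₁, rfl⟩, h₁⟩ := h i (by omega) _ ⟨bs, hbs, hlen, rfl⟩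
      obtain ⟨n₁, hn₁, hrun₁, hc₁⟩ := exec_scan_aux (w := w) hr hbs₁ hlen₁
      obtain ⟨bs', c', hc', hbs', hlen', h'⟩ := ih (i + 1) (by omega) bs₁ hbs₁ hlen₁ n₁ hn₁ hc₁
      exact ⟨bs', c', hc', hbs', hlen', Run.loop_step (col_lt hr hc)
        (by simp only; rw [hcell]; simpa using hpos i (by omega))
        ((run_home (col_lt hr hc)).seq (h₁.seq hrun₁)) h'⟩
  rintro t ⟨bs, hbs, hlen, rfl⟩
  obtain ⟨c, hc, hrun, hcell⟩ := exec_scan_aux (w := w) hr hbs hlen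
  obtain ⟨bs', c', hc', hbs', hlen', h'⟩ := key n 0 (by omega) bs hbs hlen c hc hcell
  exact ⟨_, ⟨bs', hbs', hlen', rfl⟩, hrun.seq (h'.seq (run_home (col_lt hr hc')))⟩

end Frag

/-! ### A language for expressions and output programs over bounded counters -/

attribute [ext] CState

namespace CState

theorem cnt_set (s : CState) (r v r' : ℕ) :
    (s.set r v).cnt r' = if r' = r then v else s.cnt r' := by
  simp [set, Function.update_apply]

@[simp] theorem pos_set (s : CState) (r v : ℕ) : (s.set r v).pos = s.pos := rfl

@[simp] theorem out_set (s : CState) (r v : ℕ) : (s.set r v).out = s.out := rfl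

theorem map_set {ctx : List ℕ} {d v : ℕ} (s : CState) (h : ∀ y ∈ ctx, y < d) {d' : ℕ}
    (hd : d ≤ d') : ctx.map (s.set d' v).cnt = ctx.map s.cnt := by
  apply List.map_congr_left
  intro y hy
  have := h y hy
  rw [cnt_set, if_neg (by omega)]

end CState

namespace Frag

variable {F G : Frag} {w : List Bool} {k B r : ℕ} {s s₁ s₂ : CState}

theorem Exec.to (h : F.Exec k B w s s₁) (e : s₁ = s₂) : F.Exec k B w s s₂ := e ▸ h

theorem exec_skip : skip.Exec k B w s s := by
  rintro t ⟨bs, hbs, hlen, rfl⟩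
  exact ⟨_, ⟨bs, hbs, hlen, rfl⟩, run_skip space_pos⟩

theorem exec_emit {b : Bool} : (emit b).Exec k B w s ⟨s.cnt, s.pos, s.out ++ [b]⟩ := by
  rintro t ⟨bs, hbs, hlen, rfl⟩
  refine ⟨_, ⟨bs, hbs, hlen, rfl⟩, ?_⟩
  have := Run.prim (f := fun _ c => ⟨none, c, some b, .stay, .stay⟩) (hf := by simp) (w := w)
    (t := ⟨s.pos, cells k bs, 0, s.out⟩) (space_pos (k := k) (B := B)) rfl
  simp only [TapeConf.act, TapeMove.apply, Option.toList_some, Function.update_eq_self] at this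
  exact this

theorem exec_inputLeft : inputLeft.Exec k B w s ⟨s.cnt, s.pos - 1, s.out⟩ := by
  rintro t ⟨bs, hbs, hlen, rfl⟩
  refine ⟨_, ⟨bs, hbs, hlen, rfl⟩, ?_⟩
  have := Run.prim (f := fun _ c => ⟨none, c, none, .left, .stay⟩) (hf := by simp) (w := w)
    (t := ⟨s.pos, cells k bs, 0, s.out⟩) (space_pos (k := k) (B := B)) rfl
  simp only [TapeConf.act, TapeMove.apply, Option.toList_none, List.append_nil,
    Function.update_eq_self] at this
  exact this

theorem exec_inputRight (h : s.pos < w.length) :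
    inputRight.Exec k B w s ⟨s.cnt, s.pos + 1, s.out⟩ := by
  rintro t ⟨bs, hbs, hlen, rfl⟩
  refine ⟨_, ⟨bs, hbs, hlen, rfl⟩, ?_⟩
  have := Run.prim (f := fun a c => ⟨none, c, none, if a.isSome then .right else .stay, .stay⟩)
    (hf := by simp) (w := w)
    (t := ⟨s.pos, cells k bs, 0, s.out⟩) (space_pos (k := k) (B := B)) rfl
  simp only [TapeConf.act, List.getElem?_eq_getElem h, Option.isSome_some, if_true,
    TapeMove.apply, Option.toList_none, List.append_nil, Function.update_eq_self] at this
  exact this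

/-- Branch on the input symbol. -/
def ifInput (p : Option Bool → Bool) (F G : Frag) : Frag := cond (fun a _ => p a) F G

/-- Repeat while the input symbol satisfies `p`. -/
def whileInput (p : Option Bool → Bool) (F : Frag) : Frag := loop (fun a _ => p a) F

theorem Exec.ifInput_true {p : Option Bool → Bool} (hp : p w[s.pos]? = true)
    (h : F.Exec k B w s s₁) : (ifInput p F G).Exec k B w s s₁ := by
  rintro t ⟨bs, hbs, hlen, rfl⟩
  obtain ⟨t', ht', hr⟩ := h _ ⟨bs, hbs, hlen, rfl⟩
  exact ⟨t', ht', hr.cond_true space_pos hp⟩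

theorem Exec.ifInput_false {p : Option Bool → Bool} (hp : p w[s.pos]? = false)
    (h : G.Exec k B w s s₁) : (ifInput p F G).Exec k B w s s₁ := by
  rintro t ⟨bs, hbs, hlen, rfl⟩
  obtain ⟨t', ht', hr⟩ := h _ ⟨bs, hbs, hlen, rfl⟩
  exact ⟨t', ht', hr.cond_false space_pos hp⟩

theorem Exec.whileInput_done {p : Option Bool → Bool} (hp : p w[s.pos]? = false) :
    (whileInput p F).Exec k B w s s := by
  rintro t ⟨bs, hbs, hlen, rfl⟩
  exact ⟨_, ⟨bs, hbs, hlen, rfl⟩, Run.loop_done space_pos hp⟩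

theorem Exec.whileInput_step {p : Option Bool → Bool} (hp : p w[s.pos]? = true)
    (h₁ : F.Exec k B w s s₁) (h₂ : (whileInput p F).Exec k B w s₁ s₂) :
    (whileInput p F).Exec k B w s s₂ := by
  rintro t ⟨bs, hbs, hlen, rfl⟩
  obtain ⟨t₁, ht₁, hr₁⟩ := h₁ _ ⟨bs, hbs, hlen, rfl⟩
  obtain ⟨t₂, ht₂, hr₂⟩ := h₂ _ ht₁
  exact ⟨t₂, ht₂, Run.loop_step space_pos hp hr₁ hr₂⟩

/-- Set counter `r` to zero. -/
def clear (k r : ℕ) : Frag := whileNonzero k r (dec k r)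

theorem exec_clear (hr : r < k) : (clear k r).Exec k B w s (s.set r 0) := by
  have := Exec.whileNonzero (F := dec k r) (w := w) (B := B) hr (fun i => s.set r (s.cnt r - i))
    (s.cnt r) (fun i hi => by simp [CState.cnt_set]; omega) (by simp [CState.cnt_set])
    (fun i hi => (exec_dec hr (by simp [CState.cnt_set]; omega)).to (by
      ext r'
      · simp only [CState.cnt_set]; split_ifs <;> omega
      · rfl
      · rfl))
  simp only [Nat.sub_zero, Nat.sub_self] at this
  have h0 : s.set r (s.cnt r) = s := by ext r' <;> simp [CState.cnt_set]; rintro rfl; rfl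
  rwa [h0] at this

/-- Move the contents of counter `a` to counter `b`. -/
def move (k a b : ℕ) : Frag := whileNonzero k a (seq (dec k a) (inc k b))

theorem exec_move {a b : ℕ} (ha : a < k) (hb : b < k) (hab : a ≠ b) (hB : s.cnt a + s.cnt b ≤ B) :
    (move k a b).Exec k B w s ((s.set a 0).set b (s.cnt a + s.cnt b)) := by
  have := Exec.whileNonzero (F := seq (dec k a) (inc k b)) (w := w) (B := B) ha
    (fun i => (s.set a (s.cnt a - i)).set b (i + s.cnt b))
    (s.cnt a) (fun i hi => by simp [CState.cnt_set, hab]; omega) (by simp [CState.cnt_set, hab])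
    (fun i hi => ((exec_dec ha (by simp [CState.cnt_set, hab]; omega)).seq
      (exec_inc hb (by simp [CState.cnt_set, hab.symm]; omega))).to (by
      ext r'
      · simp only [CState.cnt_set]; split_ifs <;> simp_all <;> omega
      · rfl
      · rfl))
  simp only [Nat.sub_zero, Nat.sub_self] at this
  have h0 : (s.set a (s.cnt a)).set b (0 + s.cnt b) = s := by
    ext r' <;> simp [CState.cnt_set]; split_ifs <;> simp_all
  rwa [h0] at this

/-- Add the contents of counter `a` to the zero counter `b`, with the help of the zero counter `c`. -/
def copy (k a b c : ℕ) : Frag :=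
  seq (whileNonzero k a (seq (dec k a) (seq (inc k b) (inc k c)))) (move k c a)

theorem exec_copy {a b c : ℕ} (ha : a < k) (hb : b < k) (hc : c < k) (hab : a ≠ b) (hac : a ≠ c)
    (hbc : b ≠ c) (hB : s.cnt a ≤ B) (hb0 : s.cnt b = 0) (hc0 : s.cnt c = 0) :
    (copy k a b c).Exec k B w s (s.set b (s.cnt a)) := by
  have := Exec.whileNonzero (F := seq (dec k a) (seq (inc k b) (inc k c))) (w := w) (B := B) ha
    (fun i => ((s.set a (s.cnt a - i)).set b i).set c i)
    (s.cnt a) (fun i hi => by simp [CState.cnt_set, hab, hac]; omega)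
    (by simp [CState.cnt_set, hab, hac])
    (fun i hi => ((exec_dec ha (by simp [CState.cnt_set, hab, hac]; omega)).seq
      ((exec_inc hb (by simp [CState.cnt_set, hab.symm, hbc]; omega)).seq
        (exec_inc hc (by simp [CState.cnt_set, hbc.symm, hac.symm]; omega)))).to (by
      ext r'
      · simp only [CState.cnt_set]; split_ifs <;> simp_all; omega
      · rfl
      · rfl))
  simp only [Nat.sub_zero, Nat.sub_self] at this
  have h0 : ((s.set a (s.cnt a)).set b 0).set c 0 = s := by
    ext r' <;> simp [CState.cnt_set]; split_ifs <;> simp_all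
  rw [h0] at this
  refine (this.seq (exec_move hc ha hac.symm (by simp [CState.cnt_set, hab, hac]; omega))).to ?_
  ext r'
  · simp only [CState.cnt_set]; split_ifs <;> simp_all
  · rfl
  · rfl

end Frag

/-- Expressions for natural numbers in an environment, whose variables are numbered from the
innermost one.  `fold i c s` starts with the value of `i` and applies `s` as often as `c` says; in `s`
variable `0` is the number of the iteration and variable `1` the current value.  `call f a b`
evaluates `f` in the environment that consists of the values of `a` and `b`. -/
inductive Exp where
  | var (j : ℕ)
  | zero
  | succ (e : Exp)
  | pred (e : Exp)
  | ite (c a b : Exp)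
  | fold (i c s : Exp)
  | call (f a b : Exp)

namespace Exp

/-- The value of an expression. -/
def eval : Exp → List ℕ → ℕ
  | var j, v => v.getD j 0
  | zero, _ => 0
  | succ e, v => e.eval v + 1
  | pred e, v => e.eval v - 1
  | ite c a b, v => if c.eval v ≠ 0 then a.eval v else b.eval v
  | fold i c s, v => Nat.rec (i.eval v) (fun n acc => s.eval (n :: acc :: v)) (c.eval v)
  | call f a b, v => f.eval [a.eval v, b.eval v]

/-- All numbers that occur in the evaluation of the expression are at most `B`. -/
def Bdd (B : ℕ) : Exp → List ℕ → Prop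
  | var j, v => v.getD j 0 ≤ B
  | zero, _ => True
  | succ e, v => e.Bdd B v ∧ e.eval v + 1 ≤ B
  | pred e, v => e.Bdd B v
  | ite c a b, v => c.Bdd B v ∧ if c.eval v ≠ 0 then a.Bdd B v else b.Bdd B v
  | fold i c s, v => i.Bdd B v ∧ c.Bdd B v ∧ ∀ n < c.eval v,
      s.Bdd B (n :: Nat.rec (i.eval v) (fun n acc => s.eval (n :: acc :: v)) n :: v)
  | call f a b, v => a.Bdd B v ∧ b.Bdd B v ∧ f.Bdd B [a.eval v, b.eval v]

/-- The number of additional counters for the evaluation of an expression. -/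
def need : Exp → ℕ
  | var _ => 2
  | zero => 1
  | succ e => e.need
  | pred e => e.need
  | ite c a b => max c.need (max a.need b.need)
  | fold i c s => 3 + max i.need (max c.need s.need)
  | call f a b => 2 + max f.need (max a.need b.need)

theorem need_pos (e : Exp) : 0 < e.need := by
  induction e <;> simp [need] <;> omega

open Frag

/-- The evaluation of an expression into the counter `d`.  Counters from `d` on are zero before,
and counters beyond `d` are zero afterwards; variable `j` is in the counter `ctx[j]`. -/
def frag (k : ℕ) : Exp → List ℕ → ℕ → Frag
  | var j, ctx, d => (ctx[j]?).elim skip fun y => copy k y d (d + 1)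
  | zero, _, _ => skip
  | succ e, ctx, d => seq (e.frag k ctx d) (inc k d)
  | pred e, ctx, d => seq (e.frag k ctx d) (ifNonzero k d (dec k d) skip)
  | ite c a b, ctx, d => seq (c.frag k ctx d)
      (ifNonzero k d (seq (clear k d) (a.frag k ctx d)) (b.frag k ctx d))
  | fold i c s, ctx, d => seq (i.frag k ctx d) (seq (c.frag k ctx (d + 1))
      (seq (whileNonzero k (d + 1) (seq (dec k (d + 1))
        (seq (s.frag k ((d + 2) :: d :: ctx) (d + 3))
          (seq (clear k d) (seq (move k (d + 3) d) (inc k (d + 2)))))))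
        (clear k (d + 2))))
  | call f a b, ctx, d => seq (a.frag k ctx d) (seq (b.frag k ctx (d + 1))
      (seq (f.frag k [d, d + 1] (d + 2)) (seq (clear k d) (seq (clear k (d + 1))
        (move k (d + 2) d)))))

theorem eval_le {B : ℕ} (e : Exp) : ∀ v, e.Bdd B v → e.eval v ≤ B := by
  induction e with
  | var j => intro v h; exact h
  | zero => intro v _; exact Nat.zero_le _
  | succ e ih => intro v h; exact h.2
  | pred e ih => intro v h; exact (Nat.sub_le _ _).trans (ih v h)
  | ite c a b _ iha ihb =>
    intro v h
    obtain ⟨_, h⟩ := h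
    simp only [eval]
    split_ifs at h ⊢
    · exact iha v h
    · exact ihb v h
  | fold i c s ihi ihc ihs =>
    intro v h
    obtain ⟨h1, h2, h3⟩ := h
    simp only [eval]
    rcases hc : c.eval v with _ | n
    · exact ihi v h1
    · exact ihs _ (h3 n (by omega))
  | call f a b ihf => intro v h; exact ihf _ h.2.2

variable {w : List Bool} {k B : ℕ}

/-- The compiled expression adds its value to the zero counter `d`, and leaves all counters from
`d + 1` on at zero. -/
theorem exec (e : Exp) : ∀ (ctx : List ℕ) (d : ℕ) (s : CState), (∀ y ∈ ctx, y < d) →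
    (∀ r, d ≤ r → s.cnt r = 0) → d + e.need ≤ k → e.Bdd B (ctx.map s.cnt) →
    (e.frag k ctx d).Exec k B w s (s.set d (e.eval (ctx.map s.cnt))) := by
  induction e with
  | var j =>
    intro ctx d s hc hz hk hB
    simp only [need] at hk
    simp only [frag, eval, Bdd] at *
    rcases h : ctx[j]? with _ | y
    · refine exec_skip.to ?_
      have : (ctx.map s.cnt).getD j 0 = 0 := by simp [List.getD_eq_getElem?_getD, h]
      ext r <;> simp [CState.cnt_set]
      intro hr
      rw [h, hr, hz d le_rfl]; rfl
    · have hy := hc y (List.mem_of_getElem? h)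
      have hv : (ctx.map s.cnt).getD j 0 = s.cnt y := by
        simp [List.getD_eq_getElem?_getD, h]
      rw [hv] at hB ⊢
      exact exec_copy (by omega) (by omega) (by omega) (by omega) (by omega) (by omega) hB
        (hz _ le_rfl) (hz _ (by omega))
  | zero =>
    intro ctx d s hc hz hk hB
    refine exec_skip.to ?_
    ext r <;> simp [CState.cnt_set, eval]
    rintro rfl
    exact hz _ le_rfl
  | succ e ih =>
    intro ctx d s hc hz hk hB
    have := e.need_pos
    simp only [need] at hk
    refine ((ih ctx d s hc hz hk hB.1).seq (exec_inc (by omega)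
      (by simpa [CState.cnt_set] using hB.2))).to ?_
    ext r <;> simp [CState.cnt_set, eval]
    split_ifs <;> rfl
  | pred e ih =>
    intro ctx d s hc hz hk hB
    have := e.need_pos
    simp only [need] at hk
    refine (ih ctx d s hc hz hk hB).seq ?_
    by_cases h : e.eval (ctx.map s.cnt) = 0
    · refine Exec.ifNonzero_zero (by omega) (by simpa [CState.cnt_set] using h)
        (exec_skip.to ?_)
      simp [eval, h]
    · refine Exec.ifNonzero_pos (by omega) (by simpa [CState.cnt_set] using h)
        ((exec_dec (by omega) (by simpa [CState.cnt_set] using h)).to ?_)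
      ext r <;> simp [CState.cnt_set, eval]
      split_ifs <;> rfl
  | ite c a b ihc iha ihb =>
    intro ctx d s hc hz hk hB
    have := c.need_pos
    simp only [need] at hk
    obtain ⟨hB1, hB2⟩ := hB
    refine (ihc ctx d s hc hz (by omega) hB1).seq ?_
    by_cases h : c.eval (ctx.map s.cnt) = 0
    · rw [if_neg (by simpa using h)] at hB2
      have h0 : s.set d 0 = s := by
        ext r <;> simp [CState.cnt_set]
        rintro rfl
        exact (hz _ le_rfl).symm
      refine Exec.ifNonzero_zero (by omega) (by simpa [CState.cnt_set] using h) ?_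
      simp only [eval, h, h0]
      simpa using ihb ctx d s hc hz (by omega) hB2
    · rw [if_pos h] at hB2
      refine Exec.ifNonzero_pos (by omega) (by simpa [CState.cnt_set] using h)
        ((exec_clear (by omega)).seq ((iha ctx d _ hc (fun r hr => ?_) (by omega) ?_).to ?_))
      · simp only [CState.cnt_set]; split_ifs <;> simp_all
      · rwa [CState.map_set _ hc le_rfl, CState.map_set _ hc le_rfl]
      · rw [CState.map_set _ hc le_rfl, CState.map_set _ hc le_rfl]
        ext r <;> simp [CState.cnt_set, eval, h]
        split_ifs <;> rfl
  | fold i c s ihi ihc ihs =>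
    intro ctx d σ hc hz hk hB
    have := i.need_pos
    simp only [need] at hk
    obtain ⟨hB1, hB2, hB3⟩ := hB
    set v := ctx.map σ.cnt with hv
    have hctx : ∀ y ∈ ctx, y < d + 1 := fun y hy => (hc y hy).trans (by omega)
    set acc : ℕ → ℕ := fun n => Nat.rec (i.eval v) (fun n acc => s.eval (n :: acc :: v)) n with hacc
    set n := c.eval v with hn
    have haccB : ∀ j ≤ n, acc j ≤ B := by
      intro j hj
      rcases j with _ | j
      · exact eval_le _ _ hB1
      · exact eval_le s _ (hB3 j (by omega))
    have hnB : n ≤ B := eval_le _ _ hB2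
    set f : ℕ → CState := fun j => ((σ.set d (acc j)).set (d + 1) (n - j)).set (d + 2) j with hf
    have h1 : (i.frag k ctx d).Exec k B w σ (σ.set d (acc 0)) :=
      ihi ctx d σ hc hz (by omega) hB1
    have h2 : (c.frag k ctx (d + 1)).Exec k B w (σ.set d (acc 0)) (f 0) := by
      refine (ihc ctx (d + 1) (σ.set d (acc 0)) hctx (fun r hr => ?_) (by omega) ?_).to ?_
      · rw [CState.cnt_set, if_neg (by omega)]; exact hz _ (by omega)
      · rwa [CState.map_set _ hc le_rfl]
      · rw [CState.map_set _ hc le_rfl]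
        ext r <;> simp [CState.cnt_set, hf, hn]
        split_ifs <;> first | omega | rfl | (have := hz r (by omega); omega)
    have h3 : (whileNonzero k (d + 1) (seq (dec k (d + 1))
        (seq (s.frag k ((d + 2) :: d :: ctx) (d + 3))
          (seq (clear k d) (seq (move k (d + 3) d) (inc k (d + 2))))))).Exec k B w (f 0) (f n) := by
      refine Exec.whileNonzero (by omega) f n (fun j hj => ?_) ?_ (fun j hj => ?_)
      · simp [hf, CState.cnt_set]; omega
      · simp [hf, CState.cnt_set]
      · have e1 := exec_dec (B := B) (w := w) (s := f j) (show d + 1 < k by omega)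
          (by simp [hf, CState.cnt_set]; omega)
        set σ1 := (f j).set (d + 1) ((f j).cnt (d + 1) - 1) with hσ1
        have hmap : ((d + 2) :: d :: ctx).map σ1.cnt = j :: acc j :: v := by
          simp only [List.map_cons, hσ1, hf]
          rw [CState.map_set _ hc (by omega), CState.map_set _ hc (by omega),
            CState.map_set _ hc (by omega), CState.map_set _ hc (by omega)]
          simp [CState.cnt_set, hv]
        have e2 := ihs ((d + 2) :: d :: ctx) (d + 3) σ1 (by
            intro y hy
            simp only [List.mem_cons] at hy
            rcases hy with rfl | rfl | hy
            · omega
            · omega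
            · exact (hc y hy).trans (by omega)) (by
            intro r hr
            simp only [hσ1, hf, CState.cnt_set]
            rw [if_neg (by omega), if_neg (by omega), if_neg (by omega), if_neg (by omega)]
            exact hz _ (by omega)) (by omega) (by rw [hmap]; exact hB3 j hj)
        rw [hmap, show s.eval (j :: acc j :: v) = acc (j + 1) from rfl] at e2
        refine (e1.seq (e2.seq ((exec_clear (by omega)).seq ((exec_move (by omega) (by omega)
          (by omega) ?_).seq (exec_inc (by omega) ?_))))).to ?_
        · simpa [CState.cnt_set] using haccB (j + 1) hj
        · simp [CState.cnt_set, hσ1, hf]; omega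
        · ext r
          · simp only [hσ1, hf, CState.cnt_set]
            split_ifs <;> first | omega | rfl | (have := hz r (by omega); omega)
          · rfl
          · rfl
    refine (h1.seq (h2.seq (h3.seq (exec_clear (by omega))))).to ?_
    ext r
    · simp only [hf, CState.cnt_set, eval]
      split_ifs <;> first | omega | rfl | (have := hz r (by omega); omega)
    · rfl
    · rfl
  | call f a b ihf iha ihb =>
    intro ctx d s hc hz hk hB
    have := f.need_pos
    simp only [need] at hk
    obtain ⟨hB1, hB2, hB3⟩ := hB
    have hctx : ∀ y ∈ ctx, y < d + 1 := fun y hy => (hc y hy).trans (by omega)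
    set v := ctx.map s.cnt with hv
    have h1 := iha ctx d s hc hz (by omega) hB1
    have h2 := ihb ctx (d + 1) (s.set d (a.eval v)) hctx (fun r hr => by
      rw [CState.cnt_set, if_neg (by omega)]; exact hz _ (by omega)) (by omega)
      (by rwa [CState.map_set _ hc le_rfl])
    rw [CState.map_set _ hc le_rfl, ← hv] at h2
    set s2 := (s.set d (a.eval v)).set (d + 1) (b.eval v) with hs2
    have hm : [d, d + 1].map s2.cnt = [a.eval v, b.eval v] := by
      simp [hs2, CState.cnt_set]
    have h3 := ihf [d, d + 1] (d + 2) s2 (by simp) (fun r hr => by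
      simp only [hs2, CState.cnt_set]
      rw [if_neg (by omega), if_neg (by omega)]; exact hz _ (by omega)) (by omega)
      (by rw [hm]; exact hB3)
    rw [hm] at h3
    refine (h1.seq (h2.seq (h3.seq ((exec_clear (by omega)).seq ((exec_clear (by omega)).seq
      (exec_move (by omega) (by omega) (by omega) ?_)))))).to ?_
    · simpa [CState.cnt_set] using eval_le _ _ hB3
    · ext r
      · simp only [hs2, CState.cnt_set, eval]
        split_ifs <;> first | omega | rfl | (have := hz r (by omega); omega)
      · rfl
      · rfl

end Exp

/-- Programs that write a binary string.  `rep e p` runs `p` once for each number below the value of `e`,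
in increasing order, with this number as variable `0`; `call a b c p` runs `p` in the environment
that consists of the values of `a`, `b` and `c`. -/
inductive Prog where
  | skip
  | out (b : Bool)
  | seq (p q : Prog)
  | ite (e : Exp) (p q : Prog)
  | rep (e : Exp) (p : Prog)
  | call (a b c : Exp) (p : Prog)

namespace Prog

/-- The string that the program writes. -/
def eval : Prog → List ℕ → List Bool
  | skip, _ => []
  | out b, _ => [b]
  | seq p q, v => p.eval v ++ q.eval v
  | ite e p q, v => if e.eval v ≠ 0 then p.eval v else q.eval v
  | rep e p, v => (List.range (e.eval v)).flatMap fun i => p.eval (i :: v)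
  | call a b c p, v => p.eval [a.eval v, b.eval v, c.eval v]

/-- All numbers that occur while the program runs are at most `B`. -/
def Bdd (B : ℕ) : Prog → List ℕ → Prop
  | skip, _ => True
  | out _, _ => True
  | seq p q, v => p.Bdd B v ∧ q.Bdd B v
  | ite e p q, v => e.Bdd B v ∧ if e.eval v ≠ 0 then p.Bdd B v else q.Bdd B v
  | rep e p, v => e.Bdd B v ∧ ∀ i < e.eval v, p.Bdd B (i :: v)
  | call a b c p, v => a.Bdd B v ∧ b.Bdd B v ∧ c.Bdd B v ∧
      p.Bdd B [a.eval v, b.eval v, c.eval v]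

/-- The number of additional counters that the program uses. -/
def need : Prog → ℕ
  | skip => 0
  | out _ => 0
  | seq p q => max p.need q.need
  | ite e p q => max e.need (max p.need q.need)
  | rep e p => 2 + max e.need p.need
  | call a b c p => 3 + max (max a.need b.need) (max c.need p.need)

open Frag

/-- The machine for a program, with its temporary values in the counters from `d` on. -/
def frag (k : ℕ) : Prog → List ℕ → ℕ → Frag
  | skip, _, _ => Frag.skip
  | out b, _, _ => emit b
  | seq p q, ctx, d => Frag.seq (p.frag k ctx d) (q.frag k ctx d)
  | ite e p q, ctx, d => Frag.seq (e.frag k ctx d)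
      (ifNonzero k d (Frag.seq (clear k d) (p.frag k ctx d)) (q.frag k ctx d))
  | rep e p, ctx, d => Frag.seq (e.frag k ctx d) (Frag.seq
      (whileNonzero k d (Frag.seq (dec k d) (Frag.seq (p.frag k ((d + 1) :: ctx) (d + 2))
        (inc k (d + 1))))) (clear k (d + 1)))
  | call a b c p, ctx, d => Frag.seq (a.frag k ctx d) (Frag.seq (b.frag k ctx (d + 1))
      (Frag.seq (c.frag k ctx (d + 2)) (Frag.seq (p.frag k [d, d + 1, d + 2] (d + 3))
        (Frag.seq (clear k d) (Frag.seq (clear k (d + 1)) (clear k (d + 2)))))))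

variable {w : List Bool} {k B : ℕ}

/-- The compiled program writes its output and restores all counters. -/
theorem exec (p : Prog) : ∀ (ctx : List ℕ) (d : ℕ) (s : CState), (∀ y ∈ ctx, y < d) →
    (∀ r, d ≤ r → s.cnt r = 0) → d + p.need ≤ k → p.Bdd B (ctx.map s.cnt) →
    (p.frag k ctx d).Exec k B w s ⟨s.cnt, s.pos, s.out ++ p.eval (ctx.map s.cnt)⟩ := by
  induction p with
  | skip =>
    intro ctx d s _ _ _ _
    exact exec_skip.to (by simp [eval])
  | out b =>
    intro ctx d s _ _ _ _
    exact exec_emit.to (by simp [eval])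
  | seq p q ihp ihq =>
    intro ctx d s hc hz hk hB
    simp only [need] at hk
    exact ((ihp ctx d s hc hz (by omega) hB.1).seq
      (ihq ctx d ⟨s.cnt, s.pos, _⟩ hc hz (by omega) hB.2)).to (by simp [eval])
  | ite e p q ihp ihq =>
    intro ctx d s hc hz hk hB
    have := e.need_pos
    simp only [need] at hk
    obtain ⟨hB1, hB2⟩ := hB
    refine (e.exec ctx d s hc hz (by omega) hB1).seq ?_
    have h0 : ∀ v, (s.set d v).set d 0 = s := by
      intro v
      ext r
      · simp only [CState.cnt_set]
        split_ifs with h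
        · rw [h, hz _ le_rfl]
        · rfl
      · rfl
      · rfl
    by_cases h : e.eval (ctx.map s.cnt) = 0
    · rw [if_neg (by simpa using h)] at hB2
      refine Exec.ifNonzero_zero (by omega) (by simpa [CState.cnt_set] using h) ?_
      have h1 : s.set d 0 = s := by
        ext r <;> simp [CState.cnt_set]
        rintro rfl
        exact (hz _ le_rfl).symm
      simp only [eval, h, h1]
      simpa using ihq ctx d s hc hz (by omega) hB2
    · rw [if_pos h] at hB2
      refine Exec.ifNonzero_pos (by omega) (by simpa [CState.cnt_set] using h)
        ((exec_clear (by omega)).seq ?_)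
      rw [h0]
      simpa [eval, h] using ihp ctx d s hc hz (by omega) hB2
  | rep e p ih =>
    intro ctx d s hc hz hk hB
    have := e.need_pos
    simp only [need] at hk
    obtain ⟨hB1, hB2⟩ := hB
    set v := ctx.map s.cnt with hv
    have hnB := e.eval_le _ hB1
    set n := e.eval v with hn
    set f : ℕ → CState := fun j =>
      ⟨((s.set d (n - j)).set (d + 1) j).cnt, s.pos,
        s.out ++ (List.range j).flatMap fun i => p.eval (i :: v)⟩ with hf
    have h1 := e.exec (w := w) (k := k) ctx d s hc hz (by omega) hB1
    have h0 : f 0 = s.set d n := by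
      ext r
      · simp only [hf, CState.cnt_set, Nat.sub_zero]
        split_ifs <;> first | omega | rfl | (have := hz r (by omega); omega)
      · rfl
      · simp [hf]
    have h2 : (whileNonzero k d (Frag.seq (dec k d) (Frag.seq
        (p.frag k ((d + 1) :: ctx) (d + 2)) (inc k (d + 1))))).Exec k B w (f 0) (f n) := by
      refine Exec.whileNonzero (by omega) f n (fun j hj => ?_) ?_ (fun j hj => ?_)
      · simp [hf, CState.cnt_set]; omega
      · simp [hf, CState.cnt_set]
      · have e1 := exec_dec (B := B) (w := w) (s := f j) (show d < k by omega)
          (by simp [hf, CState.cnt_set]; omega)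
        set σ := (f j).set d ((f j).cnt d - 1) with hσ
        have hmap : ((d + 1) :: ctx).map σ.cnt = j :: v := by
          simp only [List.map_cons, hσ, hf, hv, List.cons.injEq]
          refine ⟨by simp [CState.cnt_set], List.map_congr_left fun y hy => ?_⟩
          have := hc y hy
          simp only [CState.cnt_set]
          rw [if_neg (by omega), if_neg (by omega), if_neg (by omega)]
        have e2 := ih ((d + 1) :: ctx) (d + 2) σ (by
            intro y hy
            simp only [List.mem_cons] at hy
            rcases hy with rfl | hy
            · omega
            · exact (hc y hy).trans (by omega)) (by
            intro r hr
            simp only [hσ, hf, CState.cnt_set]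
            rw [if_neg (by omega), if_neg (by omega), if_neg (by omega)]
            exact hz _ (by omega)) (by omega) (by rw [hmap]; exact hB2 j hj)
        rw [hmap] at e2
        refine (e1.seq (e2.seq (exec_inc (by omega) ?_))).to ?_
        · simp [CState.cnt_set, hσ, hf]; omega
        · ext r
          · simp only [hσ, hf, CState.cnt_set]
            split_ifs <;> omega
          · rfl
          · simp [hσ, hf, List.range_succ]
    rw [h0] at h2
    refine (h1.seq (h2.seq (exec_clear (by omega)))).to ?_
    ext r
    · simp only [hf, CState.cnt_set]
      split_ifs <;> first | omega | rfl | (have := hz r (by omega); omega)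
    · rfl
    · rfl
  | call a b c p ih =>
    intro ctx d s hc hz hk hB
    have := a.need_pos
    simp only [need] at hk
    obtain ⟨hB1, hB2, hB3, hB4⟩ := hB
    have hctx : ∀ y ∈ ctx, y < d + 1 := fun y hy => (hc y hy).trans (by omega)
    have hctx2 : ∀ y ∈ ctx, y < d + 2 := fun y hy => (hc y hy).trans (by omega)
    set v := ctx.map s.cnt with hv
    have h1 := a.exec (w := w) (k := k) (B := B) ctx d s hc hz (by omega) hB1
    have h2 := b.exec (w := w) (k := k) (B := B) ctx (d + 1) (s.set d (a.eval v)) hctx (fun r hr => by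
      rw [CState.cnt_set, if_neg (by omega)]; exact hz _ (by omega)) (by omega)
      (by rwa [CState.map_set _ hc le_rfl])
    rw [CState.map_set _ hc le_rfl, ← hv] at h2
    have h3 := c.exec (w := w) (k := k) (B := B) ctx (d + 2) ((s.set d (a.eval v)).set (d + 1) (b.eval v)) hctx2
      (fun r hr => by
        rw [CState.cnt_set, if_neg (by omega), CState.cnt_set, if_neg (by omega)]
        exact hz _ (by omega)) (by omega)
      (by rwa [CState.map_set _ hc (by omega), CState.map_set _ hc le_rfl])
    rw [CState.map_set _ hc (by omega), CState.map_set _ hc le_rfl, ← hv] at h3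
    set s3 := ((s.set d (a.eval v)).set (d + 1) (b.eval v)).set (d + 2) (c.eval v) with hs3
    have hm : [d, d + 1, d + 2].map s3.cnt = [a.eval v, b.eval v, c.eval v] := by
      simp [hs3, CState.cnt_set]
    have h4 := ih [d, d + 1, d + 2] (d + 3) s3 (by simp) (fun r hr => by
      simp only [hs3, CState.cnt_set]
      rw [if_neg (by omega), if_neg (by omega), if_neg (by omega)]; exact hz _ (by omega))
      (by omega) (by rw [hm]; exact hB4)
    rw [hm] at h4
    refine (h1.seq (h2.seq (h3.seq (h4.seq ((exec_clear (by omega)).seq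
      ((exec_clear (by omega)).seq (exec_clear (by omega)))))))).to ?_
    ext r
    · simp only [hs3, CState.cnt_set]
      split_ifs <;> first | omega | rfl | (have := hz r (by omega); omega)
    · rfl
    · rfl

end Prog

/-! ### Reading the encoding of a circuit -/

/-- The digits of a field of an encoded tuple. -/
def digits (s : List Bool) : List Bool := s.flatMap fun b => [false, b]

theorem length_digits (s : List Bool) : (digits s).length = 2 * s.length := by
  induction s with
  | nil => rfl
  | cons b s ih => simp [digits] at *; omega

/-- The digits `s` stand in `w` from position `p` on. -/
def DigitsAt (w : List Bool) (p : ℕ) (s : List Bool) : Prop :=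
  ∀ j (h : j < s.length), w[p + 2 * j]? = some false ∧ w[p + 2 * j + 1]? = some s[j]

theorem digitsAt_append (u s v : List Bool) : DigitsAt (u ++ (digits s ++ v)) u.length s := by
  induction s generalizing u with
  | nil => intro j h; simp at h
  | cons b s ih =>
    intro j h
    rcases j with _ | j
    · simp [digits]
    · have := ih (u ++ [false, b]) j (by simpa using h)
      have e : u ++ (digits (b :: s) ++ v) = u ++ [false, b] ++ (digits s ++ v) := by
        simp [digits]
      rw [e]
      simp only [List.length_append, List.length_cons, List.length_nil, List.getElem_cons_succ]
        at this ⊢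
      rw [show u.length + 2 * (j + 1) = u.length + (0 + 1 + 1) + 2 * j by ring]
      exact this

namespace Frag

variable {F G : Frag} {w : List Bool} {k B r : ℕ} {s s₁ s₂ : CState}

/-- Skip digits to the right, with an action `F` for each of them. -/
def forward (F : Frag) : Frag :=
  whileInput (· == some false) (seq inputRight (seq inputRight F))

theorem exec_forward {p : ℕ} {l o : List Bool} (c : ℕ → ℕ → ℕ) (hd : DigitsAt w p l)
    (ht : w[p + 2 * l.length]? = some true)
    (hF : ∀ j < l.length, ∀ q, F.Exec k B w ⟨c j, q, o⟩ ⟨c (j + 1), q, o⟩) :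
    (forward F).Exec k B w ⟨c 0, p, o⟩ ⟨c l.length, p + 2 * l.length, o⟩ := by
  have hlen : p + 2 * l.length < w.length := (List.getElem?_eq_some_iff.1 ht).1
  have key : ∀ m j, j + m = l.length → (forward F).Exec k B w ⟨c j, p + 2 * j, o⟩
      ⟨c l.length, p + 2 * l.length, o⟩ := by
    intro m
    induction m with
    | zero =>
      intro j hj
      obtain rfl : j = l.length := by omega
      exact Exec.whileInput_done (by simp [ht])
    | succ m ih =>
      intro j hj
      have h1 : p + 2 * j < w.length := by omega
      have h2 : p + 2 * j + 1 < w.length := by omega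
      have h3 : j < l.length := by omega
      exact Exec.whileInput_step (by simp [(hd j h3).1])
        ((exec_inputRight h1).seq ((exec_inputRight h2).seq (hF j h3 _)))
        (ih (j + 1) (show j + 1 + m = l.length by omega))
  exact key l.length 0 (by omega)

/-- Skip digits to the left, with an action `F` for each of them, which finds the
input head on the digit. -/
def backward (F : Frag) : Frag :=
  seq inputLeft (seq inputLeft (whileInput (· == some false)
    (seq inputRight (seq F (seq inputLeft (seq inputLeft inputLeft))))))

theorem exec_backward {p : ℕ} {l : List Bool} (c : ℕ → ℕ → ℕ) (o : ℕ → List Bool)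
    (hd : DigitsAt w (p + 2) l) (ht : w[p]? = some true)
    (hF : ∀ j (h : j < l.length), w[p + 2 * j + 3]? = some l[j] →
      F.Exec k B w ⟨c (j + 1), p + 2 * j + 3, o (j + 1)⟩ ⟨c j, p + 2 * j + 3, o j⟩) :
    (backward F).Exec k B w ⟨c l.length, p + 2 + 2 * l.length, o l.length⟩ ⟨c 0, p, o 0⟩ := by
  refine exec_inputLeft.seq (exec_inputLeft.seq ?_)
  have key : ∀ j, j ≤ l.length → (whileInput (· == some false)
      (seq inputRight (seq F (seq inputLeft (seq inputLeft inputLeft))))).Exec k B w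
      ⟨c j, p + 2 * j, o j⟩ ⟨c 0, p, o 0⟩ := by
    intro j
    induction j with
    | zero =>
      intro _
      exact Exec.whileInput_done (by simp [ht])
    | succ j ih =>
      intro hj
      obtain ⟨h1, h2⟩ := hd j hj
      have h3 : p + 2 * (j + 1) = p + 2 + 2 * j := by ring
      have hlen : p + 2 + 2 * j < w.length := (List.getElem?_eq_some_iff.1 h1).1
      have h4 := hF j hj (by rw [← h2]; congr 1; ring)
      have h5 : p + 2 * (j + 1) + 1 = p + 2 * j + 3 := by ring
      refine Exec.whileInput_step (by simp [h3, h1])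
        ((exec_inputRight (by simp only; omega)).seq (Exec.seq (by rw [h5]; exact h4)
        (exec_inputLeft.seq (exec_inputLeft.seq exec_inputLeft)))) (ih (by omega))
  have h6 : p + 2 + 2 * l.length - 1 - 1 = p + 2 * l.length := by omega
  simp only [h6]
  exact key l.length le_rfl

end Frag

namespace Frag

variable {F G : Frag} {w : List Bool} {k B r : ℕ} {s s₁ s₂ : CState}

/-- Double counter `r` with the help of the zero counter `t`. -/
def double (k r t : ℕ) : Frag :=
  seq (whileNonzero k r (seq (dec k r) (seq (inc k t) (inc k t)))) (move k t r)

theorem exec_double {t : ℕ} (hr : r < k) (ht : t < k) (hrt : r ≠ t) (h0 : s.cnt t = 0)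
    (hB : 2 * s.cnt r ≤ B) : (double k r t).Exec k B w s (s.set r (2 * s.cnt r)) := by
  have := Exec.whileNonzero (F := seq (dec k r) (seq (inc k t) (inc k t))) (w := w) (B := B) hr
    (fun i => (s.set r (s.cnt r - i)).set t (2 * i))
    (s.cnt r) (fun i hi => by simp [CState.cnt_set, hrt]; omega)
    (by simp [CState.cnt_set, hrt])
    (fun i hi => ((exec_dec hr (by simp [CState.cnt_set, hrt]; omega)).seq
      ((exec_inc ht (by simp [CState.cnt_set, hrt.symm]; omega)).seq
        (exec_inc ht (by simp [CState.cnt_set, hrt.symm]; omega)))).to (by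
      ext r'
      · simp only [CState.cnt_set]; split_ifs <;> omega
      · rfl
      · rfl))
  simp only [Nat.sub_zero, Nat.sub_self] at this
  have e0 : (s.set r (s.cnt r)).set t (2 * 0) = s := by
    ext r' <;> simp [CState.cnt_set]; split_ifs <;> simp_all
  rw [e0] at this
  refine (this.seq (exec_move ht hr hrt.symm (by simp [CState.cnt_set, hrt]; omega))).to ?_
  ext r'
  · simp only [CState.cnt_set]; split_ifs <;> simp_all
  · rfl
  · rfl

theorem bval_bits (n : ℕ) : bval n.bits = n := by
  induction n using Nat.binaryRec' with
  | zero => rfl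
  | bit b n h ih =>
    rw [Nat.bits_append_bit _ _ h, bval, ih, Nat.bit_val]; ring

theorem bval_drop_le (l : List Bool) (j : ℕ) : bval (l.drop j) ≤ bval l := by
  induction l generalizing j with
  | nil => simp
  | cons b l ih =>
    rcases j with _ | j
    · simp
    · simp only [List.drop_succ_cons, bval]
      have := ih j
      omega

/-- Read a number to the left into the counter `r`, with the help of counter `t`. -/
def readNum (k r t : ℕ) : Frag :=
  backward (seq (double k r t) (ifInput (· == some true) (inc k r) skip))

theorem exec_readNum {t p m : ℕ} {o : List Bool} {c : ℕ → ℕ} (hr : r < k) (ht : t < k)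
    (hrt : r ≠ t) (hc : c r = 0) (hct : c t = 0) (hm : m ≤ B) (hd : DigitsAt w (p + 2) m.bits)
    (htr : w[p]? = some true) :
    (readNum k r t).Exec k B w ⟨c, p + 2 + 2 * m.bits.length, o⟩ ⟨Function.update c r m, p, o⟩ := by
  have hb := bval_bits m
  have := exec_backward (F := seq (double k r t) (ifInput (· == some true) (inc k r) skip))
    (k := k) (B := B) (fun j => Function.update c r (bval (m.bits.drop j))) (fun _ => o) hd htr ?_
  · simp only [List.drop_length, bval, List.drop_zero, hb] at this
    rw [← hc, Function.update_eq_self] at this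
    exact this
  · intro j hj hw
    have hd : bval (m.bits.drop j) = (m.bits[j]).toNat + 2 * bval (m.bits.drop (j + 1)) := by
      rw [List.drop_eq_getElem_cons hj]; rfl
    have hle := bval_drop_le m.bits j
    refine (exec_double hr ht hrt (by simp [hrt.symm, hct]) (by simp; omega)).seq ?_
    rcases hbit : m.bits[j] with _ | _
    · refine Exec.ifInput_false (by simp [CState.set, hw, hbit]) (exec_skip.to ?_)
      rw [hbit] at hd
      simp [CState.set, hd]
    · rw [hbit] at hd
      refine Exec.ifInput_true (by simp [CState.set, hw, hbit])
        ((exec_inc hr (by simp [CState.set]; simp at hd; omega)).to ?_)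
      simp [CState.set, hd, add_comm]

end Frag

theorem encodeField_eq (s : List Bool) : encodeField s = digits s ++ [true, true] := rfl

namespace Frag

/-- The counters while a circuit is read: the width `n`, the measured line `l`, and a flag. -/
def base (n l f : ℕ) : ℕ → ℕ := fun r => if r = 0 then n else if r = 1 then l else
  if r = 5 then f else 0

/-- Read the header of the encoding: count the lines in counter `0`, read the number of the measured
line into counter `1`, and stop at the end of the input string. -/
def readHeader (k : ℕ) : Frag :=
  seq inputRight (seq inputRight (seq (forward (inc k 0)) (seq inputRight (seq inputRight
    (seq (forward Frag.skip) (readNum k 1 6))))))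

/-- Go to the last block of the input. -/
def gotoEnd : Frag :=
  seq (whileInput (·.isSome) inputRight) (seq inputLeft inputLeft)

/-- Read a gate, from the last comma of its triple backwards. -/
def readGate (k : ℕ) : Frag :=
  seq inputRight (seq (forward Frag.skip) (seq inputRight (seq inputRight (seq (forward Frag.skip)
    (seq (readNum k 4 6) (seq (readNum k 3 6) (readNum k 2 6)))))))

/-- Treat the tuple that ends at the input head, which is either a gate or the header. -/
def tupleStep (k : ℕ) (pg px : Prog) : Frag :=
  seq (backward Frag.skip) (seq (backward Frag.skip) (seq inputRight (ifInput (· == some true)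
    (seq (readGate k) (seq (pg.frag k [0, 1, 2, 3, 4] 6) (seq (clear k 2) (seq (clear k 3)
      (seq (clear k 4) (seq inputLeft inputLeft))))))
    (seq inputRight (seq (forward Frag.skip) (seq (copy k 0 2 6)
      (seq (backward (seq (dec k 2) (ifInput (· == some true) (px.frag k [0, 1, 2] 6) Frag.skip)))
        (dec k 5))))))))

/-- The machine that runs `pi` after the header is read, then `pg` for each gate in reverse order,
and finally `px` for each line in reverse order whose input is `1`. -/
def driver (k : ℕ) (pi pg px : Prog) : Frag :=
  seq (readHeader k) (seq (pi.frag k [0, 1] 6) (seq gotoEnd (seq (inc k 5)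
    (whileNonzero k 5 (tupleStep k pg px)))))

variable {w : List Bool} {k B : ℕ}

/-- The string written for a gate with number `g` on the lines `i, j`. -/
def encGate (g : ℕ × ℕ × ℕ) : List Bool :=
  encodeTuple [Nat.bits g.1, Nat.bits g.2.1, Nat.bits g.2.2]

theorem encGate_length (g : ℕ × ℕ × ℕ) : (encGate g).length =
    8 + 2 * g.1.bits.length + 2 * g.2.1.bits.length + 2 * g.2.2.bits.length := by
  simp [encGate, encodeTuple, encodeField_eq, length_digits]; ring

/-- One step of the driver, backwards over the tuple of a gate: the input head moves to the end of
the preceding tuple, and the program for gates is run on the numbers read. -/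
theorem gate_step {n l f p : ℕ} {o u v : List Bool} {g : ℕ × ℕ × ℕ} {pg px : Prog} (hk : 7 ≤ k)
    (hpg : 6 + pg.need ≤ k) (hw : w = u ++ (encGate g ++ v)) (hu : 2 ≤ u.length)
    (h1 : g.1 ≤ B) (h2 : g.2.1 ≤ B) (h3 : g.2.2 ≤ B)
    (hB : pg.Bdd B [n, l, g.1, g.2.1, g.2.2]) (hp : p = u.length + (encGate g).length - 2) :
    (tupleStep k pg px).Exec k B w ⟨base n l f, p, o⟩
      ⟨base n l f, u.length - 2, o ++ pg.eval [n, l, g.1, g.2.1, g.2.2]⟩ := by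
  obtain ⟨G, I, J⟩ := g
  simp only at *
  set a := u.length with ha
  have e := encGate_length (G, I, J)
  simp only at e
  set x := G.bits.length with hx
  set y := I.bits.length with hy
  set z := J.bits.length with hz
  have split : ∀ (u' s v' : List Bool) q, w = u' ++ (digits s ++ v') → u'.length = q →
      DigitsAt w q s := by
    rintro u' s v' q rfl rfl
    exact digitsAt_append _ _ _
  have at' : ∀ (u' v' : List Bool) b q, w = u' ++ b :: v' → u'.length = q →
      w[q]? = some b := by
    rintro u' v' b q rfl rfl
    simp
  have dG : DigitsAt w (a + 2) G.bits := split (u ++ [true, false]) _ ([true, true] ++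
    (digits I.bits ++ ([true, true] ++ (digits J.bits ++ ([true, true] ++ v))))) _
    (by simp [hw, encGate, encodeTuple, encodeField_eq]) (by simp [ha])
  have dI : DigitsAt w (a + 2 + 2 * x + 2) I.bits := split
    (u ++ [true, false] ++ digits G.bits ++ [true, true]) _
    ([true, true] ++ (digits J.bits ++ ([true, true] ++ v))) _
    (by simp [hw, encGate, encodeTuple, encodeField_eq]) (by simp [ha, length_digits, hx]; ring)
  have dJ : DigitsAt w (a + 2 + 2 * x + 2 + 2 * y + 2) J.bits := split
    (u ++ [true, false] ++ digits G.bits ++ [true, true] ++ digits I.bits ++ [true, true]) _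
    ([true, true] ++ v) _
    (by simp [hw, encGate, encodeTuple, encodeField_eq])
    (by simp [ha, length_digits, hx, hy]; ring)
  have t0 : w[a]? = some true := at' u _ _ _
    (by simp [hw, encGate, encodeTuple, encodeField_eq]; rfl) (by simp [ha])
  have t1 : w[a + 2 + 2 * x]? = some true := at' (u ++ [true, false] ++ digits G.bits)
    (true :: (digits I.bits ++ ([true, true] ++ (digits J.bits ++ ([true, true] ++ v))))) _ _
    (by simp [hw, encGate, encodeTuple, encodeField_eq]) (by simp [ha, length_digits, hx]; ring)
  have t1' : w[a + 2 + 2 * x + 1]? = some true := at' (u ++ [true, false] ++ digits G.bits ++ [true])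
    (digits I.bits ++ ([true, true] ++ (digits J.bits ++ ([true, true] ++ v)))) _ _
    (by simp [hw, encGate, encodeTuple, encodeField_eq]) (by simp [ha, length_digits, hx]; ring)
  have t2 : w[a + 2 + 2 * x + 2 + 2 * y]? = some true := at'
    (u ++ [true, false] ++ digits G.bits ++ [true, true] ++ digits I.bits)
    (true :: (digits J.bits ++ ([true, true] ++ v))) _ _
    (by simp [hw, encGate, encodeTuple, encodeField_eq])
    (by simp [ha, length_digits, hx, hy]; ring)
  have t3 : w[a + 2 + 2 * x + 2 + 2 * y + 2 + 2 * z]? = some true := at'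
    (u ++ [true, false] ++ digits G.bits ++ [true, true] ++ digits I.bits ++ [true, true] ++
      digits J.bits) (true :: v) _ _
    (by simp [hw, encGate, encodeTuple, encodeField_eq])
    (by simp [ha, length_digits, hx, hy, hz]; ring)
  have hlen : a + 2 + 2 * x + 2 + 2 * y + 2 + 2 * z < w.length :=
    (List.getElem?_eq_some_iff.1 t3).1
  obtain rfl : p = a + 2 + 2 * x + 2 + 2 * y + 2 + 2 * z := by rw [hp, e]; omega
  set b := base n l f with hb
  have s1 := exec_backward (F := Frag.skip) (w := w) (k := k) (B := B) (fun _ => b) (fun _ => o) dJ t2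
    (fun j h _ => exec_skip)
  have s2 := exec_backward (F := Frag.skip) (w := w) (k := k) (B := B) (fun _ => b) (fun _ => o) dI t1
    (fun j h _ => exec_skip)
  have s3 := exec_inputRight (w := w) (k := k) (B := B) (s := ⟨b, a + 2 + 2 * x, o⟩)
    (by simp only; omega)
  have s4 := exec_inputRight (w := w) (k := k) (B := B) (s := ⟨b, a + 2 + 2 * x + 1, o⟩)
    (by simp only; omega)
  have s5 := exec_forward (F := Frag.skip) (w := w) (k := k) (B := B) (o := o) (fun _ => b) dI t2
    (fun j h q => exec_skip)
  have s6 := exec_inputRight (w := w) (k := k) (B := B) (s := ⟨b, a + 2 + 2 * x + 2 + 2 * y, o⟩)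
    (by simp only; omega)
  have s7 := exec_inputRight (w := w) (k := k) (B := B)
    (s := ⟨b, a + 2 + 2 * x + 2 + 2 * y + 1, o⟩) (by simp only; omega)
  have s8 := exec_forward (F := Frag.skip) (w := w) (k := k) (B := B) (o := o) (fun _ => b) dJ t3
    (fun j h q => exec_skip)
  have s9 := exec_readNum (k := k) (B := B) (r := 4) (t := 6) (o := o) (c := b) (by omega) (by omega)
    (by omega) rfl rfl h3 dJ t2
  have s10 := exec_readNum (k := k) (B := B) (r := 3) (t := 6) (o := o)
    (c := Function.update b 4 J) (by omega) (by omega) (by omega) rfl rfl h2 dI t1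
  have s11 := exec_readNum (k := k) (B := B) (r := 2) (t := 6) (o := o)
    (c := Function.update (Function.update b 4 J) 3 I) (by omega) (by omega) (by omega) rfl rfl
    h1 dG t0
  set c := Function.update (Function.update (Function.update b 4 J) 3 I) 2 G with hc
  have hmap : [0, 1, 2, 3, 4].map c = [n, l, G, I, J] := by
    simp [hc, hb, base]
  have s12 := pg.exec (w := w) (k := k) (B := B) [0, 1, 2, 3, 4] 6 ⟨c, a, o⟩ (by simp)
    (fun r hr => by
      simp only [hc, hb, base, Function.update_apply]
      rw [if_neg (by omega), if_neg (by omega), if_neg (by omega), if_neg (by omega),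
        if_neg (by omega), if_neg (by omega)]) hpg (by simp only; rw [hmap]; exact hB)
  simp only [hmap] at s12
  refine s1.seq (s2.seq (s3.seq (Exec.ifInput_true (by simp [t1']) ((s4.seq (s5.seq (s6.seq
    (s7.seq (s8.seq (s9.seq (s10.seq s11))))))).seq (s12.seq ((exec_clear (by omega)).seq
    ((exec_clear (by omega)).seq ((exec_clear (by omega)).seq
    (exec_inputLeft.seq (exec_inputLeft.to ?_)))))))))) 
  ext r
  · simp only [CState.set, hc, Function.update_apply]
    split_ifs <;> simp_all [base]
  · simp [CState.set]; omega
  · simp [CState.set]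

/-- The last step of the driver, backwards over the first tuple: the program for flips is run for
all positions where the input string is `1`, and the flag is cleared. -/
theorem header_step {n l : ℕ} {o v : List Bool} {xs : List Bool} {pg px : Prog} (hk : 7 ≤ k)
    (hpx : 6 + px.need ≤ k) (hn : n = xs.length) (hw : w = encodeTuple [xs, l.bits] ++ v)
    (hnB : n ≤ B) (hB : ∀ j < n, px.Bdd B [n, l, j]) :
    (tupleStep k pg px).Exec k B w
      ⟨base n l 1, (encodeTuple [xs, l.bits]).length - 2, o⟩
      ⟨base n l 0, 0, o ++ (List.range n).reverse.flatMap fun j =>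
        if xs[j]? = some true then px.eval [n, l, j] else []⟩ := by
  subst hn
  set n := xs.length with hn
  have e : (encodeTuple [xs, l.bits]).length = 6 + 2 * n + 2 * l.bits.length := by
    simp [encodeTuple, encodeField_eq, length_digits, hn]; ring
  set y := l.bits.length with hy
  have split : ∀ (u' s v' : List Bool) q, w = u' ++ (digits s ++ v') → u'.length = q →
      DigitsAt w q s := by
    rintro u' s v' q rfl rfl
    exact digitsAt_append _ _ _
  have at' : ∀ (u' v' : List Bool) b q, w = u' ++ b :: v' → u'.length = q →
      w[q]? = some b := by
    rintro u' v' b q rfl rfl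
    simp
  have dX : DigitsAt w (0 + 2) xs := split [true, false] _ ([true, true] ++
    (digits l.bits ++ ([true, true] ++ v))) _
    (by simp [hw, encodeTuple, encodeField_eq]) (by simp)
  have dL : DigitsAt w (2 + 2 * n + 2) l.bits := split
    ([true, false] ++ digits xs ++ [true, true]) _
    ([true, true] ++ v) _
    (by simp [hw, encodeTuple, encodeField_eq]) (by simp [length_digits, hn]; ring)
  have t0 : w[0]? = some true := at' [] _ _ _
    (by simp [hw, encodeTuple, encodeField_eq]; rfl) (by simp)
  have t0' : w[0 + 1]? = some false := at' [true] _ _ _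
    (by simp [hw, encodeTuple, encodeField_eq]; rfl) (by simp)
  have t1 : w[2 + 2 * n]? = some true := at' ([true, false] ++ digits xs)
    (true :: (digits l.bits ++ ([true, true] ++ v))) _ _
    (by simp [hw, encodeTuple, encodeField_eq]) (by simp [length_digits, hn]; try ring)
  have hlen : 2 + 2 * n < w.length := (List.getElem?_eq_some_iff.1 t1).1
  rw [show (encodeTuple [xs, l.bits]).length - 2 = 2 + 2 * n + 2 + 2 * y by rw [e]; omega]
  set b := base n l 1 with hb
  have s1 := exec_backward (F := Frag.skip) (w := w) (k := k) (B := B) (fun _ => b) (fun _ => o) dL t1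
    (fun j h _ => exec_skip)
  have s2 := exec_backward (F := Frag.skip) (w := w) (k := k) (B := B) (fun _ => b) (fun _ => o) dX t0
    (fun j h _ => exec_skip)
  have s3 := exec_inputRight (w := w) (k := k) (B := B) (s := ⟨b, 0, o⟩) (by simp only; omega)
  have s4 := exec_inputRight (w := w) (k := k) (B := B) (s := ⟨b, 0 + 1, o⟩) (by simp only; omega)
  have s5 := exec_forward (F := Frag.skip) (w := w) (k := k) (B := B) (o := o) (fun _ => b) dX
    (by rw [← t1]) (fun j h q => exec_skip)
  have s6 := exec_copy (k := k) (B := B) (w := w) (a := 0) (b := 2) (c := 6)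
    (s := ⟨b, 0 + 2 + 2 * xs.length, o⟩) (by omega) (by omega) (by omega) (by omega) (by omega)
    (by omega) hnB rfl rfl
  have s7 := exec_backward (F := (Frag.seq (dec k 2)
      (ifInput (· == some true) (px.frag k [0, 1, 2] 6) Frag.skip))) (w := w) (k := k) (B := B)
    (fun j => Function.update b 2 j)
    (fun j => o ++ ((List.range n).drop j).reverse.flatMap fun j =>
        if xs[j]? = some true then px.eval [n, l, j] else []) dX t0 ?_
  · have hd : (List.range n).drop xs.length = [] := by simp [hn]
    simp only [hd, List.reverse_nil, List.flatMap_nil, List.append_nil, List.drop_zero] at s7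
    refine s1.seq (s2.seq (s3.seq (Exec.ifInput_false (by simp [t0']) (s4.seq (s5.seq
      (s6.seq (Exec.seq (by simpa [CState.set, hb, base, hn] using s7)
      ((exec_dec (by omega) (by simp [base])).to ?_))))))))
    ext r
    · simp only [CState.set, base, Function.update_apply]
      split_ifs <;> first | contradiction | rfl | omega
    · rfl
    · rfl
  · intro j hj hwj
    have hmap : [0, 1, 2].map (Function.update b 2 j) = [n, l, j] := by
      simp [hb, base]
    have h1 := exec_dec (k := k) (B := B) (w := w) (r := 2) (s := ⟨Function.update b 2 (j + 1),
      0 + 2 * j + 3, o ++ ((List.range n).drop (j + 1)).reverse.flatMap fun j =>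
        if xs[j]? = some true then px.eval [n, l, j] else []⟩) (by omega) (by simp)
    have hs : ((List.range n).drop j).reverse = ((List.range n).drop (j + 1)).reverse ++ [j] := by
      rw [List.drop_eq_getElem_cons (by simp; omega)]; simp
    simp only [CState.set, Function.update_self, Function.update_idem, Nat.add_sub_cancel] at h1
    refine h1.seq ?_
    rw [hs, List.flatMap_append, ← List.append_assoc]
    have h2 := px.exec (w := w) (k := k) (B := B) [0, 1, 2] 6 ⟨Function.update b 2 j,
      0 + 2 * j + 3, o ++ ((List.range n).drop (j + 1)).reverse.flatMap fun j =>
        if xs[j]? = some true then px.eval [n, l, j] else []⟩ (by simp)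
      (fun r hr => by
        simp only [hb, base, Function.update_apply]
        rw [if_neg (by omega), if_neg (by omega), if_neg (by omega), if_neg (by omega)]) hpx
      (by simp only; rw [hmap]; exact hB j (by omega))
    simp only [hmap] at h2
    by_cases hx : xs[j] = true
    · exact Exec.ifInput_true (by simp only [hwj]; simp [hx]) (h2.to (by simp [hx, List.getElem?_eq_getElem hj]))
    · exact Exec.ifInput_false (by simp only [hwj]; simp [hx])
        (exec_skip.to (by simp [hx, List.getElem?_eq_getElem hj]))

theorem exec_readHeader {l : ℕ} {xs v : List Bool} (hk : 7 ≤ k) (hn : xs.length ≤ B) (hl : l ≤ B)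
    (hw : w = encodeTuple [xs, l.bits] ++ v) :
    (readHeader k).Exec k B w ⟨fun _ => 0, 0, []⟩ ⟨base xs.length l 0, 2 + 2 * xs.length, []⟩ := by
  set n := xs.length with hn'
  have split : ∀ (u' s v' : List Bool) q, w = u' ++ (digits s ++ v') → u'.length = q →
      DigitsAt w q s := by
    rintro u' s v' q rfl rfl
    exact digitsAt_append _ _ _
  have at' : ∀ (u' v' : List Bool) b q, w = u' ++ b :: v' → u'.length = q →
      w[q]? = some b := by
    rintro u' v' b q rfl rfl
    simp
  have dX : DigitsAt w 2 xs := split [true, false] _ ([true, true] ++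
    (digits l.bits ++ ([true, true] ++ v))) _
    (by simp [hw, encodeTuple, encodeField_eq]) (by simp)
  have dL : DigitsAt w (2 + 2 * n + 2) l.bits := split
    ([true, false] ++ digits xs ++ [true, true]) _
    ([true, true] ++ v) _
    (by simp [hw, encodeTuple, encodeField_eq]) (by simp [length_digits, hn']; ring)
  have t1 : w[2 + 2 * n]? = some true := at' ([true, false] ++ digits xs)
    (true :: (digits l.bits ++ ([true, true] ++ v))) _ _
    (by simp [hw, encodeTuple, encodeField_eq]) (by simp [length_digits, hn']; try ring)
  have t2 : w[2 + 2 * n + 2 + 2 * l.bits.length]? = some true := at'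
    ([true, false] ++ digits xs ++ [true, true] ++ digits l.bits) (true :: v) _ _
    (by simp [hw, encodeTuple, encodeField_eq]) (by simp [length_digits, hn']; ring)
  have hlen : 2 + 2 * n + 2 + 2 * l.bits.length < w.length := (List.getElem?_eq_some_iff.1 t2).1
  have s1 := exec_inputRight (w := w) (k := k) (B := B) (s := ⟨fun _ => 0, 0, []⟩)
    (by simp only; omega)
  have s2 := exec_inputRight (w := w) (k := k) (B := B) (s := ⟨fun _ => 0, 0 + 1, []⟩)
    (by simp only; omega)
  have s3 := exec_forward (F := inc k 0) (w := w) (k := k) (B := B) (o := [])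
    (fun j => base j 0 0) dX t1 (fun j h q => (exec_inc (by omega) (by simp [base]; omega)).to (by
      ext r
      · simp only [CState.set, base, Function.update_apply]; split_ifs <;> simp_all
      · rfl
      · rfl))
  have s4 := exec_inputRight (w := w) (k := k) (B := B) (s := ⟨base n 0 0, 2 + 2 * n, []⟩)
    (by simp only; omega)
  have s5 := exec_inputRight (w := w) (k := k) (B := B) (s := ⟨base n 0 0, 2 + 2 * n + 1, []⟩)
    (by simp only; omega)
  have s6 := exec_forward (F := skip) (w := w) (k := k) (B := B) (o := [])
    (fun _ => base n 0 0) dL t2 (fun j h q => exec_skip)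
  have s7 := exec_readNum (k := k) (B := B) (r := 1) (t := 6) (o := [])
    (c := base n 0 0) (by omega) (by omega) (by omega) rfl rfl hl dL t1
  have h0 : base 0 0 0 = fun _ => 0 := by funext r; simp [base]
  simp only [h0] at s3
  refine s1.seq (s2.seq (s3.seq (s4.seq (s5.seq (s6.seq (s7.to ?_))))))
  ext r
  · simp only [base, Function.update_apply]
    split_ifs <;> simp_all
  · rfl
  · rfl

theorem exec_gotoEnd {c : ℕ → ℕ} {p : ℕ} {o : List Bool} (hp : p ≤ w.length) :
    gotoEnd.Exec k B w ⟨c, p, o⟩ ⟨c, w.length - 2, o⟩ := by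
  have key : ∀ m p, p + m = w.length → (whileInput (·.isSome) inputRight).Exec k B w
      ⟨c, p, o⟩ ⟨c, w.length, o⟩ := by
    intro m
    induction m with
    | zero =>
      intro p hp
      obtain rfl : p = w.length := by omega
      exact Exec.whileInput_done (by simp)
    | succ m ih =>
      intro p hp
      have hlt : p < w.length := by omega
      exact Exec.whileInput_step (by simp [hlt]) (exec_inputRight hlt)
        (ih (p + 1) (show p + 1 + m = w.length by omega))
  exact (key (w.length - p) p (by omega)).seq (exec_inputLeft.seq exec_inputLeft)

/-- The driver reads the header, runs the first program, moves to the end of the input and handles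
the gates in reverse order and finally the input string. -/
theorem exec_driver {l : ℕ} {xs : List Bool} {gs : List (ℕ × ℕ × ℕ)} {pi pg px : Prog} (hk : 7 ≤ k)
    (hpi : 6 + pi.need ≤ k) (hpg : 6 + pg.need ≤ k) (hpx : 6 + px.need ≤ k)
    (hw : w = encodeTuple [xs, l.bits] ++ gs.flatMap encGate) (hB1 : 1 ≤ B)
    (hn : xs.length ≤ B) (hl : l ≤ B)
    (hg : ∀ g ∈ gs, g.1 ≤ B ∧ g.2.1 ≤ B ∧ g.2.2 ≤ B ∧
      pg.Bdd B [xs.length, l, g.1, g.2.1, g.2.2])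
    (hi : pi.Bdd B [xs.length, l]) (hx : ∀ j < xs.length, px.Bdd B [xs.length, l, j]) :
    (driver k pi pg px).Exec k B w ⟨fun _ => 0, 0, []⟩ ⟨base xs.length l 0, 0,
      pi.eval [xs.length, l] ++
      gs.reverse.flatMap (fun g => pg.eval [xs.length, l, g.1, g.2.1, g.2.2]) ++
      (List.range xs.length).reverse.flatMap fun j =>
        if xs[j]? = some true then px.eval [xs.length, l, j] else []⟩ := by
  set n := xs.length with hn'
  set hd := encodeTuple [xs, l.bits] with hhd
  have hdl : hd.length = 6 + 2 * n + 2 * l.bits.length := by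
    simp [hhd, encodeTuple, encodeField_eq, length_digits, hn']; ring
  have hwl : hd.length ≤ w.length := by rw [hw]; simp
  have s1 := exec_readHeader (w := w) (k := k) (B := B) (v := gs.flatMap encGate) hk hn hl hw
  have s2 := pi.exec (w := w) (k := k) (B := B) [0, 1] 6 ⟨base n l 0, 2 + 2 * n, []⟩ (by simp)
    (fun r hr => by
      simp only [base]; rw [if_neg (by omega), if_neg (by omega), if_neg (by omega)]) hpi
    (by simpa [base] using hi)
  have hm : [0, 1].map (base n l 0) = [n, l] := by simp [base]
  simp only [hm, List.nil_append] at s2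
  set o := pi.eval [n, l] with ho
  have s3 := exec_gotoEnd (w := w) (k := k) (B := B) (c := base n l 0) (p := 2 + 2 * n) (o := o)
    (by omega)
  have s4 := exec_inc (k := k) (B := B) (w := w) (r := 5) (s := ⟨base n l 0, w.length - 2, o⟩)
    (by omega) (by simpa [base] using hB1)
  have e4 : (⟨base n l 0, w.length - 2, o⟩ : CState).set 5 (base n l 0 5 + 1) =
      ⟨base n l 1, w.length - 2, o⟩ := by
    ext r
    · simp only [CState.set, base, Function.update_apply]; split_ifs <;> simp_all
    · rfl
    · rfl
  simp only [e4] at s4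
  set P : ℕ × ℕ × ℕ → List Bool := fun g => pg.eval [n, l, g.1, g.2.1, g.2.2] with hP
  set N := gs.length with hN
  -- the state after the last `i` gates, and after the header
  set f : ℕ → CState := fun i => if i ≤ N then
    ⟨base n l 1, (hd ++ (gs.take (N - i)).flatMap encGate).length - 2,
      o ++ (gs.drop (N - i)).reverse.flatMap P⟩ else
    ⟨base n l 0, 0, o ++ gs.reverse.flatMap P ++ (List.range n).reverse.flatMap fun j =>
        if xs[j]? = some true then px.eval [n, l, j] else []⟩ with hf
  have s5 : (whileNonzero k 5 (tupleStep k pg px)).Exec k B w (f 0) (f (N + 1)) := by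
    refine Exec.whileNonzero (by omega) f (N + 1) (fun i hi => ?_) ?_ (fun i hi => ?_)
    · simp [hf, show i ≤ N by omega, base]
    · simp [hf, base]
    · rcases Nat.lt_or_ge i N with hlt | hge
      · obtain ⟨j, hj⟩ : ∃ j, N - i = j + 1 := ⟨N - i - 1, by omega⟩
        have hjN : j < gs.length := by omega
        have hj' : N - (i + 1) = j := by omega
        obtain ⟨h1, h2, h3, h4⟩ := hg gs[j] (List.getElem_mem hjN)
        have ht : gs.take (j + 1) = gs.take j ++ [gs[j]] := by simp
        have hfm : gs.flatMap encGate = (gs.take j).flatMap encGate ++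
            (encGate gs[j] ++ (gs.drop (j + 1)).flatMap encGate) := by
          rw [← List.flatMap_cons, ← List.flatMap_append, ← List.drop_eq_getElem_cons hjN,
            List.take_append_drop]
        have := gate_step (k := k) (B := B) (w := w) (n := n) (l := l) (f := 1) (pg := pg)
          (px := px) (p := (hd ++ (gs.take (j + 1)).flatMap encGate).length - 2)
          (o := o ++ (gs.drop (j + 1)).reverse.flatMap P)
          (u := hd ++ (gs.take j).flatMap encGate) (v := (gs.drop (j + 1)).flatMap encGate)
          (g := gs[j]) hk hpg (by rw [hw, hfm, List.append_assoc])
          (by simp only [List.length_append]; omega) h1 h2 h3 h4 (by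
            simp only [ht, List.flatMap_append, List.flatMap_cons, List.flatMap_nil,
              List.append_nil, List.length_append]
            omega)
        simp only [hf, if_pos (show i ≤ N by omega), if_pos (show i + 1 ≤ N by omega),
          hj, hj']
        refine this.to ?_
        rw [List.drop_eq_getElem_cons hjN, List.reverse_cons, List.flatMap_append]
        simp only [List.flatMap_cons, List.flatMap_nil, List.append_nil, hP, List.append_assoc]
      · obtain rfl : i = N := by omega
        have := header_step (k := k) (B := B) (w := w) (n := n) (l := l) (pg := pg) (px := px)
          (o := o ++ gs.reverse.flatMap P) hk hpx hn' hw hn hx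
        simpa [hf] using this
  have h0 : f 0 = ⟨base n l 1, w.length - 2, o⟩ := by
    simp only [hf, Nat.zero_le, if_true, Nat.sub_zero, hN, List.take_length, List.drop_length,
      List.reverse_nil, List.flatMap_nil, List.append_nil, ← hw]
  have h1 : f (N + 1) = ⟨base n l 0, 0, o ++ gs.reverse.flatMap P ++
      (List.range n).reverse.flatMap fun j =>
        if xs[j]? = some true then px.eval [n, l, j] else []⟩ := by
    simp [hf]
  rw [h0, h1] at s5
  exact s1.seq (s2.seq (s3.seq (s4.seq s5)))

end Frag

/-- The output of three programs that are driven by the encoding of a circuit is computed by a Turing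
machine whose space is logarithmic in a bound for the numbers that occur. -/
theorem exists_machine (pi pg px : Prog) : ∃ (k : ℕ) (T : TM), ∀ (l B : ℕ) (xs : List Bool)
    (gs : List (ℕ × ℕ × ℕ)), 1 ≤ B → xs.length ≤ B → l ≤ B →
    (∀ g ∈ gs, g.1 ≤ B ∧ g.2.1 ≤ B ∧ g.2.2 ≤ B ∧
      pg.Bdd B [xs.length, l, g.1, g.2.1, g.2.2]) →
    pi.Bdd B [xs.length, l] → (∀ j < xs.length, px.Bdd B [xs.length, l, j]) →
    T.ComputesInSpace (encodeTuple [xs, l.bits] ++ gs.flatMap Frag.encGate)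
      (pi.eval [xs.length, l] ++
      gs.reverse.flatMap (fun g => pg.eval [xs.length, l, g.1, g.2.1, g.2.2]) ++
      (List.range xs.length).reverse.flatMap fun j =>
        if xs[j]? = some true then px.eval [xs.length, l, j] else [])
      (k * (Nat.size B + 1)) := by
  set k := 7 + 6 + pi.need + pg.need + px.need with hk
  refine ⟨k + 1, (Frag.seq (Frag.write (some true)) (Frag.driver k pi pg px)).toTM,
    fun l B xs gs hB1 hn hl hg hi hx => ?_⟩
  have h := Frag.exec_driver (k := k) (B := B) (by omega) (by omega) (by omega) (by omega) rfl hB1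
    hn hl hg hi hx
  obtain ⟨t', ⟨bs, _, _, rfl⟩, hrun⟩ := h ⟨0, Frag.cells k (fun _ => []), 0, []⟩
    ⟨fun _ => [], fun _ => rfl, fun _ => by simp, rfl⟩
  refine Frag.toTM_computesInSpace (Frag.Run.seq ?_ hrun) (by simp) rfl
  have := Frag.run_write (w := encodeTuple [xs, l.bits] ++ gs.flatMap Frag.encGate)
    (S := (k + 1) * (Nat.size B + 1)) (p := 0) (x := 0) (wk := fun _ => none) (o := [])
    (y := some true) (by positivity)
  convert this using 2
  funext x
  simp only [Frag.cells, Function.update_apply]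
  split_ifs <;> simp_all

/-! ### Generators of the unitary groups -/

/-- The unitary group of a qubit. -/
abbrev U2 := Matrix.unitaryGroup (Fin 2) ℂ

/-- The unitary group of two qubits. -/
abbrev U4 := Matrix.unitaryGroup (Fin 2 × Fin 2) ℂ

/-- The two-qubit matrix that applies `V` to one qubit (the target) if the other (the control) has
the value `s`.  The control is the first qubit for `o = false` and the second one for `o = true`. -/
def ctlMat (o : Bool) (s : Fin 2) (V : Matrix (Fin 2) (Fin 2) ℂ) :
    Matrix (Fin 2 × Fin 2) (Fin 2 × Fin 2) ℂ :=
  Matrix.of fun x y => match o with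
    | false => if x.1 = y.1 then (if x.1 = s then V x.2 y.2 else if x.2 = y.2 then 1 else 0) else 0
    | true => if x.2 = y.2 then (if x.2 = s then V x.1 y.1 else if x.1 = y.1 then 1 else 0) else 0

theorem ctlMat_one (o : Bool) (s : Fin 2) : ctlMat o s 1 = 1 := by
  ext ⟨a, b⟩ ⟨c, d⟩
  cases o <;> fin_cases s <;> fin_cases a <;> fin_cases b <;> fin_cases c <;> fin_cases d <;>
    simp [ctlMat]

theorem ctlMat_mul (o : Bool) (s : Fin 2) (V W : Matrix (Fin 2) (Fin 2) ℂ) :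
    ctlMat o s (V * W) = ctlMat o s V * ctlMat o s W := by
  ext ⟨a, b⟩ ⟨c, d⟩
  cases o <;> fin_cases s <;> fin_cases a <;> fin_cases b <;> fin_cases c <;> fin_cases d <;>
    simp [ctlMat, Matrix.mul_apply, Fintype.sum_prod_type, Fin.sum_univ_two]

theorem ctlMat_star (o : Bool) (s : Fin 2) (V : Matrix (Fin 2) (Fin 2) ℂ) :
    star (ctlMat o s V) = ctlMat o s (star V) := by
  ext ⟨a, b⟩ ⟨c, d⟩
  cases o <;> fin_cases s <;> fin_cases a <;> fin_cases b <;> fin_cases c <;> fin_cases d <;>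
    simp [ctlMat, Matrix.star_apply]

/-- The controlled gate as a homomorphism of unitary groups. -/
def ctl (o : Bool) (s : Fin 2) : U2 →* U4 where
  toFun V := ⟨ctlMat o s V.1, by
    rw [Matrix.mem_unitaryGroup_iff, ctlMat_star, ← ctlMat_mul,
      Matrix.mem_unitaryGroup_iff.1 V.2, ctlMat_one]⟩
  map_one' := Subtype.ext (ctlMat_one o s)
  map_mul' V W := Subtype.ext (ctlMat_mul o s V.1 W.1)

@[simp] theorem ctl_coe (o : Bool) (s : Fin 2) (V : U2) : (ctl o s V).1 = ctlMat o s V.1 := rfl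

/-- Every complex number is a phase times its absolute value. -/
theorem exists_phase (a : ℂ) : ∃ p : ℂ, ‖p‖ = 1 ∧ a = p * ‖a‖ := by
  by_cases h : a = 0
  · exact ⟨1, by simp, by simp [h]⟩
  · have : (‖a‖ : ℂ) ≠ 0 := by simpa using h
    exact ⟨a / ‖a‖, by simp [h], by field_simp⟩

theorem star_mul_self_of_norm {p : ℂ} (h : ‖p‖ = 1) : star p * p = 1 := by
  have := Complex.conj_mul' p
  rw [h] at this
  simpa using this

theorem conj_mul_self_of_norm {p : ℂ} (h : ‖p‖ = 1) : (starRingEnd ℂ) p * p = 1 :=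
  star_mul_self_of_norm h

/-- The diagonal matrix of two phases. -/
def diagU (p q : ℂ) (hp : ‖p‖ = 1) (hq : ‖q‖ = 1) : U2 :=
  ⟨Matrix.diagonal ![p, q], by
    rw [Matrix.mem_unitaryGroup_iff', Matrix.star_eq_conjTranspose, Matrix.diagonal_conjTranspose,
      Matrix.diagonal_mul_diagonal]
    ext i j
    fin_cases i <;> fin_cases j <;>
      simp [conj_mul_self_of_norm, hp, hq]⟩

/-- The bit flip. -/
def pauliX : U2 :=
  ⟨!![0, 1; 1, 0], by
    rw [Matrix.mem_unitaryGroup_iff]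
    ext i j
    fin_cases i <;> fin_cases j <;> simp [Matrix.mul_apply, Fin.sum_univ_two, Matrix.star_apply]⟩

/-- Two numbers are rotated to a nonnegative number and zero. -/
theorem exists_rotation (a b : ℂ) : ∃ (V : U2) (r : ℝ), 0 ≤ r ∧
    V.1 0 0 * a + V.1 0 1 * b = r ∧ V.1 1 0 * a + V.1 1 1 * b = 0 := by
  set r : ℝ := Real.sqrt (‖a‖ ^ 2 + ‖b‖ ^ 2) with hr
  have hr2 : r ^ 2 = ‖a‖ ^ 2 + ‖b‖ ^ 2 := Real.sq_sqrt (by positivity)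
  have ha : star a * a = (‖a‖ : ℂ) ^ 2 := Complex.conj_mul' a
  have hb : star b * b = (‖b‖ : ℂ) ^ 2 := Complex.conj_mul' b
  have hr2' : (r : ℂ) ^ 2 = star a * a + star b * b := by
    rw [ha, hb]; exact_mod_cast hr2
  have hr3 : (r : ℂ) ^ 2 = (starRingEnd ℂ) a * a + (starRingEnd ℂ) b * b := hr2'
  by_cases h0 : r = 0
  · have h1 : ‖a‖ ^ 2 = 0 := by nlinarith [sq_nonneg ‖a‖, sq_nonneg ‖b‖]
    have h2 : ‖b‖ ^ 2 = 0 := by nlinarith [sq_nonneg ‖a‖, sq_nonneg ‖b‖]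
    have h1' : a = 0 := by simpa using h1
    have h2' : b = 0 := by simpa using h2
    exact ⟨1, 0, le_rfl, by simp [h1', h2'], by simp [h1', h2']⟩
  · have hrc : (r : ℂ) ≠ 0 := by exact_mod_cast h0
    refine ⟨⟨!![star a / r, star b / r; -b / r, a / r], ?_⟩, r, Real.sqrt_nonneg _, ?_, ?_⟩
    · rw [Matrix.mem_unitaryGroup_iff]
      ext i j
      fin_cases i <;> fin_cases j <;>
        simp [Matrix.mul_apply, Fin.sum_univ_two, Matrix.star_apply] <;> field_simp <;>
        first | linear_combination -hr3 | ring
    · simp only [Matrix.of_apply, Matrix.cons_val', Matrix.cons_val_zero, Matrix.cons_val_one,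
        Matrix.cons_val_fin_one]
      field_simp
      rw [hr2']
    · simp only [Matrix.of_apply, Matrix.cons_val', Matrix.cons_val_zero, Matrix.cons_val_one,
        Matrix.cons_val_fin_one]
      field_simp
      ring

/-- Two numbers are rotated to zero and a nonnegative number. -/
theorem exists_rotation' (a b : ℂ) : ∃ (V : U2) (r : ℝ), 0 ≤ r ∧
    V.1 0 0 * a + V.1 0 1 * b = 0 ∧ V.1 1 0 * a + V.1 1 1 * b = r := by
  obtain ⟨V, r, hr, h1, h2⟩ := exists_rotation a b
  refine ⟨pauliX * V, r, hr, ?_, ?_⟩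
  · simpa [pauliX, Matrix.mul_apply, Fin.sum_univ_two] using h2
  · simpa [pauliX, Matrix.mul_apply, Fin.sum_univ_two] using h1

/-- If a column of a unitary matrix is a basis vector, then so is the row. -/
theorem unitary_row {ι : Type*} [Fintype ι] [DecidableEq ι] (U : Matrix.unitaryGroup ι ℂ) {c : ι}
    (h : ∀ i, U.1 i c = if i = c then 1 else 0) (j : ι) : U.1 c j = if j = c then 1 else 0 := by
  have := congrFun (congrFun (Matrix.mem_unitaryGroup_iff'.1 U.2) c) j
  simp only [Matrix.mul_apply, Matrix.star_apply, h, apply_ite star, star_one, star_zero, ite_mul,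
    one_mul, zero_mul, Finset.sum_ite_eq', Finset.mem_univ, if_true, Matrix.one_apply] at this
  rw [this]
  simp [eq_comm]

theorem unitary_col_norm {ι : Type*} [Fintype ι] [DecidableEq ι] (U : Matrix.unitaryGroup ι ℂ)
    (c : ι) : ∑ i, star (U.1 i c) * U.1 i c = 1 := by
  have := congrFun (congrFun (Matrix.mem_unitaryGroup_iff'.1 U.2) c) c
  simpa [Matrix.mul_apply, Matrix.star_apply] using this

theorem eq_one_of_nonneg {r : ℝ} (h : 0 ≤ r) (h1 : star (r : ℂ) * r = 1) : r = 1 := by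
  have h2 : ((r * r : ℝ) : ℂ) = 1 := by simpa using h1
  have h3 : r * r = 1 := by exact_mod_cast h2
  nlinarith

theorem norm_eq_one_of_star_mul {z : ℂ} (h : star z * z = 1) : ‖z‖ = 1 := by
  have : (‖z‖ : ℂ) ^ 2 = 1 := by rw [← h]; exact (Complex.conj_mul' z).symm
  have h2 : ‖z‖ ^ 2 = 1 := by exact_mod_cast this
  nlinarith [norm_nonneg z]

theorem ctl_false_mul (s : Fin 2) (V : U2) (U : U4) (a b : Fin 2) (y : Fin 2 × Fin 2) :
    (ctl false s V * U).1 (a, b) y =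
      if a = s then V.1 b 0 * U.1 (a, 0) y + V.1 b 1 * U.1 (a, 1) y else U.1 (a, b) y := by
  fin_cases s <;> fin_cases a <;> fin_cases b <;>
    simp [ctlMat, Matrix.mul_apply, Fintype.sum_prod_type, Fin.sum_univ_two]

theorem ctl_true_mul (s : Fin 2) (V : U2) (U : U4) (a b : Fin 2) (y : Fin 2 × Fin 2) :
    (ctl true s V * U).1 (a, b) y =
      if b = s then V.1 a 0 * U.1 (0, b) y + V.1 a 1 * U.1 (1, b) y else U.1 (a, b) y := by
  fin_cases s <;> fin_cases a <;> fin_cases b <;>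
    simp [ctlMat, Matrix.mul_apply, Fintype.sum_prod_type, Fin.sum_univ_two]

/-- The controlled gates generate all two-qubit gates.  The columns of the matrix are reduced to
basis vectors by rotations of basis vectors that are adjacent in the Gray code
`00, 01, 11, 10`. -/
theorem mem_of_ctl_mem (H : Subgroup U4) (hH : ∀ o s V, ctl o s V ∈ H) (U : U4) : U ∈ H := by
  have red : ∀ (U : U4) (h : U4), h ∈ H → h * U ∈ H → U ∈ H := fun U h h1 h2 =>
    (H.mul_mem_cancel_left h1).1 h2
  -- a matrix that differs from the identity in one entry only
  have hD : ∀ U : U4, (∀ i, U.1 i (0, 0) = if i = (0, 0) then 1 else 0) →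
      (∀ i, U.1 i (0, 1) = if i = (0, 1) then 1 else 0) →
      (∀ i, U.1 i (1, 1) = if i = (1, 1) then 1 else 0) → U ∈ H := by
    intro U h0 h1 h2
    have r0 := unitary_row U h0 (1, 0)
    have r1 := unitary_row U h1 (1, 0)
    have r2 := unitary_row U h2 (1, 0)
    have hn := unitary_col_norm U (1, 0)
    simp only [Fintype.sum_prod_type, Fin.sum_univ_two, r0, r1, r2] at hn
    simp at hn
    have hz : ‖U.1 (1, 0) (1, 0)‖ = 1 := norm_eq_one_of_star_mul (by simpa using hn)
    have : U = ctl false 1 (diagU (U.1 (1, 0) (1, 0)) 1 hz (by simp)) := by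
      apply Subtype.ext
      ext ⟨a, b⟩ ⟨c, d⟩
      fin_cases a <;> fin_cases b <;> fin_cases c <;> fin_cases d <;>
        simp [ctlMat, diagU, h0, h1, h2, r0, r1, r2]
    rw [this]
    exact hH _ _ _
  -- column `11` is turned into the basis vector by a gate on the rows `10`, `11`
  have hC : ∀ U : U4, (∀ i, U.1 i (0, 0) = if i = (0, 0) then 1 else 0) →
      (∀ i, U.1 i (0, 1) = if i = (0, 1) then 1 else 0) → U ∈ H := by
    intro U h0 h1
    obtain ⟨V, r, hr, e1, e2⟩ := exists_rotation' (U.1 (1, 0) (1, 1)) (U.1 (1, 1) (1, 1))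
    refine red U _ (hH false 1 V) (hD _ ?_ ?_ ?_)
    · rintro ⟨a, b⟩
      rw [ctl_false_mul]
      fin_cases a <;> fin_cases b <;> simp [h0]
    · rintro ⟨a, b⟩
      rw [ctl_false_mul]
      fin_cases a <;> fin_cases b <;> simp [h1]
    · have r0 := unitary_row U h0 (1, 1)
      have r1 := unitary_row U h1 (1, 1)
      have hn := unitary_col_norm (ctl false 1 V * U) (1, 1)
      have key : ∀ a b, (ctl false 1 V * U).1 (a, b) (1, 1) = if (a, b) = (1, 1) then (r : ℂ) else 0 := by
        intro a b
        rw [ctl_false_mul]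
        fin_cases a <;> fin_cases b <;> simp [r0, r1, e1, e2]
      simp only [Fintype.sum_prod_type, Fin.sum_univ_two, key] at hn
      have : r = 1 := eq_one_of_nonneg hr (by simpa using hn)
      subst this
      rintro ⟨a, b⟩
      rw [key]; simp
  -- in column `01`, the rows `10`, `11` are combined in row `11`, and this with row `01`
  have hB : ∀ U : U4, (∀ i, U.1 i (0, 0) = if i = (0, 0) then 1 else 0) → U ∈ H := by
    intro U h0
    obtain ⟨V, s, -, e1, e2⟩ := exists_rotation' (U.1 (1, 0) (0, 1)) (U.1 (1, 1) (0, 1))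
    obtain ⟨W, r, hr, f1, f2⟩ := exists_rotation (U.1 (0, 1) (0, 1)) s
    refine red U (ctl true 1 W * ctl false 1 V) (H.mul_mem (hH _ _ _) (hH _ _ _)) (hC _ ?_ ?_)
    · rintro ⟨a, b⟩
      rw [mul_assoc, ctl_true_mul]
      simp only [ctl_false_mul]
      fin_cases a <;> fin_cases b <;> simp [h0]
    · have r0 := unitary_row U h0 (0, 1)
      have hn := unitary_col_norm (ctl true 1 W * ctl false 1 V * U) (0, 1)
      have key : ∀ a b, (ctl true 1 W * ctl false 1 V * U).1 (a, b) (0, 1) =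
          if (a, b) = (0, 1) then (r : ℂ) else 0 := by
        intro a b
        rw [mul_assoc, ctl_true_mul]
        simp only [ctl_false_mul]
        fin_cases a <;> fin_cases b <;> simp [r0, e1, e2, f1, f2]
      simp only [Fintype.sum_prod_type, Fin.sum_univ_two, key] at hn
      have : r = 1 := eq_one_of_nonneg hr (by simpa using hn)
      subst this
      rintro ⟨a, b⟩
      rw [key]; simp
  -- column `00` is combined in row `11`, then in row `01` and finally in row `00`
  obtain ⟨V, s, -, e1, e2⟩ := exists_rotation' (U.1 (1, 0) (0, 0)) (U.1 (1, 1) (0, 0))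
  obtain ⟨W, t, -, f1, f2⟩ := exists_rotation (U.1 (0, 1) (0, 0)) s
  obtain ⟨X, r, hr, g1, g2⟩ := exists_rotation (U.1 (0, 0) (0, 0)) t
  refine red U (ctl false 0 X * (ctl true 1 W * ctl false 1 V))
    (H.mul_mem (hH _ _ _) (H.mul_mem (hH _ _ _) (hH _ _ _))) (hB _ ?_)
  have hn := unitary_col_norm (ctl false 0 X * (ctl true 1 W * ctl false 1 V) * U) (0, 0)
  have key : ∀ a b, (ctl false 0 X * (ctl true 1 W * ctl false 1 V) * U).1 (a, b) (0, 0) =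
      if (a, b) = (0, 0) then (r : ℂ) else 0 := by
    intro a b
    rw [mul_assoc, mul_assoc, ctl_false_mul]
    simp only [ctl_true_mul, ctl_false_mul]
    fin_cases a <;> fin_cases b <;> simp [e1, e2, f1, f2, g1, g2]
  simp only [Fintype.sum_prod_type, Fin.sum_univ_two, key] at hn
  have : r = 1 := eq_one_of_nonneg hr (by simpa using hn)
  subst this
  rintro ⟨a, b⟩
  rw [key]; simp

/-- The Hadamard gate. -/
noncomputable def hadamard : U2 :=
  ⟨!![1 / (Real.sqrt 2 : ℂ), 1 / Real.sqrt 2; 1 / Real.sqrt 2, -1 / Real.sqrt 2], by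
    have h : (Real.sqrt 2 : ℂ) * Real.sqrt 2 = 2 := by
      exact_mod_cast Real.mul_self_sqrt (by norm_num : (0 : ℝ) ≤ 2)
    have h0 : (Real.sqrt 2 : ℂ) ≠ 0 := by
      intro h0; rw [h0] at h; norm_num at h
    rw [Matrix.mem_unitaryGroup_iff]
    ext i j
    fin_cases i <;> fin_cases j <;>
      simp [Matrix.mul_apply, Fin.sum_univ_two, Matrix.star_apply] <;> field_simp <;>
      norm_num [sq, h]⟩

/-- The phase gate with angle `t`. -/
noncomputable def phaseU (t : ℝ) : U2 :=
  diagU 1 (Complex.exp (t * Complex.I)) (by simp) (Complex.norm_exp_ofReal_mul_I t)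

theorem exists_exp_of_norm {p : ℂ} (h : ‖p‖ = 1) : ∃ t : ℝ, p = Complex.exp (t * Complex.I) := by
  refine ⟨p.arg, ?_⟩
  have := Complex.norm_mul_exp_arg_mul_I p
  rw [h] at this
  simpa using this.symm

theorem hadamard_phase_hadamard (t : ℝ) : (hadamard * phaseU t * hadamard).1 =
    !![(1 + Complex.exp (t * Complex.I)) / 2, (1 - Complex.exp (t * Complex.I)) / 2;
      (1 - Complex.exp (t * Complex.I)) / 2, (1 + Complex.exp (t * Complex.I)) / 2] := by
  have h : (Real.sqrt 2 : ℂ) * Real.sqrt 2 = 2 := by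
    exact_mod_cast Real.mul_self_sqrt (by norm_num : (0 : ℝ) ≤ 2)
  have h0 : (Real.sqrt 2 : ℂ) ≠ 0 := by
    intro h0; rw [h0] at h; norm_num at h
  have e : ∀ x : ℂ, (1 / (Real.sqrt 2 : ℂ)) * x * (1 / Real.sqrt 2) = x / 2 := by
    intro x; field_simp; rw [sq, h]; ring
  have hm : (hadamard * phaseU t * hadamard).1 = hadamard.1 * (phaseU t).1 * hadamard.1 := rfl
  have a0 : hadamard.1 0 0 = 1 / Real.sqrt 2 := rfl
  have a1 : hadamard.1 0 1 = 1 / Real.sqrt 2 := rfl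
  have a2 : hadamard.1 1 0 = 1 / Real.sqrt 2 := rfl
  have a3 : hadamard.1 1 1 = -(1 / Real.sqrt 2) := neg_div _ _
  have b0 : (phaseU t).1 0 0 = 1 := by simp [phaseU, diagU]
  have b1 : (phaseU t).1 0 1 = 0 := by simp [phaseU, diagU]
  have b2 : (phaseU t).1 1 0 = 0 := by simp [phaseU, diagU]
  have b3 : (phaseU t).1 1 1 = Complex.exp (t * Complex.I) := by simp [phaseU, diagU]
  rw [hm]
  ext i j
  fin_cases i <;> fin_cases j <;>
    simp only [Fin.zero_eta, Fin.mk_one, Matrix.mul_apply, Fin.sum_univ_two, a0, a1, a2, a3, b0,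
      b1, b2, b3, Matrix.of_apply, Matrix.cons_val', Matrix.cons_val_zero, Matrix.cons_val_one,
      Matrix.cons_val_fin_one]
  · linear_combination e 1 + e (Complex.exp (t * Complex.I))
  · linear_combination e 1 - e (Complex.exp (t * Complex.I))
  · linear_combination e 1 - e (Complex.exp (t * Complex.I))
  · linear_combination e 1 + e (Complex.exp (t * Complex.I))

theorem hadamard_phase_pi : hadamard * phaseU Real.pi * hadamard = pauliX := by
  apply Subtype.ext
  rw [hadamard_phase_hadamard, Complex.exp_pi_mul_I]
  ext i j
  fin_cases i <;> fin_cases j <;> norm_num [pauliX]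

/-- The Euler decomposition: the Hadamard gate and the phase gates generate all one-qubit gates. -/
theorem mem_of_hadamard_phase (S : Submonoid U2) (hh : hadamard ∈ S) (hp : ∀ t, phaseU t ∈ S)
    (V : U2) : V ∈ S := by
  have hX := S.mul_mem (S.mul_mem hh (hp Real.pi)) hh
  rw [hadamard_phase_pi] at hX
  have hdiag : ∀ p q hp1 hq1, diagU p q hp1 hq1 ∈ S := by
    intro p q hp1 hq1
    obtain ⟨s, hs⟩ := exists_exp_of_norm hp1
    obtain ⟨t, ht⟩ := exists_exp_of_norm hq1
    have : diagU p q hp1 hq1 = pauliX * phaseU s * pauliX * phaseU t := by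
      apply Subtype.ext
      ext i j
      fin_cases i <;> fin_cases j <;>
        simp only [Submonoid.coe_mul, Matrix.mul_apply, Fin.sum_univ_two] <;>
        simp [phaseU, pauliX, diagU, hs, ht]
    rw [this]
    exact S.mul_mem (S.mul_mem (S.mul_mem hX (hp s)) hX) (hp t)
  obtain ⟨p, hp1, ha⟩ := exists_phase (V.1 0 0)
  obtain ⟨q, hq1, hc⟩ := exists_phase (V.1 1 0)
  have hn := unitary_col_norm V 0
  rw [Fin.sum_univ_two] at hn
  have hn' : ‖V.1 0 0‖ ^ 2 + ‖V.1 1 0‖ ^ 2 = 1 := by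
    have h1 : star (V.1 0 0) * V.1 0 0 = (‖V.1 0 0‖ : ℂ) ^ 2 := Complex.conj_mul' _
    have h2 : star (V.1 1 0) * V.1 1 0 = (‖V.1 1 0‖ : ℂ) ^ 2 := Complex.conj_mul' _
    rw [h1, h2] at hn
    exact_mod_cast hn
  set t := Real.arccos ‖V.1 0 0‖ with ht
  have hcos : Real.cos t = ‖V.1 0 0‖ :=
    Real.cos_arccos (by linarith [norm_nonneg (V.1 0 0)]) (by nlinarith [sq_nonneg ‖V.1 1 0‖])
  have hsin : Real.sin t = ‖V.1 1 0‖ := by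
    rw [Real.sin_arccos, show 1 - ‖V.1 0 0‖ ^ 2 = ‖V.1 1 0‖ ^ 2 by linarith,
      Real.sqrt_sq (norm_nonneg _)]
  set z := Complex.exp ((-t : ℝ) * Complex.I) with hz
  have hz1 : ‖z‖ = 1 := Complex.norm_exp_ofReal_mul_I _
  have hiq : ‖Complex.I * q‖ = 1 := by simp [hq1]
  -- `H * phaseU (2 * t) * H` has the first column `exp (i t) (cos t, -i sin t)`, so `W` has that
  -- of `V`, and `W⁻¹ * V` is diagonal
  set W := diagU p (Complex.I * q) hp1 hiq * (diagU z z hz1 hz1 *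
    (hadamard * phaseU (2 * t) * hadamard)) with hW
  have hWS : W ∈ S := S.mul_mem (hdiag _ _ _ _) (S.mul_mem (hdiag _ _ _ _)
    (S.mul_mem (S.mul_mem hh (hp _)) hh))
  have e1 : z * Complex.exp ((2 * t : ℝ) * Complex.I) = Complex.exp (t * Complex.I) := by
    rw [hz, ← Complex.exp_add]; congr 1; push_cast; ring
  have ec : Complex.exp (t * Complex.I) = Real.cos t + Real.sin t * Complex.I := by
    rw [Complex.exp_mul_I, Complex.ofReal_cos, Complex.ofReal_sin]
  have ez : z = Real.cos t - Real.sin t * Complex.I := by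
    rw [hz, Complex.exp_mul_I]; push_cast
    rw [Complex.cos_neg, Complex.sin_neg, neg_mul, sub_eq_add_neg]
  have w0 : W.1 0 0 = V.1 0 0 := by
    have : W.1 0 0 = p * (z * ((1 + Complex.exp ((2 * t : ℝ) * Complex.I)) / 2)) := by
      rw [hW]
      simp only [Submonoid.coe_mul] at *
      have := hadamard_phase_hadamard (2 * t)
      simp only [Submonoid.coe_mul] at this
      rw [this]
      simp [diagU, Matrix.mul_apply, Fin.sum_univ_two]
    rw [this, mul_div_assoc', mul_add, e1, ez, ec, ha, ← hcos]; ring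
  have w1 : W.1 1 0 = V.1 1 0 := by
    have : W.1 1 0 = Complex.I * q * (z * ((1 - Complex.exp ((2 * t : ℝ) * Complex.I)) / 2)) := by
      rw [hW]
      have := hadamard_phase_hadamard (2 * t)
      simp only [Submonoid.coe_mul] at this ⊢
      rw [this]
      simp [diagU, Matrix.mul_apply, Fin.sum_univ_two]
    rw [this, mul_div_assoc', mul_sub, e1, ez, ec, hc, ← hsin]
    linear_combination (-(q * Real.sin t)) * Complex.I_sq
  have hcol : ∀ i, (W⁻¹ * V).1 i 0 = if i = 0 then 1 else 0 := by
    have hVW : ∀ i, V.1 i 0 = W.1 i 0 := by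
      intro i; fin_cases i
      · exact w0.symm
      · exact w1.symm
    have h1 : (W⁻¹ * W).1 = 1 := by simp
    intro i
    have h2 := congrFun (congrFun h1 i) 0
    rw [Submonoid.coe_mul, Matrix.mul_apply] at h2 ⊢
    simp only [hVW]
    rw [h2, Matrix.one_apply]
  have hrow := unitary_row _ hcol 1
  have hn2 := unitary_col_norm (W⁻¹ * V) 1
  rw [Fin.sum_univ_two, hrow] at hn2
  have hr1 : ‖(W⁻¹ * V).1 1 1‖ = 1 := norm_eq_one_of_star_mul (by simpa using hn2)
  have hfin : W⁻¹ * V = diagU 1 ((W⁻¹ * V).1 1 1) (by simp) hr1 := by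
    apply Subtype.ext
    ext i j
    fin_cases i <;> fin_cases j
    · simpa [diagU] using hcol 0
    · simpa [diagU] using hrow
    · simpa [diagU] using hcol 1
    · simp [diagU]
  have : V = W * diagU 1 ((W⁻¹ * V).1 1 1) (by simp) hr1 := by rw [← hfin]; group
  rw [this]
  exact S.mul_mem hWS (hdiag _ _ _ _)

/-! ### Density of the products of gates -/

namespace GateApp

variable {G : GateSet} {n : ℕ}

/-- The matrix of a gate, acting on all lines. -/
def mat (g : GateApp G n) : Matrix (Fin n → Fin 2) (Fin n → Fin 2) ℂ :=
  Matrix.of fun x y => g.apply (ket y) x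

theorem apply_eq_mulVec (g : GateApp G n) (ψ : QState n) : g.apply ψ = g.mat.mulVec ψ := by
  funext z
  cases g with
  | one g i =>
    simp only [mat, apply, Matrix.mulVec, dotProduct, Matrix.of_apply, ket, Pi.single_apply,
      Finset.sum_mul]
    rw [Finset.sum_comm]
    simp
  | two g i j h =>
    simp only [mat, apply, Matrix.mulVec, dotProduct, Matrix.of_apply, ket, Pi.single_apply,
      Finset.sum_mul]
    symm
    rw [Finset.sum_comm]
    refine Finset.sum_congr rfl fun a _ => ?_
    rw [Finset.sum_comm]
    simp

end GateApp

namespace Circuit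

variable {G : GateSet} {n : ℕ}

/-- The matrix of a circuit. -/
def mat (c : Circuit G n) : Matrix (Fin n → Fin 2) (Fin n → Fin 2) ℂ :=
  Matrix.of fun x y => c.run (ket y) x

theorem run_append (c d : Circuit G n) (ψ : QState n) : run (c ++ d) ψ = d.run (c.run ψ) :=
  List.foldl_append

theorem run_cons (g : GateApp G n) (c : Circuit G n) (ψ : QState n) :
    run (g :: c) ψ = c.run (g.apply ψ) := rfl

theorem run_eq_mulVec (c : Circuit G n) (ψ : QState n) : c.run ψ = c.mat.mulVec ψ := by
  have lin : ∀ c : Circuit G n, ∃ M : Matrix (Fin n → Fin 2) (Fin n → Fin 2) ℂ,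
      ∀ ψ, c.run ψ = M.mulVec ψ := by
    intro c
    induction c with
    | nil => exact ⟨1, fun ψ => (Matrix.one_mulVec ψ).symm⟩
    | cons g c ih =>
      obtain ⟨M, hM⟩ := ih
      exact ⟨M * g.mat, fun ψ => by
        rw [run_cons, hM, g.apply_eq_mulVec, Matrix.mulVec_mulVec]⟩
  obtain ⟨M, hM⟩ := lin c
  have : c.mat = M := by
    ext x y
    simp [mat, hM, ket]
  rw [this, hM]

theorem mat_append (c d : Circuit G n) : mat (c ++ d) = d.mat * c.mat := by
  ext x y
  simp only [mat, Matrix.of_apply, run_append]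
  rw [run_eq_mulVec d]
  rfl

theorem mat_nil : mat ([] : Circuit G n) = 1 := by
  ext x y
  simp [mat, run, ket, Pi.single_apply, Matrix.one_apply]

theorem mat_singleton (g : GateApp G n) : mat [g] = g.mat := rfl

/-- The operations, up to a phase, of the circuits all of whose gates satisfy `q`. -/
def operations (q : GateApp G n → Prop) :
    Submonoid (Matrix (Fin n → Fin 2) (Fin n → Fin 2) ℂ) where
  carrier := {M | ∃ (p : ℂ) (c : Circuit G n), ‖p‖ = 1 ∧ (∀ g ∈ c, q g) ∧ M = p • c.mat}
  one_mem' := ⟨1, [], by simp, by simp, by simp [mat_nil]⟩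
  mul_mem' := by
    rintro _ _ ⟨p, c, hp, hc, rfl⟩ ⟨p', c', hp', hc', rfl⟩
    refine ⟨p * p', c' ++ c, by simp [hp, hp'], ?_, ?_⟩
    · intro g hg
      rcases List.mem_append.1 hg with h | h
      exacts [hc' g h, hc g h]
    · rw [mat_append, smul_mul_smul_comm]

/-- Limits of circuits can be approximated by circuits. -/
theorem exists_approximates {q : GateApp G n → Prop}
    {U : Matrix (Fin n → Fin 2) (Fin n → Fin 2) ℂ}
    (hU : U ∈ (operations q).topologicalClosure) {ε : ℝ} (hε : 0 < ε) :
    ∃ c : Circuit G n, (∀ g ∈ c, q g) ∧ c.Approximates U ε := by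
  have hU' : U ∈ closure (operations q : Set (Matrix (Fin n → Fin 2) (Fin n → Fin 2) ℂ)) := hU
  have hopen : IsOpen {M : Matrix (Fin n → Fin 2) (Fin n → Fin 2) ℂ |
      ∀ x y, ‖M x y - U x y‖ < ε} := by
    simp only [Set.ofPred_forall]
    refine isOpen_iInter_of_finite fun x => isOpen_iInter_of_finite fun y => ?_
    exact isOpen_lt (((continuous_id.matrix_elem x y).sub continuous_const).norm) continuous_const
  obtain ⟨M, hM, p, c, hp, hc, rfl⟩ := mem_closure_iff.1 hU' _ hopen (by simp [hε])
  exact ⟨c, hc, p, hp, fun x y => hM x y⟩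

theorem mem_operations {q : GateApp G n → Prop} {g : GateApp G n} (hg : q g) :
    g.mat ∈ (operations q).topologicalClosure :=
  Submonoid.le_topologicalClosure _
    ⟨1, [g], by simp, by simpa using hg, by rw [mat_singleton, one_smul]⟩

theorem smul_one_mem_operations (q : GateApp G n → Prop) {p : ℂ} (hp : ‖p‖ = 1) :
    p • (1 : Matrix (Fin n → Fin 2) (Fin n → Fin 2) ℂ) ∈ (operations q).topologicalClosure :=
  Submonoid.le_topologicalClosure _ ⟨p, [], hp, by simp, by rw [mat_nil]⟩

end Circuit

theorem phaseU_add (s t : ℝ) : phaseU (s + t) = phaseU s * phaseU t := by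
  apply Subtype.ext
  simp only [phaseU, diagU, Submonoid.coe_mul, Matrix.diagonal_mul_diagonal]
  congr 1
  funext i
  fin_cases i
  · simp
  · simp [add_mul, Complex.exp_add]

theorem phaseU_zero : phaseU 0 = 1 := by
  apply Subtype.ext
  ext i j
  fin_cases i <;> fin_cases j <;> simp [phaseU, diagU]

theorem phaseU_two_pi : phaseU (2 * Real.pi) = 1 := by
  apply Subtype.ext
  ext i j
  fin_cases i <;> fin_cases j <;> simp [phaseU, diagU]

theorem continuous_phaseU : Continuous phaseU := by
  refine Continuous.subtype_mk ?_ _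
  refine Continuous.matrix_diagonal ?_
  refine continuous_pi fun i => ?_
  fin_cases i
  · exact continuous_const
  · change Continuous fun t : ℝ => Complex.exp (t * Complex.I)
    fun_prop

/-- The Hadamard gate and the phase gate of angle `1` generate a dense group, because `1` and `2π`
are incommensurable. -/
theorem eq_top_of_isClosed (S : Submonoid U2) (hS : IsClosed (S : Set U2)) (hh : hadamard ∈ S)
    (h1 : phaseU 1 ∈ S) (h2 : phaseU (-1) ∈ S) (V : U2) : V ∈ S := by
  refine mem_of_hadamard_phase S hh (fun t => ?_) V
  let A : AddSubgroup ℝ :=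
    { carrier := {t | phaseU t ∈ S ∧ phaseU (-t) ∈ S}
      zero_mem' := by simp [phaseU_zero, S.one_mem]
      add_mem' := by
        rintro a b ⟨h1, h2⟩ ⟨h3, h4⟩
        refine ⟨?_, ?_⟩
        · rw [phaseU_add]; exact S.mul_mem h1 h3
        · rw [neg_add, phaseU_add]; exact S.mul_mem h2 h4
      neg_mem' := by
        rintro a ⟨h1, h2⟩
        exact ⟨h2, by simpa using h1⟩ }
  have hpi : phaseU (-(2 * Real.pi)) = 1 := by
    have := phaseU_add (2 * Real.pi) (-(2 * Real.pi))
    rw [add_neg_cancel, phaseU_zero, phaseU_two_pi, one_mul] at this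
    exact this.symm
  have hle : AddSubgroup.closure {1, 2 * Real.pi} ≤ A := by
    rw [AddSubgroup.closure_le]
    rintro x (rfl | rfl)
    · exact ⟨h1, h2⟩
    · exact ⟨by rw [phaseU_two_pi]; exact S.one_mem, by rw [hpi]; exact S.one_mem⟩
  have hd : Dense (AddSubgroup.closure {1, 2 * Real.pi} : Set ℝ) := by
    rw [dense_addSubgroupClosure_pair_iff]
    have := irrational_pi.natCast_mul (m := 2) (by norm_num)
    simpa using this.inv
  have hcl : IsClosed {t | phaseU t ∈ S} := hS.preimage continuous_phaseU
  exact hcl.closure_subset_iff.2 (fun x hx => (hle hx).1) (hd t)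

/-! ### Universality of controlled gates -/

/-- The gates of `G` that act on one line include `V`. -/
def GateSet.Has1 (G : GateSet) (V : U2) : Prop := V ∈ Set.range G.gate1

/-- The gates of `G` that act on two lines include `V`. -/
def GateSet.Has2 (G : GateSet) (V : U4) : Prop := V ∈ Set.range G.gate2

/-- The bit flip of the control qubit. -/
def ctlFlip (o : Bool) : Matrix (Fin 2 × Fin 2) (Fin 2 × Fin 2) ℂ :=
  Matrix.of fun x y => match o with
    | false => if x.2 = y.2 then pauliX.1 x.1 y.1 else 0
    | true => if x.1 = y.1 then pauliX.1 x.2 y.2 else 0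

theorem ctlMat_zero_eq (o : Bool) (V : Matrix (Fin 2) (Fin 2) ℂ) :
    ctlMat o 0 V = ctlFlip o * ctlMat o 1 V * ctlFlip o := by
  ext ⟨a, b⟩ ⟨c, d⟩
  cases o <;> fin_cases a <;> fin_cases b <;> fin_cases c <;> fin_cases d <;>
    simp [ctlMat, ctlFlip, pauliX, Matrix.mul_apply, Fintype.sum_prod_type, Fin.sum_univ_two]

/-- Two-qubit matrices as matrices on two lines. -/
def onLines : Matrix (Fin 2 × Fin 2) (Fin 2 × Fin 2) ℂ →*
    Matrix (Fin 2 → Fin 2) (Fin 2 → Fin 2) ℂ where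
  toFun M := M.submatrix (finTwoArrowEquiv (Fin 2)) (finTwoArrowEquiv (Fin 2))
  map_one' := Matrix.submatrix_one_equiv _
  map_mul' M N := (Matrix.submatrix_mul_equiv M N _ _ _).symm

theorem onLines_apply (M : Matrix (Fin 2 × Fin 2) (Fin 2 × Fin 2) ℂ) (x y : Fin 2 → Fin 2) :
    onLines M x y = M (x 0, x 1) (y 0, y 1) := rfl

theorem continuous_onLines : Continuous onLines :=
  Continuous.matrix_submatrix continuous_id _ _

theorem mat_two_zero_one {G : GateSet} (g : Fin G.num2) :
    (GateApp.two (n := 2) g 0 1 (by decide)).mat = onLines (G.gate2 g).1 := by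
  ext x y
  have : ∀ a b, Function.update (Function.update x 0 a) 1 b = y ↔ a = y 0 ∧ b = y 1 := by
    intro a b
    simp [funext_iff, Fin.forall_fin_two]
  simp only [GateApp.mat, GateApp.apply, onLines_apply, ket, Pi.single_apply, this, ite_and,
    Matrix.of_apply]
  generalize y 0 = c
  generalize y 1 = d
  fin_cases c <;> fin_cases d <;> simp

theorem ctl_true_mat_eq {G : GateSet} {g : Fin G.num2} {V : U2} (h : G.gate2 g = ctl false 1 V) :
    (GateApp.two (n := 2) g 1 0 (by decide)).mat = onLines (ctlMat true 1 V.1) := by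
  ext x y
  have : ∀ a b, Function.update (Function.update x 1 a) 0 b = y ↔ b = y 0 ∧ a = y 1 := by
    intro a b
    simp [funext_iff, Fin.forall_fin_two]
  simp only [GateApp.mat, GateApp.apply, onLines_apply, ket, Pi.single_apply, this, ite_and,
    Matrix.of_apply, h, ctl_coe, ctlMat]
  generalize y 0 = c
  generalize y 1 = d
  generalize x 0 = a
  generalize x 1 = b
  fin_cases a <;> fin_cases b <;> fin_cases c <;> fin_cases d <;> simp

theorem ctlFlip_mat_eq {G : GateSet} {g : Fin G.num1} (h : G.gate1 g = pauliX) (o : Bool) :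
    (GateApp.one (n := 2) g (if o then 1 else 0)).mat = onLines (ctlFlip o) := by
  ext x y
  have h0 : ∀ a, Function.update x 0 a = y ↔ a = y 0 ∧ x 1 = y 1 := by
    intro a
    simp [funext_iff, Fin.forall_fin_two]
  have h1 : ∀ a, Function.update x 1 a = y ↔ a = y 1 ∧ x 0 = y 0 := by
    intro a
    simp [funext_iff, Fin.forall_fin_two, and_comm]
  cases o <;>
  simp only [GateApp.mat, GateApp.apply, onLines_apply, ket, Pi.single_apply, h0, h1, ite_and, h,
    ctlFlip, Matrix.of_apply, if_true, Bool.false_eq_true, if_false] <;>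
  generalize y 0 = c <;>
  generalize y 1 = d <;>
  fin_cases c <;> fin_cases d <;> simp

/-- Gate sets with the required one-qubit gates and their controlled versions are universal. -/
theorem GateSet.isUniversal_of_has {G : GateSet} (hX : G.Has1 pauliX)
    (h1 : G.Has1 hadamard ∧ G.Has1 (phaseU 1) ∧ G.Has1 (phaseU (-1)))
    (h2 : G.Has2 (ctl false 1 hadamard) ∧ G.Has2 (ctl false 1 (phaseU 1)) ∧
      G.Has2 (ctl false 1 (phaseU (-1)))) : G.IsUniversal := by
  rintro n (rfl | rfl) U ε hε
  · let φ : U2 →* Matrix (Fin 1 → Fin 2) (Fin 1 → Fin 2) ℂ :=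
      { toFun := fun V => V.1.submatrix (Equiv.funUnique (Fin 1) (Fin 2))
          (Equiv.funUnique (Fin 1) (Fin 2))
        map_one' := Matrix.submatrix_one_equiv _
        map_mul' := fun M N => (Matrix.submatrix_mul_equiv M.1 N.1 _ _ _).symm }
    have hφ : Continuous φ := Continuous.matrix_submatrix continuous_subtype_val _ _
    -- one line: the limits form a closed submonoid that contains the generators
    have hg : ∀ V, G.Has1 V → φ V ∈ (Circuit.operations fun _ : GateApp G 1 => True).topologicalClosure := by
      rintro _ ⟨g, rfl⟩
      have : φ (G.gate1 g) = (GateApp.one (n := 1) g 0).mat := by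
        ext x y
        have : ∀ a, Function.update x 0 a = y ↔ a = y 0 := by
          intro a
          simp [funext_iff, Fin.forall_fin_one]
        simp only [GateApp.mat, GateApp.apply, ket, Pi.single_apply, this, Matrix.of_apply]
        change (G.gate1 g).1 (x 0) (y 0) = _
        generalize y 0 = c
        fin_cases c <;> simp
      rw [this]
      exact Circuit.mem_operations trivial
    have hall : ∀ V, φ V ∈ (Circuit.operations fun _ : GateApp G 1 => True).topologicalClosure :=
      fun V => eq_top_of_isClosed 
        ((Circuit.operations fun _ : GateApp G 1 => True).topologicalClosure.comap φ)
        ((Submonoid.isClosed_topologicalClosure _).preimage hφ)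
        (hg _ h1.1) (hg _ h1.2.1) (hg _ h1.2.2) V
    let V : U2 := ⟨U.1.submatrix (Equiv.funUnique (Fin 1) (Fin 2)).symm
      (Equiv.funUnique (Fin 1) (Fin 2)).symm, by
        rw [Matrix.mem_unitaryGroup_iff, Matrix.star_eq_conjTranspose,
          Matrix.conjTranspose_submatrix, Matrix.submatrix_mul_equiv,
          ← Matrix.star_eq_conjTranspose, Matrix.mem_unitaryGroup_iff.1 U.2,
          Matrix.submatrix_one_equiv]⟩
    have hV : φ V = U.1 := by
      change (U.1.submatrix _ _).submatrix _ _ = U.1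
      rw [Matrix.submatrix_submatrix, Equiv.symm_comp_self, Matrix.submatrix_id_id]
    obtain ⟨c, -, hc⟩ := Circuit.exists_approximates (hall V) hε
    exact ⟨c, hV ▸ hc⟩
  · set T := (Circuit.operations fun _ : GateApp G 2 => True).topologicalClosure with hT
    have hTc : IsClosed (T : Set (Matrix (Fin 2 → Fin 2) (Fin 2 → Fin 2) ℂ)) :=
      Submonoid.isClosed_topologicalClosure _
    -- two lines: the limits contain all controlled gates, in both directions since a gate may be
    -- applied to the lines in either order, and for both control values by bit flips
    have hone : ∀ o V, G.Has2 (ctl false 1 V) → onLines (ctlMat o 1 V.1) ∈ T := by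
      rintro o V ⟨g, hg⟩
      cases o
      · rw [← ctl_coe, ← hg, ← mat_two_zero_one]
        exact Circuit.mem_operations trivial
      · rw [← ctl_true_mat_eq hg]
        exact Circuit.mem_operations trivial
    have hflip : ∀ o, onLines (ctlFlip o) ∈ T := by
      intro o
      obtain ⟨g, hg⟩ := hX
      rw [← ctlFlip_mat_eq hg]
      exact Circuit.mem_operations trivial
    let ψ : U4 →* Matrix (Fin 2 → Fin 2) (Fin 2 → Fin 2) ℂ :=
      onLines.comp (Matrix.unitaryGroup (Fin 2 × Fin 2) ℂ).subtype
    have hψ : Continuous ψ := continuous_onLines.comp continuous_subtype_val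
    have hctl : ∀ o s, Continuous (ctl o s) := by
      intro o s
      refine Continuous.subtype_mk ?_ _
      refine continuous_matrix fun i j => ?_
      cases o <;> simp only [ctlMat, Matrix.of_apply] <;> split_ifs <;>
        first
        | exact continuous_const
        | exact continuous_subtype_val.matrix_elem _ _
    have h1c : ∀ o V, ψ (ctl o 1 V) ∈ T := fun o V =>
      eq_top_of_isClosed ((T.comap ψ).comap (ctl o 1)) ((hTc.preimage hψ).preimage (hctl o 1))
        (hone o _ h2.1) (hone o _ h2.2.1) (hone o _ h2.2.2) V
    have hc : ∀ o s V, ψ (ctl o s V) ∈ T := by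
      intro o s V
      fin_cases s
      · change onLines (ctlMat o 0 V.1) ∈ T
        rw [ctlMat_zero_eq, map_mul, map_mul]
        exact T.mul_mem (T.mul_mem (hflip o) (h1c o V)) (hflip o)
      · exact h1c o V
    -- the limits are a submonoid only, so invertibility is made part of the condition
    let H : Subgroup U4 :=
      { carrier := {U | ψ U ∈ T ∧ ψ U⁻¹ ∈ T}
        one_mem' := by simp [T.one_mem]
        mul_mem' := by
          rintro a b ⟨h1, h2⟩ ⟨h3, h4⟩
          refine ⟨?_, ?_⟩
          · rw [map_mul]; exact T.mul_mem h1 h3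
          · rw [mul_inv_rev, map_mul]; exact T.mul_mem h4 h2
        inv_mem' := by
          rintro a ⟨h1, h2⟩
          exact ⟨h2, by simpa using h1⟩ }
    have hall : ∀ W, ψ W ∈ T := fun W =>
      (mem_of_ctl_mem H (fun o s V => ⟨hc o s V, by rw [← map_inv]; exact hc o s V⁻¹⟩) W).1
    let W : U4 := ⟨U.1.submatrix (finTwoArrowEquiv (Fin 2)).symm (finTwoArrowEquiv (Fin 2)).symm, by
        rw [Matrix.mem_unitaryGroup_iff, Matrix.star_eq_conjTranspose,
          Matrix.conjTranspose_submatrix, Matrix.submatrix_mul_equiv,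
          ← Matrix.star_eq_conjTranspose, Matrix.mem_unitaryGroup_iff.1 U.2,
          Matrix.submatrix_one_equiv]⟩
    have hW : ψ W = U.1 := by
      ext x y
      exact congrArg₂ U.1 ((finTwoArrowEquiv (Fin 2)).symm_apply_apply x)
        ((finTwoArrowEquiv (Fin 2)).symm_apply_apply y)
    obtain ⟨c, -, hc⟩ := Circuit.exists_approximates (hall W) hε
    exact ⟨c, hW ▸ hc⟩

/-! ### Universality of matchgates -/

theorem matchgate_mul (A B A' B' : Matrix (Fin 2) (Fin 2) ℂ) :
    matchgate (A * A') (B * B') = matchgate A B * matchgate A' B' := by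
  ext ⟨a, b⟩ ⟨c, d⟩
  fin_cases a <;> fin_cases b <;> fin_cases c <;> fin_cases d <;>
    simp [matchgate, Matrix.mul_apply, Fintype.sum_prod_type, Fin.sum_univ_two]

theorem matchgate_star (A B : Matrix (Fin 2) (Fin 2) ℂ) :
    star (matchgate A B) = matchgate (star A) (star B) := by
  ext ⟨a, b⟩ ⟨c, d⟩
  fin_cases a <;> fin_cases b <;> fin_cases c <;> fin_cases d <;>
    simp [matchgate, Matrix.star_apply]

theorem matchgate_one : matchgate 1 1 = 1 := by
  ext ⟨a, b⟩ ⟨c, d⟩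
  fin_cases a <;> fin_cases b <;> fin_cases c <;> fin_cases d <;> simp [matchgate]

/-- The matchgate as an element of the unitary group. -/
def mgU (A B : U2) : U4 :=
  ⟨matchgate A.1 B.1, by
    rw [Matrix.mem_unitaryGroup_iff, matchgate_star, ← matchgate_mul,
      Matrix.mem_unitaryGroup_iff.1 A.2, Matrix.mem_unitaryGroup_iff.1 B.2, matchgate_one]⟩

theorem norm_det_eq_one (V : U2) : ‖V.1.det‖ = 1 :=
  norm_eq_one_of_star_mul (by
    have h := congrArg Matrix.det (Matrix.mem_unitaryGroup_iff'.1 V.2)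
    rwa [Matrix.det_mul, Matrix.det_one, Matrix.star_eq_conjTranspose,
      Matrix.det_conjTranspose] at h)

/-- The diagonal matrix with entries `1` and `det V`. -/
noncomputable def detU (V : U2) : U2 := diagU 1 V.1.det (by simp) (norm_det_eq_one V)

/-- The number preserving matchgate that acts as `V` on the states with one excitation, listed as
`|10⟩, |01⟩`. -/
noncomputable def npGate (V : U2) : U4 := mgU (detU V) (pauliX * V * pauliX)

theorem pauliX_mul_self : pauliX * pauliX = 1 := by
  apply Subtype.ext
  ext i j
  fin_cases i <;> fin_cases j <;> simp [pauliX]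

theorem hadamard_mul_self : hadamard * hadamard = 1 := by
  have h := hadamard_phase_hadamard 0
  rw [phaseU_zero, mul_one] at h
  apply Subtype.ext
  rw [h]
  ext i j
  fin_cases i <;> fin_cases j <;> simp

theorem det_npGate (V : U2) : (detU V).1.det = (pauliX * V * pauliX).1.det := by
  simp only [Submonoid.coe_mul, Matrix.det_mul, detU, diagU, Matrix.det_diagonal]
  simp [pauliX, Matrix.det_fin_two]

theorem detU_mul (V W : U2) : detU (V * W) = detU V * detU W := by
  apply Subtype.ext
  simp only [detU, diagU, Submonoid.coe_mul, Matrix.det_mul, Matrix.diagonal_mul_diagonal]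
  congr 1
  funext i
  fin_cases i <;> simp

theorem mgU_mul (A B A' B' : U2) : mgU (A * A') (B * B') = mgU A B * mgU A' B' :=
  Subtype.ext (matchgate_mul _ _ _ _)

theorem npGate_mul (V W : U2) : npGate (V * W) = npGate V * npGate W := by
  rw [npGate, npGate, npGate, ← mgU_mul, detU_mul]
  congr 1
  calc pauliX * (V * W) * pauliX = pauliX * V * 1 * W * pauliX := by group
    _ = _ := by rw [← pauliX_mul_self]; group

theorem npGate_one : npGate 1 = 1 := by
  have h := npGate_mul 1 1
  rw [mul_one] at h
  exact (mul_eq_left.1 h.symm)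

theorem continuous_npGate : Continuous npGate := by
  refine Continuous.subtype_mk ?_ _
  refine continuous_matrix fun x y => ?_
  simp only [matchgate, Matrix.of_apply]
  split_ifs
  · simp only [detU, diagU]
    have : ∀ i j : Fin 2, Continuous fun V : U2 => Matrix.diagonal ![1, V.1.det] i j := by
      intro i j
      refine (Continuous.matrix_diagonal (continuous_pi fun i => ?_)).matrix_elem i j
      fin_cases i
      · exact continuous_const
      · exact Continuous.matrix_det continuous_subtype_val
    exact this _ _
  · exact continuous_const
  · exact continuous_const
  · refine Continuous.matrix_elem ?_ _ _
    simp only [Submonoid.coe_mul]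
    exact (continuous_const.matrix_mul continuous_subtype_val).matrix_mul continuous_const

/-- The product of a unitary matrix with a phase. -/
noncomputable def phaseMul (p : ℂ) (hp : ‖p‖ = 1) (V : U2) : U2 := diagU p p hp hp * V

theorem phaseMul_coe (p : ℂ) (hp : ‖p‖ = 1) (V : U2) : (phaseMul p hp V).1 = p • V.1 := by
  ext i j
  fin_cases i <;> fin_cases j <;> simp [phaseMul, diagU]

/-- Gate sets with number preserving matchgates and `G(H,H)` are universal for matchgates: the
number preserving ones and phases give `G(diag(w⁻¹,w),1)`, and conjugation by `G(H,H)` gives the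
Euler decomposition of all `G(A,1)` with `det A = 1`. -/
theorem GateSet.isMatchgateUniversal_of_has {G : GateSet}
    (h1 : G.Has2 (npGate hadamard) ∧ G.Has2 (npGate (phaseU 1)) ∧ G.Has2 (npGate (phaseU (-1))))
    (h2 : G.Has2 (mgU hadamard hadamard)) : G.IsMatchgateUniversal := by
  set T := (Circuit.operations fun g : GateApp G 2 => g.IsNearestNeighbour).topologicalClosure
    with hT
  have hTc : IsClosed (T : Set (Matrix (Fin 2 → Fin 2) (Fin 2 → Fin 2) ℂ)) :=
    Submonoid.isClosed_topologicalClosure _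
  let ψ : U4 →* Matrix (Fin 2 → Fin 2) (Fin 2 → Fin 2) ℂ :=
    onLines.comp (Matrix.unitaryGroup (Fin 2 × Fin 2) ℂ).subtype
  have hψ : Continuous ψ := continuous_onLines.comp continuous_subtype_val
  have hmem : ∀ U, G.Has2 U → ψ U ∈ T := by
    rintro _ ⟨g, rfl⟩
    change onLines (G.gate2 g).1 ∈ T
    rw [← mat_two_zero_one]
    exact Circuit.mem_operations rfl
  let np : U2 →* U4 := { toFun := npGate, map_one' := npGate_one, map_mul' := npGate_mul }
  have hnp : ∀ V, ψ (npGate V) ∈ T := fun V =>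
    eq_top_of_isClosed ((T.comap ψ).comap np) ((hTc.preimage hψ).preimage continuous_npGate)
      (hmem _ h1.1) (hmem _ h1.2.1) (hmem _ h1.2.2) V
  have hHH := hmem _ h2
  have hphase : ∀ {p : ℂ}, ‖p‖ = 1 → p • (1 : Matrix (Fin 2 → Fin 2) (Fin 2 → Fin 2) ℂ) ∈ T :=
    fun hp => Circuit.smul_one_mem_operations _ hp
  -- diagonal matrices of determinant one
  have hdiag : ∀ (w : ℂ) (hw : ‖w‖ = 1) (hw' : ‖star w‖ = 1),
      ψ (mgU (diagU (star w) w hw' hw) 1) ∈ T := by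
    intro w hw hw'
    have h3 := T.mul_mem (hphase hw') (hnp (phaseMul w hw 1))
    have hww : star w * w = 1 := star_mul_self_of_norm hw
    have e : ψ (mgU (diagU (star w) w hw' hw) 1) =
        (star w • (1 : Matrix (Fin 2 → Fin 2) (Fin 2 → Fin 2) ℂ)) *
          ψ (npGate (phaseMul w hw 1)) := by
      rw [smul_mul_assoc, one_mul]
      ext x y
      change matchgate _ _ (x 0, x 1) (y 0, y 1) = star w * matchgate _ _ (x 0, x 1) (y 0, y 1)
      have hX : (pauliX * phaseMul w hw 1 * pauliX).1 = w • 1 := by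
        rw [Submonoid.coe_mul, Submonoid.coe_mul, phaseMul_coe, Matrix.mul_smul, Matrix.smul_mul]
        have : (pauliX * 1 * pauliX).1 = 1 := by rw [mul_one, pauliX_mul_self]; rfl
        rw [← this]; rfl
      have hA : (detU (phaseMul w hw 1)).1 = Matrix.diagonal ![1, w * w] := by
        simp only [detU, diagU, phaseMul_coe, Matrix.det_smul]
        simp [sq]
      rw [hX, hA]
      generalize x 0 = a
      generalize x 1 = b
      generalize y 0 = c
      generalize y 1 = d
      fin_cases a <;> fin_cases b <;> fin_cases c <;> fin_cases d <;>
        simp [matchgate, diagU, ← mul_assoc, conj_mul_self_of_norm hw]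
    rw [e]; exact h3
  -- the `V` such that some multiple `p V` of determinant one gives a limit `G(p V, 1)`
  let S : Submonoid U2 :=
    { carrier := {V | ∃ (p : ℂ) (hp : ‖p‖ = 1), p ^ 2 * V.1.det = 1 ∧
        ψ (mgU (phaseMul p hp V) 1) ∈ T}
      one_mem' := ⟨1, by simp, by simp, by
        have : mgU (phaseMul 1 (by simp) 1) 1 = 1 := by
          apply Subtype.ext
          change matchgate (phaseMul 1 (by simp) 1).1 1 = 1
          rw [phaseMul_coe, one_smul]
          exact matchgate_one
        rw [this, map_one]; exact T.one_mem⟩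
      mul_mem' := by
        rintro V W ⟨p, hp, hd, hV⟩ ⟨q, hq, he, hW⟩
        refine ⟨p * q, by simp [hp, hq], ?_, ?_⟩
        · rw [Submonoid.coe_mul, Matrix.det_mul]
          linear_combination hd * (q ^ 2 * W.1.det) + he
        · have : mgU (phaseMul (p * q) (by simp [hp, hq]) (V * W)) 1 =
              mgU (phaseMul p hp V) 1 * mgU (phaseMul q hq W) 1 := by
            rw [← mgU_mul, mul_one (1 : U2)]
            congr 1
            apply Subtype.ext
            simp only [Submonoid.coe_mul, phaseMul_coe]
            rw [Matrix.smul_mul, Matrix.mul_smul, smul_smul]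
          rw [this, map_mul]
          exact T.mul_mem hV hW }
  -- membership depends only on `V` up to a phase
  have hscal : ∀ (q : ℂ) (hq : ‖q‖ = 1) (V : U2), phaseMul q hq V ∈ S → V ∈ S := by
    rintro q hq V ⟨p, hp, hd, hV⟩
    refine ⟨p * q, by simp [hp, hq], ?_, ?_⟩
    · rw [phaseMul_coe, Matrix.det_smul, Fintype.card_fin] at hd
      rw [← hd]; ring
    · have : phaseMul (p * q) (by simp [hp, hq]) V = phaseMul p hp (phaseMul q hq V) := by
        apply Subtype.ext
        simp only [phaseMul_coe, smul_smul]
      rw [this]; exact hV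
  have hph : ∀ t, phaseU t ∈ S := by
    intro t
    have e1 : Complex.exp ((t / 2 : ℝ) * Complex.I) * Complex.exp ((t / 2 : ℝ) * Complex.I) =
        Complex.exp (t * Complex.I) := by
      rw [← Complex.exp_add]; congr 1; push_cast; ring
    set w := Complex.exp ((t / 2 : ℝ) * Complex.I) with hw
    have hw1 : ‖w‖ = 1 := Complex.norm_exp_ofReal_mul_I _
    have hw2 : ‖star w‖ = 1 := by simpa using hw1
    have hww : star w * w = 1 := star_mul_self_of_norm hw1
    refine ⟨star w, hw2, ?_, ?_⟩
    · have : (phaseU t).1.det = w * w := by simp [phaseU, diagU, e1]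
      rw [this]
      linear_combination (star w * w + 1) * hww
    · have : phaseMul (star w) hw2 (phaseU t) = diagU (star w) w hw2 hw1 := by
        apply Subtype.ext
        rw [phaseMul_coe]
        ext i j
        fin_cases i <;> fin_cases j <;>
          simp [phaseU, diagU, ← e1, ← mul_assoc, conj_mul_self_of_norm hw1]
      rw [this]; exact hdiag _ _ _
  have hconj : ∀ V, V ∈ S → hadamard * V * hadamard ∈ S := by
    rintro V ⟨p, hp, hd, hV⟩
    refine ⟨p, hp, ?_, ?_⟩
    · have h3 : hadamard.1.det * hadamard.1.det = 1 := by
        rw [← Matrix.det_mul, ← Submonoid.coe_mul, hadamard_mul_self]; simp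
      rw [Submonoid.coe_mul, Submonoid.coe_mul, Matrix.det_mul, Matrix.det_mul]
      linear_combination h3 * (p ^ 2 * V.1.det) + hd
    · have : mgU (phaseMul p hp (hadamard * V * hadamard)) 1 =
          mgU hadamard hadamard * mgU (phaseMul p hp V) 1 * mgU hadamard hadamard := by
        rw [← mgU_mul, ← mgU_mul, mul_one, hadamard_mul_self]
        congr 1
        apply Subtype.ext
        simp only [Submonoid.coe_mul, phaseMul_coe]
        rw [Matrix.mul_smul, Matrix.smul_mul]
      rw [this, map_mul, map_mul]
      exact T.mul_mem (T.mul_mem hHH hV) hHH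
  have hhad : hadamard ∈ S := by
    have e2 : Complex.exp ((Real.pi / 2 : ℝ) * Complex.I) = Complex.I := by
      push_cast; exact Complex.exp_pi_div_two_mul_I
    -- with `D = phaseU (π / 2)`, the product `D * (H * D * H) * D` is `(1 + i) / √2` times `H`
    have h := S.mul_mem (S.mul_mem (hph (Real.pi / 2)) (hconj _ (hph (Real.pi / 2))))
      (hph (Real.pi / 2))
    have hs : ‖(1 + Complex.I) / (Real.sqrt 2 : ℂ)‖ = 1 := by
      have h5 : ‖(1 + Complex.I)‖ = Real.sqrt 2 := by
        rw [Complex.norm_def]; congr 1; norm_num [Complex.normSq_apply]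
      rw [norm_div, h5, Complex.norm_real, Real.norm_of_nonneg (Real.sqrt_nonneg _)]
      exact div_self (by positivity)
    refine hscal _ hs _ ?_
    convert h using 1
    apply Subtype.ext
    rw [phaseMul_coe, Submonoid.coe_mul, Submonoid.coe_mul, hadamard_phase_hadamard, e2]
    have h7 : (Real.sqrt 2 : ℂ) * Real.sqrt 2 = 2 := by
      exact_mod_cast Real.mul_self_sqrt (by norm_num : (0 : ℝ) ≤ 2)
    have h0 : (Real.sqrt 2 : ℂ) ≠ 0 := by
      intro h0; rw [h0] at h7; norm_num at h7
    have e : ∀ x : ℂ, x / (Real.sqrt 2 : ℂ) * (1 / Real.sqrt 2) = x / 2 := by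
      intro x; field_simp; rw [sq, h7]
    have a0 : hadamard.1 0 0 = 1 / Real.sqrt 2 := rfl
    have a1 : hadamard.1 0 1 = 1 / Real.sqrt 2 := rfl
    have a2 : hadamard.1 1 0 = 1 / Real.sqrt 2 := rfl
    have a3 : hadamard.1 1 1 = -(1 / Real.sqrt 2) := neg_div _ _
    have b : (phaseU (Real.pi / 2)).1 = Matrix.diagonal ![1, Complex.I] := by
      simp only [phaseU, diagU, e2]
    rw [b]
    ext i j
    fin_cases i <;> fin_cases j <;>
      simp only [Fin.zero_eta, Fin.mk_one, Matrix.smul_apply, smul_eq_mul, a0, a1, a2, a3,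
        Matrix.diagonal_mul, Matrix.mul_diagonal, Matrix.of_apply, Matrix.cons_val',
        Matrix.cons_val_zero, Matrix.cons_val_one, Matrix.cons_val_fin_one]
    · linear_combination e (1 + Complex.I)
    · linear_combination e (1 + Complex.I) + Complex.I_sq / 2
    · linear_combination e (1 + Complex.I) + Complex.I_sq / 2
    · linear_combination -e (1 + Complex.I) - Complex.I_sq * (Complex.I + 1) / 2
  have hS : ∀ V, V ∈ S := mem_of_hadamard_phase S hhad hph
  have hone : ∀ A : U2, A.1.det = 1 → ψ (mgU A 1) ∈ T := by
    intro A hA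
    obtain ⟨p, hp, hd, hV⟩ := hS A
    rw [hA, mul_one] at hd
    -- the multiple of determinant one is unique up to sign, and `G(-1, 1)` is available
    rcases sq_eq_one_iff.1 hd with rfl | rfl
    · rwa [show phaseMul 1 hp A = A from Subtype.ext (by rw [phaseMul_coe, one_smul])] at hV
    · have h3 := T.mul_mem (hdiag (-1) (by simp) (by simp)) hV
      rw [← map_mul, ← mgU_mul, mul_one] at h3
      convert h3 using 3
      apply Subtype.ext
      rw [Submonoid.coe_mul, phaseMul_coe]
      ext i j
      fin_cases i <;> simp [diagU]
  intro A B hAB ε hε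
  -- `G(A, B)` is a number preserving gate up to `G(A', 1)` with `det A' = 1`
  have e : mgU A B = mgU (A * (detU B)⁻¹) 1 * npGate (pauliX * B * pauliX) := by
    have hd : detU (pauliX * B * pauliX) = detU B := by
      apply Subtype.ext
      simp only [detU, diagU, Submonoid.coe_mul, Matrix.det_mul]
      congr 2
      simp [pauliX, Matrix.det_fin_two]
    have hx : pauliX * (pauliX * B * pauliX) * pauliX = B := by
      calc _ = (pauliX * pauliX) * B * (pauliX * pauliX) := by group
        _ = B := by rw [pauliX_mul_self]; group
    rw [npGate, ← mgU_mul, hd, hx]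
    group
  have hU : ψ (mgU A B) ∈ T := by
    rw [e, map_mul]
    refine T.mul_mem (hone _ ?_) (hnp _)
    have h3 : (A * (detU B)⁻¹ * detU B).1.det = A.1.det := by group
    have h4 : (detU B).1.det = B.1.det := by simp [detU, diagU]
    rw [Submonoid.coe_mul, Matrix.det_mul, h4, ← hAB] at h3
    have h5 : A.1.det ≠ 0 := fun h => by
      have := norm_det_eq_one A
      rw [h] at this
      simp at this
    exact mul_right_cancel₀ h5 (by rw [h3, one_mul])
  obtain ⟨c, hc, hc'⟩ := Circuit.exists_approximates hU hε
  exact ⟨c, hc, hc'⟩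

/-! ### Matchgates and free fermions -/

/-- The action of a two-qubit matrix on lines `i` and `j`. -/
def act2 {ι : Type*} [DecidableEq ι] (M : Matrix (Fin 2 × Fin 2) (Fin 2 × Fin 2) ℂ) (i j : ι)
    (ψ : (ι → Fin 2) → ℂ) : (ι → Fin 2) → ℂ := fun z =>
  ∑ a : Fin 2, ∑ b : Fin 2,
    M (z i, z j) (a, b) * ψ (Function.update (Function.update z i a) j b)

/-- The action of a one-qubit matrix on line `i`. -/
def act1 {ι : Type*} [DecidableEq ι] (M : Matrix (Fin 2) (Fin 2) ℂ) (i : ι)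
    (ψ : (ι → Fin 2) → ℂ) : (ι → Fin 2) → ℂ := fun z =>
  ∑ a : Fin 2, M (z i) a * ψ (Function.update z i a)

/-- The sign `∏_{l < j} (-1)^{z_l}` of the Jordan-Wigner transformation. -/
def jwSign {n : ℕ} (j : Fin n) (z : Fin n → Fin 2) : ℂ :=
  ∏ l, if l < j ∧ z l = 1 then -1 else 1

/-- The field operator `∑_j (v_{j,0} a_j + v_{j,1} a_j†)` on the states of `n` lines. -/
def fieldOp {n : ℕ} (v : Fin n → Fin 2 → ℂ) (ψ : QState n) : QState n := fun z =>
  ∑ j, jwSign j z * v j (z j) * ψ (Function.update z j (z j + 1))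

/-- The field operator on two lines. -/
def fieldOp2 (v w : Fin 2 → ℂ) (φ : Fin 2 → Fin 2 → ℂ) (a b : Fin 2) : ℂ :=
  v a * φ (a + 1) b + (if a = 1 then -1 else 1) * w b * φ a (b + 1)

/-- The action of the matchgate `G(A,B)` on the four field operators `a₀, a₀†, a₁, a₁†` by
conjugation.  If these are written as the entries of a matrix `N`, it is `N ↦ B N A†`. -/
def modeMat (A B : Matrix (Fin 2) (Fin 2) ℂ) : Matrix (Fin 2 × Fin 2) (Fin 2 × Fin 2) ℂ :=
  Matrix.of fun p q => (if p = (1, 0) then -1 else 1) * (if q = (1, 0) then -1 else 1) *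
    (B (p.1 + p.2) (q.1 + q.2) * star (A (1 + p.2) (1 + q.2)))

/-- The component `p` of the image of the pair `v, w` under a matrix of size four. -/
def pairApply (M : Matrix (Fin 2 × Fin 2) (Fin 2 × Fin 2) ℂ) (v w : Fin 2 → ℂ)
    (p : Fin 2 × Fin 2) : ℂ :=
  ∑ q : Fin 2 × Fin 2, M p q * (if q.1 = 0 then v q.2 else w q.2)

/-- Conjugation by a matchgate of the field operators of its two lines. A field operator maps even
states by the matrix `N` and odd ones, up to sign, by its adjugate; the latter turns into the
adjugate of `N' = B N A†` because `A` and `B` have the same determinant. -/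
theorem matchgate_fieldOp2 (A B : U2) (h : A.1.det = B.1.det) (v w : Fin 2 → ℂ)
    (φ : Fin 2 → Fin 2 → ℂ) (a b : Fin 2) :
    ∑ a', ∑ b', matchgate A.1 B.1 (a, b) (a', b') * fieldOp2 v w φ a' b' =
      fieldOp2 (fun e => pairApply (modeMat A.1 B.1) v w (0, e))
        (fun e => pairApply (modeMat A.1 B.1) v w (1, e))
        (fun a b => ∑ a', ∑ b', matchgate A.1 B.1 (a, b) (a', b') * φ a' b') a b := by
  set N : Matrix (Fin 2) (Fin 2) ℂ := !![w 1, v 0; v 1, -w 0] with hN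
  set N' : Matrix (Fin 2) (Fin 2) ℂ := B.1 * N * star A.1 with hN'
  have hA : star A.1 * A.1 = 1 := Matrix.mem_unitaryGroup_iff'.1 A.2
  have hB : star B.1 * B.1 = 1 := Matrix.mem_unitaryGroup_iff'.1 B.2
  have E1 : B.1 * N = N' * A.1 := by rw [hN', mul_assoc, hA, mul_one]
  have adjU : ∀ U : U2, U.1.adjugate = U.1.det • star U.1 := by
    intro U
    have h1 : U.1 * star U.1 = 1 := Matrix.mem_unitaryGroup_iff.1 U.2
    calc U.1.adjugate = U.1.adjugate * (U.1 * star U.1) := by rw [h1, mul_one]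
      _ = _ := by rw [← mul_assoc, Matrix.adjugate_mul, Matrix.smul_mul, one_mul]
  have E2 : A.1 * N.adjugate = N'.adjugate * B.1 := by
    have h1 : (star A.1).adjugate = star A.1.det • A.1 := by
      rw [Matrix.star_eq_conjTranspose, ← Matrix.adjugate_conjTranspose, adjU,
        Matrix.conjTranspose_smul, Matrix.star_eq_conjTranspose, Matrix.conjTranspose_conjTranspose]
    have hd : star A.1.det * B.1.det = 1 := by
      rw [← h]; exact star_mul_self_of_norm (norm_det_eq_one A)
    rw [hN', Matrix.adjugate_mul_distrib, Matrix.adjugate_mul_distrib, h1, adjU B,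
      mul_assoc, mul_assoc, Matrix.smul_mul, Matrix.smul_mul, hB, Matrix.mul_smul, Matrix.mul_smul,
      smul_smul, mul_one, hd, one_smul]
  have E1' := fun i j => congrFun (congrFun E1 i) j
  have E2' := fun i j => congrFun (congrFun E2 i) j
  have r : ∀ p, pairApply (modeMat A.1 B.1) v w p =
      (if p = (1, 0) then -1 else 1) * N' (p.1 + p.2) (1 + p.2) := by
    rintro ⟨t, e⟩
    simp only [pairApply, modeMat, Fintype.sum_prod_type, Fin.sum_univ_two, hN', hN,
      Matrix.mul_apply, Matrix.of_apply, Matrix.star_apply]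
    fin_cases t <;> fin_cases e <;> simp <;> ring
  have e2 : (1 : Fin 2) + 1 = 0 := rfl
  simp only [r]
  generalize hN'' : N' = R at *
  simp only [Matrix.mul_apply, Fin.sum_univ_two, Fin.forall_fin_two, Matrix.adjugate_fin_two, hN,
    Matrix.of_apply, Matrix.cons_val', Matrix.cons_val_zero, Matrix.cons_val_one,
    Matrix.cons_val_fin_one] at E1' E2'
  obtain ⟨⟨f1, f2⟩, f3, f4⟩ := E1'
  obtain ⟨⟨g1, g2⟩, g3, g4⟩ := E2'
  fin_cases a <;> fin_cases b <;>
    simp only [Fin.zero_eta, Fin.mk_one, fieldOp2, matchgate, Matrix.of_apply, Fin.sum_univ_two,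
      e2, zero_add, add_zero, Prod.mk.injEq, if_true, if_false, zero_ne_one, one_ne_zero, and_false,
      and_true, and_self, zero_mul, one_mul]
  · linear_combination -φ 0 1 * g1 - φ 1 0 * g2
  · linear_combination φ 0 0 * f1 + φ 1 1 * f2
  · linear_combination φ 0 0 * f3 + φ 1 1 * f4
  · linear_combination -φ 0 1 * g3 - φ 1 0 * g4

/-- The action of a matrix of size four on the field operators of lines `i` and `j`. -/
def modeAct {ι : Type*} [DecidableEq ι] (M : Matrix (Fin 2 × Fin 2) (Fin 2 × Fin 2) ℂ) (i j : ι)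
    (v : ι → Fin 2 → ℂ) : ι → Fin 2 → ℂ := fun k e =>
  if k = i then pairApply M (v i) (v j) (0, e)
  else if k = j then pairApply M (v i) (v j) (1, e) else v k e

section

variable {n : ℕ}

theorem jwSign_update_of_le {k l : Fin n} (h : k ≤ l) (z : Fin n → Fin 2) (a : Fin 2) :
    jwSign k (Function.update z l a) = jwSign k z := by
  refine Finset.prod_congr rfl fun m _ => ?_
  by_cases hm : m = l
  · subst hm; simp [not_lt.2 h]
  · rw [Function.update_of_ne hm]

theorem jwSign_succ {i j : Fin n} (h : j.val = i.val + 1) (z : Fin n → Fin 2) :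
    jwSign j z = jwSign i z * if z i = 1 then -1 else 1 := by
  unfold jwSign
  rw [← Finset.mul_prod_erase _ _ (Finset.mem_univ i),
    ← Finset.mul_prod_erase _ (fun l => if l < i ∧ z l = 1 then (-1 : ℂ) else 1)
      (Finset.mem_univ i)]
  have hij : i < j := by rw [Fin.lt_def]; omega
  have : ∏ x ∈ Finset.univ.erase i, (if x < j ∧ z x = 1 then (-1 : ℂ) else 1) =
      ∏ x ∈ Finset.univ.erase i, if x < i ∧ z x = 1 then (-1 : ℂ) else 1 := by
    refine Finset.prod_congr rfl fun m hm => ?_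
    have hm' : m.val ≠ i.val := fun e => (Finset.mem_erase.1 hm).1 (Fin.ext e)
    have : m < j ↔ m < i := by rw [Fin.lt_def, Fin.lt_def]; omega
    simp only [this]
  rw [this]
  simp [hij, mul_comm]

theorem jwSign_update_update {i j k : Fin n} (hi : i < k) (hj : j < k) (hij : i ≠ j)
    (z : Fin n → Fin 2) (a b : Fin 2) (h : (z i = z j) ↔ (a = b)) :
    jwSign k (Function.update (Function.update z i a) j b) = jwSign k z := by
  have key : ∀ y : Fin n → Fin 2, jwSign k y = (if y i = y j then 1 else -1) *
      ∏ x ∈ (Finset.univ.erase i).erase j, if x < k ∧ y x = 1 then (-1 : ℂ) else 1 := by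
    intro y
    unfold jwSign
    rw [← Finset.mul_prod_erase _ _ (Finset.mem_univ i),
      ← Finset.mul_prod_erase (Finset.univ.erase i) _
        (Finset.mem_erase.2 ⟨hij.symm, Finset.mem_univ j⟩), ← mul_assoc]
    congr 1
    simp only [hi, hj, true_and]
    generalize y i = p
    generalize y j = q
    fin_cases p <;> fin_cases q <;> simp
  rw [key, key z]
  congr 1
  · rw [Function.update_self, Function.update_of_ne hij, Function.update_self]
    by_cases hz : z i = z j
    · simp [hz, h.1 hz]
    · simp [hz, show ¬a = b from fun hab => hz (h.2 hab)]
  · refine Finset.prod_congr rfl fun m hm => ?_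
    rw [Finset.mem_erase, Finset.mem_erase] at hm
    rw [Function.update_of_ne hm.1, Function.update_of_ne hm.2.1]

theorem matchgate_apply_eq_zero {A B : Matrix (Fin 2) (Fin 2) ℂ} {a b c d : Fin 2}
    (h : ¬((a = b) ↔ (c = d))) : matchgate A B (a, b) (c, d) = 0 := by
  simp only [matchgate, Matrix.of_apply]
  split_ifs <;> simp_all

/-- Conjugation by a matchgate transforms the field operators linearly. -/
theorem act2_fieldOp (A B : U2) (h : A.1.det = B.1.det) {i j : Fin n} (hij : j.val = i.val + 1)
    (v : Fin n → Fin 2 → ℂ) (ψ : QState n) :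
    act2 (matchgate A.1 B.1) i j (fieldOp v ψ) =
      fieldOp (modeAct (modeMat A.1 B.1) i j v) (act2 (matchgate A.1 B.1) i j ψ) := by
  have hne : i ≠ j := fun e => by rw [e] at hij; omega
  have hlt : i < j := by rw [Fin.lt_def]; omega
  funext z
  -- separate the two lines of the gate from the others
  have split : ∀ (u : Fin n → Fin 2 → ℂ) (χ : QState n) (a b : Fin 2),
      fieldOp u χ (Function.update (Function.update z i a) j b) =
        jwSign i z * fieldOp2 (u i) (u j)
          (fun a b => χ (Function.update (Function.update z i a) j b)) a b +
        ∑ k ∈ (Finset.univ.erase i).erase j,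
          jwSign k (Function.update (Function.update z i a) j b) * u k (z k) *
            χ (Function.update (Function.update (Function.update z k (z k + 1)) i a) j b) := by
    intro u χ a b
    unfold fieldOp
    rw [← Finset.add_sum_erase _ _ (Finset.mem_univ i),
      ← Finset.add_sum_erase (Finset.univ.erase i) _
        (Finset.mem_erase.2 ⟨hne.symm, Finset.mem_univ j⟩), ← add_assoc]
    congr 1
    · rw [jwSign_update_of_le hlt.le, jwSign_update_of_le le_rfl, jwSign_update_of_le le_rfl,
        jwSign_succ hij, jwSign_update_of_le le_rfl, Function.update_self,
        Function.update_of_ne hne, Function.update_self, Function.update_idem,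
        Function.update_comm hne.symm, Function.update_idem, Function.update_self]
      unfold fieldOp2
      ring
    · refine Finset.sum_congr rfl fun k hk => ?_
      rw [Finset.mem_erase, Finset.mem_erase] at hk
      rw [Function.update_of_ne hk.1, Function.update_of_ne hk.2.1,
        Function.update_comm hk.1.symm, Function.update_comm hk.2.1.symm]
  have hz : z = Function.update (Function.update z i (z i)) j (z j) := by simp
  have rhs := split (modeAct (modeMat A.1 B.1) i j v) (act2 (matchgate A.1 B.1) i j ψ) (z i) (z j)
  rw [← hz] at rhs
  rw [rhs]
  have lhs : act2 (matchgate A.1 B.1) i j (fieldOp v ψ) z =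
      jwSign i z * (∑ a, ∑ b, matchgate A.1 B.1 (z i, z j) (a, b) *
        fieldOp2 (v i) (v j) (fun a b => ψ (Function.update (Function.update z i a) j b)) a b) +
      ∑ k ∈ (Finset.univ.erase i).erase j, ∑ a, ∑ b, matchgate A.1 B.1 (z i, z j) (a, b) *
        (jwSign k (Function.update (Function.update z i a) j b) * v k (z k) *
            ψ (Function.update (Function.update (Function.update z k (z k + 1)) i a) j b)) := by
    unfold act2
    simp only [split, mul_add, Finset.sum_add_distrib]
    congr 1
    · simp only [Finset.mul_sum]
      exact Finset.sum_congr rfl fun a _ => Finset.sum_congr rfl fun b _ => by ring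
    · symm
      rw [Finset.sum_comm]
      refine Finset.sum_congr rfl fun a _ => ?_
      rw [Finset.sum_comm]
      exact Finset.sum_congr rfl fun b _ => by rw [Finset.mul_sum]
  rw [lhs, matchgate_fieldOp2 A B h]
  congr 1
  · congr 2
    · funext e; simp [modeAct]
    · funext e; simp [modeAct, hne.symm]
    · funext a b
      simp only [act2]
      simp [Function.update_of_ne hne, Function.update_comm hne.symm]
  · refine Finset.sum_congr rfl fun k hk => ?_
    rw [Finset.mem_erase, Finset.mem_erase] at hk
    have hk' : Function.update (Function.update (Function.update z k (z k + 1)) i (z i)) j (z j) =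
        Function.update z k (z k + 1) := by
      rw [Function.update_comm hk.2.1, Function.update_comm hk.1, ← hz]
    simp only [modeAct, if_neg hk.1, if_neg hk.2.1]
    rw [hk']
    unfold act2
    rw [Finset.mul_sum]
    refine Finset.sum_congr rfl fun a _ => ?_
    rw [Finset.mul_sum]
    refine Finset.sum_congr rfl fun b _ => ?_
    rw [Function.update_of_ne (Ne.symm hk.2.1), Function.update_of_ne (Ne.symm hk.1)]
    -- the sign depends only on the parity of the two lines, which the matchgate preserves
    by_cases hp : (z i = z j) ↔ (a = b)
    · have : jwSign k (Function.update (Function.update z i a) j b) = jwSign k z := by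
        rcases lt_or_gt_of_ne hk.2.1 with h1 | h1
        · rw [jwSign_update_of_le (h1.le.trans hlt.le), jwSign_update_of_le h1.le]
        · refine jwSign_update_update h1 (lt_of_le_of_ne ?_ (Ne.symm hk.1)) hne z a b hp
          rw [Fin.lt_def] at h1
          rw [Fin.le_def]; omega
      rw [this]; ring
    · rw [matchgate_apply_eq_zero hp]; ring

end

theorem modeMat_mul (A B A' B' : Matrix (Fin 2) (Fin 2) ℂ) :
    modeMat (A * A') (B * B') = modeMat A B * modeMat A' B' := by
  ext ⟨a, b⟩ ⟨c, d⟩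
  have e2 : (1 : Fin 2) + 1 = 0 := rfl
  fin_cases a <;> fin_cases b <;> fin_cases c <;> fin_cases d <;>
    simp [modeMat, Matrix.mul_apply, Fintype.sum_prod_type, Fin.sum_univ_two, e2] <;> ring

theorem modeMat_star (A B : Matrix (Fin 2) (Fin 2) ℂ) :
    star (modeMat A B) = modeMat (star A) (star B) := by
  ext p q
  simp only [modeMat, Matrix.star_apply, Matrix.of_apply, star_mul', star_star, apply_ite star,
    star_neg, star_one]
  ring

theorem modeMat_one : modeMat 1 1 = 1 := by
  ext ⟨a, b⟩ ⟨c, d⟩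
  have e2 : (1 : Fin 2) + 1 = 0 := rfl
  fin_cases a <;> fin_cases b <;> fin_cases c <;> fin_cases d <;>
    simp [modeMat, e2]

/-- The action on field operators as an element of the unitary group. -/
def modeU (A B : U2) : U4 :=
  ⟨modeMat A.1 B.1, by
    rw [Matrix.mem_unitaryGroup_iff, modeMat_star, ← modeMat_mul,
      Matrix.mem_unitaryGroup_iff.1 A.2, Matrix.mem_unitaryGroup_iff.1 B.2, modeMat_one]⟩

theorem modeU_mul (A B A' B' : U2) : modeU (A * A') (B * B') = modeU A B * modeU A' B' :=
  Subtype.ext (modeMat_mul _ _ _ _)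

theorem modeU_inv (A B : U2) : (modeU A B)⁻¹ = modeU A⁻¹ B⁻¹ := by
  refine inv_eq_of_mul_eq_one_right ?_
  rw [← modeU_mul, mul_inv_cancel, mul_inv_cancel]
  exact Subtype.ext modeMat_one

theorem modeAct_mul {ι : Type*} [DecidableEq ι] (M N : Matrix (Fin 2 × Fin 2) (Fin 2 × Fin 2) ℂ)
    {i j : ι} (h : i ≠ j) (v : ι → Fin 2 → ℂ) :
    modeAct (M * N) i j v = modeAct M i j (modeAct N i j v) := by
  have key : ∀ p, pairApply (M * N) (v i) (v j) p =
      pairApply M (modeAct N i j v i) (modeAct N i j v j) p := by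
    intro p
    have h2 : ∀ q : Fin 2 × Fin 2, (if q.1 = 0 then modeAct N i j v i q.2
        else modeAct N i j v j q.2) = pairApply N (v i) (v j) q := by
      rintro ⟨t, e⟩
      fin_cases t
      · simp [modeAct]
      · simp [modeAct, h.symm]
    simp only [pairApply, h2, Matrix.mul_apply, Finset.sum_mul, Finset.mul_sum, mul_assoc]
    rw [Finset.sum_comm]
  funext k e
  by_cases hi : k = i
  · subst hi; simp only [modeAct, if_true]
    exact key _
  · by_cases hj : k = j
    · subst hj; simp only [modeAct, if_true, if_neg hi]
      exact key _
    · simp only [modeAct, if_neg hi, if_neg hj]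

theorem modeAct_one {ι : Type*} [DecidableEq ι] (i j : ι) (v : ι → Fin 2 → ℂ) :
    modeAct 1 i j v = v := by
  have key : ∀ p, pairApply 1 (v i) (v j) p = if p.1 = 0 then v i p.2 else v j p.2 := by
    intro p
    simp only [pairApply, Matrix.one_apply, ite_mul, one_mul, zero_mul]
    rw [Finset.sum_ite_eq]
    simp
  funext k e
  by_cases hi : k = i
  · subst hi; simp [modeAct, key]
  · by_cases hj : k = j
    · subst hj; simp [modeAct, hi, key]
    · simp only [modeAct, if_neg hi, if_neg hj]

/-- A field operator is moved past a matchgate. -/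
theorem fieldOp_act2 (A B : U2) (h : A.1.det = B.1.det) {n : ℕ} {i j : Fin n}
    (hij : j.val = i.val + 1) (v : Fin n → Fin 2 → ℂ) (ψ : QState n) :
    fieldOp v (act2 (matchgate A.1 B.1) i j ψ) =
      act2 (matchgate A.1 B.1) i j (fieldOp (modeAct (modeU A B)⁻¹.1 i j v) ψ) := by
  have hne : i ≠ j := fun e => by rw [e] at hij; omega
  rw [act2_fieldOp A B h hij, ← modeAct_mul _ _ hne]
  congr 1
  have : modeMat A.1 B.1 * (modeU A B)⁻¹.1 = 1 := by
    change (modeU A B * (modeU A B)⁻¹).1 = 1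
    simp
  rw [this, modeAct_one]

/-! ### Norms and output probabilities -/

section

variable {n : ℕ}

theorem sum_sum_update (f : (Fin n → Fin 2) → ℝ) (i : Fin n) :
    ∑ z, ∑ a, f (Function.update z i a) = 2 * ∑ z, f z := by
  have hinv : Function.Involutive fun p : (Fin n → Fin 2) × Fin 2 =>
      (Function.update p.1 i p.2, p.1 i) := by
    rintro ⟨z, a⟩; simp
  have h1 := Fintype.sum_equiv hinv.toPerm (fun p => f (Function.update p.1 i p.2))
    (fun p => f p.1) (fun p => rfl)
  rw [Fintype.sum_prod_type, Fintype.sum_prod_type] at h1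
  rw [h1, Finset.mul_sum]
  exact Finset.sum_congr rfl fun z _ => by simp

theorem sum_norm_mulVec {ι : Type*} [Fintype ι] [DecidableEq ι] (U : Matrix.unitaryGroup ι ℂ)
    (φ : ι → ℂ) : ∑ i, ‖∑ j, U.1 i j * φ j‖ ^ 2 = ∑ i, ‖φ i‖ ^ 2 := by
  have key : ∀ x : ι → ℂ, ((∑ i, ‖x i‖ ^ 2 : ℝ) : ℂ) = star x ⬝ᵥ x := by
    intro x
    simp only [dotProduct, Pi.star_apply]
    push_cast
    exact Finset.sum_congr rfl fun i _ => (Complex.conj_mul' _).symm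
  have h : ((∑ i, ‖(U.1.mulVec φ) i‖ ^ 2 : ℝ) : ℂ) = ((∑ i, ‖φ i‖ ^ 2 : ℝ) : ℂ) := by
    rw [key, key, Matrix.star_mulVec, Matrix.dotProduct_mulVec, Matrix.vecMul_vecMul,
      ← Matrix.star_eq_conjTranspose, Matrix.mem_unitaryGroup_iff'.1 U.2, Matrix.vecMul_one]
  exact_mod_cast h

theorem sum_norm_act1 (U : U2) (i : Fin n) (ψ : QState n) :
    ∑ z, ‖act1 U.1 i ψ z‖ ^ 2 = ∑ z, ‖ψ z‖ ^ 2 := by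
  have h : 2 * ∑ z, ‖act1 U.1 i ψ z‖ ^ 2 = 2 * ∑ z, ‖ψ z‖ ^ 2 := by
    rw [← sum_sum_update _ i, ← sum_sum_update _ i]
    refine Finset.sum_congr rfl fun z _ => ?_
    rw [← sum_norm_mulVec U fun a => ψ (Function.update z i a)]
    simp only [act1, Function.update_self, Function.update_idem]
  linarith

theorem sum_norm_act2 (U : U4) {i j : Fin n} (hij : i ≠ j) (ψ : QState n) :
    ∑ z, ‖act2 U.1 i j ψ z‖ ^ 2 = ∑ z, ‖ψ z‖ ^ 2 := by
  have e : ∀ f : (Fin n → Fin 2) → ℝ, ∑ z, ∑ a, ∑ b,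
      f (Function.update (Function.update z i a) j b) = 4 * ∑ z, f z := by
    intro f
    have h1 := sum_sum_update (fun z => ∑ b, f (Function.update z j b)) i
    rw [h1, sum_sum_update f j]; ring
  have h : 4 * ∑ z, ‖act2 U.1 i j ψ z‖ ^ 2 = 4 * ∑ z, ‖ψ z‖ ^ 2 := by
    rw [← e, ← e]
    refine Finset.sum_congr rfl fun z _ => ?_
    have h2 := sum_norm_mulVec U fun p => ψ (Function.update (Function.update z i p.1) j p.2)
    simp only [Fintype.sum_prod_type] at h2
    rw [← h2]
    refine Finset.sum_congr rfl fun a _ => Finset.sum_congr rfl fun b _ => ?_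
    unfold act2
    simp only [Function.update_self, Function.update_of_ne hij, Function.update_idem,
      Function.update_comm hij.symm]
  linarith

theorem GateApp.sum_norm_apply {G : GateSet} (g : GateApp G n) (ψ : QState n) :
    ∑ z, ‖g.apply ψ z‖ ^ 2 = ∑ z, ‖ψ z‖ ^ 2 := by
  cases g with
  | one g i => exact sum_norm_act1 (G.gate1 g) i ψ
  | two g i j h => exact sum_norm_act2 (G.gate2 g) h ψ

theorem Circuit.sum_norm_run {G : GateSet} (c : Circuit G n) (ψ : QState n) :
    ∑ z, ‖c.run ψ z‖ ^ 2 = ∑ z, ‖ψ z‖ ^ 2 := by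
  induction c generalizing ψ with
  | nil => rfl
  | cons g c ih => rw [run_cons, ih, g.sum_norm_apply]

theorem Circuit.outProb_zero_add_one {G : GateSet} (c : Circuit G n) (x : Fin n → Fin 2)
    (k : Fin n) : c.outProb x k 0 + c.outProb x k 1 = 1 := by
  have h : ∑ z, ‖c.run (ket x) z‖ ^ 2 = 1 := by
    rw [c.sum_norm_run]
    simp [ket, Pi.single_apply, apply_ite norm]
  rw [← h, outProb, outProb, ← Finset.sum_add_distrib]
  refine Finset.sum_congr rfl fun z _ => ?_
  generalize z k = a
  fin_cases a <;> simp

theorem circuitEquiv_of_one {G H : GateSet} {m : ℕ} {c : Circuit G n} {x : Fin n → Fin 2}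
    {k : Fin n} {d : Circuit H m} {y : Fin m → Fin 2} {l : Fin m} {b : Fin 2}
    (h : c.outProb x k b = d.outProb y l b) : CircuitEquiv c x k d y l := by
  have h1 := c.outProb_zero_add_one x k
  have h2 := d.outProb_zero_add_one y l
  intro b'
  fin_cases b <;> fin_cases b' <;> simp_all <;> linarith

/-- The vector of the field operator `a_k` (for `e = 0`) or `a_k†` (for `e = 1`). -/
def deltaMode {ι : Type*} [DecidableEq ι] (k : ι) (e : Fin 2) : ι → Fin 2 → ℂ :=
  Pi.single k (Pi.single e 1)

theorem norm_jwSign (j : Fin n) (z : Fin n → Fin 2) : ‖jwSign j z‖ = 1 := by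
  unfold jwSign
  rw [norm_prod]
  refine Finset.prod_eq_one fun l _ => ?_
  split_ifs <;> simp

/-- An annihilation or creation operator projects on the states with one value of a line. -/
theorem sum_norm_fieldOp_delta (k : Fin n) (b : Fin 2) (ψ : QState n) :
    ∑ z, ‖fieldOp (deltaMode k (b + 1)) ψ z‖ ^ 2 = ∑ z, if z k = b then ‖ψ z‖ ^ 2 else 0 := by
  have hinv : Function.Involutive fun z : Fin n → Fin 2 => Function.update z k (z k + 1) := by
    intro z
    have : z k + 1 + 1 = z k := by generalize z k = a; fin_cases a <;> rfl
    simp [this]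
  refine Fintype.sum_equiv hinv.toPerm _ _ fun z => ?_
  have h1 : fieldOp (deltaMode k (b + 1)) ψ z =
      jwSign k z * (if z k = b + 1 then 1 else 0) * ψ (Function.update z k (z k + 1)) := by
    unfold fieldOp
    rw [Finset.sum_eq_single k]
    · simp [deltaMode, Pi.single_apply]
    · intro j _ hj
      simp [deltaMode, hj]
    · simp
  have h2 : (z k = b + 1) ↔ (z k + 1 = b) := by
    generalize z k = a
    fin_cases a <;> fin_cases b <;> decide
  rw [h1, norm_mul, norm_mul, norm_jwSign]
  change _ = if (Function.update z k (z k + 1)) k = b then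
    ‖ψ (Function.update z k (z k + 1))‖ ^ 2 else 0
  rw [Function.update_self]
  by_cases h : z k + 1 = b
  · simp [h, h2]
  · simp [h, h2]

/-- The norm of a field operator applied to a basis state: the single terms are multiples of
distinct basis states, those with one flipped line. -/
theorem sum_norm_fieldOp_ket (v : Fin n → Fin 2 → ℂ) (x : Fin n → Fin 2) :
    ∑ z, ‖fieldOp v (ket x) z‖ ^ 2 = ∑ j, ‖v j (x j + 1)‖ ^ 2 := by
  have hne : ∀ a : Fin 2, a + 1 ≠ a := by decide
  have h2 : ∀ a : Fin 2, a + 1 + 1 = a := by decide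
  let F : Fin n → Fin n → Fin 2 := fun j => Function.update x j (x j + 1)
  have hF : Function.Injective F := by
    intro j k h
    by_contra hjk
    have := congrFun h j
    simp only [F, Function.update_self, Function.update_of_ne hjk] at this
    exact hne _ this
  have hval : ∀ j, ‖fieldOp v (ket x) (F j)‖ = ‖v j (x j + 1)‖ := by
    intro j
    have : fieldOp v (ket x) (F j) = jwSign j (F j) * v j (x j + 1) := by
      unfold fieldOp
      rw [Finset.sum_eq_single j]
      · simp [F, ket, h2]
      · intro k _ hk
        have : Function.update (F j) k (F j k + 1) ≠ x := by
          intro h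
          have := congrFun h j
          rw [Function.update_of_ne (Ne.symm hk)] at this
          simp only [F, Function.update_self] at this
          exact hne _ this
        simp [ket, this]
      · simp
    rw [this, norm_mul, norm_jwSign, one_mul]
  have hzero : ∀ z, z ∉ Set.range F → fieldOp v (ket x) z = 0 := by
    intro z hz
    refine Finset.sum_eq_zero fun j _ => ?_
    have : Function.update z j (z j + 1) ≠ x := by
      intro h
      refine hz ⟨j, ?_⟩
      have hx : x j = z j + 1 := by rw [← h, Function.update_self]
      simp only [F]
      rw [hx, h2, ← h, Function.update_idem, Function.update_eq_self]
    simp [ket, this]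
  rw [← Finset.sum_subset (Finset.subset_univ (Finset.univ.map ⟨F, hF⟩))]
  · rw [Finset.sum_map]
    exact Finset.sum_congr rfl fun j _ => by rw [← hval j]; rfl
  · intro z _ hz
    rw [hzero z]
    · simp
    · rintro ⟨j, rfl⟩
      exact hz (Finset.mem_map.2 ⟨j, Finset.mem_univ _, rfl⟩)

/-- The number of a gate and the (equal or distinct) lines on which it acts, counted from zero. -/
def GateApp.raw {G : GateSet} : GateApp G n → ℕ × ℕ × ℕ
  | .one g i => (g.val, i.val, i.val)
  | .two g i j _ => (G.num1 + g.val, i.val, j.val)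

/-- The action of a sequence of named gates on field operators, in the order in which the
operators are moved past the gates; `W` lists the actions of the inverse gates. -/
def backAct (W : ℕ → U4) (c : List (ℕ × ℕ × ℕ)) (u : ℕ → Fin 2 → ℂ) : ℕ → Fin 2 → ℂ :=
  c.foldr (fun g u => modeAct (W g.1).1 g.2.1 g.2.2 u) u

/-- `W` lists the inverse actions on field operators of the gates of a set of matchgates. -/
def GateSet.BackTable (G : GateSet) (W : ℕ → U4) : Prop :=
  G.num1 = 0 ∧ ∀ g : Fin G.num2, ∃ A B : U2, A.1.det = B.1.det ∧
    (G.gate2 g).1 = matchgate A.1 B.1 ∧ W (G.num1 + g.val) = (modeU A B)⁻¹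

theorem modeAct_val (M : Matrix (Fin 2 × Fin 2) (Fin 2 × Fin 2) ℂ) (i j : Fin n)
    (u : ℕ → Fin 2 → ℂ) :
    modeAct M i j (fun k => u k.val) = fun k => modeAct M i.val j.val u k.val := by
  funext k e
  simp [modeAct, Fin.ext_iff]

/-- The output probabilities of a matchgate circuit, from the evolution of one field operator. -/
theorem Circuit.outProb_eq_backAct {G : GateSet} {W : ℕ → U4} (hW : G.BackTable W)
    (c : Circuit G n) (hc : c.IsNearestNeighbour) (x : Fin n → Fin 2) (k : Fin n) (b : Fin 2) :
    c.outProb x k b = ∑ j : Fin n,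
      ‖backAct W (c.map GateApp.raw) (deltaMode k.val (b + 1)) j.val (x j + 1)‖ ^ 2 := by
  have key : ∀ (c : Circuit G n) (_ : c.IsNearestNeighbour) (u : ℕ → Fin 2 → ℂ) (ψ : QState n),
      fieldOp (fun k => u k.val) (c.run ψ) =
        c.run (fieldOp (fun k => backAct W (c.map GateApp.raw) u k.val) ψ) := by
    intro c
    induction c with
    | nil => intro _ u ψ; rfl
    | cons g c ih =>
      intro hc u ψ
      rw [run_cons, run_cons, ih (fun g hg => hc g (List.mem_cons_of_mem _ hg))]
      congr 1
      have hg := hc g List.mem_cons_self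
      cases g with
      | one g i => exact hg.elim
      | two g i j hij =>
        obtain ⟨A, B, hd, hM, hWg⟩ := hW.2 g
        have e : ∀ ψ : QState n, (GateApp.two g i j hij).apply ψ =
            act2 (matchgate A.1 B.1) i j ψ := by
          intro ψ
          rw [← hM]; rfl
        rw [e, e, fieldOp_act2 A B hd hg, modeAct_val, ← hWg]
        rfl
  have hdel : (fun j : Fin n => deltaMode k.val (b + 1) j.val) = deltaMode k (b + 1) := by
    funext j
    simp [deltaMode, Pi.single_apply, Fin.ext_iff]
  -- measure by `a_k` or `a_k†`, move it past all gates and drop the gates, which preserve norms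
  have h1 : c.outProb x k b = ∑ z, ‖fieldOp (deltaMode k (b + 1)) (c.run (ket x)) z‖ ^ 2 :=
    (sum_norm_fieldOp_delta k b _).symm
  rw [h1, ← hdel, key c hc, c.sum_norm_run, sum_norm_fieldOp_ket]

end

/-! ### Circuits given by the names of their gates -/

namespace GateSet

variable (G : GateSet)

/-- The action of a named gate on infinitely many lines. -/
def actRaw (g : ℕ × ℕ × ℕ) (ψ : (ℕ → Fin 2) → ℂ) : (ℕ → Fin 2) → ℂ :=
  if h : g.1 < G.num1 then act1 (G.gate1 ⟨g.1, h⟩).1 g.2.1 ψ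
  else if h : g.1 - G.num1 < G.num2 then act2 (G.gate2 ⟨g.1 - G.num1, h⟩).1 g.2.1 g.2.2 ψ
  else ψ

/-- The action of a sequence of named gates. -/
def runRaw (c : List (ℕ × ℕ × ℕ)) (ψ : (ℕ → Fin 2) → ℂ) : (ℕ → Fin 2) → ℂ :=
  c.foldl (fun φ g => G.actRaw g φ) ψ

/-- The name and the lines are those of a gate in a circuit of width `n`. -/
def ValidRaw (n : ℕ) (g : ℕ × ℕ × ℕ) : Prop :=
  g.2.1 < n ∧ g.2.2 < n ∧ if g.1 < G.num1 then g.2.1 = g.2.2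
    else g.1 < G.num1 + G.num2 ∧ g.2.1 ≠ g.2.2

variable {G} {n : ℕ}

theorem runRaw_append (c d : List (ℕ × ℕ × ℕ)) (ψ : (ℕ → Fin 2) → ℂ) :
    G.runRaw (c ++ d) ψ = G.runRaw d (G.runRaw c ψ) :=
  List.foldl_append

theorem exists_circuit (c : List (ℕ × ℕ × ℕ)) (hc : ∀ g ∈ c, G.ValidRaw n g) :
    ∃ d : Circuit G n, d.map GateApp.raw = c := by
  induction c with
  | nil => exact ⟨[], rfl⟩
  | cons g c ih =>
    obtain ⟨d, rfl⟩ := ih fun g hg => hc g (List.mem_cons_of_mem _ hg)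
    obtain ⟨hi, hj, h⟩ := hc g List.mem_cons_self
    obtain ⟨g, i, j⟩ := g
    simp only at hi hj h
    split_ifs at h with h1
    · exact ⟨.one ⟨g, h1⟩ ⟨i, hi⟩ :: d, by simp [GateApp.raw, h]⟩
    · refine ⟨.two ⟨g - G.num1, by omega⟩ ⟨i, hi⟩ ⟨j, hj⟩ (by simpa using h.2) :: d, ?_⟩
      simp only [List.map_cons, GateApp.raw]
      congr 2
      omega

theorem apply_lift (g : GateApp G n) (ψ : QState n) :
    (fun z : ℕ → Fin 2 => g.apply ψ fun l => z l.val) =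
      G.actRaw g.raw fun z => ψ fun l => z l.val := by
  have upd : ∀ (z : ℕ → Fin 2) (i : Fin n) (a : Fin 2),
      (fun l : Fin n => Function.update z i.val a l.val) = Function.update (fun l => z l.val) i a := by
    intro z i a
    funext l
    simp [Function.update_apply, Fin.ext_iff]
  funext z
  cases g with
  | one g i => simp [actRaw, GateApp.raw, GateApp.apply, act1, upd]
  | two g i j h => simp [actRaw, GateApp.raw, GateApp.apply, act2, upd]

theorem run_lift (c : Circuit G n) (ψ : QState n) :
    (fun z : ℕ → Fin 2 => c.run ψ fun l => z l.val) =
      G.runRaw (c.map GateApp.raw) fun z => ψ fun l => z l.val := by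
  induction c generalizing ψ with
  | nil => rfl
  | cons g c ih =>
    rw [Circuit.run_cons, ih, apply_lift]
    rfl

theorem encode_eq_encGate (g : GateApp G n) :
    g.encode = Frag.encGate (g.raw.1, g.raw.2.1 + 1, g.raw.2.2 + 1) := by
  cases g <;> rfl

end GateSet

/-! ### Bits of numbers -/

theorem xor_two_pow_eq_add {a t : ℕ} (h : a.testBit t = false) : a ^^^ 2 ^ t = a + 2 ^ t := by
  refine Nat.eq_of_testBit_eq fun u => ?_
  have hr : a % 2 ^ t < 2 ^ t := Nat.mod_lt _ (by positivity)
  have ha : a = 2 ^ t * (a / 2 ^ t) + a % 2 ^ t := (Nat.div_add_mod a _).symm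
  have hb : a / 2 ^ t % 2 = 0 := by
    rw [Nat.testBit_eq_decide_div_mod_eq] at h
    have := of_decide_eq_false h
    omega
  have hs : a + 2 ^ t = 2 ^ t * (a / 2 ^ t + 1) + a % 2 ^ t := by rw [mul_add]; omega
  rw [Nat.testBit_xor, Nat.testBit_two_pow, hs, Nat.testBit_two_pow_mul_add _ hr]
  nth_rewrite 1 [ha]
  rw [Nat.testBit_two_pow_mul_add _ hr]
  by_cases hu : u < t
  · simp [hu, show ¬t = u by omega]
  · rw [if_neg hu, if_neg hu]
    obtain ⟨q, hq⟩ : ∃ q, a / 2 ^ t = 2 * q := ⟨a / 2 ^ t / 2, by omega⟩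
    rw [hq]
    obtain ⟨w, rfl⟩ : ∃ w, u = t + w := ⟨u - t, by omega⟩
    cases w with
    | zero => simp [Nat.testBit_zero]
    | succ w =>
      rw [show t + (w + 1) - t = w + 1 by omega, Nat.testBit_succ, Nat.testBit_succ,
        show 2 * q / 2 = q by omega, show (2 * q + 1) / 2 = q by omega]
      simp

/-- The number `j` with bit `t` replaced by `b`. -/
def setBit (j t : ℕ) (b : Bool) : ℕ := if j.testBit t = b then j else j ^^^ 2 ^ t

theorem testBit_setBit (j t u : ℕ) (b : Bool) :
    (setBit j t b).testBit u = if u = t then b else j.testBit u := by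
  unfold setBit
  by_cases hu : u = t
  · subst hu
    cases hb : j.testBit u <;> cases b <;> simp [hb, Nat.testBit_xor]
  · split_ifs
    · rfl
    · simp [Nat.testBit_xor, Ne.symm hu]

theorem setBit_self {j t : ℕ} : setBit j t (j.testBit t) = j := by simp [setBit]

theorem setBit_setBit (j t : ℕ) (a b : Bool) : setBit (setBit j t a) t b = setBit j t b := by
  refine Nat.eq_of_testBit_eq fun u => ?_
  simp only [testBit_setBit]
  split_ifs <;> rfl

theorem setBit_lt {j t n : ℕ} (hj : j < 2 ^ n) (ht : t < n) (b : Bool) : setBit j t b < 2 ^ n := by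
  unfold setBit
  split_ifs
  · exact hj
  · exact Nat.xor_lt_two_pow hj (Nat.pow_lt_pow_right (by norm_num) ht)

/-- A bit as an element of `Fin 2`. -/
def toBit (b : Bool) : Fin 2 := if b then 1 else 0

/-- An element of `Fin 2` as a bit. -/
def ofBit (a : Fin 2) : Bool := decide (a = 1)

@[simp] theorem ofBit_toBit (b : Bool) : ofBit (toBit b) = b := by cases b <;> rfl

@[simp] theorem toBit_ofBit (a : Fin 2) : toBit (ofBit a) = a := by
  fin_cases a <;> rfl

/-! ### Rotations of pairs of modes -/

/-- The matrix `V` acts on the components `i` and `j` of a vector. -/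
def pairAct {ι : Type*} [DecidableEq ι] (V : Matrix (Fin 2) (Fin 2) ℂ) (i j : ι) (w : ι → ℂ) :
    ι → ℂ := fun k =>
  if k = i then V 0 0 * w i + V 0 1 * w j else if k = j then V 1 0 * w i + V 1 1 * w j else w k

/-- A rotation of distant coordinates, from one of nearer coordinates and a transposition. -/
theorem pairAct_swap {a b c : ℕ} (h : a < b) (hc : c = b + 1) (V : Matrix (Fin 2) (Fin 2) ℂ)
    (w : ℕ → ℂ) :
    pairAct pauliX.1 b c (pairAct V a b (pairAct pauliX.1 b c w)) = pairAct V a c w := by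
  subst hc
  have h1 : a ≠ b := by omega
  have h2 : a ≠ b + 1 := by omega
  funext k
  by_cases ha : k = a
  · subst ha; simp [pairAct, h1, h2, pauliX]
  by_cases hb : k = b
  · subst hb; simp [pairAct, h1, h2, Ne.symm h1, Ne.symm h2, pauliX]
  by_cases hb1 : k = b + 1
  · subst hb1; simp [pairAct, h1, h2, Ne.symm h1, Ne.symm h2, pauliX]
  simp [pairAct, ha, hb, hb1]

/-- The matrix `V` acts on bit `t` of the indices whose bit `c` is `s`. -/
def letterAct (V : Matrix (Fin 2) (Fin 2) ℂ) (c : ℕ) (s : Bool) (t : ℕ) (w : ℕ → ℂ) : ℕ → ℂ :=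
  fun z => if z.testBit c = s then
    ∑ b : Fin 2, V (toBit (z.testBit t)) b * w (setBit z t (ofBit b)) else w z

/-- Rotations of disjoint pairs that differ in bit `t`. -/
theorem foldr_pairAct (V : Matrix (Fin 2) (Fin 2) ℂ) (t : ℕ) (w : ℕ → ℂ) (l : List ℕ)
    (hl : l.Nodup) (h0 : ∀ a ∈ l, a.testBit t = false) (z : ℕ) :
    l.foldr (fun a w => pairAct V a (a + 2 ^ t) w) w z =
      if setBit z t false ∈ l then
        ∑ b : Fin 2, V (toBit (z.testBit t)) b * w (setBit z t (ofBit b)) else w z := by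
  induction l generalizing z with
  | nil => simp
  | cons a l ih =>
    rw [List.nodup_cons] at hl
    have ih := ih hl.2 fun b hb => h0 b (List.mem_cons_of_mem _ hb)
    have ha := h0 a List.mem_cons_self
    have hp : a + 2 ^ t = setBit a t true := by
      rw [← xor_two_pow_eq_add ha, setBit, if_neg (by simp [ha])]
    have ha0 : setBit a t false = a := by rw [← ha, setBit_self]
    have hp0 : setBit (a + 2 ^ t) t false = a := by rw [hp, setBit_setBit, ha0]
    have hpt : (a + 2 ^ t).testBit t = true := by rw [hp, testBit_setBit, if_pos rfl]
    have hne : a + 2 ^ t ≠ a := by have := Nat.two_pow_pos t; omega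
    rw [List.foldr_cons]
    by_cases hz : setBit z t false = a
    · rw [if_pos (by rw [hz]; exact List.mem_cons_self)]
      have w1 : l.foldr (fun a w => pairAct V a (a + 2 ^ t) w) w a = w a := by
        rw [ih, ha0, if_neg hl.1]
      have w2 : l.foldr (fun a w => pairAct V a (a + 2 ^ t) w) w (a + 2 ^ t) = w (a + 2 ^ t) := by
        rw [ih, hp0, if_neg hl.1]
      have hs1 : setBit z t true = a + 2 ^ t := by rw [hp, ← hz, setBit_setBit]
      simp only [Fin.sum_univ_two, show ofBit 0 = false from rfl, show ofBit 1 = true from rfl, hz,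
        hs1]
      rcases Bool.eq_false_or_eq_true (z.testBit t) with hb | hb
      · have : z = a + 2 ^ t := by rw [← hs1, ← hb, setBit_self]
        subst this
        simp only [pairAct, if_neg hne, if_true, w1, w2, hpt]
        rfl
      · have : z = a := by rw [← hz, ← hb, setBit_self]
        subst this
        simp only [pairAct, if_true, w1, w2, ha]
        rfl
    · have n1 : z ≠ a := by rintro rfl; exact hz ha0
      have n2 : z ≠ a + 2 ^ t := by rintro rfl; exact hz hp0
      simp only [pairAct, if_neg n1, if_neg n2]
      rw [ih]
      simp [hz]

/-- The creation operators `∑ w_k a_k†`. -/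
def creation (w : ℕ → ℂ) : ℕ → Fin 2 → ℂ := fun k e => if e = 1 then w k else 0

/-- Number preserving matchgates rotate creation operators among themselves. -/
theorem modeAct_npGate (V : U2) {i j : ℕ} (w : ℕ → ℂ) :
    modeAct (modeU (detU V) (pauliX * V * pauliX)).1 i j (creation w) =
      creation (pairAct V.1 i j w) := by
  have e2 : (1 : Fin 2) + 1 = 0 := rfl
  have hX : ∀ s t : Fin 2, (pauliX * V * pauliX).1 (s + 1) (t + 1) = V.1 s t := by
    intro s t
    fin_cases s <;> fin_cases t <;>
      simp only [Submonoid.coe_mul, Matrix.mul_apply, Fin.sum_univ_two] <;> simp [pauliX]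
  have hD : ∀ s t : Fin 2, (detU V).1 s t = if s = t then if s = 0 then 1 else V.1.det else 0 := by
    intro s t
    fin_cases s <;> fin_cases t <;> simp [detU, diagU]
  have key : ∀ s e, pairApply (modeU (detU V) (pauliX * V * pauliX)).1 (creation w i)
      (creation w j) (s, e) = if e = 1 then V.1 s 0 * w i + V.1 s 1 * w j else 0 := by
    intro s e
    change pairApply (modeMat _ _) _ _ _ = _
    simp only [pairApply, creation, modeMat, Matrix.of_apply, Fintype.sum_prod_type,
      Fin.sum_univ_two, hD]
    fin_cases s <;> fin_cases e <;> simp [e2, ← hX]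
  funext k e
  simp only [modeAct, key]
  by_cases hi : k = i
  · simp [hi, creation, pairAct]
  · by_cases hj : k = j
    · subst hj
      simp [hi, creation, pairAct]
    · simp [hi, hj, creation, pairAct]

theorem backAct_append (W : ℕ → U4) (c d : List (ℕ × ℕ × ℕ)) (u : ℕ → Fin 2 → ℂ) :
    backAct W (c ++ d) u = backAct W c (backAct W d u) :=
  List.foldr_append

/-! ### Circuits of number preserving matchgates -/

/-- Names of number preserving matchgates: gate `base + v` is the one for `Vt v`.  The letters `vX`
and `vI` stand for the bit flip and the identity. -/
structure NpTable (K : ℕ) where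
  Vt : Fin K → U2
  W : ℕ → U4
  base : ℕ
  vX : Fin K
  vI : Fin K
  hX : Vt vX = pauliX
  hI : Vt vI = 1
  hW : ∀ v, W (base + v.val) = (modeU (detU (Vt v)) (pauliX * Vt v * pauliX))⁻¹

namespace NpTable

variable {K : ℕ} (T : NpTable K)

/-- The rotation of modes `a` and `a + D + 1`, by transpositions of neighbours. -/
def chain (v : Fin K) (a : ℕ) : ℕ → List (ℕ × ℕ × ℕ)
  | 0 => [(T.base + v.val, a, a + 1)]
  | D + 1 => (T.base + T.vX.val, a + D + 1, a + D + 2) :: chain v a D ++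
      [(T.base + T.vX.val, a + D + 1, a + D + 2)]

theorem chain_eq (v : Fin K) (a D : ℕ) :
    T.chain v a D =
      (List.range D).map (fun k => (T.base + T.vX.val, a + (D - k), a + (D - k) + 1)) ++
      (T.base + v.val, a, a + 1) ::
      (List.range D).map (fun k => (T.base + T.vX.val, a + (k + 1), a + (k + 1) + 1)) := by
  induction D with
  | zero => rfl
  | succ D ih =>
    have h1 : (List.range (D + 1)).map
        (fun k => (T.base + T.vX.val, a + (D + 1 - k), a + (D + 1 - k) + 1)) =
        (T.base + T.vX.val, a + D + 1, a + D + 2) ::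
          (List.range D).map (fun k => (T.base + T.vX.val, a + (D - k), a + (D - k) + 1)) := by
      rw [List.range_succ_eq_map, List.map_cons, List.map_map]
      refine congrArg₂ _ rfl (List.map_congr_left fun k _ => ?_)
      simp
    rw [chain, ih, h1, List.range_succ, List.map_append]
    simp [add_assoc]

theorem backAct_single (v : Fin K) {i j : ℕ} (w : ℕ → ℂ) :
    backAct T.W [(T.base + v.val, i, j)] (creation w) =
      creation (pairAct (T.Vt v)⁻¹.1 i j w) := by
  have h : (modeU (detU (T.Vt v)) (pauliX * T.Vt v * pauliX))⁻¹ =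
      modeU (detU (T.Vt v)⁻¹) (pauliX * (T.Vt v)⁻¹ * pauliX) := by
    have hX : pauliX⁻¹ = pauliX := inv_eq_of_mul_eq_one_right pauliX_mul_self
    have hd : detU (T.Vt v)⁻¹ = (detU (T.Vt v))⁻¹ := by
      refine eq_inv_of_mul_eq_one_right ?_
      rw [← detU_mul, mul_inv_cancel]
      apply Subtype.ext
      ext i j
      fin_cases i <;> fin_cases j <;> simp [detU, diagU]
    rw [modeU_inv, hd, mul_inv_rev, mul_inv_rev, hX, mul_assoc]
  change modeAct (T.W (T.base + v.val)).1 i j (creation w) = _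
  rw [T.hW, h, modeAct_npGate]

theorem backAct_chain (v : Fin K) (a D : ℕ) (w : ℕ → ℂ) :
    backAct T.W (T.chain v a D) (creation w) =
      creation (pairAct (T.Vt v)⁻¹.1 a (a + D + 1) w) := by
  have hX : (T.Vt T.vX)⁻¹ = pauliX := by
    rw [T.hX]; exact inv_eq_of_mul_eq_one_right pauliX_mul_self
  induction D generalizing w with
  | zero => exact T.backAct_single v w
  | succ D ih =>
    rw [chain, ← List.singleton_append, backAct_append, backAct_append, T.backAct_single, ih,
      T.backAct_single, hX, pairAct_swap (by omega) (by omega)]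
    rfl

/-- The rotations of all pairs of modes below `n` that differ in bit `t` and whose bit `c` is
`s`. -/
def letter (n : ℕ) (v : Fin K) (c : ℕ) (s : Bool) (t : ℕ) : List (ℕ × ℕ × ℕ) :=
  (List.range n).flatMap fun a =>
    if a.testBit c = s ∧ a.testBit t = false then T.chain v a (2 ^ t - 1) else []

/-- The rotations of a letter commute, and act together as a controlled gate on the bits of the
index of a mode. -/
theorem backAct_letter {n : ℕ} (v : Fin K) {c t : ℕ} (hct : c ≠ t) (ht : t < n) (s : Bool)
    (w : ℕ → ℂ) :
    ∃ w', backAct T.W (T.letter (2 ^ n) v c s t) (creation w) = creation w' ∧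
      ∀ z < 2 ^ n, w' z = letterAct (T.Vt v)⁻¹.1 c s t w z := by
  have key : ∀ l : List ℕ, backAct T.W (l.flatMap fun a =>
        if a.testBit c = s ∧ a.testBit t = false then T.chain v a (2 ^ t - 1) else []) (creation w) =
      creation ((l.filter fun a => a.testBit c = s ∧ a.testBit t = false).foldr
        (fun a w => pairAct (T.Vt v)⁻¹.1 a (a + 2 ^ t) w) w) := by
    intro l
    induction l with
    | nil => rfl
    | cons a l ih =>
      rw [List.flatMap_cons, backAct_append, ih]
      by_cases h : a.testBit c = s ∧ a.testBit t = false
      · have h2 : a + (2 ^ t - 1) + 1 = a + 2 ^ t := by have := Nat.two_pow_pos t; omega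
        rw [if_pos h, backAct_chain, List.filter_cons_of_pos (by simp [h]), h2]
        rfl
      · rw [if_neg h, List.filter_cons_of_neg (by simpa using h)]
        rfl
  refine ⟨_, key _, fun z hz => ?_⟩
  rw [foldr_pairAct _ _ _ _ (List.nodup_range.filter _)]
  · unfold letterAct
    have : setBit z t false ∈ ((List.range (2 ^ n)).filter fun a =>
        a.testBit c = s ∧ a.testBit t = false) ↔ z.testBit c = s := by
      rw [List.mem_filter]
      simp [setBit_lt hz ht, testBit_setBit, hct]
    simp only [this]
  · intro a ha
    have := (List.mem_filter.1 ha).2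
    simp at this
    exact this.2

end NpTable

/-! ### Qubits encoded in the index of a mode -/

/-- The vector of amplitudes on mode indices: bit `l + 1` of the index is the value of qubit `l`,
and bit `0` of the index is zero. -/
def ampl (ψ : (ℕ → Fin 2) → ℂ) : ℕ → ℂ := fun j =>
  if j.testBit 0 then 0 else ψ fun l => toBit (j.testBit (l + 1))

theorem act2_mul {ι : Type*} [DecidableEq ι] (M N : Matrix (Fin 2 × Fin 2) (Fin 2 × Fin 2) ℂ)
    {i j : ι} (h : i ≠ j) (ψ : (ι → Fin 2) → ℂ) :
    act2 (M * N) i j ψ = act2 M i j (act2 N i j ψ) := by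
  funext z
  unfold act2
  simp only [Function.update_self, Function.update_of_ne h, Function.update_idem,
    Function.update_comm h.symm, Matrix.mul_apply, Fintype.sum_prod_type, Fin.sum_univ_two]
  ring

theorem act2_one {ι : Type*} [DecidableEq ι] (i j : ι) (ψ : (ι → Fin 2) → ℂ) :
    act2 1 i j ψ = ψ := by
  funext z
  have hz : ψ (Function.update (Function.update z i (z i)) j (z j)) = ψ z := by simp
  rw [← hz]
  unfold act2
  generalize z i = a
  generalize z j = b
  fin_cases a <;> fin_cases b <;> simp [Matrix.one_apply, Fin.sum_univ_two]

theorem act2_ctl_false {ι : Type*} [DecidableEq ι] (s : Fin 2) (V : Matrix (Fin 2) (Fin 2) ℂ)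
    (i j : ι) (ψ : (ι → Fin 2) → ℂ) (z : ι → Fin 2) :
    act2 (ctlMat false s V) i j ψ z = if z i = s then act1 V j ψ z else ψ z := by
  have h0 : Function.update z i (z i) = z := Function.update_eq_self _ _
  have h1 : Function.update z j (z j) = z := Function.update_eq_self _ _
  simp only [act2, act1, ctlMat, Matrix.of_apply, ite_mul, zero_mul, one_mul, Finset.sum_ite_irrel,
    Finset.sum_const_zero, Finset.sum_ite_eq, Finset.mem_univ, if_true, h0, h1]

theorem act2_ctl_true {ι : Type*} [DecidableEq ι] (s : Fin 2) (V : Matrix (Fin 2) (Fin 2) ℂ)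
    {i j : ι} (hij : i ≠ j) (ψ : (ι → Fin 2) → ℂ) (z : ι → Fin 2) :
    act2 (ctlMat true s V) i j ψ z = if z j = s then act1 V i ψ z else ψ z := by
  have h0 : Function.update z i (z i) = z := Function.update_eq_self _ _
  have h1 : Function.update z j (z j) = z := Function.update_eq_self _ _
  simp only [act2, act1, ctlMat, Matrix.of_apply, ite_mul, zero_mul, one_mul, Finset.sum_ite_irrel,
    Finset.sum_ite_eq, Finset.mem_univ, if_true, h0, h1,
    Function.update_comm hij]

theorem ampl_setBit (ψ : (ℕ → Fin 2) → ℂ) (z l : ℕ) (b : Fin 2) :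
    ampl ψ (setBit z (l + 1) (ofBit b)) = if z.testBit 0 then 0 else
      ψ (Function.update (fun k => toBit (z.testBit (k + 1))) l b) := by
  have h : (fun k => toBit ((setBit z (l + 1) (ofBit b)).testBit (k + 1))) =
      Function.update (fun k => toBit (z.testBit (k + 1))) l b := by
    funext k
    rw [testBit_setBit]
    by_cases hk : k = l
    · subst hk; simp
    · simp [hk]
  unfold ampl
  rw [h, testBit_setBit]
  simp

theorem letterAct_ampl (V : Matrix (Fin 2) (Fin 2) ℂ) (i j : ℕ) (s : Bool)
    (ψ : (ℕ → Fin 2) → ℂ) :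
    letterAct V (i + 1) s (j + 1) (ampl ψ) = ampl (act2 (ctlMat false (toBit s) V) i j ψ) := by
  funext z
  have hs : toBit (z.testBit (i + 1)) = toBit s ↔ z.testBit (i + 1) = s := by
    cases z.testBit (i + 1) <;> cases s <;> decide
  unfold letterAct
  simp only [ampl_setBit]
  unfold ampl
  simp only [act2_ctl_false, hs, act1]
  by_cases h0 : z.testBit 0 <;> simp [h0]

theorem letterAct_ampl_zero (V : Matrix (Fin 2) (Fin 2) ℂ) (i : ℕ) (ψ : (ℕ → Fin 2) → ℂ) :
    letterAct V 0 false (i + 1) (ampl ψ) = ampl (act1 V i ψ) := by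
  funext z
  unfold letterAct
  simp only [ampl_setBit]
  unfold ampl
  simp only [act1]
  by_cases h0 : z.testBit 0 <;> simp [h0]

theorem letterAct_congr {n : ℕ} {V : Matrix (Fin 2) (Fin 2) ℂ} {c t : ℕ} {s : Bool}
    (ht : t < n) {w w' : ℕ → ℂ} (h : ∀ z < 2 ^ n, w z = w' z) {z : ℕ} (hz : z < 2 ^ n) :
    letterAct V c s t w z = letterAct V c s t w' z := by
  unfold letterAct
  rw [h z hz]
  split_ifs
  · exact Finset.sum_congr rfl fun b _ => by rw [h _ (setBit_lt hz ht _)]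
  · rfl

/-- The field operator `u` is the combination of creation operators that encodes the state `ψ`. -/
def EncodesState (n : ℕ) (u : ℕ → Fin 2 → ℂ) (ψ : (ℕ → Fin 2) → ℂ) : Prop :=
  ∃ w, u = creation w ∧ ∀ z < 2 ^ n, w z = ampl ψ z

/-- The basis state `|x⟩` of the first `n` lines. -/
def basisState (n : ℕ) (x : ℕ → Fin 2) : (ℕ → Fin 2) → ℂ := fun z =>
  if ∀ l < n, z l = x l then 1 else 0

theorem ket_lift {n : ℕ} (x : ℕ → Fin 2) :
    (fun z : ℕ → Fin 2 => ket (fun l : Fin n => x l.val) fun l => z l.val) = basisState n x := by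
  funext z
  simp only [ket, Pi.single_apply, basisState, funext_iff]
  refine if_congr ⟨fun h l hl => h ⟨l, hl⟩, fun h l => h l.val l.2⟩ rfl rfl

theorem basisState_congr {n : ℕ} {x y : ℕ → Fin 2} (h : ∀ l < n, x l = y l) :
    basisState n x = basisState n y := by
  funext z
  refine if_congr ⟨fun h' l hl => (h' l hl).trans (h l hl), fun h' l hl =>
    (h' l hl).trans (h l hl).symm⟩ rfl rfl

/-- The string with the value of one line flipped. -/
def flipAt {ι : Type*} [DecidableEq ι] (i : ι) (z : ι → Fin 2) : ι → Fin 2 :=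
  Function.update z i (z i + 1)

theorem flipAt_flipAt {ι : Type*} [DecidableEq ι] (i : ι) (z : ι → Fin 2) :
    flipAt i (flipAt i z) = z := by
  have h : ∀ a : Fin 2, a + 1 + 1 = a := by decide
  simp [flipAt, h]

theorem act1_pauliX {ι : Type*} [DecidableEq ι] (i : ι) (ψ : (ι → Fin 2) → ℂ) :
    act1 pauliX.1 i ψ = ψ ∘ flipAt i := by
  funext z
  simp only [act1, Function.comp, flipAt]
  generalize z i = a
  fin_cases a <;> simp [pauliX, Fin.sum_univ_two]

theorem act2_matchgate_pauliX {ι : Type*} [DecidableEq ι] (i j : ι) (ψ : (ι → Fin 2) → ℂ) :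
    act2 (matchgate pauliX.1 pauliX.1) i j ψ = fun z =>
      ψ (Function.update (Function.update z i (z i + 1)) j (z j + 1)) := by
  funext z
  simp only [act2]
  have e2 : (1 : Fin 2) + 1 = 0 := rfl
  generalize z i = a
  generalize z j = b
  fin_cases a <;> fin_cases b <;> simp [matchgate, pauliX, Fin.sum_univ_two, e2]

theorem basisState_flipAt {n i : ℕ} (hi : i < n) (x z : ℕ → Fin 2) :
    basisState n x (flipAt i z) = basisState n (flipAt i x) z := by
  refine if_congr (forall₂_congr fun l _ => ?_) rfl rfl
  by_cases h : l = i
  · subst h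
    simp only [flipAt, Function.update_self]
    generalize z l = a
    generalize x l = b
    fin_cases a <;> fin_cases b <;> decide
  · simp [flipAt, h]

/-! ### Simulation of a quantum circuit by matchgates -/

/-- Names of the matchgates used in a simulation. -/
structure MatchTable (𝓜 : GateSet) (K : ℕ) extends NpTable K where
  xx : ℕ
  hback : 𝓜.BackTable W
  hgate : ∀ v : Fin K, ∃ h : base + v.val < 𝓜.num2, 𝓜.gate2 ⟨base + v.val, h⟩ = npGate (Vt v)
  hxx : ∃ h : xx < 𝓜.num2, 𝓜.gate2 ⟨xx, h⟩ = mgU pauliX pauliX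

/-- A controlled gate in the decomposition of a gate on lines `i` and `j`: the control is `i`, `j`
or (for the decomposition of one-qubit gates) an additional line in state `0`. -/
abbrev Letter (K : ℕ) := Fin 3 × Bool × Fin K

/-- The number of the control line. -/
def ctlOf (k : Fin 3) (i j : ℕ) : ℕ := if k = 0 then i else if k = 1 then j else 0

/-- The number of the target line. -/
def tgtOf (k : Fin 3) (i j : ℕ) : ℕ := if k = 0 then j else i

/-- Decompositions of the gates of a quantum circuit into the inverses of letters. -/
def GateSet.WordTable (𝓠 : GateSet) {K : ℕ} (Vt : Fin K → U2) (word : ℕ → List (Letter K)) : Prop :=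
  (∀ g : Fin 𝓠.num1, ∃ v, word g.val = [(2, false, v)] ∧ (Vt v)⁻¹ = 𝓠.gate1 g) ∧
  ∀ g : Fin 𝓠.num2, (∀ l ∈ word (𝓠.num1 + g.val), l.1 ≠ 2) ∧
    ((word (𝓠.num1 + g.val)).map fun l => ctl (decide (l.1 = 1)) (toBit l.2.1) (Vt l.2.2)⁻¹).prod =
      𝓠.gate2 g

namespace MatchTable

variable {𝓜 𝓠 : GateSet} {K : ℕ} (T : MatchTable 𝓜 K) (word : ℕ → List (Letter K))

/-- The matchgates that simulate one gate; lines are numbered from `1`. -/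
def block (n : ℕ) (g : ℕ × ℕ × ℕ) : List (ℕ × ℕ × ℕ) :=
  (word g.1).flatMap fun l => T.letter n l.2.2 (ctlOf l.1 g.2.1 g.2.2) l.2.1 (tgtOf l.1 g.2.1 g.2.2)

/-- The matchgates that excite the modes whose first qubit has the value `1`. -/
def prologue (m : ℕ) : List (ℕ × ℕ × ℕ) :=
  (List.range (2 ^ m)).map fun i =>
    (if i.testBit 0 then T.xx else T.base + T.vI.val, 2 * i, 2 * i + 1)

/-- The matchgates that simulate a bit flip. -/
def flipBlock (n l : ℕ) : List (ℕ × ℕ × ℕ) := T.letter n T.vX 0 false (l + 1)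

/-- The matchgate circuit that simulates a quantum circuit.  Field operators evolve backwards through
a circuit, so the gates come in reverse order, and the input of the qubits is prepared at the end. -/
def simulation (m : ℕ) (gs : List (ℕ × ℕ × ℕ)) (y : ℕ → Bool) : List (ℕ × ℕ × ℕ) :=
  T.prologue m ++ (gs.reverse.flatMap (T.block word (2 ^ (m + 1))) ++
    (List.range m).reverse.flatMap fun l => if y l then T.flipBlock (2 ^ (m + 1)) l else [])

variable {word}

/-- A letter acts on the encoded state as a controlled gate. -/
theorem encodes_letter {n : ℕ} (v : Fin K) {c t : ℕ} (hct : c ≠ t) (ht : t < n) (s : Bool)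
    {u : ℕ → Fin 2 → ℂ} {ψ ψ' : (ℕ → Fin 2) → ℂ} (hu : EncodesState n u ψ)
    (hψ : letterAct (T.Vt v)⁻¹.1 c s t (ampl ψ) = ampl ψ') :
    EncodesState n (backAct T.W (T.letter (2 ^ n) v c s t) u) ψ' := by
  obtain ⟨w, rfl, hw⟩ := hu
  obtain ⟨w', h1, h2⟩ := T.backAct_letter v hct ht s w
  refine ⟨w', h1, fun z hz => ?_⟩
  rw [h2 z hz, letterAct_congr ht hw hz, hψ]

/-- The block of a gate performs it on the encoded state. One-qubit gates are controlled by bit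
`0` of the index, which belongs to no qubit and has the value `0`. -/
theorem encodes_block (hword : 𝓠.WordTable T.Vt word) {m : ℕ} {g : ℕ × ℕ × ℕ}
    (hg : 𝓠.ValidRaw m g) {u : ℕ → Fin 2 → ℂ} {ψ : (ℕ → Fin 2) → ℂ}
    (hu : EncodesState (m + 1) u ψ) :
    EncodesState (m + 1)
      (backAct T.W (T.block word (2 ^ (m + 1)) (g.1, g.2.1 + 1, g.2.2 + 1)) u)
      (𝓠.actRaw g ψ) := by
  obtain ⟨g, i, j⟩ := g
  obtain ⟨hi, hj, h⟩ := hg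
  simp only at hi hj h
  unfold block GateSet.actRaw
  split_ifs at h with h1
  · obtain ⟨v, hv, hV⟩ := hword.1 ⟨g, h1⟩
    simp only [h1, dif_pos] at hv ⊢
    rw [hv, List.flatMap_singleton]
    refine T.encodes_letter v (by simp [ctlOf, tgtOf]) (by simp [tgtOf]; omega) false hu ?_
    rw [← hV]
    exact letterAct_ampl_zero _ _ _
  · have h2 : g - 𝓠.num1 < 𝓠.num2 := by omega
    simp only [h1, h2, dif_pos, dif_neg, not_false_eq_true]
    obtain ⟨hk, hp⟩ := hword.2 ⟨g - 𝓠.num1, h2⟩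
    have e : 𝓠.num1 + (g - 𝓠.num1) = g := by omega
    simp only [e] at hk hp
    rw [← hp]
    clear hp
    generalize word g = l at *
    induction l with
    | nil =>
      simp only [List.map_nil, List.prod_nil]
      change EncodesState (m + 1) u (act2 1 i j ψ)
      rwa [act2_one]
    | cons a l ih =>
      have ih := ih fun b hb => hk b (List.mem_cons_of_mem _ hb)
      have ha := hk a List.mem_cons_self
      obtain ⟨k, s, v⟩ := a
      simp only at ha
      rw [List.flatMap_cons, backAct_append, List.map_cons, List.prod_cons, Submonoid.coe_mul,
        act2_mul _ _ h.2]
      have hk2 : k = 0 ∨ k = 1 := by omega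
      rcases hk2 with rfl | rfl
      · refine T.encodes_letter v (by simp [ctlOf, tgtOf, h.2]) (by simp [tgtOf]; omega) s ih ?_
        exact letterAct_ampl _ _ _ _ _
      · refine T.encodes_letter v (by simp [ctlOf, tgtOf, Ne.symm h.2]) (by simp [tgtOf]; omega)
          s ih ?_
        simp only [ctlOf, tgtOf]
        refine (letterAct_ampl _ _ _ _ _).trans (congrArg ampl ?_)
        funext z
        simp only [decide_true]
        rw [ctl_coe, act2_ctl_false, act2_ctl_true _ _ h.2]

theorem encodes_blocks (hword : 𝓠.WordTable T.Vt word) {m : ℕ} (gs : List (ℕ × ℕ × ℕ))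
    (hg : ∀ g ∈ gs, 𝓠.ValidRaw m g) {u : ℕ → Fin 2 → ℂ} {ψ : (ℕ → Fin 2) → ℂ}
    (hu : EncodesState (m + 1) u ψ) :
    EncodesState (m + 1) (backAct T.W
      ((gs.map fun g => (g.1, g.2.1 + 1, g.2.2 + 1)).reverse.flatMap
        (T.block word (2 ^ (m + 1)))) u) (𝓠.runRaw gs ψ) := by
  induction gs generalizing u ψ with
  | nil => exact hu
  | cons g gs ih =>
    rw [List.map_cons, List.reverse_cons, List.flatMap_append, backAct_append,
      List.flatMap_singleton]
    exact ih (fun g hg' => hg g (List.mem_cons_of_mem _ hg'))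
      (T.encodes_block hword (hg g List.mem_cons_self) hu)

/-- The encoding of a basis state of the qubits, from that of the state `|0⋯0⟩`. -/
theorem encodes_flips (m : ℕ) (y : ℕ → Bool) :
    EncodesState (m + 1) (backAct T.W
      ((List.range m).reverse.flatMap fun l => if y l then T.flipBlock (2 ^ (m + 1)) l else [])
      (deltaMode 0 1)) (basisState m fun l => toBit (y l)) := by
  have key : ∀ p ≤ m, EncodesState (m + 1) (backAct T.W
      ((List.range p).reverse.flatMap fun l => if y l then T.flipBlock (2 ^ (m + 1)) l else [])
      (deltaMode 0 1)) (basisState m fun l => if l < p then toBit (y l) else 0) := by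
    intro p hp
    induction p with
    | zero =>
      refine ⟨Pi.single 0 1, ?_, ?_⟩
      · funext k e
        change deltaMode 0 1 k e = _
        simp only [deltaMode, creation, Pi.single_apply]
        split_ifs <;> simp_all
      · intro z hz
        simp only [ampl, basisState, Pi.single_apply, Nat.not_lt_zero, if_false]
        have : z = 0 ↔ z.testBit 0 = false ∧ ∀ l < m, toBit (z.testBit (l + 1)) = 0 := by
          constructor
          · rintro rfl; simp [toBit]
          · rintro ⟨h0, h1⟩
            refine Nat.eq_of_testBit_eq fun u => ?_
            rw [Nat.zero_testBit]
            by_cases hu : u < m + 1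
            · cases u with
              | zero => exact h0
              | succ u =>
                have := h1 u (by omega)
                cases hb : z.testBit (u + 1)
                · rfl
                · simp [hb, toBit] at this
            · exact Nat.testBit_lt_two_pow (hz.trans_le (Nat.pow_le_pow_right (by norm_num)
                (by omega)))
        simp only [this]
        cases z.testBit 0 <;> simp
    | succ p ih =>
      have ih := ih (by omega)
      rw [List.range_succ, List.reverse_append, List.reverse_singleton, List.singleton_append,
        List.flatMap_cons, backAct_append]
      by_cases hy : y p
      · rw [if_pos hy]
        refine T.encodes_letter T.vX (by omega) (by omega) false ih ?_
        have hX : (T.Vt T.vX)⁻¹ = pauliX := by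
          rw [T.hX]; exact inv_eq_of_mul_eq_one_right pauliX_mul_self
        rw [hX, letterAct_ampl_zero, act1_pauliX]
        congr 1
        funext z
        rw [Function.comp, basisState_flipAt (by omega)]
        congr 1
        funext l
        by_cases hl : l = p
        · subst hl; simp [flipAt, hy, toBit]
        · simp only [flipAt, Function.update_of_ne hl]
          have : l < p + 1 ↔ l < p := by omega
          simp only [this]
      · rw [if_neg hy]
        change EncodesState (m + 1) (backAct T.W _ _) _
        have : basisState m (fun l => if l < p + 1 then toBit (y l) else 0) =
            basisState m (fun l => if l < p then toBit (y l) else 0) := by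
          refine basisState_congr fun l _ => ?_
          by_cases hl : l = p
          · subst hl; simp [hy, toBit]
          · have : l < p + 1 ↔ l < p := by omega
            simp only [this]
        rw [this]
        exact ih
  refine (basisState_congr fun l hl => ?_) ▸ key m le_rfl
  simp [hl]

/-- The state after the prologue. -/
theorem runRaw_prologue (m : ℕ) :
    𝓜.runRaw (T.prologue m) (basisState (2 ^ (m + 1)) fun _ => 0) =
      basisState (2 ^ (m + 1)) fun j => toBit (j.testBit 1) := by
  have key : ∀ p ≤ 2 ^ m, 𝓜.runRaw ((List.range p).map fun i =>
        (if i.testBit 0 then T.xx else T.base + T.vI.val, 2 * i, 2 * i + 1))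
      (basisState (2 ^ (m + 1)) fun _ => 0) =
      basisState (2 ^ (m + 1)) fun j => if j < 2 * p then toBit (j.testBit 1) else 0 := by
    intro p hp
    induction p with
    | zero => rfl
    | succ p ih =>
      have h2 : 2 ^ (m + 1) = 2 * 2 ^ m := by rw [pow_succ]; ring
      rw [List.range_succ, List.map_append, GateSet.runRaw_append, ih (by omega)]
      change 𝓜.actRaw _ _ = _
      unfold GateSet.actRaw
      have hb : ∀ k, (2 * p + k) / 2 = p → (2 * p + k).testBit 1 = p.testBit 0 := by
        intro k hk
        rw [Nat.testBit_succ, hk]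
      have hb0 : (2 * p).testBit 1 = p.testBit 0 := hb 0 (by omega)
      by_cases h0 : p.testBit 0
      · obtain ⟨h, hx⟩ := T.hxx
        simp only [h0, if_true, T.hback.1, Nat.not_lt_zero, dif_neg, not_false_eq_true,
          Nat.sub_zero, h, dif_pos, hx]
        change act2 (matchgate pauliX.1 pauliX.1) _ _ _ = _
        rw [act2_matchgate_pauliX]
        funext z
        have : Function.update (Function.update z (2 * p) (z (2 * p) + 1)) (2 * p + 1)
            (z (2 * p + 1) + 1) = flipAt (2 * p + 1) (flipAt (2 * p) z) := by
          simp [flipAt]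
        rw [this, basisState_flipAt (by omega), basisState_flipAt (by omega)]
        congr 1
        funext l
        by_cases hl : l = 2 * p
        · subst hl
          simp [flipAt, hb0, h0, toBit]
        · by_cases hl' : l = 2 * p + 1
          · subst hl'
            simp [flipAt, hb 1 (by omega), h0, toBit, show 2 * p + 1 < 2 * (p + 1) by omega]
          · simp only [flipAt, Function.update_of_ne hl, Function.update_of_ne hl']
            have : l < 2 * (p + 1) ↔ l < 2 * p := by omega
            simp only [this]
      · obtain ⟨h, hx⟩ := T.hgate T.vI
        simp only [h0, T.hback.1, Nat.not_lt_zero, dif_neg, not_false_eq_true,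
          Nat.sub_zero, h, dif_pos, hx, T.hI, npGate_one, if_false, Bool.false_eq_true]
        change act2 1 _ _ _ = _
        rw [act2_one]
        refine basisState_congr fun l _ => ?_
        by_cases hl : l = 2 * p
        · subst hl
          simp [hb0, h0, toBit]
        · by_cases hl' : l = 2 * p + 1
          · subst hl'
            simp [hb 1 (by omega), h0, toBit]
          · have : l < 2 * (p + 1) ↔ l < 2 * p := by omega
            simp only [this]
  have h2 : 2 ^ (m + 1) = 2 * 2 ^ m := by rw [pow_succ]; ring
  refine (key _ le_rfl).trans (basisState_congr fun l hl => ?_)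
  rw [if_pos (by omega)]

/-- The squared norms of the amplitudes of the modes whose first qubit has the value `0`. -/
theorem sum_norm_encodes {m : ℕ} (hm : 0 < m) {u : ℕ → Fin 2 → ℂ} {χ : QState m}
    (hu : EncodesState (m + 1) u fun z => χ fun l => z l.val) :
    ∑ j : Fin (2 ^ (m + 1)), ‖u j.val (toBit (j.val.testBit 1) + 1)‖ ^ 2 =
      ∑ z, if z ⟨0, hm⟩ = 0 then ‖χ z‖ ^ 2 else 0 := by
  obtain ⟨w, rfl, hw⟩ := hu
  let bits : (Fin m → Fin 2) → Fin (m + 1) → Bool := fun z => Fin.cons false fun l => ofBit (z l)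
  let e : (Fin m → Fin 2) → Fin (2 ^ (m + 1)) := fun z =>
    ⟨Nat.ofBits (bits z), Nat.ofBits_lt_two_pow _⟩
  have he0 : ∀ z, (e z).val.testBit 0 = false := fun z => by
    simp only [e]; rw [Nat.testBit_ofBits_lt _ 0 (by omega)]; rfl
  have he : ∀ z (l : Fin m), (e z).val.testBit (l.val + 1) = ofBit (z l) := fun z l => by
    simp only [e]; rw [Nat.testBit_ofBits_lt _ _ (by omega)]
    rfl
  symm
  refine Finset.sum_of_injOn e ?_ (fun _ _ => Finset.mem_coe.2 (Finset.mem_univ _)) ?_ ?_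
  · intro z _ z' _ h
    funext l
    have := congrArg (fun j : Fin (2 ^ (m + 1)) => toBit (j.val.testBit (l.val + 1))) h
    simpa only [he, toBit_ofBit] using this
  · intro j _ hj
    have h0 : j.val.testBit 0 = true := by
      by_contra h0
      refine hj ⟨fun l => toBit (j.val.testBit (l.val + 1)), Finset.mem_coe.2 (Finset.mem_univ _),
        Fin.ext (Nat.eq_of_testBit_eq fun u => ?_)⟩
      by_cases hu : u < m + 1
      · cases u with
        | zero => rw [he0]; simpa using h0
        | succ u => rw [he _ ⟨u, by omega⟩]; simp
      · rw [Nat.testBit_lt_two_pow ((e _).2.trans_le (Nat.pow_le_pow_right (by norm_num)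
          (by omega))), Nat.testBit_lt_two_pow (j.2.trans_le (Nat.pow_le_pow_right (by norm_num)
          (by omega)))]
    have : w j.val = 0 := by rw [hw _ j.2, ampl, if_pos h0]
    simp [creation, this]
  · intro z _
    have h1 := he z ⟨0, hm⟩
    simp only [zero_add] at h1
    have h2 : w (e z).val = χ z := by
      rw [hw _ (e z).2, ampl, he0]
      simp only [he, toBit_ofBit, Bool.false_eq_true, if_false]
    simp only [h1, toBit_ofBit, creation, h2]
    generalize z ⟨0, hm⟩ = a
    fin_cases a <;> simp

/-- The matchgate circuit has the output probabilities of the quantum circuit. -/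
theorem equiv_simulation (hword : 𝓠.WordTable T.Vt word) {m : ℕ} (hm : 0 < m) (c : Circuit 𝓠 m)
    (y : Fin m → Fin 2) (yb : ℕ → Bool) (hy : ∀ l : Fin m, y l = toBit (yb l.val))
    (d : Circuit 𝓜 (2 ^ (m + 1))) (hd : d.IsNearestNeighbour)
    (hraw : d.map GateApp.raw = T.simulation word m
      ((c.map GateApp.raw).map fun g => (g.1, g.2.1 + 1, g.2.2 + 1)) yb) :
    CircuitEquiv c y ⟨0, hm⟩ d (fun _ => 0) 0 := by
  refine circuitEquiv_of_one (b := 0) ?_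
  obtain ⟨d1, d2, rfl, h1, h2⟩ := List.map_eq_append_iff.1 hraw
  have hpos : 0 < 2 ^ (m + 1) := by positivity
  have hrun : Circuit.run d1 (ket fun _ => 0) = ket fun j => toBit (j.val.testBit 1) := by
    have h3 := GateSet.run_lift d1 (ket fun _ => 0)
    rw [h1, ket_lift (n := 2 ^ (m + 1)) fun _ => 0, T.runRaw_prologue, ← ket_lift] at h3
    funext z
    have := congrFun h3 fun l => if hl : l < 2 ^ (m + 1) then z ⟨l, hl⟩ else 0
    simpa using this
  have hP : Circuit.outProb (d1 ++ d2) (fun _ => 0) 0 0 =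
      Circuit.outProb d2 (fun j => toBit (j.val.testBit 1)) 0 0 := by
    unfold Circuit.outProb
    simp only [Circuit.run_append, hrun]
  rw [hP, Circuit.outProb_eq_backAct T.hback d2 fun g hg => hd g (List.mem_append_right _ hg), h2,
    backAct_append]
  have hvalid : ∀ g ∈ c.map GateApp.raw, 𝓠.ValidRaw m g := by
    intro g hg
    obtain ⟨a, -, rfl⟩ := List.mem_map.1 hg
    cases a with
    | one g i => simp [GateSet.ValidRaw, GateApp.raw]
    | two g i j h => simpa [GateSet.ValidRaw, GateApp.raw, Fin.ext_iff] using h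
  have h4 := T.encodes_blocks hword (c.map GateApp.raw) hvalid (T.encodes_flips m yb)
  rw [← ket_lift, ← GateSet.run_lift] at h4
  have h5 := sum_norm_encodes hm h4
  unfold Circuit.outProb
  rw [show y = fun l => toBit (yb l.val) from funext hy]
  rw [← h5]
  rfl

end MatchTable

/-! ### Reversible circuits -/

theorem act1_mul {ι : Type*} [DecidableEq ι] (M N : Matrix (Fin 2) (Fin 2) ℂ) (i : ι)
    (ψ : (ι → Fin 2) → ℂ) : act1 (M * N) i ψ = act1 M i (act1 N i ψ) := by
  funext z
  unfold act1
  simp only [Function.update_self, Function.update_idem, Matrix.mul_apply, Fin.sum_univ_two]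
  ring

theorem act1_one {ι : Type*} [DecidableEq ι] (i : ι) (ψ : (ι → Fin 2) → ℂ) : act1 1 i ψ = ψ := by
  funext z
  have hz : ψ (Function.update z i (z i)) = ψ z := by simp
  rw [← hz]
  unfold act1
  generalize z i = a
  fin_cases a <;> simp [Matrix.one_apply]

theorem act1_congr {ι : Type*} [DecidableEq ι] {M : Matrix (Fin 2) (Fin 2) ℂ} {i : ι}
    {ψ φ : (ι → Fin 2) → ℂ} {z : ι → Fin 2}
    (h : ∀ a, ψ (Function.update z i a) = φ (Function.update z i a)) :
    act1 M i ψ z = act1 M i φ z :=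
  Finset.sum_congr rfl fun a _ => by rw [h]

/-- The string with the value of line `i` flipped under a condition. -/
def condFlip (P : Prop) [Decidable P] (i : ℕ) (z : ℕ → Fin 2) : ℕ → Fin 2 :=
  if P then flipAt i z else z

/-- Names of the gates of a universal set that are used in a simulation: gate `base1 + v` acts as
`Vt v` on one line, and the two-qubit gate `base2 + v` is its controlled version.  The letters `vX`,
`vS` and `vT` stand for the bit flip, its square root and the inverse of the root. -/
structure QubitTable (𝓠 : GateSet) (K : ℕ) where
  Vt : Fin K → U2
  base1 : ℕ
  base2 : ℕ
  vX : Fin K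
  vS : Fin K
  vT : Fin K
  hX : Vt vX = pauliX
  hS : Vt vS * Vt vS = pauliX
  hT : Vt vT * Vt vS = 1
  hone : ∀ v : Fin K, ∃ h : base1 + v.val < 𝓠.num1, 𝓠.gate1 ⟨base1 + v.val, h⟩ = Vt v
  htwo : ∀ v : Fin K, ∃ h : base2 + v.val < 𝓠.num2,
    𝓠.gate2 ⟨base2 + v.val, h⟩ = ctl false 1 (Vt v)

namespace QubitTable

variable {𝓠 : GateSet} {K : ℕ} (T : QubitTable 𝓠 K)

/-- The bit flip of a line. -/
def flip (i : ℕ) : ℕ × ℕ × ℕ := (T.base1 + T.vX.val, i, i)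

/-- The gate `Vt v` on line `t` controlled by line `c`. -/
def cgate (v : Fin K) (c t : ℕ) : ℕ × ℕ × ℕ := (𝓠.num1 + (T.base2 + v.val), c, t)

/-- The doubly controlled bit flip, with controls `a` and `b`. -/
def toffoli (a b t : ℕ) : List (ℕ × ℕ × ℕ) :=
  [T.cgate T.vS b t, T.cgate T.vX a b, T.cgate T.vT b t, T.cgate T.vX a b, T.cgate T.vS a t]

theorem actRaw_cgate (v : Fin K) (c t : ℕ) (ψ : (ℕ → Fin 2) → ℂ) (z : ℕ → Fin 2) :
    𝓠.actRaw (T.cgate v c t) ψ z = if z c = 1 then act1 (T.Vt v).1 t ψ z else ψ z := by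
  obtain ⟨h, hv⟩ := T.htwo v
  have h1 : ¬𝓠.num1 + (T.base2 + v.val) < 𝓠.num1 := by omega
  have h2 : 𝓠.num1 + (T.base2 + v.val) - 𝓠.num1 = T.base2 + v.val := by omega
  unfold GateSet.actRaw cgate
  simp only [h1, dif_neg, not_false_eq_true, h2, h, dif_pos, hv]
  exact act2_ctl_false _ _ _ _ _ _

/-- The circuit permutes the basis states; `π` gives the preimages. -/
def IsPerm (𝓠 : GateSet) (c : List (ℕ × ℕ × ℕ)) (π : (ℕ → Fin 2) → ℕ → Fin 2) : Prop :=
  ∀ ψ, 𝓠.runRaw c ψ = ψ ∘ π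

theorem isPerm_nil : IsPerm 𝓠 [] id := fun _ => rfl

theorem IsPerm.append {c d : List (ℕ × ℕ × ℕ)} {π ρ : (ℕ → Fin 2) → ℕ → Fin 2}
    (h1 : IsPerm 𝓠 c π) (h2 : IsPerm 𝓠 d ρ) : IsPerm 𝓠 (c ++ d) (π ∘ ρ) := by
  intro ψ
  rw [GateSet.runRaw_append, h1, h2]
  rfl

theorem isPerm_flip (i : ℕ) : IsPerm 𝓠 [T.flip i] (flipAt i) := by
  intro ψ
  obtain ⟨h, hv⟩ := T.hone T.vX
  change 𝓠.actRaw (T.flip i) ψ = _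
  unfold GateSet.actRaw flip
  simp only [h, dif_pos, hv, T.hX]
  exact act1_pauliX i ψ

theorem isPerm_cnot (c t : ℕ) :
    IsPerm 𝓠 [T.cgate T.vX c t] fun z => condFlip (z c = 1) t z := by
  intro ψ
  funext z
  change 𝓠.actRaw (T.cgate T.vX c t) ψ z = _
  rw [T.actRaw_cgate, T.hX, act1_pauliX]
  simp only [Function.comp, condFlip]
  split_ifs <;> rfl

theorem isPerm_toffoli {a b t : ℕ} (hab : a ≠ b) (hat : a ≠ t) (hbt : b ≠ t) :
    IsPerm 𝓠 (T.toffoli a b t) fun z => condFlip (z a = 1 ∧ z b = 1) t z := by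
  intro ψ
  -- the square root of the bit flip, its inverse and the root again are applied under the
  -- conditions `z b`, `z a + z b` and `z a`; they multiply to the flip only if both hold
  have hT' : T.Vt T.vS * T.Vt T.vT = 1 := mul_eq_one_comm.1 T.hT
  have h1 : ∀ φ : (ℕ → Fin 2) → ℂ, act1 (T.Vt T.vT).1 t (act1 (T.Vt T.vS).1 t φ) = φ := fun φ => by
    rw [← act1_mul, ← Submonoid.coe_mul, T.hT]; exact act1_one _ _
  have h2 : ∀ φ : (ℕ → Fin 2) → ℂ, act1 (T.Vt T.vS).1 t (act1 (T.Vt T.vT).1 t φ) = φ := fun φ => by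
    rw [← act1_mul, ← Submonoid.coe_mul, hT']; exact act1_one _ _
  have h3 : ∀ φ : (ℕ → Fin 2) → ℂ, act1 (T.Vt T.vS).1 t (act1 (T.Vt T.vS).1 t φ) =
      φ ∘ flipAt t := fun φ => by
    rw [← act1_mul, ← Submonoid.coe_mul, T.hS, act1_pauliX]
  have e0 : ∀ u : Fin 2, u ≠ 1 → u = 0 := by decide
  have e2 : (1 : Fin 2) + 1 = 0 := rfl
  have hX := T.isPerm_cnot a b
  have hc : ∀ (z : ℕ → Fin 2) (u : Fin 2), flipAt b (Function.update z t u) =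
      Function.update (flipAt b z) t u := by
    intro z u
    simp only [flipAt, Function.update_of_ne hbt]
    exact Function.update_comm (Ne.symm hbt) _ _ _
  have hfa : ∀ z, flipAt b z a = z a := fun z => Function.update_of_ne hab _ _
  have hfb : ∀ z, flipAt b z b = z b + 1 := fun z => Function.update_self _ _ _
  have hft : ∀ z, flipAt b z t = z t := fun z => Function.update_of_ne (Ne.symm hbt) _ _
  -- the states after the single gates
  set ψ1 := 𝓠.actRaw (T.cgate T.vS b t) ψ with hψ1
  set κ : (ℕ → Fin 2) → ℕ → Fin 2 := fun z => condFlip (z a = 1) b z with hκ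
  set ψ3 := 𝓠.actRaw (T.cgate T.vT b t) (ψ1 ∘ κ) with hψ3
  have f1 : ∀ y, ψ1 y = if y b = 1 then act1 (T.Vt T.vS).1 t ψ y else ψ y :=
    T.actRaw_cgate T.vS b t ψ
  have f3 : ∀ y, ψ3 y = if y b = 1 then act1 (T.Vt T.vT).1 t (ψ1 ∘ κ) y else (ψ1 ∘ κ) y :=
    T.actRaw_cgate T.vT b t _
  have κ1 : ∀ y, y a = 1 → κ y = flipAt b y := fun y h => if_pos h
  have κ0 : ∀ y, ¬y a = 1 → κ y = y := fun y h => if_neg h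
  funext z
  change 𝓠.runRaw ([T.cgate T.vS b t] ++ ([T.cgate T.vX a b] ++ ([T.cgate T.vT b t] ++
    ([T.cgate T.vX a b] ++ [T.cgate T.vS a t])))) ψ z = _
  rw [GateSet.runRaw_append, GateSet.runRaw_append, GateSet.runRaw_append, GateSet.runRaw_append,
    hX, hX]
  change 𝓠.actRaw (T.cgate T.vS a t) (ψ3 ∘ κ) z = _
  rw [T.actRaw_cgate]
  simp only [condFlip, Function.comp_apply]
  by_cases ha : z a = 1
  · simp only [ha, true_and, if_true]
    have ha' : ∀ u, Function.update z t u a = 1 := fun u => by rw [Function.update_of_ne hat, ha]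
    by_cases hb : z b = 1
    · rw [if_pos hb]
      have : ∀ u, (ψ3 ∘ κ) (Function.update z t u) =
          act1 (T.Vt T.vS).1 t ψ (Function.update z t u) := by
        intro u
        have hb' : Function.update z t u b = 1 := by rw [Function.update_of_ne hbt, hb]
        rw [Function.comp_apply, κ1 _ (ha' u), f3, hfb, hb', if_neg (by decide),
          Function.comp_apply, κ1 _ (by rw [hfa, ha' u]), flipAt_flipAt, f1, hb', if_pos rfl]
      rw [act1_congr this, h3]
      rfl
    · rw [if_neg hb]
      have hb0 := e0 _ hb
      have : ∀ u, (ψ3 ∘ κ) (Function.update z t u) =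
          act1 (T.Vt T.vT).1 t ψ (Function.update z t u) := by
        intro u
        have hb' : ∀ v, Function.update z t v b = 0 := fun v => by
          rw [Function.update_of_ne hbt, hb0]
        rw [Function.comp_apply, κ1 _ (ha' u), f3, hfb, hb', if_pos (by decide)]
        refine Finset.sum_congr rfl fun v _ => ?_
        rw [hft, ← hc, Function.comp_apply, Function.update_idem, κ1 _ (by rw [hfa, ha' v]),
          flipAt_flipAt, f1, hb', if_neg (by decide)]
      rw [act1_congr this, h2]
  · have ha' : ∀ u, ¬Function.update z t u a = 1 := fun u => by rwa [Function.update_of_ne hat]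
    rw [if_neg ha, κ0 _ ha, if_neg (fun h => ha h.1), f3]
    by_cases hb : z b = 1
    · rw [if_pos hb]
      have : ∀ u, (ψ1 ∘ κ) (Function.update z t u) =
          act1 (T.Vt T.vS).1 t ψ (Function.update z t u) := by
        intro u
        rw [Function.comp_apply, κ0 _ (ha' u), f1, Function.update_of_ne hbt, if_pos hb]
      rw [act1_congr this, h1]
    · rw [if_neg hb, Function.comp_apply, κ0 _ ha, f1, if_neg hb]

/-- Toggles all lines `a s` with `s ≤ r`, by the conjunctions of the lines `c 1, …, c s`. -/
def chain (c a : ℕ → ℕ) : ℕ → List (ℕ × ℕ × ℕ)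
  | 0 => [T.flip (a 0)]
  | r + 1 => T.toffoli (a r) (c (r + 1)) (a (r + 1)) ++ chain c a r ++
      T.toffoli (a r) (c (r + 1)) (a (r + 1))

/-- Toggles line `a r` by the conjunction of the lines `c 1, …, c r`.  The other lines `a s` are
borrowed in any state and returned. -/
def andToggle (c a : ℕ → ℕ) : ℕ → List (ℕ × ℕ × ℕ)
  | 0 => T.chain c a 0
  | r + 1 => T.chain c a (r + 1) ++ T.chain c a r

theorem chain_eq (c a : ℕ → ℕ) (r : ℕ) :
    T.chain c a r =
      (List.range r).flatMap (fun k => T.toffoli (a (r - k - 1)) (c (r - k)) (a (r - k))) ++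
      T.flip (a 0) ::
      (List.range r).flatMap (fun k => T.toffoli (a k) (c (k + 1)) (a (k + 1))) := by
  induction r with
  | zero => rfl
  | succ r ih =>
    have h1 : (List.range (r + 1)).flatMap
        (fun k => T.toffoli (a (r + 1 - k - 1)) (c (r + 1 - k)) (a (r + 1 - k))) =
        T.toffoli (a r) (c (r + 1)) (a (r + 1)) ++ (List.range r).flatMap
          (fun k => T.toffoli (a (r - k - 1)) (c (r - k)) (a (r - k))) := by
      rw [List.range_succ_eq_map, List.flatMap_cons, List.flatMap_map]
      refine congrArg₂ _ rfl (List.flatMap_congr fun k _ => ?_)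
      simp
    rw [chain, ih, h1, List.range_succ, List.flatMap_append, List.flatMap_singleton]
    simp

/-- The conjunction of the lines `c 1, …, c r`. -/
def AllOn (c : ℕ → ℕ) (r : ℕ) (z : ℕ → Fin 2) : Prop := ∀ u, 1 ≤ u → u ≤ r → z (c u) = 1

open Classical in
/-- A chain toggles each line `a s` by the conjunction of the lines `c 1, …, c s`. -/
theorem exists_isPerm_chain (c a : ℕ → ℕ) {r : ℕ} (ha : ∀ s ≤ r, ∀ u ≤ r, a s = a u → s = u)
    (hc : ∀ s ≤ r, ∀ u, 1 ≤ u → u ≤ r → a s ≠ c u) :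
    ∃ π, IsPerm 𝓠 (T.chain c a r) π ∧ (∀ z, ∀ s ≤ r,
      π z (a s) = z (a s) + if AllOn c s z then 1 else 0) ∧
      ∀ z l, (∀ s ≤ r, l ≠ a s) → π z l = z l := by
  induction r with
  | zero =>
    refine ⟨_, T.isPerm_flip _, ?_, ?_⟩
    · intro z s hs
      obtain rfl : s = 0 := by omega
      rw [if_pos (show AllOn c 0 z from fun u h1 h2 => by omega)]
      simp [flipAt]
    · intro z l hl
      exact Function.update_of_ne (hl 0 le_rfl) _ _
  | succ r ih =>
    obtain ⟨π, h1, h2, h3⟩ := ih (fun s hs u hu => ha s (by omega) u (by omega))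
      (fun s hs u h1 hu => hc s (by omega) u h1 (by omega))
    have n1 : a r ≠ c (r + 1) := hc r (by omega) _ (by omega) le_rfl
    have n2 : a r ≠ a (r + 1) := fun h => by
      have := ha r (by omega) (r + 1) le_rfl h; omega
    have n3 : c (r + 1) ≠ a (r + 1) := (hc (r + 1) le_rfl _ (by omega) le_rfl).symm
    have hT := T.isPerm_toffoli n1 n2 n3
    set τ : (ℕ → Fin 2) → ℕ → Fin 2 :=
      fun z => condFlip (z (a r) = 1 ∧ z (c (r + 1)) = 1) (a (r + 1)) z with hτ
    have t1 : ∀ z l, l ≠ a (r + 1) → τ z l = z l := by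
      intro z l hl
      simp only [hτ, condFlip]
      split_ifs
      · exact Function.update_of_ne hl _ _
      · rfl
    have t2 : ∀ z, τ z (a (r + 1)) =
        z (a (r + 1)) + if z (a r) = 1 ∧ z (c (r + 1)) = 1 then 1 else 0 := by
      intro z
      simp only [hτ, condFlip]
      split_ifs
      · simp [flipAt]
      · simp
    have hall : ∀ z s, s ≤ r → (AllOn c s (τ z) ↔ AllOn c s z) := by
      intro z s hs
      refine forall₃_congr fun u hu1 hu2 => ?_
      rw [t1 z _ (hc (r + 1) le_rfl u hu1 (by omega)).symm]
    have hne : ∀ s ≤ r, a s ≠ a (r + 1) := fun s hs h => by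
      have := ha s (by omega) (r + 1) le_rfl h; omega
    refine ⟨τ ∘ π ∘ τ, (hT.append h1).append hT, ?_, ?_⟩
    · intro z s hs
      rcases Nat.lt_or_ge s (r + 1) with hs' | hs'
      · simp only [Function.comp]
        rw [t1 _ _ (hne s (by omega)), h2 _ s (by omega), t1 _ _ (hne s (by omega))]
        simp only [hall z s (by omega)]
      · obtain rfl : s = r + 1 := by omega
        simp only [Function.comp]
        rw [t2, h3 _ _ (fun s hs => (hne s hs).symm), t2, h2 _ r le_rfl,
          t1 _ _ (hne r le_rfl), h3 _ (c (r + 1)) (fun s hs => (hc s (by omega) _ (by omega)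
            le_rfl).symm), t1 _ _ n3]
        have hs1 : AllOn c (r + 1) z ↔ AllOn c r z ∧ z (c (r + 1)) = 1 := by
          constructor
          · exact fun h => ⟨fun u h1 h2 => h u h1 (by omega), h _ (by omega) le_rfl⟩
          · rintro ⟨h, h'⟩ u hu1 hu2
            rcases Nat.lt_or_ge u (r + 1) with hu | hu
            · exact h u hu1 (by omega)
            · obtain rfl : u = r + 1 := by omega
              exact h'
        simp only [hall z r le_rfl, hs1]
        generalize z (a r) = p
        generalize z (c (r + 1)) = q
        generalize z (a (r + 1)) = t
        by_cases hA : AllOn c r z <;> fin_cases p <;> fin_cases q <;> fin_cases t <;> simp [hA]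
    · intro z l hl
      simp only [Function.comp]
      rw [t1 _ _ (hl _ le_rfl), h3 _ _ (fun s hs => hl s (by omega)), t1 _ _ (hl _ le_rfl)]

open Classical in
theorem isPerm_andToggle (c a : ℕ → ℕ) {r : ℕ} (ha : ∀ s ≤ r, ∀ u ≤ r, a s = a u → s = u)
    (hc : ∀ s ≤ r, ∀ u, 1 ≤ u → u ≤ r → a s ≠ c u) :
    IsPerm 𝓠 (T.andToggle c a r) fun z => condFlip (AllOn c r z) (a r) z := by
  have e2 : ∀ x y : Fin 2, x + y + y = x := by decide
  cases r with
  | zero =>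
    intro ψ
    rw [andToggle, chain, T.isPerm_flip]
    funext z
    rw [Function.comp, Function.comp, condFlip, if_pos (show AllOn c 0 z from fun u h1 h2 => by omega)]
  | succ r =>
    obtain ⟨π, h1, h2, h3⟩ := T.exists_isPerm_chain c a ha hc
    -- the second, shorter chain undoes the toggles of all lines but the last one
    obtain ⟨ρ, k1, k2, k3⟩ := T.exists_isPerm_chain (r := r) c a
      (fun s hs u hu => ha s (by omega) u (by omega))
      (fun s hs u h1 hu => hc s (by omega) u h1 (by omega))
    have hne : ∀ s ≤ r, a s ≠ a (r + 1) := fun s hs h => by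
      have := ha s (by omega) (r + 1) le_rfl h; omega
    have hall : ∀ z s, s ≤ r + 1 → (AllOn c s (ρ z) ↔ AllOn c s z) := by
      intro z s hs
      refine forall₃_congr fun u hu1 hu2 => ?_
      rw [k3 z _ fun s hs => (hc s (by omega) u hu1 (by omega)).symm]
    intro ψ
    rw [andToggle, h1.append k1]
    funext z
    refine congrArg ψ (funext fun l => ?_)
    change π (ρ z) l = condFlip (AllOn c (r + 1) z) (a (r + 1)) z l
    by_cases hl : ∃ s ≤ r, l = a s
    · obtain ⟨s, hs, rfl⟩ := hl
      have h4 : condFlip (AllOn c (r + 1) z) (a (r + 1)) z (a s) = z (a s) := by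
        unfold condFlip
        split_ifs
        · exact Function.update_of_ne (hne s hs) _ _
        · rfl
      rw [h2 _ s (by omega), k2 _ s hs, h4]
      simp only [hall z s (by omega), e2]
    · by_cases hl' : l = a (r + 1)
      · subst hl'
        rw [h2 _ _ le_rfl, k3 _ _ fun s hs => (hne s hs).symm]
        simp only [hall z _ le_rfl]
        unfold condFlip
        split_ifs
        · simp [flipAt]
        · simp
      · have hl2 : ∀ s ≤ r, l ≠ a s := fun s hs h => hl ⟨s, hs, h⟩
        rw [h3 _ _ fun s hs => by
          rcases Nat.lt_or_ge s (r + 1) with h | h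
          · exact hl2 s (by omega)
          · obtain rfl : s = r + 1 := by omega
            exact hl', k3 _ _ hl2]
        unfold condFlip
        split_ifs
        · exact (Function.update_of_ne hl' _ _).symm
        · rfl

end QubitTable

/-! ### A gate on two indexed modes -/

/-- The action of a two-qubit matrix on lines `1` and `0`, controlled by line `h`. -/
def flagAct (h : ℕ) (M : Matrix (Fin 2 × Fin 2) (Fin 2 × Fin 2) ℂ) (ψ : (ℕ → Fin 2) → ℂ) :
    (ℕ → Fin 2) → ℂ := fun z => if z h = 1 then act2 M 1 0 ψ z else ψ z

theorem act2_congr {ι : Type*} [DecidableEq ι] {M : Matrix (Fin 2 × Fin 2) (Fin 2 × Fin 2) ℂ}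
    {i j : ι} {ψ φ : (ι → Fin 2) → ℂ} {z : ι → Fin 2}
    (h : ∀ a b, ψ (Function.update (Function.update z i a) j b) =
      φ (Function.update (Function.update z i a) j b)) :
    act2 M i j ψ z = act2 M i j φ z :=
  Finset.sum_congr rfl fun a _ => Finset.sum_congr rfl fun b _ => by rw [h]

theorem flagAct_mul {h : ℕ} (h1 : h ≠ 1) (h0 : h ≠ 0)
    (M N : Matrix (Fin 2 × Fin 2) (Fin 2 × Fin 2) ℂ) (ψ : (ℕ → Fin 2) → ℂ) :
    flagAct h M (flagAct h N ψ) = flagAct h (M * N) ψ := by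
  funext z
  by_cases hz : z h = 1
  · have : act2 M 1 0 (flagAct h N ψ) z = act2 M 1 0 (act2 N 1 0 ψ) z := by
      refine act2_congr fun a b => ?_
      rw [flagAct, Function.update_of_ne h0, Function.update_of_ne h1, if_pos hz]
    rw [flagAct, if_pos hz, this, flagAct, if_pos hz, act2_mul _ _ (by norm_num)]
  · simp [flagAct, hz]

/-- The number whose bits are the values of the lines `1, …, L`. -/
def lineIndex (L : ℕ) (z : ℕ → Fin 2) : ℕ := Nat.ofBits fun s : Fin L => ofBit (z (s.val + 1))

theorem lineIndex_lt (L : ℕ) (z : ℕ → Fin 2) : lineIndex L z < 2 ^ L := Nat.ofBits_lt_two_pow _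

theorem lineIndex_eq_iff {L q : ℕ} (hq : q < 2 ^ L) (z : ℕ → Fin 2) :
    lineIndex L z = q ↔ ∀ s < L, z (s + 1) = toBit (q.testBit s) := by
  constructor
  · rintro rfl s hs
    rw [lineIndex, Nat.testBit_ofBits_lt _ _ hs, toBit_ofBit]
  · intro h
    refine Nat.eq_of_testBit_eq fun u => ?_
    by_cases hu : u < L
    · rw [lineIndex, Nat.testBit_ofBits_lt _ _ hu, h u hu, ofBit_toBit]
    · have hp : 2 ^ L ≤ 2 ^ u := Nat.pow_le_pow_right (by norm_num) (by omega)
      rw [Nat.testBit_lt_two_pow ((lineIndex_lt L z).trans_le hp),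
        Nat.testBit_lt_two_pow (hq.trans_le hp)]

/-- The state that encodes a combination of field operators: line `0` distinguishes annihilation
and creation operators, the lines `1, …, L` hold the index of the mode, and the two further
lines are zero. -/
def modeState (L : ℕ) (v : ℕ → Fin 2 → ℂ) : (ℕ → Fin 2) → ℂ := fun z =>
  if z (L + 1) = 0 ∧ z (L + 2) = 0 then v (lineIndex L z) (z 0) else 0

namespace QubitTable

variable {𝓠 : GateSet} {K : ℕ} (T : QubitTable 𝓠 K)

/-- The bit flips of line `f = L + 1` by the conjunction of line `h = L + 2` and the condition that
line `cl` has the value `s`. -/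
def flagPrep (L cl : ℕ) (s : Bool) : List (ℕ × ℕ × ℕ) :=
  (if s then [] else [T.flip cl]) ++ T.toffoli (L + 2) cl (L + 1) ++
    if s then [] else [T.flip cl]

/-- A controlled gate on the lines `0` and `1`, additionally controlled by line `L + 2`. -/
def flagLetter (L : ℕ) (l : Bool × Bool × Fin K) : List (ℕ × ℕ × ℕ) :=
  T.flagPrep L (if l.1 then 0 else 1) l.2.1 ++
    T.cgate l.2.2 (L + 1) (if l.1 then 1 else 0) :: T.flagPrep L (if l.1 then 0 else 1) l.2.1

/-- Writes the conjunction of the lines `2, …, L` to line `L + 2`.  The conjunction over the even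
lines is kept on line `L + 1` in between, while the odd lines are borrowed, and conversely. -/
def conjunction (L : ℕ) : List (ℕ × ℕ × ℕ) :=
  T.andToggle (fun u => 2 * u) (fun u => if u = L / 2 then L + 1 else 2 * u + 1) (L / 2) ++
  T.andToggle (fun u => if u = (L - 1) / 2 + 1 then L + 1 else 2 * u + 1)
    (fun u => if u = (L - 1) / 2 + 1 then L + 2 else 2 * u) ((L - 1) / 2 + 1) ++
  T.andToggle (fun u => 2 * u) (fun u => if u = L / 2 then L + 1 else 2 * u + 1) (L / 2)

/-- The operations on the lines `2, …, L` of the affine map that moves the indices `i` and `i + 1`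
to the strings with ones in all these lines. -/
def affine (L i : ℕ) : List (ℕ × ℕ × ℕ) :=
  (List.range (L - 1)).flatMap fun s =>
    (if i.testBit (s + 1) = (i + 1).testBit (s + 1) then [] else [T.cgate T.vX 1 (s + 2)]) ++
      if (i + 1).testBit (s + 1) then [] else [T.flip (s + 2)]

/-- The operations on line `1` of this affine map. -/
def parityFlip (i : ℕ) : List (ℕ × ℕ × ℕ) := if i.testBit 0 then [T.flip 1] else []

/-- A gate of size four, given by a decomposition into letters, on the modes `i` and `i + 1`. -/
def block (word : List (Bool × Bool × Fin K)) (L i : ℕ) : List (ℕ × ℕ × ℕ) :=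
  T.affine L i ++ T.parityFlip i ++ T.conjunction L ++ word.flatMap (T.flagLetter L) ++
    T.conjunction L ++ T.parityFlip i ++ T.affine L i

/-- The two-qubit gate with the given decomposition. -/
def wordGate (Vt : Fin K → U2) (word : List (Bool × Bool × Fin K)) : U4 :=
  (word.reverse.map fun l => ctl l.1 (toBit l.2.1) (Vt l.2.2)).prod

theorem isPerm_flagPrep {L cl : ℕ} (h1 : cl ≠ L + 1) (h2 : cl ≠ L + 2) (s : Bool) :
    IsPerm 𝓠 (T.flagPrep L cl s) fun z =>
      condFlip (z (L + 2) = 1 ∧ z cl = toBit s) (L + 1) z := by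
  have hT := T.isPerm_toffoli (a := L + 2) (b := cl) (t := L + 1) h2.symm (by omega) h1
  cases s with
  | true =>
    have : T.flagPrep L cl true = T.toffoli (L + 2) cl (L + 1) := by simp [flagPrep]
    rw [this]
    exact hT
  | false =>
    have hX := T.isPerm_flip cl
    have h := (hX.append hT).append hX
    intro ψ
    rw [flagPrep, if_neg (by decide), h]
    refine funext fun z => congrArg ψ ?_
    have e : ∀ a : Fin 2, a + 1 = 1 ↔ a = 0 := by decide
    simp only [Function.comp, condFlip]
    have e1 : flipAt cl z (L + 2) = z (L + 2) := Function.update_of_ne h2.symm _ _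
    have e2 : flipAt cl z cl = z cl + 1 := Function.update_self _ _ _
    simp only [e1, e2, e, toBit, Bool.false_eq_true, if_false]
    split_ifs
    · have : flipAt (L + 1) (flipAt cl z) = flipAt cl (flipAt (L + 1) z) := by
        simp only [flipAt, Function.update_of_ne h1, Function.update_of_ne h1.symm]
        exact Function.update_comm h1 _ _ _
      rw [this, flipAt_flipAt]
    · rw [flipAt_flipAt]

/-- The flag on line `L + 1`, which is `0` before, is computed, used as a control and uncomputed.
-/
theorem runRaw_flagLetter {L : ℕ} (hL : 1 ≤ L) (l : Bool × Bool × Fin K) (ψ : (ℕ → Fin 2) → ℂ)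
    (hψ : ∀ z, z (L + 1) ≠ 0 → ψ z = 0) :
    𝓠.runRaw (T.flagLetter L l) ψ =
      flagAct (L + 2) (ctl l.1 (toBit l.2.1) (T.Vt l.2.2)).1 ψ := by
  obtain ⟨o, s, v⟩ := l
  set cl : ℕ := if o then 0 else 1 with hcl
  set tl : ℕ := if o then 1 else 0 with htl
  have hc1 : cl ≠ L + 1 := by rw [hcl]; split_ifs <;> omega
  have hc2 : cl ≠ L + 2 := by rw [hcl]; split_ifs <;> omega
  have ht1 : tl ≠ L + 1 := by rw [htl]; split_ifs <;> omega
  have ht2 : tl ≠ L + 2 := by rw [htl]; split_ifs <;> omega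
  have hct : cl ≠ tl := by rw [hcl, htl]; split_ifs <;> omega
  have hP := T.isPerm_flagPrep hc1 hc2 s
  have e0 : ∀ u : Fin 2, u ≠ 1 → u = 0 := by decide
  have e01 : ∀ u : Fin 2, u ≠ 0 → u = 1 := by decide
  have e2 : (1 : Fin 2) + 1 = 0 := rfl
  have lhs : 𝓠.runRaw (T.flagLetter L (o, s, v)) ψ =
      fun z => if z (L + 2) = 1 ∧ z cl = toBit s then act1 (T.Vt v).1 tl ψ z else ψ z := by
    change 𝓠.runRaw (T.flagPrep L cl s ++ ([T.cgate v (L + 1) tl] ++ T.flagPrep L cl s)) ψ = _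
    rw [GateSet.runRaw_append, GateSet.runRaw_append, hP, hP]
    change 𝓠.actRaw _ _ ∘ _ = _
    funext z
    rw [Function.comp_apply, T.actRaw_cgate]
    set κ : (ℕ → Fin 2) → ℕ → Fin 2 :=
      fun z => condFlip (z (L + 2) = 1 ∧ z cl = toBit s) (L + 1) z with hκ
    have κ1 : ∀ y, y (L + 2) = 1 ∧ y cl = toBit s → κ y = flipAt (L + 1) y := fun y h => if_pos h
    have κ0 : ∀ y, ¬(y (L + 2) = 1 ∧ y cl = toBit s) → κ y = y := fun y h => if_neg h
    have hf1 : ∀ z, flipAt (L + 1) z (L + 1) = z (L + 1) + 1 := fun z => Function.update_self _ _ _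
    have hf2 : ∀ z, flipAt (L + 1) z (L + 2) = z (L + 2) :=
      fun z => Function.update_of_ne (by omega) _ _
    have hf3 : ∀ z, flipAt (L + 1) z cl = z cl := fun z => Function.update_of_ne hc1 _ _
    have hf4 : ∀ z, flipAt (L + 1) z tl = z tl := fun z => Function.update_of_ne ht1 _ _
    have hu : ∀ z a, flipAt (L + 1) (Function.update z tl a) =
        Function.update (flipAt (L + 1) z) tl a := by
      intro z a
      simp only [flipAt, Function.update_of_ne ht1.symm]
      exact Function.update_comm ht1 _ _ _
    have hcu : ∀ (z : ℕ → Fin 2) (a : Fin 2),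
        (Function.update z tl a (L + 2) = 1 ∧ Function.update z tl a cl = toBit s) ↔
        (z (L + 2) = 1 ∧ z cl = toBit s) := by
      intro z a
      rw [Function.update_of_ne ht2.symm, Function.update_of_ne hct]
    have hcf : ∀ z : ℕ → Fin 2, (flipAt (L + 1) z (L + 2) = 1 ∧ flipAt (L + 1) z cl = toBit s) ↔
        (z (L + 2) = 1 ∧ z cl = toBit s) := by
      intro z
      rw [hf2, hf3]
    change (if κ z (L + 1) = 1 then act1 _ tl (ψ ∘ κ) (κ z) else (ψ ∘ κ) (κ z)) = _
    by_cases hc : z (L + 2) = 1 ∧ z cl = toBit s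
    · rw [κ1 z hc, hf1, if_pos hc]
      by_cases hz : z (L + 1) = 0
      · rw [if_pos (by rw [hz]; rfl)]
        refine Finset.sum_congr rfl fun a _ => ?_
        rw [hf4, ← hu, Function.comp_apply, κ1 _ ((hcf _).2 ((hcu z a).2 hc)), flipAt_flipAt]
      · rw [if_neg (by rw [e01 _ hz]; decide), Function.comp_apply, κ1 _ ((hcf z).2 hc),
          flipAt_flipAt, hψ z hz]
        symm
        refine Finset.sum_eq_zero fun a _ => ?_
        rw [hψ _ (by rwa [Function.update_of_ne ht1.symm]), mul_zero]
    · rw [κ0 z hc, if_neg hc]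
      by_cases hz : z (L + 1) = 0
      · rw [if_neg (by rw [hz]; decide), Function.comp_apply, κ0 z hc]
      · rw [if_pos (e01 _ hz), hψ z hz]
        refine Finset.sum_eq_zero fun a _ => ?_
        rw [Function.comp_apply, κ0 _ (mt (hcu z a).1 hc),
          hψ _ (by rwa [Function.update_of_ne ht1.symm]), mul_zero]
  rw [lhs]
  funext z
  have hctl : act2 (ctl o (toBit s) (T.Vt v)).1 1 0 ψ z =
      if z cl = toBit s then act1 (T.Vt v).1 tl ψ z else ψ z := by
    cases o
    · exact act2_ctl_false _ _ _ _ _ _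
    · exact act2_ctl_true _ _ (by norm_num) _ _
  rw [flagAct]
  simp only [hctl]
  by_cases h1 : z (L + 2) = 1
  · simp [h1]
  · simp [h1]

theorem runRaw_word {L : ℕ} (hL : 1 ≤ L) (word : List (Bool × Bool × Fin K))
    (ψ : (ℕ → Fin 2) → ℂ) (hψ : ∀ z, z (L + 1) ≠ 0 → ψ z = 0) :
    𝓠.runRaw (word.flatMap (T.flagLetter L)) ψ = flagAct (L + 2) (wordGate T.Vt word).1 ψ := by
  induction word generalizing ψ with
  | nil =>
    change ψ = flagAct (L + 2) 1 ψ
    funext z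
    simp [flagAct, act2_one]
  | cons l word ih =>
    have hs : ∀ z, z (L + 1) ≠ 0 →
        flagAct (L + 2) (ctl l.1 (toBit l.2.1) (T.Vt l.2.2)).1 ψ z = 0 := by
      intro z hz
      unfold flagAct
      split_ifs
      · refine Finset.sum_eq_zero fun a _ => Finset.sum_eq_zero fun b _ => ?_
        rw [hψ, mul_zero]
        rwa [Function.update_of_ne (by omega), Function.update_of_ne (by omega)]
      · exact hψ z hz
    rw [List.flatMap_cons, GateSet.runRaw_append, T.runRaw_flagLetter hL l ψ hψ, ih _ hs,
      flagAct_mul (by omega) (by omega)]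
    congr 1
    rw [wordGate, wordGate, List.reverse_cons, List.map_append, List.prod_append,
      Submonoid.coe_mul, List.map_singleton, List.prod_singleton]

/-- All lines `2, …, L` have the value `1`. -/
def LinesOn (L : ℕ) (z : ℕ → Fin 2) : Prop := ∀ s < L - 1, z (s + 2) = 1

open Classical in
/-- The conjunction circuit is a reversible circuit that returns line `L + 1`, and that toggles
line `L + 2` by the conjunction if line `L + 1` is `0`. -/
theorem exists_isPerm_conjunction {L : ℕ} (hL : 1 ≤ L) :
    ∃ σ, IsPerm 𝓠 (T.conjunction L) σ ∧ (∀ z, σ z (L + 1) = z (L + 1)) ∧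
      ∀ z, z (L + 1) = 0 → σ z = condFlip (LinesOn L z) (L + 2) z := by
  have e01 : ∀ u : Fin 2, u ≠ 0 → u = 1 := by decide
  have h1 := T.isPerm_andToggle (fun u => 2 * u)
    (fun u => if u = L / 2 then L + 1 else 2 * u + 1) (r := L / 2)
    (by intro s hs u hu; split_ifs <;> omega)
    (by intro s hs u hu1 hu; split_ifs <;> omega)
  have h2 := T.isPerm_andToggle (fun u => if u = (L - 1) / 2 + 1 then L + 1 else 2 * u + 1)
    (fun u => if u = (L - 1) / 2 + 1 then L + 2 else 2 * u) (r := (L - 1) / 2 + 1)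
    (by intro s hs u hu; split_ifs <;> omega)
    (by intro s hs u hu1 hu; split_ifs <;> omega)
  simp only [if_true] at h1 h2
  set E := AllOn (fun u => 2 * u) (L / 2) with hE
  set O := AllOn (fun u => if u = (L - 1) / 2 + 1 then L + 1 else 2 * u + 1) ((L - 1) / 2 + 1)
    with hO
  have hEf : ∀ z l, L + 1 ≤ l → (E (flipAt l z) ↔ E z) := by
    intro z l hl
    refine forall₃_congr fun u hu1 hu2 => ?_
    have : flipAt l z (2 * u) = z (2 * u) := Function.update_of_ne (by omega) _ _
    simp only [this]
  have hOO : ∀ z, O z ↔ (z (L + 1) = 1 ∧ ∀ u, 1 ≤ u → u ≤ (L - 1) / 2 → z (2 * u + 1) = 1) := by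
    intro z
    constructor
    · intro h
      refine ⟨by simpa using h _ (by omega) le_rfl, fun u h1 h2 => ?_⟩
      have := h u h1 (by omega)
      simp only at this
      rwa [if_neg (by omega)] at this
    · rintro ⟨h, h'⟩ u hu1 hu2
      simp only
      split_ifs
      · exact h
      · exact h' u hu1 (by omega)
  have hA : ∀ z, LinesOn L z ↔
      (E z ∧ ∀ u, 1 ≤ u → u ≤ (L - 1) / 2 → z (2 * u + 1) = 1) := by
    intro z
    constructor
    · intro h
      refine ⟨fun u h1 h2 => ?_, fun u h1 h2 => ?_⟩
      · have := h (2 * u - 2) (by omega)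
        rwa [show 2 * u - 2 + 2 = 2 * u by omega] at this
      · have := h (2 * u - 1) (by omega)
        rwa [show 2 * u - 1 + 2 = 2 * u + 1 by omega] at this
    · rintro ⟨h, h'⟩ s hs
      rcases Nat.even_or_odd' s with ⟨q, rfl | rfl⟩
      · exact h (q + 1) (by omega) (by omega)
      · exact h' (q + 1) (by omega) (by omega)
  have hflip : ∀ z, flipAt (L + 1) (flipAt (L + 2) z) = flipAt (L + 2) (flipAt (L + 1) z) := by
    intro z
    have n1 : L + 1 ≠ L + 2 := by omega
    simp only [flipAt, Function.update_of_ne n1, Function.update_of_ne n1.symm]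
    exact Function.update_comm n1.symm _ _ _
  have hff : ∀ z, flipAt (L + 1) z (L + 1) = z (L + 1) + 1 := fun z => Function.update_self _ _ _
  have hfh : ∀ z, flipAt (L + 2) z (L + 1) = z (L + 1) :=
    fun z => Function.update_of_ne (by omega) _ _
  have e2 : ∀ x : Fin 2, x + 1 + 1 = x := by decide
  -- line `L + 1` is toggled by the even lines, controls with the odd ones, and is toggled back
  set e : (ℕ → Fin 2) → ℕ → Fin 2 := fun z => condFlip (E z) (L + 1) z
  set o : (ℕ → Fin 2) → ℕ → Fin 2 := fun z => condFlip (O z) (L + 2) z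
  have eP : ∀ z, E z → e z = flipAt (L + 1) z := fun z h => if_pos h
  have eN : ∀ z, ¬E z → e z = z := fun z h => if_neg h
  have oP : ∀ z, O z → o z = flipAt (L + 2) z := fun z h => if_pos h
  have oN : ∀ z, ¬O z → o z = z := fun z h => if_neg h
  refine ⟨_, (h1.append h2).append h1, fun z => ?_, fun z hz => ?_⟩
  · change e (o (e z)) (L + 1) = _
    by_cases hEz : E z
    · rw [eP z hEz]
      have hE1 := (hEf z _ le_rfl).2 hEz
      by_cases h3 : O (flipAt (L + 1) z)
      · rw [oP _ h3, eP _ ((hEf _ _ (by omega)).2 hE1), hff, hfh, hff, e2]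
      · rw [oN _ h3, eP _ hE1, hff, hff, e2]
    · rw [eN z hEz]
      by_cases h3 : O z
      · rw [oP _ h3, eN _ (mt (hEf _ _ (by omega)).1 hEz), hfh]
      · rw [oN _ h3, eN _ hEz]
  · change e (o (e z)) = _
    by_cases hEz : E z
    · rw [eP z hEz]
      have hE1 := (hEf z _ le_rfl).2 hEz
      have h5 : flipAt (L + 1) z (L + 1) = 1 := by rw [hff, hz]; rfl
      have h6 : ∀ u, 1 ≤ u → u ≤ (L - 1) / 2 →
          flipAt (L + 1) z (2 * u + 1) = z (2 * u + 1) :=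
        fun u h1 h2 => Function.update_of_ne (by omega) _ _
      have h7 : O (flipAt (L + 1) z) ↔ LinesOn L z := by
        rw [hOO, hA, h5]
        simp only [true_and, hEz]
        exact forall₃_congr fun u h1 h2 => by rw [h6 u h1 h2]
      by_cases h3 : LinesOn L z
      · rw [oP _ (h7.2 h3), eP _ ((hEf _ _ (by omega)).2 hE1), hflip, flipAt_flipAt, condFlip,
          if_pos h3]
      · rw [oN _ (mt h7.1 h3), eP _ hE1, flipAt_flipAt, condFlip, if_neg h3]
    · have h3 : ¬O z := fun h => by
        have := ((hOO z).1 h).1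
        rw [hz] at this
        exact absurd this (by decide)
      have h4 : ¬LinesOn L z := fun h => hEz ((hA z).1 h).1
      rw [eN _ hEz, oN _ h3, eN _ hEz, condFlip, if_neg h4]

open Classical in
/-- The gate given by a word, controlled by the lines `2, …, L`. -/
theorem runRaw_controlled {L : ℕ} (hL : 1 ≤ L) (word : List (Bool × Bool × Fin K))
    (ψ : (ℕ → Fin 2) → ℂ) (hf : ∀ z, z (L + 1) ≠ 0 → ψ z = 0)
    (hh : ∀ z, z (L + 2) ≠ 0 → ψ z = 0) :
    𝓠.runRaw (T.conjunction L ++ word.flatMap (T.flagLetter L) ++ T.conjunction L) ψ =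
      fun z => if LinesOn L z then act2 (wordGate T.Vt word).1 1 0 ψ z else ψ z := by
  obtain ⟨σ, hσ, hσf, hσ0⟩ := T.exists_isPerm_conjunction hL
  have e01 : ∀ u : Fin 2, u ≠ 0 → u = 1 := by decide
  set M := (wordGate T.Vt word).1
  have hsup : ∀ z, z (L + 1) ≠ 0 → (ψ ∘ σ) z = 0 := fun z hz => hf _ (by rwa [hσf])
  rw [GateSet.runRaw_append, GateSet.runRaw_append, hσ ψ, T.runRaw_word hL _ _ hsup, hσ]
  have hupd : ∀ (z : ℕ → Fin 2) (a b : Fin 2) (l : ℕ), 2 ≤ l →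
      Function.update (Function.update z 1 a) 0 b l = z l := fun z a b l hl => by
    rw [Function.update_of_ne (by omega), Function.update_of_ne (by omega)]
  have hflip : ∀ (z : ℕ → Fin 2) (l : ℕ), l < L + 2 → flipAt (L + 2) z l = z l :=
    fun z l hl => Function.update_of_ne (by omega) _ _
  have hon : ∀ z, LinesOn L (flipAt (L + 2) z) ↔ LinesOn L z := fun z =>
    forall₂_congr fun s hs => by rw [hflip _ _ (by omega)]
  funext z
  change flagAct (L + 2) M (ψ ∘ σ) (σ z) = _
  by_cases hz : z (L + 1) = 0
  · rw [hσ0 z hz]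
    unfold condFlip
    by_cases hA : LinesOn L z
    · rw [if_pos hA, if_pos hA, flagAct]
      have hs2 : flipAt (L + 2) z (L + 2) = z (L + 2) + 1 := Function.update_self _ _ _
      rw [hs2]
      by_cases hzh : z (L + 2) = 0
      · rw [if_pos (by rw [hzh]; rfl)]
        unfold act2
        refine Finset.sum_congr rfl fun a _ => Finset.sum_congr rfl fun b _ => ?_
        rw [hflip _ _ (by omega), hflip _ _ (by omega)]
        congr 1
        have hc : Function.update (Function.update (flipAt (L + 2) z) 1 a) 0 b =
            flipAt (L + 2) (Function.update (Function.update z 1 a) 0 b) := by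
          simp only [flipAt, hupd _ _ _ _ (show 2 ≤ L + 2 by omega)]
          rw [Function.update_comm (show L + 2 ≠ 1 by omega),
            Function.update_comm (show L + 2 ≠ 0 by omega)]
        rw [hc, Function.comp, hσ0, condFlip, if_pos, flipAt_flipAt]
        · rw [hon]
          intro s hs
          rw [hupd _ _ _ _ (by omega)]
          exact hA s hs
        · rw [hflip _ _ (by omega), hupd _ _ _ _ (by omega), hz]
      · rw [if_neg (by rw [e01 _ hzh]; decide), Function.comp, hσ0 _ (by
          rw [hflip _ _ (by omega), hz]), condFlip, if_pos ((hon z).2 hA), flipAt_flipAt, hh z hzh]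
        symm
        refine Finset.sum_eq_zero fun a _ => Finset.sum_eq_zero fun b _ => ?_
        rw [hh, mul_zero]
        rwa [hupd _ _ _ _ (by omega)]
    · rw [if_neg hA, if_neg hA, flagAct]
      have hzz : ∀ a b, (ψ ∘ σ) (Function.update (Function.update z 1 a) 0 b) =
          ψ (Function.update (Function.update z 1 a) 0 b) := by
        intro a b
        rw [Function.comp, hσ0 _ (by rw [hupd _ _ _ _ (by omega), hz]), condFlip, if_neg]
        intro h
        refine hA fun s hs => ?_
        have := h s hs
        rwa [hupd _ _ _ _ (by omega)] at this
      split_ifs with hzh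
      · rw [hh z (by rw [hzh]; decide)]
        refine Finset.sum_eq_zero fun a _ => Finset.sum_eq_zero fun b _ => ?_
        rw [hzz, hh, mul_zero]
        rw [hupd _ _ _ _ (by omega), hzh]; decide
      · rw [Function.comp, hσ0 z hz, condFlip, if_neg hA]
  · have hr : (if LinesOn L z then act2 M 1 0 ψ z else ψ z) = 0 := by
      split_ifs
      · refine Finset.sum_eq_zero fun a _ => Finset.sum_eq_zero fun b _ => ?_
        rw [hf, mul_zero]
        rwa [hupd _ _ _ _ (by omega)]
      · exact hf z hz
    rw [hr, flagAct]
    have hz' : σ z (L + 1) ≠ 0 := by rwa [hσf]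
    split_ifs
    · refine Finset.sum_eq_zero fun a _ => Finset.sum_eq_zero fun b _ => ?_
      rw [hsup, mul_zero]
      rwa [hupd _ _ _ _ (by omega)]
    · exact hsup _ hz'

/-- The permutation of `affine`. -/
def affineMap (p i : ℕ) (z : ℕ → Fin 2) : ℕ → Fin 2 := fun l =>
  if 2 ≤ l ∧ l < p + 2 then z l + (if (i + 1).testBit (l - 1) then 0 else 1) +
    (if i.testBit (l - 1) = (i + 1).testBit (l - 1) then 0 else z 1) else z l

/-- `affine` complements line `l` if `i + 1` has the digit `0` there, and adds line `1` to it if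
the digits of `i` and `i + 1` differ. -/
theorem isPerm_affine (L i : ℕ) : IsPerm 𝓠 (T.affine L i) (affineMap (L - 1) i) := by
  unfold affine
  generalize L - 1 = p
  induction p with
  | zero =>
    have : affineMap 0 i = id := by
      funext z l
      rw [affineMap, if_neg (by omega)]
      rfl
    rw [this]
    exact isPerm_nil
  | succ p ih =>
    have hg : IsPerm 𝓠 ((if i.testBit (p + 1) = (i + 1).testBit (p + 1) then []
        else [T.cgate T.vX 1 (p + 2)]) ++
        if (i + 1).testBit (p + 1) then [] else [T.flip (p + 2)])
        (fun z => Function.update z (p + 2) (z (p + 2) +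
          (if (i + 1).testBit (p + 1) then 0 else 1) +
          (if i.testBit (p + 1) = (i + 1).testBit (p + 1) then 0 else z 1))) := by
      have h1 : IsPerm 𝓠 (if i.testBit (p + 1) = (i + 1).testBit (p + 1) then []
          else [T.cgate T.vX 1 (p + 2)]) (fun z => Function.update z (p + 2) (z (p + 2) +
          (if i.testBit (p + 1) = (i + 1).testBit (p + 1) then 0 else z 1))) := by
        split_ifs
        · intro ψ
          simp only [add_zero, Function.update_eq_self]
          rfl
        · intro ψ
          rw [T.isPerm_cnot]
          refine funext fun z => congrArg ψ ?_
          simp only [condFlip, flipAt]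
          have e01 : ∀ u : Fin 2, u ≠ 1 → u = 0 := by decide
          split_ifs with h
          · rw [h]
          · rw [e01 _ h, add_zero, Function.update_eq_self]
      have h2 : IsPerm 𝓠 (if (i + 1).testBit (p + 1) then [] else [T.flip (p + 2)])
          (fun z => Function.update z (p + 2) (z (p + 2) +
          (if (i + 1).testBit (p + 1) then 0 else 1))) := by
        split_ifs
        · intro ψ
          simp only [add_zero, Function.update_eq_self]
          rfl
        · exact T.isPerm_flip _
      intro ψ
      rw [h1.append h2]
      refine funext fun z => congrArg ψ ?_
      simp only [Function.comp, Function.update_self, Function.update_idem,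
        Function.update_of_ne (show 1 ≠ p + 2 by omega)]
    intro ψ
    rw [List.range_succ, List.flatMap_append, List.flatMap_singleton, ih.append hg]
    refine funext fun z => congrArg ψ ?_
    funext l
    simp only [Function.comp, affineMap, Function.update_of_ne (show 1 ≠ p + 2 by omega)]
    by_cases hl : l = p + 2
    · subst hl
      have n1 : ¬(2 ≤ p + 2 ∧ p + 2 < p + 2) := by omega
      rw [if_pos (show 2 ≤ p + 2 ∧ p + 2 < p + 1 + 2 by omega), Function.update_self]
      simp only [if_neg n1]
      rfl
    · rw [Function.update_of_ne hl]
      have : (2 ≤ l ∧ l < p + 1 + 2) ↔ (2 ≤ l ∧ l < p + 2) := by omega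
      simp only [this]

theorem isPerm_parityFlip (i : ℕ) :
    IsPerm 𝓠 (T.parityFlip i) fun z => Function.update z 1 (z 1 + toBit (i.testBit 0)) := by
  unfold parityFlip
  cases i.testBit 0
  · intro ψ
    simp only [toBit, Bool.false_eq_true, if_false, add_zero, Function.update_eq_self]
    rfl
  · exact T.isPerm_flip 1

/-- A block acts on the field operators of two neighbouring modes.  The affine map sends the indices
`i` and `i + 1` to the strings with ones in the lines `2, …, L`, where line `1` tells which of the two
it is; on these strings the gate is performed, and then the map is undone. -/
theorem runRaw_block {L i : ℕ} (hi : i + 1 < 2 ^ L) (word : List (Bool × Bool × Fin K))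
    (v : ℕ → Fin 2 → ℂ) :
    𝓠.runRaw (T.block word L i) (modeState L v) =
      modeState L (modeAct (wordGate T.Vt word).1 i (i + 1) v) := by
  have hL : 1 ≤ L := by
    by_contra h
    obtain rfl : L = 0 := by omega
    simp at hi
  set M := (wordGate T.Vt word).1
  set α := affineMap (L - 1) i with hα
  set β : (ℕ → Fin 2) → ℕ → Fin 2 :=
    fun z => Function.update z 1 (z 1 + toBit (i.testBit 0)) with hβ
  have f2 : ∀ x y : Fin 2, x + y + y = x := by decide
  have hβ1 : ∀ z, β z 1 = z 1 + toBit (i.testBit 0) := fun z => Function.update_self _ _ _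
  have hβl : ∀ z l, l ≠ 1 → β z l = z l := fun z l h => Function.update_of_ne h _ _
  have hα1 : ∀ z l, ¬(2 ≤ l ∧ l ≤ L) → α z l = z l := fun z l h => by
    rw [hα, affineMap, if_neg (by omega)]
  have hαs : ∀ z l, 2 ≤ l → l ≤ L → α z l = z l + (if (i + 1).testBit (l - 1) then 0 else 1) +
      (if i.testBit (l - 1) = (i + 1).testBit (l - 1) then 0 else z 1) := fun z l h h' => by
    rw [hα, affineMap, if_pos (by omega)]
  have hαα : ∀ z, α (α z) = z := by
    intro z
    funext l
    by_cases hl : 2 ≤ l ∧ l ≤ L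
    · rw [hαs _ _ hl.1 hl.2, hαs _ _ hl.1 hl.2, hα1 z 1 (by omega)]
      generalize (if (i + 1).testBit (l - 1) = true then (0 : Fin 2) else 1) = x
      generalize (if i.testBit (l - 1) = (i + 1).testBit (l - 1) then (0 : Fin 2) else z 1) = y
      generalize z l = u
      revert x y u
      decide
    · rw [hα1 _ _ hl, hα1 _ _ hl]
  have hββ : ∀ z, β (β z) = z := by
    intro z
    funext l
    by_cases hl : l = 1
    · subst hl; rw [hβ1, hβ1, f2]
    · rw [hβl _ _ hl, hβl _ _ hl]
  -- `i` and `i + 1` differ in bit zero, so bit zero tells which other digits apply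
  have hbits : ∀ (l : ℕ) (t : Fin 2), 2 ≤ l → toBit ((i + 1).testBit (l - 1)) +
      (if i.testBit (l - 1) = (i + 1).testBit (l - 1) then 0 else t + toBit (i.testBit 0)) =
      toBit ((i + t.val).testBit (l - 1)) := by
    intro l t hl
    obtain ⟨s, rfl⟩ : ∃ s, l = s + 2 := ⟨l - 2, by omega⟩
    rw [show s + 2 - 1 = s + 1 by omega]
    cases h0 : i.testBit 0
    · have : i.testBit (s + 1) = (i + 1).testBit (s + 1) := by
        rw [Nat.testBit_succ, Nat.testBit_succ]
        rw [Nat.testBit_zero] at h0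
        have := of_decide_eq_false h0
        rw [show (i + 1) / 2 = i / 2 by omega]
      rw [if_pos this, add_zero]
      fin_cases t
      · simp [this]
      · rfl
    · fin_cases t
      · simp only [Fin.zero_eta, add_zero, zero_add]
        cases i.testBit (s + 1) <;> cases (i + 1).testBit (s + 1) <;> decide
      · simp only [Fin.mk_one]
        cases i.testBit (s + 1) <;> cases (i + 1).testBit (s + 1) <;> decide
  have hbit0 : ∀ t : Fin 2, toBit ((i + t.val).testBit 0) = t + toBit (i.testBit 0) := by
    intro t
    fin_cases t
    · simp
    · simp only [Fin.mk_one, Nat.testBit_zero]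
      rcases Nat.mod_two_eq_zero_or_one i with h | h
      · have : (i + 1) % 2 = 1 := by omega
        rw [h, this]; rfl
      · have : (i + 1) % 2 = 0 := by omega
        rw [h, this]; rfl
  have hlt : ∀ t : Fin 2, i + t.val < 2 ^ L := fun t => by have := t.2; omega
  have hidx : ∀ z (t : Fin 2), lineIndex L z = i + t.val ↔ z 1 = t + toBit (i.testBit 0) ∧
      ∀ l, 2 ≤ l → l ≤ L → z l = toBit ((i + t.val).testBit (l - 1)) := by
    intro z t
    rw [lineIndex_eq_iff (hlt t)]
    constructor
    · intro h
      refine ⟨(h 0 (by omega)).trans (hbit0 t), fun l h1 h2 => ?_⟩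
      have := h (l - 1) (by omega)
      rwa [show l - 1 + 1 = l by omega] at this
    · rintro ⟨h1, h2⟩ s hs
      by_cases h0 : s = 0
      · subst h0; rw [hbit0]; exact h1
      · exact h2 (s + 1) (by omega) (by omega)
  have f1 : ∀ x y u : Fin 2, x + (if y = 1 then 0 else 1) + u = 1 ↔ x = y + u := by decide
  have tb : ∀ b : Bool, toBit b = 1 ↔ b = true := by intro b; cases b <;> decide
  -- exactly the two indices are sent to strings of ones
  have hon : ∀ z, LinesOn L (β (α z)) ↔
      lineIndex L z = i + (z 1 + toBit (i.testBit 0)).val := by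
    intro z
    rw [hidx, f2]
    simp only [true_and]
    have : LinesOn L (β (α z)) ↔ ∀ l, 2 ≤ l → l ≤ L → α z l = 1 := by
      constructor
      · intro h l h1 h2
        have := h (l - 2) (by omega)
        rwa [show l - 2 + 2 = l by omega, hβl _ _ (by omega)] at this
      · intro h s hs
        rw [hβl _ _ (by omega)]
        exact h _ (by omega) (by omega)
    rw [this]
    refine forall₃_congr fun l h1 h2 => ?_
    rw [hαs _ _ h1 h2, ← hbits l _ h1, f2]
    simp only [← tb]
    exact f1 _ _ _
  have hsup : ∀ z, (modeState L v ∘ α ∘ β) z = if z (L + 1) = 0 ∧ z (L + 2) = 0 then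
      v (lineIndex L (α (β z))) (z 0) else 0 := by
    intro z
    rw [Function.comp, Function.comp, modeState, hα1 _ (L + 1) (by omega),
      hα1 _ (L + 2) (by omega), hα1 _ 0 (by omega), hβl _ _ (by omega), hβl _ _ (by omega),
      hβl _ _ (by omega)]
  have hrun := T.runRaw_controlled hL word (modeState L v ∘ α ∘ β)
    (fun z hz => by rw [hsup, if_neg (fun h => hz h.1)])
    (fun z hz => by rw [hsup, if_neg (fun h => hz h.2)])
  have hsplit : T.block word L i = (T.affine L i ++ T.parityFlip i) ++
      ((T.conjunction L ++ word.flatMap (T.flagLetter L) ++ T.conjunction L) ++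
        (T.parityFlip i ++ T.affine L i)) := by
    simp only [block, List.append_assoc]
  rw [hsplit, GateSet.runRaw_append, GateSet.runRaw_append,
    (T.isPerm_affine L i).append (T.isPerm_parityFlip i),
    (T.isPerm_parityFlip i).append (T.isPerm_affine L i)]
  change (𝓠.runRaw _ (modeState L v ∘ α ∘ β)) ∘ (β ∘ α) = _
  rw [hrun]
  funext z
  simp only [Function.comp_apply]
  by_cases hA : LinesOn L (β (α z))
  · rw [if_pos hA]
    set t := z 1 + toBit (i.testBit 0) with ht
    have hA' := (hon z).1 hA
    have h1 : β (α z) 1 = t := by rw [hβ1, hα1 _ _ (by omega)]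
    have h0 : β (α z) 0 = z 0 := by rw [hβl _ _ (by omega), hα1 _ _ (by omega)]
    -- the strings that occur in the action of the matrix
    have hterm : ∀ a b : Fin 2, (modeState L v ∘ α ∘ β)
        (Function.update (Function.update (β (α z)) 1 a) 0 b) =
        if z (L + 1) = 0 ∧ z (L + 2) = 0 then v (i + a.val) b else 0 := by
      intro a b
      set y := Function.update (Function.update (β (α z)) 1 a) 0 b with hy
      have y1 : y 1 = a := by rw [hy, Function.update_of_ne (by omega), Function.update_self]
      have y0 : y 0 = b := by rw [hy, Function.update_self]
      have yl : ∀ l, 2 ≤ l → y l = β (α z) l := fun l hl => by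
        rw [hy, Function.update_of_ne (by omega), Function.update_of_ne (by omega)]
      have hi' : lineIndex L (α (β y)) = i + a.val := by
        rw [hidx]
        refine ⟨by rw [hα1 _ _ (by omega), hβ1, y1], fun l hl1 hl2 => ?_⟩
        have hone : y l = 1 := by
          rw [yl l hl1]
          have := hA (l - 2) (by omega)
          rwa [show l - 2 + 2 = l by omega] at this
        rw [hαs _ _ hl1 hl2, hβ1, y1, hβl _ _ (by omega), hone, ← hbits l a hl1]
        simp only [← tb]
        generalize toBit ((i + 1).testBit (l - 1)) = p
        generalize (if i.testBit (l - 1) = (i + 1).testBit (l - 1) then (0 : Fin 2)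
          else a + toBit (i.testBit 0)) = q
        revert p q
        decide
      have hl3 : ∀ l, L + 1 ≤ l → y l = z l := fun l hl => by
        rw [yl l (by omega), hβl _ _ (by omega), hα1 _ _ (by omega)]
      rw [hsup, hi', y0, hl3 _ le_rfl, hl3 _ (by omega)]
    have key : act2 M 1 0 (modeState L v ∘ α ∘ β) (β (α z)) =
        if z (L + 1) = 0 ∧ z (L + 2) = 0 then pairApply M (v i) (v (i + 1)) (t, z 0) else 0 := by
      unfold act2
      simp only [hterm, h1, h0]
      split_ifs
      · simp [pairApply, Fintype.sum_prod_type, Fin.sum_univ_two]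
      · simp
    rw [key, modeState, hA', ← ht]
    have e : modeAct M i (i + 1) v (i + t.val) (z 0) =
        pairApply M (v i) (v (i + 1)) (t, z 0) := by
      clear_value t
      fin_cases t <;> simp [modeAct]
    rw [e]
  · rw [if_neg hA, hββ, hαα]
    have hne : ∀ t : Fin 2, lineIndex L z ≠ i + t.val := by
      intro t ht
      apply hA
      rw [hon]
      have := ((hidx z t).1 ht).1
      rw [this, f2]
      exact ht
    have n0 := hne 0
    have n1 := hne 1
    simp only [Fin.val_zero, add_zero, Fin.val_one] at n0 n1
    simp only [modeState, modeAct, if_neg n0, if_neg n1]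

end QubitTable

/-! ### The qubit circuit that simulates a matchgate circuit -/

theorem backAct_eq_zero {W : ℕ → U4} {n : ℕ} {c : List (ℕ × ℕ × ℕ)}
    (hc : ∀ g ∈ c, g.2.1 < n ∧ g.2.2 < n)
    {u : ℕ → Fin 2 → ℂ} (hu : ∀ j, n ≤ j → u j = 0) {j : ℕ} (hj : n ≤ j) : backAct W c u j = 0 := by
  induction c with
  | nil => exact hu j hj
  | cons g c ih =>
    have hg := hc g List.mem_cons_self
    change modeAct _ _ _ (backAct W c u) j = 0
    funext e
    simp only [modeAct, if_neg (show j ≠ g.2.1 by omega), if_neg (show j ≠ g.2.2 by omega)]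
    exact congrFun (ih fun g hg => hc g (List.mem_cons_of_mem _ hg)) e

/-- The two components of mode `j` are exchanged. -/
def flipEntry (j : ℕ) (v : ℕ → Fin 2 → ℂ) : ℕ → Fin 2 → ℂ :=
  Function.update v j fun e => v j (e + 1)

/-- The probability of the value `1` on line `0` is the squared norm of the creation part. -/
theorem sum_norm_modeState {L : ℕ} {v : ℕ → Fin 2 → ℂ} {χ : QState (L + 3)}
    (h : (fun z : ℕ → Fin 2 => χ fun l => z l.val) = modeState L v) :
    (∑ z, if z 0 = 1 then ‖χ z‖ ^ 2 else 0) = ∑ j : Fin (2 ^ L), ‖v j.val 1‖ ^ 2 := by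
  let e : Fin (2 ^ L) → Fin (L + 3) → Fin 2 := fun j l =>
    if l.val = 0 then 1 else toBit (j.val.testBit (l.val - 1))
  let ex : (Fin (L + 3) → Fin 2) → ℕ → Fin 2 := fun z l =>
    if hl : l < L + 3 then z ⟨l, hl⟩ else 0
  have hχ : ∀ z, χ z = modeState L v (ex z) := fun z => by
    rw [← h]
    exact congrArg χ (funext fun l => by simp [ex])
  have hj0 : ∀ (j : Fin (2 ^ L)) (l : ℕ), L ≤ l → j.val.testBit l = false := fun j l hl =>
    Nat.testBit_lt_two_pow (j.2.trans_le (Nat.pow_le_pow_right (by norm_num) hl))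
  have ex0 : ∀ z, ex z 0 = z 0 := fun z => dif_pos (by omega)
  have hidx : ∀ j, lineIndex L (ex (e j)) = j.val := fun j => by
    rw [lineIndex_eq_iff j.2]
    intro s hs
    simp [ex, e, show s + 1 < L + 3 by omega]
  symm
  refine Finset.sum_of_injOn e ?_ (fun _ _ => Finset.mem_coe.2 (Finset.mem_univ _)) ?_ ?_
  · intro j _ j' _ hjj
    have := congrArg (fun z => lineIndex L (ex z)) hjj
    simp only [hidx] at this
    exact Fin.ext this
  · intro z _ hz
    by_cases h0 : z 0 = 1
    · rw [if_pos h0, hχ, modeState, if_neg]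
      · simp
      · rintro ⟨h1, h2⟩
        refine hz ⟨⟨lineIndex L (ex z), lineIndex_lt L _⟩, Finset.mem_coe.2 (Finset.mem_univ _),
          funext fun l => ?_⟩
        have hl := l.2
        have hb := (lineIndex_eq_iff (lineIndex_lt L (ex z)) (ex z)).1 rfl
        by_cases hl0 : l.val = 0
        · rw [show l = 0 from Fin.ext hl0, h0]; rfl
        have hz : z l = ex z l.val := by simp [ex]
        simp only [e, if_neg hl0]
        rw [hz]
        by_cases hlL : l.val ≤ L
        · have := hb (l.val - 1) (by omega)
          rw [show l.val - 1 + 1 = l.val by omega] at this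
          exact this.symm
        · rw [hj0 ⟨lineIndex L (ex z), lineIndex_lt L _⟩ _ (by omega)]
          have : l.val = L + 1 ∨ l.val = L + 2 := by omega
          rcases this with h | h <;> rw [h]
          · exact h1.symm
          · exact h2.symm
    · exact if_neg h0
  · intro j _
    have h1 : ex (e j) (L + 1) = 0 := by simp [ex, e, hj0 j L le_rfl, toBit]
    have h2 : ex (e j) (L + 2) = 0 := by
      simp [ex, e, hj0 j (L + 1) (by omega), toBit]
    have h3 : e j 0 = 1 := rfl
    rw [if_pos h3, hχ, modeState, if_pos ⟨h1, h2⟩, hidx, ex0, h3]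

namespace QubitTable

variable {𝓜 𝓠 : GateSet} {K : ℕ} (T : QubitTable 𝓠 K) (word : ℕ → List (Bool × Bool × Fin K))

/-- Prepares the annihilation operator of mode `k`.  Lines that keep the value `0` are flipped twice,
so that no line is idle. -/
def prologue (L k : ℕ) : List (ℕ × ℕ × ℕ) :=
  (List.range (L + 3)).flatMap fun l =>
    T.flip l :: if l = 0 ∨ k.testBit (l - 1) = false then [T.flip l] else []

/-- Exchanges the annihilation and the creation operator of mode `j`, by a controlled bit flip on the
modes `j - 1` and `j`, or on the modes `0` and `1` if `j = 0`. -/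
def flipBlock (L j : ℕ) : List (ℕ × ℕ × ℕ) := T.block [(false, decide (j ≠ 0), T.vX)] L (j - 1)

/-- The circuit that simulates a matchgate circuit, whose lines are numbered from `1`.  The gates come
in reverse order, as the field operator is moved past the last gate first.  At the end, the component
that counts for the input `x` becomes the creation operator of each mode. -/
def simulation (L n k : ℕ) (gs : List (ℕ × ℕ × ℕ)) (x : ℕ → Bool) : List (ℕ × ℕ × ℕ) :=
  T.prologue L k ++ (gs.reverse.flatMap (fun g => T.block (word g.1) L (g.2.1 - 1)) ++
    (List.range n).reverse.flatMap fun j => if x j then T.flipBlock L j else [])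

theorem runRaw_prologue {L k : ℕ} (hk : k < 2 ^ L) :
    𝓠.runRaw (T.prologue L k) (basisState (L + 3) fun _ => 0) = modeState L (deltaMode k 0) := by
  set x : ℕ → Fin 2 := fun l => if l = 0 ∨ k.testBit (l - 1) = false then 0 else 1 with hx
  have key : ∀ p ≤ L + 3, 𝓠.runRaw ((List.range p).flatMap fun l =>
      T.flip l :: if l = 0 ∨ k.testBit (l - 1) = false then [T.flip l] else [])
      (basisState (L + 3) fun _ => 0) = basisState (L + 3) fun l => if l < p then x l else 0 := by
    intro p hp
    induction p with
    | zero => rfl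
    | succ p ih =>
      have hf := T.isPerm_flip p
      rw [List.range_succ, List.flatMap_append, GateSet.runRaw_append, ih (by omega),
        List.flatMap_singleton]
      by_cases h : p = 0 ∨ k.testBit (p - 1) = false
      · rw [if_pos h, show [T.flip p, T.flip p] = [T.flip p] ++ [T.flip p] from rfl, hf.append hf]
        funext z
        rw [Function.comp_apply, Function.comp_apply, flipAt_flipAt]
        refine congrFun (basisState_congr fun l _ => ?_) z
        by_cases hl : l = p
        · subst hl; simp [hx, h]
        · simp only [show l < p + 1 ↔ l < p by omega]
      · rw [if_neg h, hf]
        funext z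
        rw [Function.comp_apply, basisState_flipAt (by omega)]
        refine congrFun (basisState_congr fun l _ => ?_) z
        by_cases hl : l = p
        · subst hl; simp [hx, h, flipAt]
        · simp only [show l < p + 1 ↔ l < p by omega, flipAt, Function.update_of_ne hl]
  rw [prologue, key _ le_rfl]
  funext z
  have hxb : ∀ s, x (s + 1) = toBit (k.testBit s) := fun s => by
    simp only [hx]
    cases hs : k.testBit s <;> simp [hs, toBit]
  have h0 : ∀ l, L ≤ l → k.testBit l = false := fun l hl =>
    Nat.testBit_lt_two_pow (hk.trans_le (Nat.pow_le_pow_right (by norm_num) hl))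
  have hiff : (∀ l < L + 3, z l = if l < L + 3 then x l else 0) ↔
      (z (L + 1) = 0 ∧ z (L + 2) = 0) ∧ lineIndex L z = k ∧ z 0 = 0 := by
    rw [lineIndex_eq_iff hk]
    constructor
    · intro h
      have h' : ∀ l < L + 3, z l = x l := fun l hl => by rw [h l hl, if_pos hl]
      refine ⟨⟨?_, ?_⟩, fun s hs => by rw [h' _ (by omega), hxb], ?_⟩
      · rw [h' _ (by omega), hxb, h0 L le_rfl]; rfl
      · rw [h' _ (by omega), hxb, h0 (L + 1) (by omega)]; rfl
      · rw [h' _ (by omega)]; simp [hx]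
    · rintro ⟨⟨h1, h2⟩, h3, h4⟩ l hl
      rw [if_pos hl]
      rcases l with _ | l
      · rw [h4]; simp [hx]
      · rw [hxb]
        by_cases hlL : l < L
        · exact h3 l hlL
        · rw [h0 l (by omega)]
          have : l = L ∨ l = L + 1 := by omega
          rcases this with rfl | rfl
          · exact h1
          · exact h2
  unfold basisState modeState
  simp only [hiff, deltaMode, Pi.single_apply]
  by_cases c1 : z (L + 1) = 0 ∧ z (L + 2) = 0 <;> by_cases c2 : lineIndex L z = k <;>
    by_cases c3 : z 0 = 0 <;> simp [c1, c2, c3]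

theorem runRaw_flipBlock {L j : ℕ} (hL : 1 ≤ L) (hj : j < 2 ^ L) (v : ℕ → Fin 2 → ℂ) :
    𝓠.runRaw (T.flipBlock L j) (modeState L v) = modeState L (flipEntry j v) := by
  have h2 : 2 ≤ 2 ^ L := Nat.pow_le_pow_right (n := 2) (by norm_num) hL
  rw [flipBlock, T.runRaw_block (by omega)]
  refine congrArg _ (funext fun k => funext fun e => ?_)
  have hw : wordGate T.Vt [(false, decide (j ≠ 0), T.vX)] =
      ctl false (toBit (decide (j ≠ 0))) pauliX := by
    simp [wordGate, T.hX]
  rw [hw, ctl_coe]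
  unfold modeAct flipEntry
  by_cases h0 : j = 0
  · subst h0
    by_cases hk : k = 0
    · subst hk
      fin_cases e <;> simp [pairApply, Fintype.sum_prod_type, ctlMat, toBit, pauliX]
    · by_cases hk1 : k = 1
      · subst hk1
        fin_cases e <;> simp [pairApply, Fintype.sum_prod_type, ctlMat, toBit]
      · simp [hk, hk1]
  · obtain ⟨j, rfl⟩ : ∃ i, j = i + 1 := ⟨j - 1, by omega⟩
    simp only [Nat.add_sub_cancel]
    by_cases hk : k = j
    · subst hk
      fin_cases e <;> simp [pairApply, Fintype.sum_prod_type, ctlMat, toBit]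
    · by_cases hk1 : k = j + 1
      · subst hk1
        fin_cases e <;> simp [pairApply, Fintype.sum_prod_type, ctlMat, toBit, pauliX]
      · simp [hk, hk1]

theorem runRaw_flipBlocks {L n : ℕ} (hL : 1 ≤ L) (hn : n ≤ 2 ^ L) (x : ℕ → Bool)
    (v : ℕ → Fin 2 → ℂ) :
    𝓠.runRaw ((List.range n).reverse.flatMap fun j => if x j then T.flipBlock L j else [])
      (modeState L v) = modeState L fun j => if j < n ∧ x j then fun e => v j (e + 1) else v j := by
  induction n generalizing v with
  | zero => simp [GateSet.runRaw]
  | succ n ih =>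
    rw [List.range_succ, List.reverse_append, List.reverse_singleton, List.singleton_append,
      List.flatMap_cons, GateSet.runRaw_append]
    have hrun : 𝓠.runRaw (if x n then T.flipBlock L n else []) (modeState L v) =
        modeState L (if x n then flipEntry n v else v) := by
      split_ifs
      · exact T.runRaw_flipBlock hL (by omega) v
      · rfl
    rw [hrun, ih (by omega)]
    refine congrArg _ (funext fun j => ?_)
    by_cases hj : j = n
    · subst hj
      by_cases hx : x j <;> simp [hx, flipEntry]
    · have hf : (if x n then flipEntry n v else v) j = v j := by
        split_ifs
        · exact Function.update_of_ne hj _ _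
        · rfl
      simp only [hf, show j < n + 1 ↔ j < n by omega]

variable {word}

theorem runRaw_blocks {W : ℕ → U4} (hword : ∀ g < 𝓜.num2, wordGate T.Vt (word g) = W g) {L n : ℕ}
    (hn : n ≤ 2 ^ L) (gs : List (ℕ × ℕ × ℕ))
    (hg : ∀ g ∈ gs, g.1 < 𝓜.num2 ∧ g.2.2 = g.2.1 + 1 ∧ g.2.2 < n) (v : ℕ → Fin 2 → ℂ) :
    𝓠.runRaw ((gs.map fun g => (g.1, g.2.1 + 1, g.2.2 + 1)).reverse.flatMap fun g =>
      T.block (word g.1) L (g.2.1 - 1)) (modeState L v) = modeState L (backAct W gs v) := by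
  induction gs with
  | nil => rfl
  | cons g gs ih =>
    obtain ⟨h1, h2, h3⟩ := hg g List.mem_cons_self
    rw [List.map_cons, List.reverse_cons, List.flatMap_append, GateSet.runRaw_append,
      ih fun g hg' => hg g (List.mem_cons_of_mem _ hg'), List.flatMap_singleton]
    simp only [Nat.add_sub_cancel]
    rw [T.runRaw_block (by omega), hword _ h1, ← h2]
    rfl

/-- The quantum circuit has the output probabilities of the matchgate circuit. -/
theorem equiv_simulation {W : ℕ → U4} (hW : 𝓜.BackTable W)
    (hword : ∀ g < 𝓜.num2, wordGate T.Vt (word g) = W g) {L n : ℕ} (hL : 1 ≤ L) (hn : n ≤ 2 ^ L)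
    (c : Circuit 𝓜 n) (hc : c.IsNearestNeighbour) (x : Fin n → Fin 2) (k : Fin n) (xb : ℕ → Bool)
    (hx : ∀ l : Fin n, x l = toBit (xb l.val)) (d : Circuit 𝓠 (L + 3))
    (hraw : d.map GateApp.raw = T.simulation word L n k.val
      ((c.map GateApp.raw).map fun g => (g.1, g.2.1 + 1, g.2.2 + 1)) xb) :
    CircuitEquiv c x k d (fun _ => 0) 0 := by
  refine circuitEquiv_of_one (b := 1) ?_
  have hk : k.val < 2 ^ L := k.2.trans_le hn
  have hvalid : ∀ g ∈ c.map GateApp.raw, g.1 < 𝓜.num2 ∧ g.2.2 = g.2.1 + 1 ∧ g.2.2 < n := by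
    intro g hg
    obtain ⟨a, ha, rfl⟩ := List.mem_map.1 hg
    have hnn := hc a ha
    cases a with
    | one g i => exact hnn.elim
    | two g i j h => exact ⟨by simp [GateApp.raw, hW.1], hnn, j.2⟩
  set w := backAct W (c.map GateApp.raw) (deltaMode k.val 0) with hw
  have hrun := GateSet.run_lift d (ket fun _ => 0)
  rw [hraw, ket_lift (n := L + 3) fun _ => 0, simulation, GateSet.runRaw_append,
    GateSet.runRaw_append, T.runRaw_prologue hk, T.runRaw_blocks hword hn _ hvalid,
    T.runRaw_flipBlocks hL hn] at hrun
  rw [Circuit.outProb_eq_backAct hW c hc]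
  unfold Circuit.outProb
  rw [sum_norm_modeState hrun]
  refine Finset.sum_of_injOn (Fin.castLE hn) ((Fin.castLE_injective hn).injOn)
    (fun _ _ => Finset.mem_coe.2 (Finset.mem_univ _)) ?_ ?_
  · intro j _ hj
    have hjn : n ≤ j.val := by
      by_contra h
      exact hj ⟨⟨j.val, by omega⟩, Finset.mem_coe.2 (Finset.mem_univ _), rfl⟩
    have : w j.val = 0 := by
      refine backAct_eq_zero (n := n) (fun g hg => ?_) (fun i hi => ?_) hjn
      · have := hvalid g hg; omega
      · exact Pi.single_eq_of_ne (by have := k.2; omega) _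
    simp [show ¬j.val < n by omega, ← hw, this]
  · intro j _
    have e : (1 : Fin 2) + 1 = 0 := rfl
    simp only [Fin.val_castLE, j.2, true_and, e, ← hw, hx]
    cases xb j.val <;> simp [toBit, e]

end QubitTable

/-! ### The gate sets -/

/-- The words in controlled gates form a subgroup, hence all of `U(4)`. -/
theorem exists_word (U : U4) : ∃ l : List (Bool × Bool × U2),
    (l.map fun a => ctl a.1 (toBit a.2.1) a.2.2).prod = U := by
  let H : Subgroup U4 :=
    { carrier := {U | ∃ l : List (Bool × Bool × U2),
        (l.map fun a => ctl a.1 (toBit a.2.1) a.2.2).prod = U}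
      one_mem' := ⟨[], rfl⟩
      mul_mem' := by
        rintro _ _ ⟨l, rfl⟩ ⟨l', rfl⟩
        exact ⟨l ++ l', by simp⟩
      inv_mem' := by
        rintro _ ⟨l, rfl⟩
        refine ⟨l.reverse.map fun a => (a.1, a.2.1, a.2.2⁻¹), ?_⟩
        rw [List.prod_inv_reverse, List.map_map, List.map_map, List.map_reverse]
        simp [Function.comp_def] }
  exact mem_of_ctl_mem H (fun o s V => ⟨[(o, ofBit s, V)], by simp⟩) U

/-- Complex conjugation of the entries. -/
def conjU : U2 →* U2 where
  toFun V := ⟨V.1.map (starRingEnd ℂ), by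
    rw [Matrix.mem_unitaryGroup_iff]
    have h : star (V.1.map (starRingEnd ℂ)) = (star V.1).map (starRingEnd ℂ) := by
      ext i j; simp [Matrix.star_apply]
    rw [h, ← Matrix.map_mul, Matrix.mem_unitaryGroup_iff.1 V.2]
    simp⟩
  map_one' := Subtype.ext (by simp)
  map_mul' V W := Subtype.ext (by simp [Matrix.map_mul])

theorem conjU_conjU (V : U2) : conjU (conjU V) = V := Subtype.ext (by ext; simp [conjU])

/-- The action of a number-preserving matchgate on the creation and the annihilation operators. -/
theorem modeU_npGate (V : U2) : modeU (detU V) (pauliX * V * pauliX) =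
    ctl true 0 (conjU V) * ctl true 1 V := by
  have hV : V.1 * star V.1 = 1 := Matrix.mem_unitaryGroup_iff.1 V.2
  have h1 : star V.1 = star V.1.det • V.1.adjugate := by
    have h2 : V.1.adjugate = V.1.det • star V.1 := by
      calc V.1.adjugate = V.1.adjugate * (V.1 * star V.1) := by rw [hV, mul_one]
        _ = _ := by rw [← mul_assoc, Matrix.adjugate_mul, Matrix.smul_mul, one_mul]
    rw [h2, smul_smul, star_mul_self_of_norm (norm_det_eq_one V), one_smul]
  have h := fun i j => congrFun (congrFun h1 i) j
  simp only [Matrix.star_apply, Matrix.adjugate_fin_two, Matrix.smul_apply, smul_eq_mul,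
    Fin.forall_fin_two, Matrix.of_apply, Matrix.cons_val', Matrix.cons_val_zero,
    Matrix.cons_val_one, Matrix.cons_val_fin_one] at h
  obtain ⟨⟨a1, a2⟩, a3, a4⟩ := h
  simp only [RCLike.star_def] at a1 a2 a3 a4
  have hX : ∀ s t : Fin 2, (pauliX * V * pauliX).1 s t = V.1 (s + 1) (t + 1) := by
    intro s t
    fin_cases s <;> fin_cases t <;>
      simp only [Submonoid.coe_mul, Matrix.mul_apply, Fin.sum_univ_two] <;> simp [pauliX]
  have e2 : (1 : Fin 2) + 1 = 0 := rfl
  apply Subtype.ext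
  ext ⟨t, e⟩ ⟨t', e'⟩
  rw [Submonoid.coe_mul, ctl_coe, ctl_coe]
  change modeMat (detU V).1 (pauliX * V * pauliX).1 (t, e) (t', e') = _
  simp only [modeMat, Matrix.of_apply, hX, Matrix.mul_apply, Fintype.sum_prod_type,
    Fin.sum_univ_two]
  fin_cases t <;> fin_cases e <;> fin_cases t' <;> fin_cases e' <;>
    simp [detU, diagU, ctlMat, conjU, e2, a1, a2, a3, a4, mul_comm]

/-- A finite set of one-qubit gates that is closed under inverses and complex conjugation. -/
theorem exists_letters (S : List U2) : ∃ (K : ℕ) (Vt : Fin K → U2), (∀ V ∈ S, ∃ v, Vt v = V) ∧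
    (∀ v, ∃ w, Vt w = (Vt v)⁻¹) ∧ ∀ v, ∃ w, Vt w = conjU (Vt v) := by
  set l := S.flatMap fun V => [V, V⁻¹, conjU V, (conjU V)⁻¹] with hl
  have hget : ∀ V ∈ l, ∃ v : Fin l.length, l.get v = V := fun V h => List.mem_iff_get.1 h
  have hmem : ∀ V, V ∈ l ↔ ∃ U ∈ S, V = U ∨ V = U⁻¹ ∨ V = conjU U ∨ V = (conjU U)⁻¹ := by
    intro V
    simp [hl]
  refine ⟨l.length, l.get, fun V hV => hget V ((hmem V).2 ⟨V, hV, Or.inl rfl⟩),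
    fun v => hget _ ?_, fun v => hget _ ?_⟩ <;>
  obtain ⟨U, hU, h⟩ := (hmem _).1 (l.get_mem v) <;>
  refine (hmem _).2 ⟨U, hU, ?_⟩ <;>
  rcases h with h | h | h | h <;> rw [h] <;> simp [conjU_conjU]

theorem exists_sqrt_pauliX : ∃ V : U2, V * V = pauliX := by
  refine ⟨hadamard * phaseU (Real.pi / 2) * hadamard, ?_⟩
  calc _ = hadamard * phaseU (Real.pi / 2) * (hadamard * hadamard) * phaseU (Real.pi / 2) *
        hadamard := by group
    _ = pauliX := by
      rw [hadamard_mul_self, mul_one, mul_assoc hadamard, ← phaseU_add, add_halves,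
        hadamard_phase_pi]

/-- Gate sets for both simulations. The words of all given gates involve finitely many one-qubit
gates `Vt`; for each of them, and for the generators of a dense subgroup, a number preserving
matchgate is added to one set, a one-qubit gate and a controlled gate to the other. -/
theorem exists_gateSets (𝓜₀ 𝓠₀ : GateSet) (h𝓜₀ : 𝓜₀.IsMatchgateSet) :
    ∃ (𝓜 𝓠 : GateSet) (K : ℕ) (S : MatchTable 𝓜 K) (T : QubitTable 𝓠 K)
      (w : ℕ → List (Letter K)) (w' : ℕ → List (Bool × Bool × Fin K)),
      𝓜₀.Sub 𝓜 ∧ 𝓜.IsMatchgateUniversal ∧ 𝓠₀.Sub 𝓠 ∧ 𝓠.IsUniversal ∧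
      𝓠.WordTable S.Vt w ∧ ∀ g < 𝓜.num2, QubitTable.wordGate T.Vt (w' g) = S.W g := by
  choose A₀ B₀ hdet₀ hgate₀ using h𝓜₀.2
  obtain ⟨R, hR⟩ := exists_sqrt_pauliX
  -- `G(X, X)` excites two modes in the simulation, `G(H, H)` is needed for universality
  set A₁ : Fin (𝓜₀.num2 + 2) → U2 := Fin.append A₀ ![pauliX, hadamard] with hA₁
  set B₁ : Fin (𝓜₀.num2 + 2) → U2 := Fin.append B₀ ![pauliX, hadamard] with hB₁
  choose wM hwM using fun g => exists_word (modeU (A₁ g) (B₁ g))⁻¹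
  choose wQ hwQ using fun g => exists_word (𝓠₀.gate2 g)
  obtain ⟨K, Vt, hVt, hinv, hconj⟩ := exists_letters
    ([1, pauliX, R, hadamard, phaseU 1, phaseU (-1)] ++ List.ofFn 𝓠₀.gate1 ++
      (List.ofFn wM).flatten.map (fun a => a.2.2) ++ (List.ofFn wQ).flatten.map fun a => a.2.2)
  have hM : ∀ g, ∀ a ∈ wM g, ∃ v, Vt v = a.2.2 := fun g a ha => hVt _ (by
    simp only [List.mem_append, List.mem_map, List.mem_flatten, List.mem_ofFn]
    exact Or.inl (Or.inr ⟨a, ⟨_, ⟨g, rfl⟩, ha⟩, rfl⟩))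
  have hQ : ∀ g, ∀ a ∈ wQ g, ∃ v, Vt v = a.2.2 := fun g a ha => hVt _ (by
    simp only [List.mem_append, List.mem_map, List.mem_flatten, List.mem_ofFn]
    exact Or.inr ⟨a, ⟨_, ⟨g, rfl⟩, ha⟩, rfl⟩)
  have h1 : ∀ g, ∃ v, Vt v = 𝓠₀.gate1 g := fun g => hVt _ (by simp)
  obtain ⟨vI, hI⟩ := hVt 1 (by simp)
  obtain ⟨vX, hX⟩ := hVt pauliX (by simp)
  obtain ⟨vS, hS⟩ := hVt R (by simp)
  obtain ⟨vH, hH⟩ := hVt hadamard (by simp)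
  obtain ⟨vP, hP⟩ := hVt (phaseU 1) (by simp)
  obtain ⟨vN, hN⟩ := hVt (phaseU (-1)) (by simp)
  obtain ⟨vT, hT⟩ := hinv vS
  set A : Fin (𝓜₀.num2 + 2 + K) → U2 := Fin.append A₁ fun v => detU (Vt v) with hA
  set B : Fin (𝓜₀.num2 + 2 + K) → U2 := Fin.append B₁ fun v => pauliX * Vt v * pauliX with hB
  have hdet : ∀ g, (A g).1.det = (B g).1.det := by
    refine Fin.addCases (fun g => ?_) (fun v => ?_)
    · simp only [hA, hB, hA₁, hB₁, Fin.append_left]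
      induction g using Fin.addCases with
      | left g => simpa only [Fin.append_left] using hdet₀ g
      | right g => simp only [Fin.append_right]
    · simpa only [hA, hB, Fin.append_right] using det_npGate (Vt v)
  let 𝓜 : GateSet := ⟨0, 𝓜₀.num2 + 2 + K, Fin.elim0, fun g => mgU (A g) (B g)⟩
  let 𝓠 : GateSet := ⟨𝓠₀.num1 + K, 𝓠₀.num2 + K, Fin.append 𝓠₀.gate1 Vt,
    Fin.append 𝓠₀.gate2 fun v => ctl false 1 (Vt v)⟩
  let W : ℕ → U4 := fun g =>
    if h : g < 𝓜₀.num2 + 2 + K then (modeU (A ⟨g, h⟩) (B ⟨g, h⟩))⁻¹ else 1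
  have hWnp : ∀ v, W (𝓜₀.num2 + 2 + v.val) =
      (modeU (detU (Vt v)) (pauliX * Vt v * pauliX))⁻¹ := by
    intro v
    have hv : 𝓜₀.num2 + 2 + v.val < 𝓜₀.num2 + 2 + K := by omega
    have hA' : A ⟨_, hv⟩ = detU (Vt v) := Fin.append_right A₁ _ v
    have hB' : B ⟨_, hv⟩ = pauliX * Vt v * pauliX := Fin.append_right B₁ _ v
    simp only [W, dif_pos hv, hA', hB']
  have hnp : ∀ v, mgU (A (Fin.natAdd _ v)) (B (Fin.natAdd _ v)) = npGate (Vt v) := by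
    intro v
    simp only [hA, hB, Fin.append_right]
    rfl
  have hxx : ∀ j : Fin 2, mgU (A (Fin.castAdd K (Fin.natAdd 𝓜₀.num2 j)))
      (B (Fin.castAdd K (Fin.natAdd 𝓜₀.num2 j))) =
      mgU (![pauliX, hadamard] j) (![pauliX, hadamard] j) := by
    intro j
    simp only [hA, hB, hA₁, hB₁, Fin.append_left, Fin.append_right]
  have hq2 : ∀ v, 𝓠.gate2 (Fin.natAdd 𝓠₀.num2 v) = ctl false 1 (Vt v) := by
    intro v
    exact Fin.append_right 𝓠₀.gate2 (fun v => (ctl false 1 (Vt v) : U4)) v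
  have hq0 : ∀ g, 𝓠.gate2 (Fin.castAdd K g) = 𝓠₀.gate2 g := by
    intro g
    exact Fin.append_left 𝓠₀.gate2 (fun v => (ctl false 1 (Vt v) : U4)) g
  let S : MatchTable 𝓜 K :=
    { Vt := Vt, W := W, base := 𝓜₀.num2 + 2, vX := vX, vI := vI, hX := hX, hI := hI, hW := hWnp
      xx := 𝓜₀.num2
      hback := ⟨rfl, fun g => ⟨A g, B g, hdet g, rfl, by
        change W (0 + g.val) = _
        rw [zero_add]
        exact dif_pos g.2⟩⟩
      hgate := fun v => ⟨by change _ < 𝓜₀.num2 + 2 + K; omega, hnp v⟩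
      hxx := ⟨by change _ < 𝓜₀.num2 + 2 + K; omega, hxx 0⟩ }
  let T : QubitTable 𝓠 K :=
    { Vt := Vt, base1 := 𝓠₀.num1, base2 := 𝓠₀.num2, vX := vX, vS := vS, vT := vT, hX := hX
      hS := by rw [hS, hR]
      hT := by rw [hT, inv_mul_cancel]
      hone := fun v => ⟨by change _ < 𝓠₀.num1 + K; omega, Fin.append_right _ _ v⟩
      htwo := fun v => ⟨by change _ < 𝓠₀.num2 + K; omega, hq2 v⟩ }
  have q1 : ∀ v, 𝓠.Has1 (Vt v) := fun v => ⟨Fin.natAdd _ v, Fin.append_right _ _ v⟩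
  have q2 : ∀ v, 𝓠.Has2 (ctl false 1 (Vt v)) := fun v => ⟨Fin.natAdd _ v, hq2 v⟩
  have m2 : ∀ v, 𝓜.Has2 (npGate (Vt v)) := fun v => ⟨Fin.natAdd _ v, hnp v⟩
  -- the decompositions of the two-qubit gates
  have hword1 : ∀ g : Fin 𝓠.num1, ∃ v, (Vt v)⁻¹ = 𝓠.gate1 g := by
    refine Fin.addCases (fun g => ?_) (fun v => ?_)
    · obtain ⟨v, hv⟩ := h1 g
      obtain ⟨u, hu⟩ := hinv v
      exact ⟨u, by rw [hu, inv_inv, hv]; exact (Fin.append_left _ _ g).symm⟩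
    · obtain ⟨u, hu⟩ := hinv v
      exact ⟨u, by rw [hu, inv_inv]; exact (Fin.append_right _ _ v).symm⟩
  have hletters : ∀ l : List (Bool × Bool × U2), (∀ a ∈ l, ∃ v, Vt v = a.2.2) →
      ∃ l' : List (Bool × Bool × Fin K), l'.map (fun a => (a.1, a.2.1, Vt a.2.2)) = l := by
    intro l hl
    have : l ∈ Set.range (List.map fun a : Bool × Bool × Fin K => (a.1, a.2.1, Vt a.2.2)) := by
      rw [Set.range_list_map]
      rintro ⟨o, s, V⟩ ha
      obtain ⟨v, rfl⟩ := hl _ ha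
      exact ⟨(o, s, v), rfl⟩
    exact this
  have hword2 : ∀ g : Fin 𝓠.num2, ∃ l : List (Letter K), (∀ a ∈ l, a.1 ≠ 2) ∧
      (l.map fun a => ctl (decide (a.1 = 1)) (toBit a.2.1) (Vt a.2.2)⁻¹).prod = 𝓠.gate2 g := by
    have key : ∀ l : List (Bool × Bool × U2), (∀ a ∈ l, ∃ v, Vt v = a.2.2) →
        ∃ l' : List (Letter K), (∀ a ∈ l', a.1 ≠ 2) ∧
          (l'.map fun a => ctl (decide (a.1 = 1)) (toBit a.2.1) (Vt a.2.2)⁻¹).prod =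
            (l.map fun a => ctl a.1 (toBit a.2.1) a.2.2).prod := by
      intro l hl
      obtain ⟨l', rfl⟩ := hletters l hl
      choose f hf using hinv
      refine ⟨l'.map fun a => (if a.1 then 1 else 0, a.2.1, f a.2.2), ?_, ?_⟩
      · intro a ha
        obtain ⟨b, -, rfl⟩ := List.mem_map.1 ha
        simp only
        split_ifs <;> decide
      · rw [List.map_map, List.map_map]
        congr 1
        refine List.map_congr_left fun a _ => ?_
        obtain ⟨o, s, v⟩ := a
        cases o <;> simp [hf]
    refine Fin.addCases (fun g => ?_) (fun v => ?_)
    · obtain ⟨l, h2, h3⟩ := key _ (hQ g)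
      exact ⟨l, h2, by rw [h3, hwQ]; exact (hq0 g).symm⟩
    · obtain ⟨l, h2, h3⟩ := key [(false, true, Vt v)] (by simp)
      refine ⟨l, h2, ?_⟩
      rw [h3, List.map_singleton, List.prod_singleton]
      exact (hq2 v).symm
  have hword3 : ∀ g : Fin 𝓜.num2, ∃ l : List (Bool × Bool × Fin K),
      QubitTable.wordGate Vt l = (modeU (A g) (B g))⁻¹ := by
    refine Fin.addCases (fun g => ?_) (fun v => ?_)
    · obtain ⟨l, hl⟩ := hletters _ (hM g)
      refine ⟨l.reverse, ?_⟩
      simp only [hA, hB, Fin.append_left]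
      rw [← hwM, ← hl, QubitTable.wordGate, List.reverse_reverse, List.map_map]
      rfl
    · obtain ⟨u, hu⟩ := hinv v
      obtain ⟨u', hu'⟩ := hconj u
      refine ⟨[(true, false, u'), (true, true, u)], ?_⟩
      simp only [hA, hB, Fin.append_right]
      rw [modeU_npGate, mul_inv_rev, ← map_inv, ← map_inv, ← map_inv, ← hu, ← hu']
      simp [QubitTable.wordGate, toBit]
  choose w1 hw1 using hword1
  choose w2 hw2 using hword2
  choose w3 hw3 using hword3
  refine ⟨𝓜, 𝓠, K, S, T, fun g => if h : g < 𝓠.num1 then [(2, false, w1 ⟨g, h⟩)] else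
      if h : g - 𝓠.num1 < 𝓠.num2 then w2 ⟨g - 𝓠.num1, h⟩ else [],
    fun g => if h : g < 𝓜.num2 then w3 ⟨g, h⟩ else [], ⟨?_, ?_⟩, ?_, ⟨?_, ?_⟩, ?_, ⟨?_, ?_⟩, ?_⟩
  · rintro _ ⟨g, -⟩
    exact (Fin.cast h𝓜₀.1 g).elim0
  · rintro _ ⟨g, rfl⟩
    refine ⟨Fin.castAdd K (Fin.castAdd 2 g), Subtype.ext ?_⟩
    rw [hgate₀]
    change matchgate (A _).1 (B _).1 = _
    simp only [hA, hB, hA₁, hB₁, Fin.append_left]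
  · exact GateSet.isMatchgateUniversal_of_has ⟨hH ▸ m2 vH, hP ▸ m2 vP, hN ▸ m2 vN⟩ ⟨_, hxx 1⟩
  · rintro _ ⟨g, rfl⟩
    exact ⟨Fin.castAdd K g, Fin.append_left _ _ g⟩
  · rintro _ ⟨g, rfl⟩
    exact ⟨Fin.castAdd K g, hq0 g⟩
  · exact GateSet.isUniversal_of_has (hX ▸ q1 vX) ⟨hH ▸ q1 vH, hP ▸ q1 vP, hN ▸ q1 vN⟩
      ⟨hH ▸ q2 vH, hP ▸ q2 vP, hN ▸ q2 vN⟩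
  · exact fun g => ⟨w1 g, dif_pos g.2, hw1 g⟩
  · intro g
    have h2 : ¬𝓠.num1 + g.val < 𝓠.num1 := by omega
    have h3 : 𝓠.num1 + g.val - 𝓠.num1 = g.val := by omega
    simp only [h2, dif_neg, not_false_eq_true, h3, g.2, dif_pos]
    exact hw2 g
  · intro g hg
    simp only [hg, dif_pos]
    rw [hw3]
    symm
    exact dif_pos hg

/-! ### Families of expressions and programs -/

/-- The numbers `f a` are the values of a single expression on the tuples `v a`, and its evaluation
takes place within a bound that is linear in `b a`. -/
def ExpC {α : Type} (b : α → ℕ) (v : α → List ℕ) (f : α → ℕ) : Prop :=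
  ∃ (e : Exp) (c : ℕ), ∀ a, e.eval (v a) = f a ∧ e.Bdd (c * (b a + 1)) (v a)

/-- The strings `F a` are written by a single program on the tuples `v a`, within a bound that is
linear in `b a`. -/
def ProgC {α : Type} (b : α → ℕ) (v : α → List ℕ) (F : α → List Bool) : Prop :=
  ∃ (p : Prog) (c : ℕ), ∀ a, p.eval (v a) = F a ∧ p.Bdd (c * (b a + 1)) (v a)

theorem toNat_ne_zero (s : Bool) : s.toNat ≠ 0 ↔ s = true := by cases s <;> simp

theorem Exp.Bdd.mono {B B' : ℕ} (h : B ≤ B') {e : Exp} : ∀ {v}, e.Bdd B v → e.Bdd B' v := by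
  induction e with
  | var j => exact fun h1 => le_trans h1 h
  | zero => exact fun _ => trivial
  | succ e ih => exact fun h1 => ⟨ih h1.1, h1.2.trans h⟩
  | pred e ih => exact fun h1 => ih h1
  | ite c a b ihc iha ihb =>
    rintro v ⟨h1, h2⟩
    refine ⟨ihc h1, ?_⟩
    split_ifs at h2 ⊢
    · exact iha h2
    · exact ihb h2
  | fold i c s ihi ihc ihs => exact fun h1 => ⟨ihi h1.1, ihc h1.2.1, fun n hn => ihs (h1.2.2 n hn)⟩
  | call f a b ihf iha ihb => exact fun h1 => ⟨iha h1.1, ihb h1.2.1, ihf h1.2.2⟩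

theorem Prog.Bdd.mono {B B' : ℕ} (h : B ≤ B') {p : Prog} : ∀ {v}, p.Bdd B v → p.Bdd B' v := by
  induction p with
  | skip => exact fun _ => trivial
  | out b => exact fun _ => trivial
  | seq p q ihp ihq => exact fun h1 => ⟨ihp h1.1, ihq h1.2⟩
  | ite e p q ihp ihq =>
    rintro v ⟨h1, h2⟩
    refine ⟨h1.mono h, ?_⟩
    split_ifs at h2 ⊢
    · exact ihp h2
    · exact ihq h2
  | rep e p ih => exact fun h1 => ⟨h1.1.mono h, fun i hi => ih (h1.2 i hi)⟩
  | call a b c p ih =>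
    exact fun h1 => ⟨h1.1.mono h, h1.2.1.mono h, h1.2.2.1.mono h, ih h1.2.2.2⟩

namespace ExpC

variable {α β : Type} {b : α → ℕ} {v : α → List ℕ} {f x y z : α → ℕ}

theorem exists_le (h : ExpC b v f) : ∃ c, ∀ a, f a ≤ c * (b a + 1) := by
  obtain ⟨e, c, h⟩ := h
  exact ⟨c, fun a => (h a).1 ▸ e.eval_le _ (h a).2⟩

theorem of_eq (h : ExpC b v f) (hf : ∀ a, f a = x a) : ExpC b v x := funext hf ▸ h

theorem var (j : ℕ) (h : ∀ a, (v a).getD j 0 = f a) (hb : ∀ a, f a ≤ b a) : ExpC b v f :=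
  ⟨.var j, 1, fun a => ⟨h a, by
    change (v a).getD j 0 ≤ _
    rw [h a]; have := hb a; omega⟩⟩

theorem succ (h : ExpC b v f) : ExpC b v fun a => f a + 1 := by
  obtain ⟨e, c, h⟩ := h
  refine ⟨.succ e, c + 1, fun a => ⟨by simp [Exp.eval, (h a).1], ?_⟩⟩
  have hm : c * (b a + 1) ≤ (c + 1) * (b a + 1) := Nat.mul_le_mul_right _ (by omega)
  refine ⟨(h a).2.mono hm, (Nat.add_le_add_right (e.eval_le _ (h a).2) 1).trans ?_⟩
  rw [add_mul]; omega

theorem pred (h : ExpC b v f) : ExpC b v fun a => f a - 1 := by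
  obtain ⟨e, c, h⟩ := h
  exact ⟨.pred e, c, fun a => ⟨by simp [Exp.eval, (h a).1], (h a).2⟩⟩

theorem const (n : ℕ) : ExpC b v fun _ => n := by
  induction n with
  | zero => exact ⟨.zero, 0, fun a => ⟨rfl, trivial⟩⟩
  | succ n ih => exact ih.succ

theorem ite (hz : ExpC b v z) (hx : ExpC b v x) (hy : ExpC b v y) :
    ExpC b v fun a => if z a ≠ 0 then x a else y a := by
  obtain ⟨e1, c1, h1⟩ := hz
  obtain ⟨e2, c2, h2⟩ := hx
  obtain ⟨e3, c3, h3⟩ := hy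
  refine ⟨.ite e1 e2 e3, c1 + c2 + c3, fun a => ⟨by simp [Exp.eval, (h1 a).1, (h2 a).1, (h3 a).1],
    (h1 a).2.mono (Nat.mul_le_mul_right _ (by omega)), ?_⟩⟩
  split_ifs
  · exact (h2 a).2.mono (Nat.mul_le_mul_right _ (by omega))
  · exact (h3 a).2.mono (Nat.mul_le_mul_right _ (by omega))

/-- Composition with a fixed function of two numbers, computed in space linear in their lengths.
-/
theorem comp {g : ℕ → ℕ → ℕ}
    (hg : ExpC (fun p : ℕ × ℕ => p.1 + p.2) (fun p => [p.1, p.2]) fun p => g p.1 p.2)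
    (hx : ExpC b v x) (hy : ExpC b v y) : ExpC b v fun a => g (x a) (y a) := by
  obtain ⟨e, c, h⟩ := hg
  obtain ⟨e1, c1, h1⟩ := hx
  obtain ⟨e2, c2, h2⟩ := hy
  refine ⟨.call e e1 e2, c * (c1 + c2 + 1) + c1 + c2, fun a => ⟨?_, ?_, ?_, ?_⟩⟩
  · simp only [Exp.eval, (h1 a).1, (h2 a).1, (h (x a, y a)).1]
  · exact (h1 a).2.mono (Nat.mul_le_mul_right _ (by omega))
  · exact (h2 a).2.mono (Nat.mul_le_mul_right _ (by omega))
  · have l1 := e1.eval_le _ (h1 a).2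
    have l2 := e2.eval_le _ (h2 a).2
    rw [(h1 a).1] at l1 ⊢
    rw [(h2 a).1] at l2 ⊢
    refine (h (x a, y a)).2.mono ?_
    calc c * (x a + y a + 1) ≤ c * (c1 * (b a + 1) + c2 * (b a + 1) + (b a + 1)) :=
          Nat.mul_le_mul_left _ (by omega)
      _ = c * (c1 + c2 + 1) * (b a + 1) := by ring
      _ ≤ _ := Nat.mul_le_mul_right _ (by omega)

/-- Recursion of length `N a`, all of whose values are bounded by `k * (b a + 1)`. -/
theorem fold {i N : α → ℕ} {S : ℕ → ℕ → α → ℕ} (hi : ExpC b v i) (hN : ExpC b v N)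
    (hS : ExpC (fun p : ℕ × ℕ × α => p.1 + p.2.1 + b p.2.2) (fun p => p.1 :: p.2.1 :: v p.2.2)
      fun p => S p.1 p.2.1 p.2.2) (r : α → ℕ → ℕ) (h0 : ∀ a, r a 0 = i a)
    (hr : ∀ a n, r a (n + 1) = S n (r a n) a) (k : ℕ) (hk : ∀ a, ∀ n ≤ N a, r a n ≤ k * (b a + 1)) :
    ExpC b v fun a => r a (N a) := by
  obtain ⟨e, c, h⟩ := hS
  obtain ⟨e1, c1, h1⟩ := hi
  obtain ⟨e2, c2, h2⟩ := hN
  have key : ∀ a n, Nat.rec (e1.eval (v a)) (fun n acc => e.eval (n :: acc :: v a)) n = r a n := by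
    intro a n
    induction n with
    | zero => exact (h1 a).1.trans (h0 a).symm
    | succ n ih =>
      exact (congrArg (fun m => e.eval (n :: m :: v a)) ih).trans
        ((h (n, r a n, a)).1.trans (hr a n).symm)
  refine ⟨.fold e1 e2 e, c1 + c2 + c * (c2 + k + 1), fun a => ⟨?_, ?_, ?_, fun n hn => ?_⟩⟩
  · simp only [Exp.eval, (h2 a).1]
    exact key _ _
  · exact (h1 a).2.mono (Nat.mul_le_mul_right _ (by omega))
  · exact (h2 a).2.mono (Nat.mul_le_mul_right _ (by omega))
  · have l2 := e2.eval_le _ (h2 a).2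
    rw [(h2 a).1] at hn l2
    have l3 := hk a n hn.le
    rw [key]
    refine (h (n, r a n, a)).2.mono ?_
    calc c * (n + r a n + b a + 1) ≤ c * (c2 * (b a + 1) + k * (b a + 1) + (b a + 1)) :=
          Nat.mul_le_mul_left _ (by omega)
      _ = c * (c2 + k + 1) * (b a + 1) := by ring
      _ ≤ _ := Nat.mul_le_mul_right _ (by omega)

/-- A function of two numbers that is defined by recursion in the second one. -/
theorem recursion (g : ℕ → ℕ → ℕ) {S : ℕ → ℕ → ℕ → ℕ}
    (h0 : ExpC (fun p : ℕ × ℕ => p.1 + p.2) (fun p => [p.1, p.2]) fun p => g p.1 0)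
    (hS : ExpC (fun p : ℕ × ℕ × ℕ × ℕ => p.1 + p.2.1 + (p.2.2.1 + p.2.2.2))
      (fun p => [p.1, p.2.1, p.2.2.1, p.2.2.2]) fun p => S p.1 p.2.1 p.2.2.1)
    (hg : ∀ x n, g x (n + 1) = S n (g x n) x) (hb : ∀ x n, g x n ≤ x + n + 1)
    (hx : ExpC b v x) (hy : ExpC b v y) : ExpC b v fun a => g (x a) (y a) := by
  refine comp ?_ hx hy
  exact fold (α := ℕ × ℕ) (N := fun p => p.2) (S := fun n r p => S n r p.1) h0
    (.var 1 (fun _ => rfl) fun p => by omega) hS (fun p n => g p.1 n) (fun _ => rfl)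
    (fun p n => hg p.1 n) 1 fun p n hn => (hb p.1 n).trans (by omega)

theorem add (hx : ExpC b v x) (hy : ExpC b v y) : ExpC b v fun a => x a + y a :=
  recursion (fun x y => x + y) (S := fun _ r _ => r + 1) (.var 0 (fun _ => rfl) fun _ => by omega)
    (ExpC.succ (.var 1 (fun _ => rfl) fun _ => by omega)) (fun _ _ => rfl) (fun _ _ => by omega)
    hx hy

theorem sub (hx : ExpC b v x) (hy : ExpC b v y) : ExpC b v fun a => x a - y a :=
  recursion (fun x y => x - y) (S := fun _ r _ => r - 1) (.var 0 (fun _ => rfl) fun _ => by omega)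
    (ExpC.pred (.var 1 (fun _ => rfl) fun _ => by omega)) (fun _ _ => rfl) (fun _ _ => by omega)
    hx hy

theorem two_mul (hx : ExpC b v x) : ExpC b v fun a => 2 * x a :=
  (hx.add hx).of_eq fun _ => (Nat.two_mul _).symm

theorem half (hx : ExpC b v x) : ExpC b v fun a => x a / 2 :=
  -- `(n + 1) / 2 = n - n / 2`
  recursion (fun _ y => y / 2) (S := fun n r _ => n - r) (const 0)
    (.sub (.var 0 (fun _ => rfl) fun _ => by omega) (.var 1 (fun _ => rfl) fun _ => by omega))
    (fun _ _ => by omega) (fun _ _ => by omega) hx hx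

theorem shift (hx : ExpC b v x) (hy : ExpC b v y) : ExpC b v fun a => x a / 2 ^ y a :=
  recursion (fun x y => x / 2 ^ y) (S := fun _ r _ => r / 2)
    (ExpC.of_eq (.var 0 (fun _ => rfl) fun p => Nat.le_add_right p.1 p.2) fun _ => by simp)
    (half (.var 1 (fun _ => rfl) fun _ => by omega))
    (fun _ n => by rw [pow_succ, Nat.div_div_eq_div_mul])
    (fun x n => by have := Nat.div_le_self x (2 ^ n); omega) hx hy

/-- The value of a bit as a number. -/
theorem bit (hx : ExpC b v x) (hy : ExpC b v y) :
    ExpC b v fun a => ((x a).testBit (y a)).toNat := by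
  have hs := hx.shift hy
  refine (hs.sub (hs.half.two_mul)).of_eq fun a => ?_
  rw [Nat.testBit_eq_decide_div_mod_eq]
  generalize x a / 2 ^ y a = q
  by_cases h : q % 2 = 1
  · simp [h]; omega
  · simp [h]; omega

theorem iteEq (hx : ExpC b v x) (hy : ExpC b v y) (hz : ExpC b v z) (hf : ExpC b v f) :
    ExpC b v fun a => if x a = y a then z a else f a := by
  refine (((hx.sub hy).add (hy.sub hx)).ite hf hz).of_eq fun a => ?_
  split_ifs <;> omega

theorem eq (hx : ExpC b v x) (hy : ExpC b v y) :
    ExpC b v fun a => if x a = y a then 1 else 0 := hx.iteEq hy (const 1) (const 0)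

theorem pow (hx : ExpC b v x) (c : ℕ) (hc : ∀ a, 2 ^ x a ≤ c * (b a + 1)) :
    ExpC b v fun a => 2 ^ x a :=
  fold (S := fun _ r _ => r + r) (const 1) hx
    (.add (.var 1 (fun _ => rfl) fun _ => by omega) (.var 1 (fun _ => rfl) fun _ => by omega))
    (fun _ n => 2 ^ n) (fun _ => rfl) (fun _ n => by rw [pow_succ]; omega) c
    fun a n hn => (Nat.pow_le_pow_right (by norm_num) hn).trans (hc a)

/-- The number of binary digits counts the numbers `s` with `2 ^ s ≤ x`. -/
theorem size (hx : ExpC b v x) : ExpC b v fun a => Nat.size (x a) := by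
  have hs : ∀ n, Nat.size n ≤ n := fun n => Nat.size_le.2 Nat.lt_two_pow_self
  have hr : ExpC (fun p : ℕ × ℕ × ℕ × ℕ => p.1 + p.2.1 + (p.2.2.1 + p.2.2.2))
      (fun p => [p.1, p.2.1, p.2.2.1, p.2.2.2]) fun p => p.2.1 :=
    .var 1 (fun _ => rfl) fun _ => by omega
  refine (recursion (fun x n => min n (Nat.size x))
    (S := fun _ r x => if x / 2 ^ r ≠ 0 then r + 1 else r) ((const 0).of_eq fun _ => by simp)
    (.ite (.shift (.var 2 (fun _ => rfl) fun _ => by omega) hr) hr.succ hr) (fun x n => ?_)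
    (fun x n => by omega) hx hx).of_eq fun a => min_eq_right (hs _)
  have h : x / 2 ^ min n (Nat.size x) ≠ 0 ↔ min n (Nat.size x) < Nat.size x := by
    rw [Nat.lt_size, ← Nat.pos_iff_ne_zero, Nat.div_pos_iff]
    simp
  simp only [h]
  split_ifs <;> omega

end ExpC

namespace ProgC

variable {α β : Type} {b : α → ℕ} {v : α → List ℕ} {x y z : α → ℕ} {F G : α → List Bool}

theorem of_eq (h : ProgC b v F) (hf : ∀ a, F a = G a) : ProgC b v G := funext hf ▸ h

theorem append (hF : ProgC b v F) (hG : ProgC b v G) : ProgC b v fun a => F a ++ G a := by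
  obtain ⟨p, c, hp⟩ := hF
  obtain ⟨q, d, hq⟩ := hG
  exact ⟨.seq p q, c + d, fun a => ⟨by simp [Prog.eval, (hp a).1, (hq a).1],
    (hp a).2.mono (Nat.mul_le_mul_right _ (by omega)),
    (hq a).2.mono (Nat.mul_le_mul_right _ (by omega))⟩⟩

theorem const (w : List Bool) : ProgC b v fun _ => w := by
  induction w with
  | nil => exact ⟨.skip, 0, fun _ => ⟨rfl, trivial⟩⟩
  | cons s w ih => exact ProgC.append (F := fun _ => [s]) ⟨.out s, 0, fun _ => ⟨rfl, trivial⟩⟩ ih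

theorem ite (P : α → Prop) [DecidablePred P] (hx : ExpC b v x) (hP : ∀ a, x a ≠ 0 ↔ P a)
    (hF : ProgC b v F) (hG : ProgC b v G) : ProgC b v fun a => if P a then F a else G a := by
  obtain ⟨e, c, he⟩ := hx
  obtain ⟨p, d, hp⟩ := hF
  obtain ⟨q, k, hq⟩ := hG
  refine ⟨.ite e p q, c + d + k, fun a => ⟨?_, (he a).2.mono (Nat.mul_le_mul_right _ (by omega)),
    ?_⟩⟩
  · simp only [Prog.eval, (he a).1, (hp a).1, (hq a).1, hP]
  · split_ifs
    · exact (hp a).2.mono (Nat.mul_le_mul_right _ (by omega))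
    · exact (hq a).2.mono (Nat.mul_le_mul_right _ (by omega))

theorem rep {N : α → ℕ} {F : ℕ → α → List Bool} (hN : ExpC b v N)
    (hF : ProgC (fun p : {p : ℕ × α // p.1 < N p.2} => b p.1.2) (fun p => p.1.1 :: v p.1.2)
      fun p => F p.1.1 p.1.2) : ProgC b v fun a => (List.range (N a)).flatMap fun i => F i a := by
  obtain ⟨e, c, he⟩ := hN
  obtain ⟨p, d, hp⟩ := hF
  refine ⟨.rep e p, c + d, fun a => ⟨?_, (he a).2.mono (Nat.mul_le_mul_right _ (by omega)),
    fun i hi => ?_⟩⟩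
  · simp only [Prog.eval, (he a).1]
    exact List.flatMap_congr fun i hi => (hp ⟨(i, a), List.mem_range.1 hi⟩).1
  · rw [(he a).1] at hi
    exact (hp ⟨(i, a), hi⟩).2.mono (Nat.mul_le_mul_right _ (by omega))

theorem call (hx : ExpC b v x) (hy : ExpC b v y) (hz : ExpC b v z)
    (hF : ProgC b (fun a => [x a, y a, z a]) F) : ProgC b v F := by
  obtain ⟨e1, c1, h1⟩ := hx
  obtain ⟨e2, c2, h2⟩ := hy
  obtain ⟨e3, c3, h3⟩ := hz
  obtain ⟨p, d, hp⟩ := hF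
  refine ⟨.call e1 e2 e3 p, c1 + c2 + c3 + d, fun a => ⟨?_,
    (h1 a).2.mono (Nat.mul_le_mul_right _ (by omega)),
    (h2 a).2.mono (Nat.mul_le_mul_right _ (by omega)),
    (h3 a).2.mono (Nat.mul_le_mul_right _ (by omega)), ?_⟩⟩ <;>
  simp only [Prog.eval, (h1 a).1, (h2 a).1, (h3 a).1]
  · exact (hp a).1
  · exact (hp a).2.mono (Nat.mul_le_mul_right _ (by omega))

/-- A program that depends on a number below a fixed bound. -/
theorem table {F : ℕ → α → List Bool} (hx : ExpC b v x) (hF : ∀ i, ProgC b v (F i)) (N : ℕ)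
    (hN : ∀ a, x a < N) : ProgC b v fun a => F (x a) a := by
  have key : ∀ N, ProgC b v fun a => if x a < N then F (x a) a else [] := by
    intro N
    induction N with
    | zero => exact (const []).of_eq fun a => by simp
    | succ N ih =>
      refine (ProgC.ite (fun a => x a = N) (hx.eq (ExpC.const N)) (fun a => by split_ifs <;> simp_all)
        (hF N) ih).of_eq fun a => ?_
      by_cases h : x a = N
      · simp [h]
      · simp [h, show x a < N + 1 ↔ x a < N by omega]
  exact (key N).of_eq fun a => if_pos (hN a)

theorem bits (hx : ExpC b v x) : ProgC b v fun a => encodeField (Nat.bits (x a)) := by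
  obtain ⟨c, hc⟩ := hx.exists_le
  have hb : ∀ n : ℕ, n.bits = (List.range n.size).map n.testBit := by
    intro n
    refine List.ext_getElem (by simp [Nat.size_eq_bits_len]) fun i h1 h2 => ?_
    rw [List.getElem_map, List.getElem_range, Nat.testBit_eq_inth, List.getI_eq_getElem _ h1]
  have h0 : ProgC (fun n : ℕ => n) (fun n => [n, 0, 0]) fun n => encodeField (Nat.bits n) := by
    have hn : ExpC (fun n : ℕ => n) (fun n => [n, 0, 0]) fun n => n :=
      .var 0 (fun _ => rfl) fun _ => le_rfl
    refine (ProgC.append (ProgC.rep (F := fun i n => [false, n.testBit i]) hn.size ?_)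
      (const [true, true])).of_eq fun n => ?_
    · refine ProgC.append (F := fun _ => [false]) (const _) ((ProgC.ite
        (fun p : {p : ℕ × ℕ // p.1 < Nat.size p.2} => p.1.2.testBit p.1.1)
        (.bit (.var 1 (fun _ => rfl) fun _ => le_rfl) (.var 0 (fun _ => rfl) fun p => ?_))
        (fun p => toNat_ne_zero _) (const [true])
        (const [false])).of_eq fun p => by
          by_cases h : p.1.2.testBit p.1.1 = true <;> simp [h])
      exact p.2.le.trans (Nat.size_le.2 Nat.lt_two_pow_self)
    · rw [encodeField, hb n, List.flatMap_map]
  obtain ⟨p, d, hp⟩ := h0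
  refine call hx (ExpC.const 0) (ExpC.const 0) ⟨p, d * (c + 1), fun a => ⟨(hp (x a)).1,
    (hp (x a)).2.mono ?_⟩⟩
  rw [mul_assoc]
  refine Nat.mul_le_mul_left _ ?_
  have := hc a
  change x a + 1 ≤ _
  rw [add_mul]; omega

end ProgC

/-! ### Programs that write circuits -/

/-- The circuits `G a`, with lines numbered from `0`, are written by a single program. -/
def GateC {α : Type} (b : α → ℕ) (v : α → List ℕ) (G : α → List (ℕ × ℕ × ℕ)) : Prop :=
  ProgC b v fun a => (G a).flatMap fun g => Frag.encGate (g.1, g.2.1 + 1, g.2.2 + 1)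

/-- The type of the values of a loop variable, together with the remaining data. -/
abbrev Below {α : Type} (N : α → ℕ) : Type := {p : ℕ × α // p.1 < N p.2}

/-- Expressions in the body of a loop. -/
abbrev ExpIn {α : Type} (b : α → ℕ) (v : α → List ℕ) (N : α → ℕ) (x : Below N → ℕ) : Prop :=
  ExpC (fun p : Below N => b p.1.2) (fun p => p.1.1 :: v p.1.2) x

namespace GateC

variable {α : Type} {b : α → ℕ} {v : α → List ℕ} {x y z : α → ℕ} {G H : α → List (ℕ × ℕ × ℕ)}

theorem of_eq (h : GateC b v G) (hf : ∀ a, G a = H a) : GateC b v H := funext hf ▸ h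

theorem nil : GateC b v fun _ => [] := ProgC.const []

theorem append (hG : GateC b v G) (hH : GateC b v H) : GateC b v fun a => G a ++ H a :=
  (ProgC.append hG hH).of_eq fun _ => List.flatMap_append.symm

theorem single (hx : ExpC b v x) (hy : ExpC b v y) (hz : ExpC b v z) :
    GateC b v fun a => [(x a, y a, z a)] :=
  ((ProgC.const [true, false]).append ((ProgC.bits hx).append ((ProgC.bits hy.succ).append
    (ProgC.bits hz.succ)))).of_eq fun a => by simp [Frag.encGate, encodeTuple]

theorem ite (P : α → Prop) [DecidablePred P] (hx : ExpC b v x) (hP : ∀ a, x a ≠ 0 ↔ P a)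
    (hG : GateC b v G) (hH : GateC b v H) : GateC b v fun a => if P a then G a else H a :=
  (ProgC.ite P hx hP hG hH).of_eq fun a => by dsimp only; split_ifs <;> rfl

theorem rep {N : α → ℕ} {G : ℕ → α → List (ℕ × ℕ × ℕ)} (hN : ExpC b v N)
    (hG : GateC (fun p : Below N => b p.1.2) (fun p => p.1.1 :: v p.1.2)
      fun p => G p.1.1 p.1.2) : GateC b v fun a => (List.range (N a)).flatMap fun i => G i a := by
  have h : ProgC b v fun a => (List.range (N a)).flatMap fun i =>
      (G i a).flatMap fun g => Frag.encGate (g.1, g.2.1 + 1, g.2.2 + 1) := by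
    apply ProgC.rep hN
    exact hG
  refine h.of_eq fun a => ?_
  rw [List.flatMap_assoc]

theorem repMap {N : α → ℕ} {x y z : ℕ → α → ℕ} (hN : ExpC b v N)
    (hx : ExpIn b v N fun p => x p.1.1 p.1.2) (hy : ExpIn b v N fun p => y p.1.1 p.1.2)
    (hz : ExpIn b v N fun p => z p.1.1 p.1.2) :
    GateC b v fun a => (List.range (N a)).map fun i => (x i a, y i a, z i a) :=
  (rep (G := fun i a => [(x i a, y i a, z i a)]) hN (single hx hy hz)).of_eq fun _ =>
    (List.map_eq_flatMap).symm

theorem ofList {β : Type} {G : β → α → List (ℕ × ℕ × ℕ)} (h : ∀ c, GateC b v (G c)) (l : List β) :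
    GateC b v fun a => l.flatMap fun c => G c a := by
  induction l with
  | nil => exact nil
  | cons c l ih => exact ((h c).append ih).of_eq fun a => by rw [List.flatMap_cons]

end GateC

namespace QubitTable

variable {𝓠 : GateSet} {K : ℕ} (T : QubitTable 𝓠 K) {α : Type} {b : α → ℕ} {v : α → List ℕ}

theorem gateC_flip {x : α → ℕ} (hx : ExpC b v x) : GateC b v fun a => [T.flip (x a)] :=
  .single (.const _) hx hx

theorem gateC_cgate (u : Fin K) {x y : α → ℕ} (hx : ExpC b v x) (hy : ExpC b v y) :
    GateC b v fun a => [T.cgate u (x a) (y a)] :=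
  .single (.const _) hx hy

theorem gateC_toffoli {x y z : α → ℕ} (hx : ExpC b v x) (hy : ExpC b v y) (hz : ExpC b v z) :
    GateC b v fun a => T.toffoli (x a) (y a) (z a) :=
  (((((T.gateC_cgate _ hy hz).append (T.gateC_cgate _ hx hy)).append
    (T.gateC_cgate _ hy hz)).append (T.gateC_cgate _ hx hy)).append (T.gateC_cgate _ hx hz))

theorem gateC_chain {c d : α → ℕ → ℕ} {r : α → ℕ}
    (hc : ∀ (N : α → ℕ) x, ExpIn b v N x → ExpIn b v N fun p => c p.1.2 (x p))
    (hd : ∀ (N : α → ℕ) x, ExpIn b v N x → ExpIn b v N fun p => d p.1.2 (x p))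
    (h0 : ExpC b v fun a => d a 0) (hr : ExpC b v r) (hr' : ExpIn b v r fun p => r p.1.2)
    (hb : ∀ a, r a ≤ b a) : GateC b v fun a => T.chain (c a) (d a) (r a) := by
  have hk : ExpIn b v r fun p => p.1.1 :=
    .var 0 (fun _ => rfl) fun p => p.2.le.trans (hb _)
  have h1 := GateC.rep (G := fun k a => T.toffoli (d a (r a - k - 1)) (c a (r a - k))
    (d a (r a - k))) hr (T.gateC_toffoli (hd _ _ (hr'.sub hk).pred) (hc _ _ (hr'.sub hk))
      (hd _ _ (hr'.sub hk)))
  have h2 := GateC.rep (G := fun k a => T.toffoli (d a k) (c a (k + 1)) (d a (k + 1))) hr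
    (T.gateC_toffoli (hd _ _ hk) (hc _ _ hk.succ) (hd _ _ hk.succ))
  exact (h1.append ((T.gateC_flip h0).append h2)).of_eq fun a => (T.chain_eq _ _ _).symm

theorem gateC_andToggle {c d : α → ℕ → ℕ} {r : α → ℕ}
    (hc : ∀ (N : α → ℕ) x, ExpIn b v N x → ExpIn b v N fun p => c p.1.2 (x p))
    (hd : ∀ (N : α → ℕ) x, ExpIn b v N x → ExpIn b v N fun p => d p.1.2 (x p))
    (h0 : ExpC b v fun a => d a 0) (hr : ExpC b v r)
    (hr' : ∀ N : α → ℕ, ExpIn b v N fun p => r p.1.2)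
    (hb : ∀ a, r a ≤ b a) : GateC b v fun a => T.andToggle (c a) (d a) (r a) := by
  refine ((T.gateC_chain hc hd h0 hr (hr' _) hb).append (.ite (fun a => r a ≠ 0) hr
    (fun _ => Iff.rfl) (T.gateC_chain (r := fun a => r a - 1) hc hd h0 hr.pred (hr' _).pred
      fun a => (Nat.sub_le _ _).trans (hb a)) .nil)).of_eq fun a => ?_
  cases r a with
  | zero => simp [andToggle]
  | succ r => simp [andToggle]

variable {L i z : α → ℕ}

theorem gateC_conjunction (hL : ∀ a, L a + 2 ≤ b a) :
    GateC b (fun a => [L a, i a, z a]) fun a => T.conjunction (L a) := by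
  have e : ExpC b (fun a => [L a, i a, z a]) L :=
    .var 0 (fun _ => rfl) fun a => by have := hL a; omega
  have eN : ∀ N : α → ℕ, ExpIn b (fun a => [L a, i a, z a]) N fun p => L p.1.2 := fun N =>
    .var 1 (fun _ => rfl) fun p => by have := hL p.1.2; omega
  have h1 := T.gateC_andToggle (c := fun _ u => 2 * u)
    (d := fun a u => if u = L a / 2 then L a + 1 else 2 * u + 1) (r := fun a => L a / 2)
    (fun N x hx => hx.two_mul)
    (fun N x hx => hx.iteEq (eN N).half (eN N).succ hx.two_mul.succ)
    ((ExpC.const 0).iteEq e.half e.succ (.const _)) e.half (fun N => (eN N).half)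
    fun a => by have := hL a; omega
  have h2 := T.gateC_andToggle
    (c := fun a u => if u = (L a - 1) / 2 + 1 then L a + 1 else 2 * u + 1)
    (d := fun a u => if u = (L a - 1) / 2 + 1 then L a + 2 else 2 * u)
    (r := fun a => (L a - 1) / 2 + 1)
    (fun N x hx => hx.iteEq (eN N).pred.half.succ (eN N).succ hx.two_mul.succ)
    (fun N x hx => hx.iteEq (eN N).pred.half.succ (eN N).succ.succ hx.two_mul)
    ((ExpC.const 0).iteEq e.pred.half.succ e.succ.succ (.const _)) e.pred.half.succ
    (fun N => (eN N).pred.half.succ) fun a => by have := hL a; omega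
  exact (h1.append h2).append h1

theorem gateC_affine (hL : ∀ a, L a + 2 ≤ b a) (hi : ∀ a, i a ≤ b a) :
    GateC b (fun a => [L a, i a, z a]) fun a => T.affine (L a) (i a) := by
  have e : ExpC b (fun a => [L a, i a, z a]) L :=
    .var 0 (fun _ => rfl) fun a => by have := hL a; omega
  have es : ExpIn b (fun a => [L a, i a, z a]) (fun a => L a - 1) fun p => p.1.1 :=
    .var 0 (fun _ => rfl) fun p => by have := hL p.1.2; have h : p.1.1 < L p.1.2 - 1 := p.2; omega
  have ei : ExpIn b (fun a => [L a, i a, z a]) (fun a => L a - 1) fun p => i p.1.2 :=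
    .var 2 (fun _ => rfl) fun p => hi _
  refine GateC.rep (G := fun s a => (if (i a).testBit (s + 1) = (i a + 1).testBit (s + 1) then []
    else [T.cgate T.vX 1 (s + 2)]) ++ if (i a + 1).testBit (s + 1) then [] else [T.flip (s + 2)])
    e.pred (.append (.ite _ ((ei.bit es.succ).eq (ei.succ.bit es.succ)) (fun p => ?_) .nil
      (T.gateC_cgate _ (.const 1) es.succ.succ)) (.ite _ (ei.succ.bit es.succ)
      (fun p => toNat_ne_zero _) .nil (T.gateC_flip es.succ.succ)))
  cases (i p.1.2).testBit (p.1.1 + 1) <;> cases (i p.1.2 + 1).testBit (p.1.1 + 1) <;> simp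

theorem gateC_block (word : List (Bool × Bool × Fin K)) (hL : ∀ a, L a + 2 ≤ b a)
    (hi : ∀ a, i a ≤ b a) :
    GateC b (fun a => [L a, i a, z a]) fun a => T.block word (L a) (i a) := by
  have e : ExpC b (fun a => [L a, i a, z a]) L :=
    .var 0 (fun _ => rfl) fun a => by have := hL a; omega
  have hP : GateC b (fun a => [L a, i a, z a]) fun a => T.parityFlip (i a) :=
    .ite _ ((ExpC.var 1 (fun _ => rfl) hi).bit (.const 0)) (fun a => toNat_ne_zero _)
      (T.gateC_flip (.const 1)) .nil
  have hp : ∀ cl s, GateC b (fun a => [L a, i a, z a]) fun a => T.flagPrep (L a) cl s := by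
    intro cl s
    have hT := T.gateC_toffoli e.succ.succ (.const cl) e.succ
    cases s with
    | true => exact hT.of_eq fun a => by simp [flagPrep]
    | false =>
      exact (((T.gateC_flip (.const cl)).append hT).append (T.gateC_flip (.const cl))).of_eq
        fun a => by simp [flagPrep]
  have hw := GateC.ofList (G := fun l a => T.flagLetter (L a) l) (fun l => (hp _ _).append
    ((T.gateC_cgate l.2.2 e.succ (.const (if l.1 then 1 else 0))).append (hp _ _))) word
  have hA := T.gateC_affine (z := z) hL hi
  have hC := T.gateC_conjunction (i := i) (z := z) hL
  exact (((((hA.append hP).append hC).append hw).append hC).append hP).append hA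

theorem gateC_prologue (hL : ∀ a, L a + 2 ≤ b a) (hi : ∀ a, i a ≤ b a) :
    GateC b (fun a => [L a, i a, z a]) fun a => T.prologue (L a) (i a) := by
  have e : ExpC b (fun a => [L a, i a, z a]) L :=
    .var 0 (fun _ => rfl) fun a => by have := hL a; omega
  have es : ExpIn b (fun a => [L a, i a, z a]) (fun a => L a + 3) fun p => p.1.1 :=
    .var 0 (fun _ => rfl) fun p => by have := hL p.1.2; have h : p.1.1 < L p.1.2 + 3 := p.2; omega
  have ei : ExpIn b (fun a => [L a, i a, z a]) (fun a => L a + 3) fun p => i p.1.2 :=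
    .var 2 (fun _ => rfl) fun p => hi _
  refine GateC.rep (G := fun l a => T.flip l :: if l = 0 ∨ (i a).testBit (l - 1) = false then
    [T.flip l] else []) e.succ.succ.succ ((T.gateC_flip es).append (.ite _
      (es.iteEq (.const 0) (.const 1) (ExpC.sub (.const 1) (ei.bit es.pred))) (fun p => ?_)
      (T.gateC_flip es) .nil))
  by_cases h : p.1.1 = 0
  · simp [h]
  · cases (i p.1.2).testBit (p.1.1 - 1) <;> simp [h]

theorem gateC_flipBlock (hL : ∀ a, L a + 2 ≤ b a) (hi : ∀ a, i a ≤ b a) :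
    GateC b (fun a => [L a, i a, z a]) fun a => T.flipBlock (L a) (i a) := by
  have e : ExpC b (fun a => [L a, i a, z a]) L :=
    .var 0 (fun _ => rfl) fun a => by have := hL a; omega
  have ei : ExpC b (fun a => [L a, i a, z a]) i := .var 1 (fun _ => rfl) hi
  have h : ∀ s, GateC b (fun a => [L a, i a, z a])
      fun a => T.block [(false, s, T.vX)] (L a) (i a - 1) := fun s =>
    ProgC.call e ei.pred (.const 0) (T.gateC_block _ hL fun a => (Nat.sub_le _ _).trans (hi a))
  exact (GateC.ite (fun a => i a ≠ 0) ei (fun _ => Iff.rfl) (h true) (h false)).of_eq fun a => by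
    by_cases h : i a = 0 <;> simp [flipBlock, h]

end QubitTable

namespace MatchTable

variable {𝓜 : GateSet} {K : ℕ} (T : MatchTable 𝓜 K) {α : Type} {b : α → ℕ} {v : α → List ℕ}

theorem gateC_chain (u : Fin K) {x D z : α → ℕ} (hx : ∀ a, x a ≤ b a) (hD : ∀ a, D a ≤ b a) :
    GateC b (fun a => [x a, D a, z a]) fun a => T.chain u (x a) (D a) := by
  have ek : ExpIn b (fun a => [x a, D a, z a]) D fun p => p.1.1 :=
    .var 0 (fun _ => rfl) fun p => p.2.le.trans (hD _)
  have ex : ExpIn b (fun a => [x a, D a, z a]) D fun p => x p.1.2 := .var 1 (fun _ => rfl) fun p => hx _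
  have eD : ExpIn b (fun a => [x a, D a, z a]) D fun p => D p.1.2 := .var 2 (fun _ => rfl) fun p => hD _
  have e : ExpC b (fun a => [x a, D a, z a]) x := .var 0 (fun _ => rfl) hx
  have e' : ExpC b (fun a => [x a, D a, z a]) D := .var 1 (fun _ => rfl) hD
  have h1 := GateC.repMap (x := fun _ _ => T.base + T.vX.val) (y := fun k a => x a + (D a - k))
    (z := fun k a => x a + (D a - k) + 1) e' (.const _) (ex.add (eD.sub ek))
    (ex.add (eD.sub ek)).succ
  have h2 := GateC.repMap (x := fun _ _ => T.base + T.vX.val) (y := fun k a => x a + (k + 1))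
    (z := fun k a => x a + (k + 1) + 1) e' (.const _) (ex.add ek.succ) (ex.add ek.succ).succ
  exact (h1.append ((GateC.single (.const (T.base + u.val)) e e.succ).append h2)).of_eq fun a =>
    (T.chain_eq _ _ _).symm

theorem gateC_letter (u : Fin K) (s : Bool) {n c t : α → ℕ} (hn : ∀ a, n a ≤ b a)
    (hc : ∀ a, c a ≤ b a) (ht : ∀ a, 2 ^ t a ≤ b a) :
    GateC b (fun a => [n a, c a, t a]) fun a => T.letter (n a) u (c a) s (t a) := by
  have ht' : ∀ a, t a ≤ b a := fun a => Nat.lt_two_pow_self.le.trans (ht a)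
  have ex : ExpIn b (fun a => [n a, c a, t a]) n fun p => p.1.1 :=
    .var 0 (fun _ => rfl) fun p => p.2.le.trans (hn _)
  have ec : ExpIn b (fun a => [n a, c a, t a]) n fun p => c p.1.2 := .var 2 (fun _ => rfl) fun p => hc _
  have et : ExpIn b (fun a => [n a, c a, t a]) n fun p => t p.1.2 := .var 3 (fun _ => rfl) fun p => ht' _
  have hG : GateC (fun p : Below n => b p.1.2) (fun p => p.1.1 :: [n p.1.2, c p.1.2, t p.1.2])
      fun p => T.chain u p.1.1 (2 ^ t p.1.2 - 1) :=
    ProgC.call ex (et.pow 1 fun p => by have := ht p.1.2; omega).pred (.const 0)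
      (T.gateC_chain u (fun p => p.2.le.trans (hn _)) fun p => (Nat.sub_le _ _).trans (ht _))
  have h1 := GateC.ite (fun p : Below n => p.1.1.testBit (c p.1.2) = s)
    ((ex.bit ec).eq (.const s.toNat)) (fun p => by
      cases p.1.1.testBit (c p.1.2) <;> cases s <;> simp)
    (GateC.ite (fun p : Below n => p.1.1.testBit (t p.1.2) = false)
      (ExpC.sub (.const 1) (ex.bit et)) (fun p => by
        cases p.1.1.testBit (t p.1.2) <;> simp) hG .nil) .nil
  exact GateC.rep (G := fun x a => if x.testBit (c a) = s ∧ x.testBit (t a) = false then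
    T.chain u x (2 ^ t a - 1) else []) (.var 0 (fun _ => rfl) hn) (h1.of_eq fun p => by
      split_ifs <;> simp_all)

theorem gateC_prologue {m y z : α → ℕ} (hm : ∀ a, 2 ^ m a ≤ b a) :
    GateC b (fun a => [m a, y a, z a]) fun a => T.prologue (m a) := by
  have em : ExpC b (fun a => [m a, y a, z a]) m :=
    .var 0 (fun _ => rfl) fun a => Nat.lt_two_pow_self.le.trans (hm a)
  have ei : ExpIn b (fun a => [m a, y a, z a]) (fun a => 2 ^ m a) fun p => p.1.1 :=
    .var 0 (fun _ => rfl) fun p => p.2.le.trans (hm _)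
  exact GateC.repMap (x := fun i _ => if i.testBit 0 then T.xx else T.base + T.vI.val)
    (y := fun i _ => 2 * i) (z := fun i _ => 2 * i + 1)
    (em.pow 1 fun a => by have := hm a; omega)
    (((ei.bit (.const 0)).ite (.const T.xx) (.const (T.base + T.vI.val))).of_eq fun p => by
      simp only [toNat_ne_zero]) ei.two_mul ei.two_mul.succ

end MatchTable

/-! ### Machines from families of programs -/

namespace ProgC

theorem header {α : Type} {b : α → ℕ} {v : α → List ℕ} {x : α → ℕ} (hx : ExpC b v x) :
    ProgC b v fun a => encodeTuple [List.replicate (x a) false, Nat.bits 1] := by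
  refine (((const [true, false]).append (rep (F := fun _ _ => [false, false]) hx (const _))).append
    (const ([true, true] ++ encodeField (Nat.bits 1)))).of_eq fun a => ?_
  have h : ∀ n, (List.range n).flatMap (fun _ => [false, false]) =
      (List.replicate n false).flatMap fun b => [false, b] := by
    intro n
    induction n with
    | zero => rfl
    | succ n ih => rw [List.range_succ, List.flatMap_append, ih, List.replicate_succ']; simp
  simp [encodeTuple, encodeField, h]

end ProgC

theorem Nat.size_mul_le (a b : ℕ) : Nat.size (a * b) ≤ Nat.size a + Nat.size b := by
  rw [Nat.size_le, pow_add]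
  exact Nat.mul_lt_mul'' (Nat.lt_size_self a) (Nat.lt_size_self b)

/-- A machine that writes a circuit given by three programs: one for the start, one for each gate of
the input circuit, in reverse order, and one for each `1` in the input string.  The counters are
bounded by a multiple of `β n + 1`, so the space is logarithmic in `β n`. -/
theorem exists_machine_of_programs {β : ℕ → ℕ} {D : ℕ} {P : ℕ → ℕ → Prop}
    {Q : ℕ → ℕ × ℕ × ℕ → Prop} {Fi : ℕ → ℕ → List Bool} {Fg : ℕ → ℕ × ℕ × ℕ → List Bool}
    {Fx : ℕ → ℕ → List Bool}
    (hP : ∀ n l, P n l → n ≤ D * (β n + 1) ∧ l ≤ D * (β n + 1))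
    (hQ : ∀ n g, Q n g → g.1 ≤ D * (β n + 1) ∧ g.2.1 ≤ D * (β n + 1) ∧ g.2.2 ≤ D * (β n + 1))
    (hi : ProgC (fun p : {p : ℕ × ℕ // P p.1 p.2} => D * (β p.1.1 + 1))
      (fun p => [p.1.1, p.1.2]) fun p => Fi p.1.1 p.1.2)
    (hg : ProgC (fun p : {p : (ℕ × ℕ) × ℕ × ℕ × ℕ // P p.1.1 p.1.2 ∧ Q p.1.1 p.2} =>
        D * (β p.1.1.1 + 1))
      (fun p => [p.1.1.1, p.1.1.2, p.1.2.1, p.1.2.2.1, p.1.2.2.2]) fun p => Fg p.1.1.1 p.1.2)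
    (hx : ProgC (fun p : {p : (ℕ × ℕ) × ℕ // P p.1.1 p.1.2 ∧ p.2 < p.1.1} => D * (β p.1.1.1 + 1))
      (fun p => [p.1.1.1, p.1.1.2, p.1.2]) fun p => Fx p.1.1.1 p.1.2) :
    ∃ (K : ℕ) (T : TM), ∀ (l : ℕ) (xs : List Bool) (gs : List (ℕ × ℕ × ℕ)), P xs.length l →
      (∀ g ∈ gs, Q xs.length g) →
      T.ComputesInSpace (encodeTuple [xs, l.bits] ++ gs.flatMap Frag.encGate)
        (Fi xs.length l ++ gs.reverse.flatMap (Fg xs.length) ++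
          (List.range xs.length).reverse.flatMap fun j =>
            if xs[j]? = some true then Fx xs.length j else [])
        (K * (Nat.size (β xs.length) + 1)) := by
  obtain ⟨pi, ci, hi⟩ := hi
  obtain ⟨pg, cg, hg⟩ := hg
  obtain ⟨px, cx, hx⟩ := hx
  obtain ⟨k, T, hT⟩ := exists_machine pi pg px
  refine ⟨k * (Nat.size ((ci + cg + cx + 1) * (D + 1)) + 2), T, fun l xs gs hp hq => ?_⟩
  set n := xs.length with hn
  set B := (ci + cg + cx + 1) * (D + 1) * (β n + 1) with hB
  have hD : D * (β n + 1) + 1 ≤ (D + 1) * (β n + 1) := by rw [add_mul D]; omega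
  have hle : ∀ c, c ≤ ci + cg + cx + 1 → c * (D * (β n + 1) + 1) ≤ B := fun c hc => by
    rw [hB, mul_assoc]
    exact Nat.mul_le_mul hc hD
  have h1 := hle 1 (by omega)
  rw [one_mul] at h1
  obtain ⟨p1, p2⟩ := hP n l hp
  have hmem : ∀ j ∈ (List.range n).reverse, j < n := fun j hj => by simpa using hj
  have h := hT l B xs gs (by omega) (by omega) (by omega)
    (fun g hg' => by
      obtain ⟨q1, q2, q3⟩ := hQ n g (hq g hg')
      exact ⟨by omega, by omega, by omega,
        (hg ⟨((n, l), g), hp, hq g hg'⟩).2.mono (hle cg (by omega))⟩)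
    ((hi ⟨(n, l), hp⟩).2.mono (hle ci (by omega)))
    fun j hj => (hx ⟨((n, l), j), hp, hj⟩).2.mono (hle cx (by omega))
  obtain ⟨t, t1, t2, t3⟩ := h
  refine ⟨t, t1, t2.trans ?_, fun r hr => (t3 r hr).trans_le ?_⟩
  · congr 1
    · congr 1
      · exact (hi ⟨(n, l), hp⟩).1
      · exact List.flatMap_congr fun g hg' =>
          (hg ⟨((n, l), g), hp, hq g (List.mem_reverse.1 hg')⟩).1
    · refine List.flatMap_congr fun j hj => ?_
      rw [show px.eval [xs.length, l, j] = Fx n j from (hx ⟨((n, l), j), hp, hmem j hj⟩).1]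
  · rw [mul_assoc]
    refine Nat.mul_le_mul_left _ ?_
    have s1 : Nat.size (β n + 1) ≤ Nat.size (β n) + 1 := by
      rw [Nat.size_le, pow_succ]
      have := Nat.lt_size_self (β n)
      omega
    have s2 := Nat.size_mul_le ((ci + cg + cx + 1) * (D + 1)) (β n + 1)
    rw [← hB] at s2
    calc Nat.size B + 1 ≤ Nat.size ((ci + cg + cx + 1) * (D + 1)) + 2 * (Nat.size (β n) + 1) := by
          omega
      _ ≤ Nat.size ((ci + cg + cx + 1) * (D + 1)) * (Nat.size (β n) + 1) +
          2 * (Nat.size (β n) + 1) := Nat.add_le_add_right (Nat.le_mul_of_pos_right _ (by omega)) _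
      _ = _ := by ring

/-! ### Lines and sizes of circuits -/

/-- A list of at most `N` gates with property `P`. -/
def Fits (P : ℕ × ℕ × ℕ → Prop) (N : ℕ) (l : List (ℕ × ℕ × ℕ)) : Prop :=
  (∀ g ∈ l, P g) ∧ l.length ≤ N

namespace Fits

variable {P : ℕ × ℕ × ℕ → Prop} {M N : ℕ} {l l' : List (ℕ × ℕ × ℕ)}

theorem nil : Fits P N [] := ⟨by simp, by simp⟩

theorem single {g : ℕ × ℕ × ℕ} (h : P g) : Fits P 1 [g] := ⟨by simpa, by simp⟩

theorem mono (h : Fits P M l) (hMN : M ≤ N) : Fits P N l := ⟨h.1, h.2.trans hMN⟩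

theorem append (h : Fits P M l) (h' : Fits P N l') : Fits P (M + N) (l ++ l') :=
  ⟨List.forall_mem_append.2 ⟨h.1, h'.1⟩, by rw [List.length_append]; exact add_le_add h.2 h'.2⟩

theorem flatMap {β : Type} {xs : List β} {f : β → List (ℕ × ℕ × ℕ)}
    (h : ∀ x ∈ xs, Fits P N (f x)) : Fits P (xs.length * N) (xs.flatMap f) := by
  induction xs with
  | nil => exact nil
  | cons x xs ih =>
    rw [List.flatMap_cons]
    refine ((h x List.mem_cons_self).append
      (ih fun y hy => h y (List.mem_cons_of_mem _ hy))).mono ?_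
    rw [List.length_cons, add_mul]; omega

theorem ite {p : Prop} [Decidable p] (h : p → Fits P N l) (h' : ¬p → Fits P N l') :
    Fits P N (if p then l else l') := by
  split_ifs with hp
  · exact h hp
  · exact h' hp

end Fits

theorem GateApp.actsOn_iff {G : GateSet} {n : ℕ} (g : GateApp G n) (l : Fin n) :
    g.ActsOn l ↔ l.val = g.raw.2.1 ∨ l.val = g.raw.2.2 := by
  cases g <;> simp [GateApp.ActsOn, GateApp.raw, Fin.ext_iff]

/-- A gate acts on at most two lines. -/
theorem Circuit.NoIdleLine.le {G : GateSet} {n : ℕ} {c : Circuit G n} (h : c.NoIdleLine) :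
    n ≤ 2 * c.length := by
  have h1 : Finset.range n ⊆ (c.flatMap fun g => [g.raw.2.1, g.raw.2.2]).toFinset := by
    intro l hl
    obtain ⟨g, hg, ha⟩ := h ⟨l, Finset.mem_range.1 hl⟩
    rw [GateApp.actsOn_iff] at ha
    rw [List.mem_toFinset, List.mem_flatMap]
    exact ⟨g, hg, by simpa using ha⟩
  have h2 := (Finset.card_le_card h1).trans (List.toFinset_card_le _)
  rw [Finset.card_range, List.length_flatMap] at h2
  simp at h2
  omega

theorem GateApp.valid_raw {G : GateSet} {n : ℕ} (a : GateApp G n) : G.ValidRaw n a.raw := by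
  cases a with
  | one g i => simp [GateSet.ValidRaw, GateApp.raw]
  | two g i j h => simpa [GateSet.ValidRaw, GateApp.raw, Fin.ext_iff] using h

/-- The string of a gate with lines numbered from `0`. -/
theorem Circuit.encode_eq {G : GateSet} {n : ℕ} (c : Circuit G n) (x : Fin n → Fin 2) (k : Fin n) :
    c.encode x k = encodeTuple [List.ofFn fun l => decide (x l = 1), Nat.bits (k.val + 1)] ++
      (c.map GateApp.raw).flatMap fun g => Frag.encGate (g.1, g.2.1 + 1, g.2.2 + 1) := by
  rw [Circuit.encode, List.flatMap_map]
  congr 1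
  exact List.flatMap_congr fun g _ => GateSet.encode_eq_encGate g

namespace QubitTable

variable {𝓠 : GateSet} {K : ℕ} (T : QubitTable 𝓠 K) {n : ℕ}

theorem valid_flip {i : ℕ} (hi : i < n) : 𝓠.ValidRaw n (T.flip i) := by
  obtain ⟨h, -⟩ := T.hone T.vX
  simp [GateSet.ValidRaw, flip, h, hi]

theorem fits_cgate (v : Fin K) {c t : ℕ} (hc : c < n) (ht : t < n) (hct : c ≠ t) :
    Fits (𝓠.ValidRaw n) 1 [T.cgate v c t] := by
  obtain ⟨h, -⟩ := T.htwo v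
  exact .single ⟨hc, ht, by rw [if_neg (by simp [cgate])]; exact ⟨by simpa [cgate] using h, hct⟩⟩

theorem fits_toffoli {a b t : ℕ} (ha : a < n) (hb : b < n) (ht : t < n) (hab : a ≠ b)
    (hat : a ≠ t) (hbt : b ≠ t) : Fits (𝓠.ValidRaw n) 5 (T.toffoli a b t) :=
  ((((T.fits_cgate _ hb ht hbt).append (T.fits_cgate _ ha hb hab)).append
    (T.fits_cgate _ hb ht hbt)).append (T.fits_cgate _ ha hb hab)).append (T.fits_cgate _ ha ht hat)

theorem fits_chain {c a : ℕ → ℕ} {r : ℕ} (han : ∀ s ≤ r, a s < n)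
    (hcn : ∀ u, 1 ≤ u → u ≤ r → c u < n) (ha : ∀ s ≤ r, ∀ u ≤ r, a s = a u → s = u)
    (hc : ∀ s ≤ r, ∀ u, 1 ≤ u → u ≤ r → a s ≠ c u) :
    Fits (𝓠.ValidRaw n) (10 * r + 1) (T.chain c a r) := by
  induction r with
  | zero => exact .single (T.valid_flip (han 0 le_rfl))
  | succ r ih =>
    have hT := T.fits_toffoli (han r (by omega)) (hcn (r + 1) (by omega) le_rfl) (han _ le_rfl)
      (hc r (by omega) _ (by omega) le_rfl) (fun h => by
        have := ha r (by omega) _ le_rfl h; omega) (hc _ le_rfl _ (by omega) le_rfl).symm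
    exact ((hT.append (ih (fun s hs => han s (by omega)) (fun u h1 h2 => hcn u h1 (by omega))
      (fun s hs u hu => ha s (by omega) u (by omega))
      (fun s hs u h1 hu => hc s (by omega) u h1 (by omega)))).append hT).mono (by omega)

theorem fits_andToggle {c a : ℕ → ℕ} {r : ℕ} (han : ∀ s ≤ r, a s < n)
    (hcn : ∀ u, 1 ≤ u → u ≤ r → c u < n) (ha : ∀ s ≤ r, ∀ u ≤ r, a s = a u → s = u)
    (hc : ∀ s ≤ r, ∀ u, 1 ≤ u → u ≤ r → a s ≠ c u) :
    Fits (𝓠.ValidRaw n) (20 * r + 1) (T.andToggle c a r) := by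
  cases r with
  | zero => exact T.fits_chain han hcn ha hc
  | succ r =>
    exact ((T.fits_chain han hcn ha hc).append (T.fits_chain (r := r)
      (fun s hs => han s (by omega)) (fun u h1 h2 => hcn u h1 (by omega))
      (fun s hs u hu => ha s (by omega) u (by omega))
      (fun s hs u h1 hu => hc s (by omega) u h1 (by omega)))).mono (by omega)

theorem fits_conjunction {L : ℕ} (hL : 1 ≤ L) :
    Fits (𝓠.ValidRaw (L + 3)) (60 * L + 3) (T.conjunction L) := by
  have h1 := T.fits_andToggle (n := L + 3) (c := fun u => 2 * u)
    (a := fun u => if u = L / 2 then L + 1 else 2 * u + 1) (r := L / 2)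
    (by intro s hs; split_ifs <;> omega) (by intro u h1 h2; omega)
    (by intro s hs u hu; split_ifs <;> omega) (by intro s hs u hu1 hu; split_ifs <;> omega)
  have h2 := T.fits_andToggle (n := L + 3)
    (c := fun u => if u = (L - 1) / 2 + 1 then L + 1 else 2 * u + 1)
    (a := fun u => if u = (L - 1) / 2 + 1 then L + 2 else 2 * u) (r := (L - 1) / 2 + 1)
    (by intro s hs; split_ifs <;> omega) (by intro u h1 h2; split_ifs <;> omega)
    (by intro s hs u hu; split_ifs <;> omega) (by intro s hs u hu1 hu; split_ifs <;> omega)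
  exact ((h1.append h2).append h1).mono (by omega)

theorem fits_block (word : List (Bool × Bool × Fin K)) {L i : ℕ} (hL : 1 ≤ L) :
    Fits (𝓠.ValidRaw (L + 3)) ((140 + 15 * word.length) * L) (T.block word L i) := by
  have hf : ∀ l < L + 3, Fits (𝓠.ValidRaw (L + 3)) 1 [T.flip l] := fun l hl =>
    .single (T.valid_flip hl)
  have hA : Fits (𝓠.ValidRaw (L + 3)) ((List.range (L - 1)).length * 2) (T.affine L i) := by
    refine .flatMap fun s hs => .append (M := 1) (N := 1) (.ite (fun _ => .nil) fun _ => ?_)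
      (.ite (fun _ => .nil) fun _ => ?_) <;>
    have hs := List.mem_range.1 hs
    · exact T.fits_cgate _ (by omega) (by omega) (by omega)
    · exact hf _ (by omega)
  have hP : Fits (𝓠.ValidRaw (L + 3)) 1 (T.parityFlip i) := .ite (fun _ => hf _ (by omega)) fun _ => .nil
  have hC := T.fits_conjunction hL
  have hp : ∀ cl s, cl ≤ 1 → Fits (𝓠.ValidRaw (L + 3)) 7 (T.flagPrep L cl s) := fun cl s hcl =>
    ((Fits.ite (N := 1) (fun _ => .nil) fun _ => hf _ (by omega)).append (T.fits_toffoli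
      (show L + 2 < L + 3 by omega) (show cl < L + 3 by omega) (show L + 1 < L + 3 by omega)
      (by omega) (by omega) (by omega))).append (.ite (N := 1) (fun _ => .nil) fun _ => hf _ (by omega))
  have hW : Fits (𝓠.ValidRaw (L + 3)) (word.length * (7 + (1 + 7)))
      (word.flatMap (T.flagLetter L)) := by
    refine .flatMap fun l _ => (hp _ _ (by split_ifs <;> omega)).append
      ((T.fits_cgate _ (by omega) (by split_ifs <;> omega) (by split_ifs <;> omega)).append
        (hp _ _ (by split_ifs <;> omega)))
  refine ((((((hA.append hP).append hC).append hW).append hC).append hP).append hA).mono ?_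
  rw [List.length_range, add_mul]
  have : word.length * 15 ≤ 15 * word.length * L := by
    rw [mul_comm word.length]; exact Nat.le_mul_of_pos_right _ hL
  omega

theorem fits_prologue (L k : ℕ) : Fits (𝓠.ValidRaw (L + 3)) ((L + 3) * 2) (T.prologue L k) := by
  have h : Fits (𝓠.ValidRaw (L + 3)) ((List.range (L + 3)).length * 2) (T.prologue L k) := by
    refine .flatMap fun l hl => ?_
    have hf := Fits.single (T.valid_flip (List.mem_range.1 hl))
    exact hf.append (.ite (fun _ => hf) fun _ => .nil)
  rwa [List.length_range] at h

end QubitTable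

namespace MatchTable

variable {𝓜 : GateSet} {K : ℕ} (T : MatchTable 𝓜 K)

/-- The gate is a two-qubit gate on two consecutive lines. -/
def Consecutive (𝓜 : GateSet) (n : ℕ) (g : ℕ × ℕ × ℕ) : Prop :=
  𝓜.ValidRaw n g ∧ g.2.2 = g.2.1 + 1

theorem fits_single (v : Fin K) {n i : ℕ} (hi : i + 1 < n) :
    Fits (Consecutive 𝓜 n) 1 [(T.base + v.val, i, i + 1)] := by
  obtain ⟨h, -⟩ := T.hgate v
  exact .single ⟨⟨by dsimp only; omega, hi, by simp [T.hback.1, h]⟩, rfl⟩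

theorem fits_chain (v : Fin K) {n a D : ℕ} (h : a + D + 1 < n) :
    Fits (Consecutive 𝓜 n) (2 * D + 1) (T.chain v a D) := by
  induction D with
  | zero => exact T.fits_single v h
  | succ D ih =>
    have hX := T.fits_single T.vX (n := n) (i := a + D + 1) (by omega)
    exact ((hX.append (ih (by omega))).append hX).mono (by omega)

theorem fits_letter {m : ℕ} (v : Fin K) (c : ℕ) (s : Bool) {t : ℕ} (ht : t ≤ m) :
    Fits (Consecutive 𝓜 (2 ^ (m + 1))) (4 * 2 ^ (2 * m)) (T.letter (2 ^ (m + 1)) v c s t) := by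
  have h2 : 2 ^ t ≤ 2 ^ m := Nat.pow_le_pow_right (by norm_num) ht
  have h1 := Nat.two_pow_pos t
  have h : Fits (Consecutive 𝓜 (2 ^ (m + 1))) ((List.range (2 ^ (m + 1))).length * (2 * 2 ^ m))
      (T.letter (2 ^ (m + 1)) v c s t) := by
    refine .flatMap fun a ha => .ite (fun hb => ?_) fun _ => .nil
    have h3 : a + 2 ^ t < 2 ^ (m + 1) := by
      rw [← xor_two_pow_eq_add hb.2]
      exact Nat.xor_lt_two_pow (List.mem_range.1 ha) (Nat.pow_lt_pow_right (by norm_num) (by omega))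
    exact (T.fits_chain v (by omega)).mono (by omega)
  refine h.mono (le_of_eq ?_)
  rw [List.length_range]; ring

theorem fits_block (word : ℕ → List (Letter K)) {m : ℕ} {g : ℕ × ℕ × ℕ} (hi : g.2.1 ≤ m)
    (hj : g.2.2 ≤ m) : Fits (Consecutive 𝓜 (2 ^ (m + 1))) ((word g.1).length * (4 * 2 ^ (2 * m)))
      (T.block word (2 ^ (m + 1)) g) :=
  .flatMap fun l _ => T.fits_letter _ _ _ (by unfold tgtOf; split_ifs <;> omega)

theorem fits_prologue (m : ℕ) :
    Fits (Consecutive 𝓜 (2 ^ (m + 1))) (2 ^ m) (T.prologue m) := by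
  refine ⟨fun g hg => ?_, by simp [prologue]⟩
  obtain ⟨i, hi, rfl⟩ := List.mem_map.1 hg
  have hi := List.mem_range.1 hi
  have : 2 ^ (m + 1) = 2 * 2 ^ m := by rw [pow_succ]; ring
  refine ⟨⟨by dsimp only; omega, by dsimp only; omega, ?_⟩, rfl⟩
  obtain ⟨h, -⟩ := T.hxx
  obtain ⟨h', -⟩ := T.hgate T.vI
  rw [T.hback.1, if_neg (by omega)]
  refine ⟨?_, by dsimp only; omega⟩
  simp only [zero_add]
  split_ifs
  exacts [h, h']

end MatchTable

/-! ### Matchgate circuits by quantum circuits of logarithmic width -/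

theorem Nat.clog_two_eq_size (n : ℕ) : Nat.clog 2 n = Nat.size (n - 1) := by
  refine eq_of_forall_ge_iff fun k => ?_
  rw [Nat.clog_le_iff_le_pow (by norm_num), Nat.size_le]
  have := Nat.two_pow_pos k
  omega

/-- The encoding of a circuit, whose lines are numbered from `1`. -/
theorem Circuit.encode_eq_shift {G : GateSet} {n : ℕ} (c : Circuit G n) (x : Fin n → Fin 2)
    (k : Fin n) :
    c.encode x k = encodeTuple [List.ofFn fun l => decide (x l = 1), Nat.bits (k.val + 1)] ++
      ((c.map GateApp.raw).map fun g => (g.1, g.2.1 + 1, g.2.2 + 1)).flatMap Frag.encGate := by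
  rw [Circuit.encode_eq]; simp only [List.flatMap_map]

/-- The encoding of a circuit with input `|0⋯0⟩` and measurement of the first line. -/
theorem Circuit.encode_zero {G : GateSet} {n : ℕ} [NeZero n] (d : Circuit G n) :
    d.encode (fun _ => 0) 0 = encodeTuple [List.replicate n false, Nat.bits 1] ++
      (d.map GateApp.raw).flatMap fun g => Frag.encGate (g.1, g.2.1 + 1, g.2.2 + 1) := by
  rw [Circuit.encode_eq]
  simp

theorem toBit_ofFn {n : ℕ} (x : Fin n → Fin 2) (l : Fin n) :
    x l = toBit (decide ((List.ofFn fun l => decide (x l = 1))[l.val]? = some true)) := by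
  have h : ∀ a : Fin 2, a = toBit (decide (a = 1)) := by decide
  simpa using h (x l)

theorem exists_length_le {α : Type*} (word : ℕ → List α) (N : ℕ) :
    ∃ W, ∀ g < N, (word g).length ≤ W :=
  ⟨∑ g ∈ Finset.range N, (word g).length, fun _ hg =>
    Finset.single_le_sum (f := fun g => (word g).length) (fun _ _ => Nat.zero_le _)
      (Finset.mem_range.2 hg)⟩

theorem add_mul_succ_le (N n : ℕ) : N + 4 * (n + 1) ≤ (N + 4) * (n + 1) := by
  rw [add_mul]
  exact Nat.add_le_add_right (Nat.le_mul_of_pos_right _ (Nat.succ_pos _)) _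

theorem GateC.table {α : Type} {b x : α → ℕ} {v : α → List ℕ} {G : ℕ → α → List (ℕ × ℕ × ℕ)}
    (hx : ExpC b v x) (hG : ∀ i, GateC b v (G i)) (N : ℕ) (hN : ∀ a, x a < N) :
    GateC b v fun a => G (x a) a :=
  ProgC.table hx hG N hN

namespace QubitTable

variable {𝓜 𝓠 : GateSet} {K : ℕ} (T : QubitTable 𝓠 K) (word : ℕ → List (Bool × Bool × Fin K))

theorem gateC_blockTable {α : Type} {b L i g : α → ℕ} (N : ℕ) (hL : ∀ a, L a + 2 ≤ b a)
    (hi : ∀ a, i a ≤ b a) (hg : ∀ a, g a ≤ b a) (hN : ∀ a, g a < N) :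
    GateC b (fun a => [L a, i a, g a]) fun a => T.block (word (g a)) (L a) (i a) := by
  have h1 : ExpC b (fun a => [L a, i a, g a]) g := .var 2 (fun _ => rfl) hg
  exact GateC.table (G := fun k a => T.block (word k) (L a) (i a)) h1
    (fun k => T.gateC_block (word k) hL hi) N hN

theorem _root_.Nat.clog_two_le (n : ℕ) : Nat.clog 2 n ≤ n :=
  Nat.clog_le_of_le_pow Nat.lt_two_pow_self.le

theorem _root_.ExpC.clog {α : Type} {b n : α → ℕ} {v : α → List ℕ} (h : ExpC b v n) :
    ExpC b v fun a => Nat.clog 2 (n a) :=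
  h.pred.size.of_eq fun _ => (Nat.clog_two_eq_size _).symm

section Programs

variable {α : Type} {b n i g : α → ℕ} {v : α → List ℕ}

theorem gateC_prologue_clog (en : ExpC b v n) (ei : ExpC b v i)
    (hb : ∀ a, n a + 4 ≤ b a ∧ i a ≤ b a) :
    GateC b v fun a => T.prologue (Nat.clog 2 (n a)) (i a - 1) :=
  ProgC.call en.clog ei.pred (.const 0) (T.gateC_prologue
    (fun a => (Nat.add_le_add_right (Nat.clog_two_le _) 2).trans (by have := hb a; omega))
    fun a => (Nat.sub_le _ _).trans (hb a).2)

theorem gateC_block_clog (N : ℕ) (en : ExpC b v n) (ei : ExpC b v i) (eg : ExpC b v g)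
    (hb : ∀ a, n a + 4 ≤ b a ∧ i a ≤ b a ∧ g a ≤ b a) (hN : ∀ a, g a < N) :
    GateC b v fun a => T.block (word (g a)) (Nat.clog 2 (n a)) (i a - 1) :=
  ProgC.call en.clog ei.pred eg (T.gateC_blockTable word N
    (fun a => (Nat.add_le_add_right (Nat.clog_two_le _) 2).trans (by have := hb a; omega))
    (fun a => (Nat.sub_le _ _).trans (hb a).2.1) (fun a => (hb a).2.2) hN)

theorem gateC_flipBlock_clog (en : ExpC b v n) (ei : ExpC b v i)
    (hb : ∀ a, n a + 4 ≤ b a ∧ i a ≤ b a) :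
    GateC b v fun a => T.flipBlock (Nat.clog 2 (n a)) (i a) :=
  ProgC.call en.clog ei (.const 0) (T.gateC_flipBlock
    (fun a => (Nat.add_le_add_right (Nat.clog_two_le _) 2).trans (by have := hb a; omega))
    fun a => (hb a).2)

end Programs

/-- A single machine writes the simulations of all matchgate circuits. -/
theorem exists_machine_simulation (N : ℕ) :
    ∃ (C : ℕ) (M : TM), ∀ (l : ℕ) (xs : List Bool) (gs : List (ℕ × ℕ × ℕ)),
      (1 ≤ l ∧ l ≤ xs.length) →
      (∀ g ∈ gs, g.1 < N ∧ g.2.1 ≤ xs.length ∧ g.2.2 ≤ xs.length) →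
      M.ComputesInSpace (encodeTuple [xs, l.bits] ++ gs.flatMap Frag.encGate)
        (encodeTuple [List.replicate (Nat.clog 2 xs.length + 3) false, Nat.bits 1] ++
          (T.simulation word (Nat.clog 2 xs.length) xs.length (l - 1) gs
            fun j => decide (xs[j]? = some true)).flatMap
              fun g => Frag.encGate (g.1, g.2.1 + 1, g.2.2 + 1))
        (C * (Nat.size xs.length + 1)) := by
  set D := N + 4 with hD
  have hlin : ∀ n, N + 4 * (n + 1) ≤ D * (n + 1) := add_mul_succ_le N
  clear_value D
  have h1 : ProgC (fun p : {p : ℕ × ℕ // 1 ≤ p.2 ∧ p.2 ≤ p.1} => D * (p.1.1 + 1))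
      (fun p => [p.1.1, p.1.2]) fun p =>
        encodeTuple [List.replicate (Nat.clog 2 p.1.1 + 3) false, Nat.bits 1] ++
          (T.prologue (Nat.clog 2 p.1.1) (p.1.2 - 1)).flatMap
            fun g => Frag.encGate (g.1, g.2.1 + 1, g.2.2 + 1) := by
    have hb : ∀ p : {p : ℕ × ℕ // 1 ≤ p.2 ∧ p.2 ≤ p.1},
        p.1.1 + 4 ≤ D * (p.1.1 + 1) ∧ p.1.2 ≤ D * (p.1.1 + 1) := fun p => by
      have := hlin p.1.1
      have := p.2
      omega
    have en : ExpC (fun p : {p : ℕ × ℕ // 1 ≤ p.2 ∧ p.2 ≤ p.1} => D * (p.1.1 + 1))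
        (fun p => [p.1.1, p.1.2]) fun p => p.1.1 :=
      .var 0 (fun _ => rfl) fun p => (Nat.le_add_right _ 4).trans (hb p).1
    exact (ProgC.header en.clog.succ.succ.succ).append
      (T.gateC_prologue_clog en (.var 1 (fun _ => rfl) fun p => (hb p).2) hb)
  have h2 : GateC (fun p : {p : (ℕ × ℕ) × ℕ × ℕ × ℕ // (1 ≤ p.1.2 ∧ p.1.2 ≤ p.1.1) ∧
      p.2.1 < N ∧ p.2.2.1 ≤ p.1.1 ∧ p.2.2.2 ≤ p.1.1} => D * (p.1.1.1 + 1))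
      (fun p => [p.1.1.1, p.1.1.2, p.1.2.1, p.1.2.2.1, p.1.2.2.2]) fun p =>
        T.block (word p.1.2.1) (Nat.clog 2 p.1.1.1) (p.1.2.2.1 - 1) := by
    have hb : ∀ p : {p : (ℕ × ℕ) × ℕ × ℕ × ℕ // (1 ≤ p.1.2 ∧ p.1.2 ≤ p.1.1) ∧
        p.2.1 < N ∧ p.2.2.1 ≤ p.1.1 ∧ p.2.2.2 ≤ p.1.1}, p.1.1.1 + 4 ≤ D * (p.1.1.1 + 1) ∧
        p.1.2.2.1 ≤ D * (p.1.1.1 + 1) ∧ p.1.2.1 ≤ D * (p.1.1.1 + 1) := fun p => by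
      have := hlin p.1.1.1
      have := p.2
      omega
    exact T.gateC_block_clog word N
      (.var 0 (fun _ => rfl) fun p => (Nat.le_add_right _ 4).trans (hb p).1)
      (.var 3 (fun _ => rfl) fun p => (hb p).2.1) (.var 2 (fun _ => rfl) fun p => (hb p).2.2) hb
      fun p => p.2.2.1
  have h3 : GateC (fun p : {p : (ℕ × ℕ) × ℕ // (1 ≤ p.1.2 ∧ p.1.2 ≤ p.1.1) ∧ p.2 < p.1.1} =>
      D * (p.1.1.1 + 1)) (fun p => [p.1.1.1, p.1.1.2, p.1.2]) fun p =>
        T.flipBlock (Nat.clog 2 p.1.1.1) p.1.2 := by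
    have hb : ∀ p : {p : (ℕ × ℕ) × ℕ // (1 ≤ p.1.2 ∧ p.1.2 ≤ p.1.1) ∧ p.2 < p.1.1},
        p.1.1.1 + 4 ≤ D * (p.1.1.1 + 1) ∧ p.1.2 ≤ D * (p.1.1.1 + 1) := fun p => by
      have := hlin p.1.1.1
      have := p.2
      omega
    exact T.gateC_flipBlock_clog
      (.var 0 (fun _ => rfl) fun p => (Nat.le_add_right _ 4).trans (hb p).1)
      (.var 2 (fun _ => rfl) fun p => (hb p).2) hb
  have hP : ∀ n l, 1 ≤ l ∧ l ≤ n → n ≤ D * (n + 1) ∧ l ≤ D * (n + 1) := fun n l h => by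
    have := hlin n
    omega
  have hQ : ∀ (n : ℕ) (g : ℕ × ℕ × ℕ), g.1 < N ∧ g.2.1 ≤ n ∧ g.2.2 ≤ n →
      g.1 ≤ D * (n + 1) ∧ g.2.1 ≤ D * (n + 1) ∧ g.2.2 ≤ D * (n + 1) := fun n g h => by
    have := hlin n
    omega
  have key := @exists_machine_of_programs (fun n => n) D (fun n l => 1 ≤ l ∧ l ≤ n)
    (fun n g => g.1 < N ∧ g.2.1 ≤ n ∧ g.2.2 ≤ n)
    (fun n l => encodeTuple [List.replicate (Nat.clog 2 n + 3) false, Nat.bits 1] ++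
      (T.prologue (Nat.clog 2 n) (l - 1)).flatMap
        fun g => Frag.encGate (g.1, g.2.1 + 1, g.2.2 + 1))
    (fun n g => (T.block (word g.1) (Nat.clog 2 n) (g.2.1 - 1)).flatMap
      fun g => Frag.encGate (g.1, g.2.1 + 1, g.2.2 + 1))
    (fun n j => (T.flipBlock (Nat.clog 2 n) j).flatMap
      fun g => Frag.encGate (g.1, g.2.1 + 1, g.2.2 + 1)) hP hQ
  obtain ⟨C, M, h⟩ := key h1 h2 h3
  refine ⟨C, M, fun l xs gs hl hg => ?_⟩
  have := h l xs gs hl hg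
  simpa [simulation, List.flatMap_append, List.flatMap_assoc, apply_ite] using this

variable {word}

theorem fits_simulation {L n k W : ℕ} (hL : 1 ≤ L) {gs : List (ℕ × ℕ × ℕ)}
    (hW : ∀ g ∈ gs, (word g.1).length ≤ W) (x : ℕ → Bool) :
    Fits (𝓠.ValidRaw (L + 3)) ((L + 3) * 2 + (gs.length * ((140 + 15 * W) * L) + n * (155 * L)))
      (T.simulation word L n k gs x) := by
  have h1 : Fits (𝓠.ValidRaw (L + 3)) (gs.reverse.length * ((140 + 15 * W) * L))
      (gs.reverse.flatMap fun g => T.block (word g.1) L (g.2.1 - 1)) :=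
    .flatMap fun g hg => (T.fits_block (word g.1) hL).mono (Nat.mul_le_mul_right _
      (Nat.add_le_add_left (Nat.mul_le_mul_left _ (hW g (List.mem_reverse.1 hg))) _))
  have h2 : Fits (𝓠.ValidRaw (L + 3)) ((List.range n).reverse.length * (155 * L))
      ((List.range n).reverse.flatMap fun j => if x j then T.flipBlock L j else []) :=
    .flatMap fun j _ => .ite (fun _ => T.fits_block _ hL) fun _ => .nil
  rw [List.length_reverse] at h1
  rw [List.length_reverse, List.length_range] at h2
  exact (T.fits_prologue L k).append (h1.append h2)

/-- The simulation of matchgate circuits in logarithmic width. -/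
theorem exists_simulation {W : ℕ → U4} (hback : 𝓜.BackTable W)
    (hword : ∀ g < 𝓜.num2, wordGate T.Vt (word g) = W g) :
    ∃ (C : ℕ) (M : TM), ∀ (n : ℕ) (c : Circuit 𝓜 n) (x : Fin n → Fin 2) (k : Fin n),
      c.IsNearestNeighbour → c.NoIdleLine →
        ∃ d : Circuit 𝓠 (Nat.clog 2 n + 3),
          d.NoIdleLine ∧ d.length ≤ C * (c.length * Nat.clog 2 n) ∧
          CircuitEquiv c x k d (fun _ => 0) 0 ∧
          M.ComputesInSpace (c.encode x k) (d.encode (fun _ => 0) 0) (C * Nat.clog 2 n) := by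
  obtain ⟨C, M, hM⟩ := T.exists_machine_simulation word 𝓜.num2
  obtain ⟨V, hV⟩ := exists_length_le word 𝓜.num2
  refine ⟨458 + 15 * V + 3 * C, M, fun n c x k hc hidle => ?_⟩
  have hn : 2 ≤ n ∧ 1 ≤ c.length := by
    obtain ⟨g, hg, -⟩ := hidle k
    refine ⟨?_, List.length_pos_of_mem hg⟩
    have h := hc g hg
    cases g with
    | one g i => exact h.elim
    | two g i j hij =>
      have h : j.val = i.val + 1 := h
      omega
  have hN := hidle.le
  have hL : 1 ≤ Nat.clog 2 n := Nat.clog_pos (by norm_num) hn.1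
  set L := Nat.clog 2 n with hLdef
  set xs := List.ofFn fun l => decide (x l = 1) with hxs
  have hlen : xs.length = n := by simp [hxs]
  set gs := (c.map GateApp.raw).map fun g => (g.1, g.2.1 + 1, g.2.2 + 1) with hgs
  have hraw : ∀ g ∈ gs, g.1 < 𝓜.num2 ∧ g.2.1 ≤ n ∧ g.2.2 ≤ n := by
    intro g hg
    obtain ⟨r, hr, rfl⟩ := List.mem_map.1 hg
    obtain ⟨a, -, rfl⟩ := List.mem_map.1 hr
    obtain ⟨h1, h2, h3⟩ := a.valid_raw
    rw [hback.1, if_neg (Nat.not_lt_zero _), zero_add] at h3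
    exact ⟨h3.1, h1, h2⟩
  have hglen : gs.length = c.length := by simp [hgs]
  have hfits := T.fits_simulation (word := word) (n := n) (k := k.val) (W := V) hL
    (fun g hg => hV _ (hraw g hg).1) fun j => decide (xs[j]? = some true)
  obtain ⟨d, hd⟩ := GateSet.exists_circuit _ hfits.1
  refine ⟨d, fun l => ?_, ?_, ?_, ?_⟩
  · have h : T.flip l.val ∈ d.map GateApp.raw := by
      rw [hd, simulation, prologue]
      exact List.mem_append_left _ (List.mem_flatMap.2 ⟨l, List.mem_range.2 l.2, by simp⟩)
    obtain ⟨g, hg, h⟩ := List.mem_map.1 h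
    exact ⟨g, hg, (g.actsOn_iff l).2 (by simp [h, flip])⟩
  · have h := hfits.2
    rw [← hd, List.length_map, hglen] at h
    have h1 : L ≤ c.length * L := Nat.le_mul_of_pos_left _ hn.2
    have h2 : n * (155 * L) ≤ 310 * (c.length * L) :=
      (Nat.mul_le_mul_right _ hN).trans (le_of_eq (by ring))
    calc d.length ≤ 8 * (c.length * L) + (c.length * ((140 + 15 * V) * L) +
          310 * (c.length * L)) := h.trans (by omega)
      _ = (458 + 15 * V) * (c.length * L) := by ring
      _ ≤ _ := Nat.mul_le_mul_right _ (by omega)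
  · exact T.equiv_simulation hback hword hL (Nat.le_pow_clog (by norm_num) n) c hc x k _
      (toBit_ofFn x) d hd
  · have h := hM (k.val + 1) xs gs (by omega) (by rwa [hlen])
    rw [hlen, Nat.add_sub_cancel] at h
    rw [Circuit.encode_eq_shift, Circuit.encode_zero, hd]
    obtain ⟨t, h1, h2, h3⟩ := h
    refine ⟨t, h1, h2, fun r hr => (h3 r hr).trans_le ?_⟩
    have hs : Nat.size n ≤ L + 1 := by
      have : n ≤ 2 ^ L := Nat.le_pow_clog (by norm_num) n
      rw [Nat.size_le, pow_succ]
      have := Nat.two_pow_pos L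
      omega
    calc C * (Nat.size n + 1) ≤ C * (3 * L) := Nat.mul_le_mul_left _ (by omega)
      _ = 3 * C * L := by ring
      _ ≤ _ := Nat.mul_le_mul_right _ (by omega)

end QubitTable

/-! ### Quantum circuits by matchgate circuits of exponential width -/

namespace MatchTable

variable {𝓜 𝓠 : GateSet} {K : ℕ} (T : MatchTable 𝓜 K) (word : ℕ → List (Letter K))

section Programs

variable {α : Type} {b m i j g : α → ℕ} {v : α → List ℕ}

theorem _root_.ExpC.two_pow_succ (em : ExpC b v m) (hb : ∀ a, 2 * 2 ^ m a ≤ b a) :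
    ExpC b v fun a => 2 ^ (m a + 1) :=
  (em.pow 1 fun a => by have := hb a; omega).two_mul.of_eq fun _ => by rw [pow_succ, mul_comm]

theorem gateC_letter_two_pow (u : Fin K) (s : Bool) {c t : α → ℕ} (em : ExpC b v m)
    (ec : ExpC b v c) (et : ExpC b v t) (hb : ∀ a, 2 * 2 ^ m a ≤ b a ∧ c a ≤ m a ∧ t a ≤ m a) :
    GateC b v fun a => T.letter (2 ^ (m a + 1)) u (c a) s (t a) := by
  refine ProgC.call (em.two_pow_succ fun a => (hb a).1) ec et (T.gateC_letter u s (fun a => ?_)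
    (fun a => ?_) fun a => ?_)
  · rw [pow_succ, mul_comm]; exact (hb a).1
  · have := hb a
    have := Nat.lt_two_pow_self (n := m a)
    omega
  · have := hb a
    have : 2 ^ t a ≤ 2 ^ m a := Nat.pow_le_pow_right (by norm_num) (hb a).2.2
    omega

theorem gateC_block_two_pow (N : ℕ) (em : ExpC b v m) (eg : ExpC b v g) (ei : ExpC b v i)
    (ej : ExpC b v j) (hb : ∀ a, 2 * 2 ^ m a ≤ b a ∧ i a ≤ m a ∧ j a ≤ m a) (hN : ∀ a, g a < N) :
    GateC b v fun a => T.block word (2 ^ (m a + 1)) (g a, i a, j a) := by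
  have hl : ∀ l : Letter K, GateC b v fun a => T.letter (2 ^ (m a + 1)) l.2.2
      (ctlOf l.1 (i a) (j a)) l.2.1 (tgtOf l.1 (i a) (j a)) := by
    refine fun l => T.gateC_letter_two_pow _ _ em ?_ ?_ fun a => ?_
    · unfold ctlOf; split_ifs
      exacts [ei, ej, .const 0]
    · unfold tgtOf; split_ifs
      exacts [ej, ei]
    · have := hb a
      unfold ctlOf tgtOf
      split_ifs <;> omega
  have hw : ∀ k, GateC b v fun a => T.block word (2 ^ (m a + 1)) (k, i a, j a) := fun k =>
    GateC.ofList hl (word k)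
  exact GateC.table (G := fun k a => T.block word (2 ^ (m a + 1)) (k, i a, j a)) eg hw N hN

end Programs

/-- A single machine writes the simulations of all quantum circuits. -/
theorem exists_machine_simulation (N : ℕ) :
    ∃ (C : ℕ) (M : TM), ∀ (l : ℕ) (xs : List Bool) (gs : List (ℕ × ℕ × ℕ)), l ≤ xs.length →
      (∀ g ∈ gs, g.1 < N ∧ g.2.1 ≤ xs.length ∧ g.2.2 ≤ xs.length) →
      M.ComputesInSpace (encodeTuple [xs, l.bits] ++ gs.flatMap Frag.encGate)
        (encodeTuple [List.replicate (2 ^ (xs.length + 1)) false, Nat.bits 1] ++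
          (T.simulation word xs.length gs fun j => decide (xs[j]? = some true)).flatMap
              fun g => Frag.encGate (g.1, g.2.1 + 1, g.2.2 + 1))
        (C * (xs.length + 2)) := by
  set D := N + 4 with hD
  have hlin : ∀ m, N + 4 * (2 ^ m + 1) ≤ D * (2 ^ m + 1) := fun m => add_mul_succ_le N (2 ^ m)
  have hpow : ∀ m, m < 2 ^ m := fun m => Nat.lt_two_pow_self
  clear_value D
  have h1 : ProgC (fun p : {p : ℕ × ℕ // p.2 ≤ p.1} => D * (2 ^ p.1.1 + 1))
      (fun p => [p.1.1, p.1.2]) fun p =>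
        encodeTuple [List.replicate (2 ^ (p.1.1 + 1)) false, Nat.bits 1] ++
          (T.prologue p.1.1).flatMap fun g => Frag.encGate (g.1, g.2.1 + 1, g.2.2 + 1) := by
    have hb : ∀ p : {p : ℕ × ℕ // p.2 ≤ p.1}, 2 * 2 ^ p.1.1 ≤ D * (2 ^ p.1.1 + 1) := fun p => by
      have := hlin p.1.1
      omega
    have en : ExpC (fun p : {p : ℕ × ℕ // p.2 ≤ p.1} => D * (2 ^ p.1.1 + 1))
        (fun p => [p.1.1, p.1.2]) fun p => p.1.1 :=
      .var 0 (fun _ => rfl) fun p => by have := hb p; have := hpow p.1.1; omega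
    exact (ProgC.header (en.two_pow_succ hb)).append (ProgC.call en (.const 0) (.const 0)
      (T.gateC_prologue fun p => by have := hb p; omega))
  have h2 : GateC (fun p : {p : (ℕ × ℕ) × ℕ × ℕ × ℕ // p.1.2 ≤ p.1.1 ∧
      p.2.1 < N ∧ p.2.2.1 ≤ p.1.1 ∧ p.2.2.2 ≤ p.1.1} => D * (2 ^ p.1.1.1 + 1))
      (fun p => [p.1.1.1, p.1.1.2, p.1.2.1, p.1.2.2.1, p.1.2.2.2]) fun p =>
        T.block word (2 ^ (p.1.1.1 + 1)) p.1.2 := by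
    have hb : ∀ p : {p : (ℕ × ℕ) × ℕ × ℕ × ℕ // p.1.2 ≤ p.1.1 ∧ p.2.1 < N ∧ p.2.2.1 ≤ p.1.1 ∧
        p.2.2.2 ≤ p.1.1}, 2 * 2 ^ p.1.1.1 ≤ D * (2 ^ p.1.1.1 + 1) ∧
        p.1.1.1 ≤ D * (2 ^ p.1.1.1 + 1) ∧ p.1.2.1 ≤ D * (2 ^ p.1.1.1 + 1) := fun p => by
      have := hlin p.1.1.1
      have := hpow p.1.1.1
      have := p.2
      omega
    exact T.gateC_block_two_pow word N (.var 0 (fun _ => rfl) fun p => (hb p).2.1)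
      (.var 2 (fun _ => rfl) fun p => (hb p).2.2)
      (.var 3 (fun _ => rfl) fun p => p.2.2.2.1.trans (hb p).2.1)
      (.var 4 (fun _ => rfl) fun p => p.2.2.2.2.trans (hb p).2.1)
      (fun p => ⟨(hb p).1, p.2.2.2⟩) fun p => p.2.2.1
  have h3 : GateC (fun p : {p : (ℕ × ℕ) × ℕ // p.1.2 ≤ p.1.1 ∧ p.2 < p.1.1} =>
      D * (2 ^ p.1.1.1 + 1)) (fun p => [p.1.1.1, p.1.1.2, p.1.2]) fun p =>
        T.flipBlock (2 ^ (p.1.1.1 + 1)) p.1.2 := by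
    have hb : ∀ p : {p : (ℕ × ℕ) × ℕ // p.1.2 ≤ p.1.1 ∧ p.2 < p.1.1},
        2 * 2 ^ p.1.1.1 ≤ D * (2 ^ p.1.1.1 + 1) ∧ p.1.1.1 ≤ D * (2 ^ p.1.1.1 + 1) := fun p => by
      have := hlin p.1.1.1
      have := hpow p.1.1.1
      omega
    exact T.gateC_letter_two_pow _ _ (.var 0 (fun _ => rfl) fun p => (hb p).2) (.const 0)
      (ExpC.succ (.var 2 (fun _ => rfl) fun p => p.2.2.le.trans (hb p).2))
      fun p => ⟨(hb p).1, Nat.zero_le _, p.2.2⟩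
  have hP : ∀ m l, l ≤ m → m ≤ D * (2 ^ m + 1) ∧ l ≤ D * (2 ^ m + 1) := fun m l h => by
    have := hlin m
    have := hpow m
    omega
  have hQ : ∀ (m : ℕ) (g : ℕ × ℕ × ℕ), g.1 < N ∧ g.2.1 ≤ m ∧ g.2.2 ≤ m →
      g.1 ≤ D * (2 ^ m + 1) ∧ g.2.1 ≤ D * (2 ^ m + 1) ∧ g.2.2 ≤ D * (2 ^ m + 1) := fun m g h => by
    have := hlin m
    have := hpow m
    omega
  have key := @exists_machine_of_programs (fun m => 2 ^ m) D (fun m l => l ≤ m)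
    (fun m g => g.1 < N ∧ g.2.1 ≤ m ∧ g.2.2 ≤ m)
    (fun m l => encodeTuple [List.replicate (2 ^ (m + 1)) false, Nat.bits 1] ++
      (T.prologue m).flatMap fun g => Frag.encGate (g.1, g.2.1 + 1, g.2.2 + 1))
    (fun m g => (T.block word (2 ^ (m + 1)) g).flatMap
      fun g => Frag.encGate (g.1, g.2.1 + 1, g.2.2 + 1))
    (fun m j => (T.flipBlock (2 ^ (m + 1)) j).flatMap
      fun g => Frag.encGate (g.1, g.2.1 + 1, g.2.2 + 1)) hP hQ
  obtain ⟨C, M, h⟩ := key h1 h2 h3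
  refine ⟨C, M, fun l xs gs hl hg => ?_⟩
  have := h l xs gs hl hg
  rw [Nat.size_pow] at this
  simpa [simulation, List.flatMap_append, List.flatMap_assoc, apply_ite] using this

variable {word}

theorem fits_simulation {m W : ℕ} {gs : List (ℕ × ℕ × ℕ)}
    (hgs : ∀ g ∈ gs, (word g.1).length ≤ W ∧ g.2.1 ≤ m ∧ g.2.2 ≤ m) (y : ℕ → Bool) :
    Fits (Consecutive 𝓜 (2 ^ (m + 1)))
      (2 ^ m + (gs.length * (W * (4 * 2 ^ (2 * m))) + m * (4 * 2 ^ (2 * m))))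
      (T.simulation word m gs y) := by
  have h1 : Fits (Consecutive 𝓜 (2 ^ (m + 1))) (gs.reverse.length * (W * (4 * 2 ^ (2 * m))))
      (gs.reverse.flatMap (T.block word (2 ^ (m + 1)))) :=
    .flatMap fun g hg => by
      obtain ⟨h1, h2, h3⟩ := hgs g (List.mem_reverse.1 hg)
      exact (T.fits_block word h2 h3).mono (Nat.mul_le_mul_right _ h1)
  have h2 : Fits (Consecutive 𝓜 (2 ^ (m + 1))) ((List.range m).reverse.length * (4 * 2 ^ (2 * m)))
      ((List.range m).reverse.flatMap fun l =>
        if y l then T.flipBlock (2 ^ (m + 1)) l else []) :=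
    .flatMap fun l hl => .ite (fun _ => T.fits_letter _ _ _ (by simpa using hl)) fun _ => .nil
  rw [List.length_reverse] at h1
  rw [List.length_reverse, List.length_range] at h2
  exact (T.fits_prologue m).append (h1.append h2)

/-- The simulation of quantum circuits in exponential width. -/
theorem exists_simulation (hword : 𝓠.WordTable T.Vt word) :
    ∃ (C : ℕ) (M : TM), ∀ (m : ℕ) (hm : 0 < m) (c : Circuit 𝓠 m) (y : Fin m → Fin 2),
      c.NoIdleLine →
        ∃ d : Circuit 𝓜 (2 ^ (m + 1)),
          d.IsNearestNeighbour ∧ d.NoIdleLine ∧ d.length ≤ C * (c.length * 2 ^ (2 * m)) ∧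
          CircuitEquiv c y ⟨0, hm⟩ d (fun _ => 0) 0 ∧
          M.ComputesInSpace (c.encode y ⟨0, hm⟩) (d.encode (fun _ => 0) 0) (C * m) := by
  obtain ⟨C, M, hM⟩ := T.exists_machine_simulation word (𝓠.num1 + 𝓠.num2)
  obtain ⟨V, hV⟩ := exists_length_le word (𝓠.num1 + 𝓠.num2)
  refine ⟨9 + 4 * V + 3 * C, M, fun m hm c y hidle => ?_⟩
  have hc := hidle.le
  set xs := List.ofFn fun l => decide (y l = 1) with hxs
  have hlen : xs.length = m := by simp [hxs]
  set gs := (c.map GateApp.raw).map fun g => (g.1, g.2.1 + 1, g.2.2 + 1) with hgs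
  have hraw : ∀ g ∈ gs, g.1 < 𝓠.num1 + 𝓠.num2 ∧ g.2.1 ≤ m ∧ g.2.2 ≤ m := by
    intro g hg
    obtain ⟨r, hr, rfl⟩ := List.mem_map.1 hg
    obtain ⟨a, -, rfl⟩ := List.mem_map.1 hr
    obtain ⟨h1, h2, h3⟩ := a.valid_raw
    refine ⟨?_, h1, h2⟩
    split_ifs at h3 with h
    exacts [h.trans_le (Nat.le_add_right _ _), h3.1]
  have hglen : gs.length = c.length := by simp [hgs]
  have hfits := T.fits_simulation (word := word) (m := m) (W := V)
    (fun g hg => ⟨hV _ (hraw g hg).1, (hraw g hg).2⟩) fun j => decide (xs[j]? = some true)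
  obtain ⟨d, hd⟩ := GateSet.exists_circuit _ fun g hg => (hfits.1 g hg).1
  have hnn : d.IsNearestNeighbour := by
    intro g hg
    obtain ⟨⟨-, -, h1⟩, h2⟩ := hfits.1 g.raw (hd ▸ List.mem_map_of_mem hg)
    cases g with
    | one g i => exact absurd h2 (by simp [GateApp.raw])
    | two g i j h => exact h2
  refine ⟨d, hnn, fun l => ?_, ?_, ?_, ?_⟩
  · have hl : l.val < 2 * 2 ^ m := by
      rw [← pow_succ']
      exact l.2
    have h : (if (l.val / 2).testBit 0 then T.xx else T.base + T.vI.val, 2 * (l.val / 2),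
        2 * (l.val / 2) + 1) ∈ d.map GateApp.raw := by
      rw [hd, simulation, prologue]
      exact List.mem_append_left _ (List.mem_map.2
        ⟨l / 2, List.mem_range.2 (by omega), rfl⟩)
    obtain ⟨g, hg, h⟩ := List.mem_map.1 h
    refine ⟨g, hg, (g.actsOn_iff l).2 ?_⟩
    rw [h]
    dsimp only
    omega
  · have h := hfits.2
    rw [← hd, List.length_map, hglen] at h
    have h0 : 2 ^ m ≤ 2 ^ (2 * m) := Nat.pow_le_pow_right (by norm_num) (by omega)
    have h1 : 2 ^ (2 * m) ≤ c.length * 2 ^ (2 * m) := Nat.le_mul_of_pos_left _ (by omega)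
    have h2 : m * (4 * 2 ^ (2 * m)) ≤ 8 * (c.length * 2 ^ (2 * m)) :=
      (Nat.mul_le_mul_right _ hc).trans (le_of_eq (by ring))
    calc d.length ≤ c.length * 2 ^ (2 * m) + (c.length * (V * (4 * 2 ^ (2 * m))) +
          8 * (c.length * 2 ^ (2 * m))) := h.trans (by omega)
      _ = (9 + 4 * V) * (c.length * 2 ^ (2 * m)) := by ring
      _ ≤ _ := Nat.mul_le_mul_right _ (by omega)
  · exact T.equiv_simulation hword hm c y _ (toBit_ofFn y) d hnn hd
  · have h := hM 1 xs gs (by omega) (by rwa [hlen])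
    rw [hlen] at h
    rw [Circuit.encode_eq_shift, Circuit.encode_zero, hd]
    obtain ⟨t, h1, h2, h3⟩ := h
    refine ⟨t, h1, h2, fun r hr => (h3 r hr).trans_le ?_⟩
    calc C * (m + 2) ≤ C * (3 * m) := Nat.mul_le_mul_left _ (by omega)
      _ = 3 * C * m := by ring
      _ ≤ _ := Nat.mul_le_mul_right _ (by omega)

end MatchTable

theorem theorem2 (𝓜₀ 𝓠₀ : GateSet) (h𝓜₀ : 𝓜₀.IsMatchgateSet) :
    ∃ 𝓜 𝓠 : GateSet,
      𝓜₀.Sub 𝓜 ∧ 𝓜.IsMatchgateSet ∧ 𝓜.IsMatchgateUniversal ∧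
      𝓠₀.Sub 𝓠 ∧ 𝓠.IsUniversal ∧
      -- (a)
      (∃ (K : ℕ) (T : TM), ∀ (n : ℕ) (c : Circuit 𝓜 n) (x : Fin n → Fin 2) (k : Fin n),
        c.IsNearestNeighbour → c.NoIdleLine →
          ∃ d : Circuit 𝓠 (Nat.clog 2 n + 3),
            d.NoIdleLine ∧
            d.length ≤ K * (c.length * Nat.clog 2 n) ∧
            CircuitEquiv c x k d (fun _ => 0) 0 ∧
            T.ComputesInSpace (c.encode x k) (d.encode (fun _ => 0) 0) (K * Nat.clog 2 n)) ∧
      -- (b)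
      (∃ (K : ℕ) (T : TM), ∀ (m : ℕ) (hm : 0 < m) (c : Circuit 𝓠 m) (y : Fin m → Fin 2),
        c.NoIdleLine →
          ∃ d : Circuit 𝓜 (2 ^ (m + 1)),
            d.IsNearestNeighbour ∧ d.NoIdleLine ∧
            d.length ≤ K * (c.length * 2 ^ (2 * m)) ∧
            CircuitEquiv c y ⟨0, hm⟩ d (fun _ => 0) 0 ∧
            T.ComputesInSpace (c.encode y ⟨0, hm⟩) (d.encode (fun _ => 0) 0) (K * m)) := by
  obtain ⟨𝓜, 𝓠, K, S, T, w, w', h1, h2, h3, h4, h5, h6⟩ := exists_gateSets 𝓜₀ 𝓠₀ h𝓜₀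
  refine ⟨𝓜, 𝓠, h1, ⟨S.hback.1, fun g => ?_⟩, h2, h3, h4, T.exists_simulation S.hback h6,
    S.exists_simulation h5⟩
  obtain ⟨A, B, hdet, hg, -⟩ := S.hback.2 g
  exact ⟨A, B, hdet, hg⟩
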